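/- **Setting.** Let $k$ be an algebraically closed field of characteristic $0$, let $n\ge 1$ and let $(d_i)_{i\in\mathbb Z/n}$ be integers (for a Looijenga pair $(Y,D)$ with $D=D_1+\dots+D_n$, take $d_i=D_i^2$). Let $B$ be the cone complex, homeomorphic to $\mathbb R^2$, with fan $\Sigma$ consisting of the origin, rays $\rho_i=\mathbb R_{\ge0}v_i$ and two-dimensional cones $\sigma_{i,i+1}=\mathbb R_{\ge0}v_i+\mathbb R_{\ge0}v_{i+1}$ (each with integral points $\mathbb Nv_i+\mathbb Nv_{i+1}$), glued cyclically, with the integral affine structure on $B_0=B\setminus\{0\}$ for which $v_{i-1}+d_iv_i+v_{i+1}=0$ along $\rho_i$. Write $\Lambda$ for the local system of integral tangent vectors, $B_0(\mathbb Z)$ for the integral points of $B_0$, and $B(\mathbb Z)=B_0(\mathbb Z)\cup\{0\}$. Let $P$ be a toric monoid (finitely generated, saturated, in a lattice $P^{\rm gp}$ of finite rank which it generates), and $\varphi$ a multivalued $\Sigma$-piecewise linear function with values in $P^{\rm gp}$ (functions $\varphi_i$ near $\rho_i$, linear on each cone, differing by linear functions on overlaps) whose bending parameters $p_\rho=p_{\rho,\varphi}$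 all lie in $P$. (If $\rho=\sigma_-\cap\sigma_+$ and $n_\rho\in\Lambda_\rho^*$ is primitive, zero on $\rho$ and positive on $\sigma_+$, the linear extensions of $\varphi$ satisfy $\varphi_{\sigma_+}-\varphi_{\sigma_-}=n_\rho\otimes p_\rho$.) Let $\mathcal P$ be the local system on $B_0$ which is $\Lambda\oplus P^{\rm gp}$ near $\rho_i$ with transition maps $(m,p)\mapsto(m,p+(\varphi_{i+1}-\varphi_i)(m))$; let $r:\mathcal P\to\Lambda$ be the projection. For $m\in\Lambda_\tau$ write $\varphi_\tau(m)$ also for the element $(m,\varphi_\tau(m))$ of $\mathcal P_\tau$. For $\tau\in\Sigma\setminus\{0\}$ put $P_{\varphi_\tau}=\{q\in\mathcal P_\tau: q-\varphi_\tau(r(q))\in P\}$ (for a ray $\rho$, $\varphi_\rho$ is $\varphi_{\sigma_\pm}$ on the two half planes). Let $I\subset P$ be a monoid ideal and $J=\sqrt I$. For $\tau\subset\sigma$ with $\sigma$ two-dimensional let $I_{\tau,\sigma}=\{q\in P_{\varphi_\tau}: q-\varphi_\sigma(r(q))\in I\}$, for a ray $\rho$ let $I_{\rho,\rho}=I_{\rho,\sigma_+}\cup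 I_{\rho,\sigma_-}$, and let $R_{\tau,\tau',I}$ be $k[P_{\varphi_\tau}]$ modulo the monomials in $I_{\tau,\tau'}$. For any monoid ideal $I'$ write likewise $I'_{\tau,\tau'}$. **Scattering diagrams.** A scattering diagram $\mathfrak D$ is a set of pairs $(\mathfrak d,f_{\mathfrak d})$, where $\mathfrak d\subset B$ is a ray from $0$ of rational slope, with minimal cone $\tau\in\Sigma$, and $f_{\mathfrak d}=1+\sum c_pz^p$ lies in the $J_{\tau,\tau}$-adic completion of $k[P_{\varphi_\tau}]$, all its $r(p)$ being nonzero and tangent to $\mathfrak d$ and either all pointing towards, or all pointing away from, the origin. It is required that $f_{\mathfrak d}\equiv1$ mod $J$ if $\dim\tau=2$ or if $\tau=\rho$ is a ray with $p_\rho\notin J$, and that for each $I'$ with $\sqrt{I'}=J$ only finitely many $f_{\mathfrak d}$ are $\not\equiv1$ mod $I'_{\tau,\tau}$; the union of the corresponding rays is $\mathrm{Supp}_{I'}(\mathfrak D)$. If a path $\gamma$ in the interior of $\sigma$ crosses $\mathfrak d$, put $\theta_{\gamma,\mathfrak d}(z^p)=z^pf_{\mathfrak d}^{\langle n_{\mathfrak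 d},r(p)\rangle}$ on $R_{\sigma,\sigma,I}$, where $n_{\mathfrak d}$ is primitive, zero on $\mathfrak d$ and negative on the direction of $\gamma$; $\theta_{\gamma,\mathfrak D}$ is the composition of these, in the order of crossing, over the rays crossed which are nontrivial mod $I$. For a ray $\rho$ of $\Sigma$ let $f_\rho\in R_{\rho,\rho,I}$ be the product of the $f_{\mathfrak d}$ with $\mathfrak d=\rho$, and let $R_{\rho,I}=R_{\rho,\sigma_-,I}\times_{(R_{\rho,\rho,I})_{f_\rho}}R_{\rho,\sigma_+,I}$, where the first map is canonical and the second is $z^p\mapsto z^pf_\rho^{\langle n_\rho,r(p)\rangle}$; put $U_{\rho,I}=\operatorname{Spec}R_{\rho,I}$. The projections give open subsets $\operatorname{Spec}R_{\sigma_\pm,\sigma_\pm,I}\subset U_{\rho,I}$. For every two-dimensional cone $\sigma$ with edges $\rho,\rho'$, glue $\operatorname{Spec}R_{\sigma,\sigma,I}\subset U_{\rho',I}$ to $\operatorname{Spec}R_{\sigma,\sigma,I}\subset U_{\rho,I}$ by the isomorphism induced by $\theta_{\gamma,\mathfrak D}$, with $\gamma$ a path in the interior of $\sigma$ from near $\rho$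 to near $\rho'$. The quotient of $\coprod_\rho U_{\rho,I}$ by the equivalence relation generated by these gluings is $X^o_{I,\mathfrak D}$, over $\operatorname{Spec}k[P]/I$. **Broken lines and consistency.** A broken line for $q\in B_0(\mathbb Z)$ with endpoint $Q\in B_0$ is a proper continuous piecewise integral affine map $\gamma:(-\infty,0]\to B_0$ with $\gamma(0)=Q$, together with a monomial $c_Lz^{q_L}$ ($q_L$ a section of $\gamma^{-1}\mathcal P$) on each maximal domain of linearity $L$, such that: the unbounded domain goes to infinity in a cone $\sigma\ni q$ and has monomial $z^{\varphi_\sigma(q)}$; $\gamma'=-r(q_L)$ on $L$; and where $\gamma$ bends from $L$ to $L'$ at a point with minimal cone $\tau$, $c_{L'}z^{q_{L'}}=c_Lz^{q_L}\cdot cz^e$ for a term $cz^e$ of $\prod_{\mathfrak d\ni\gamma(t)}f_{\mathfrak d}^{\langle n,r(q_L)\rangle}$, where $n\in\Lambda_\tau^*$ is primitive, zero on $\mathfrak d$ and negative on $\gamma'$. Let $\mathrm{Lift}_Q(q)$ be the sum over all such broken lines of their last monomials. $\mathfrak D$ is consistent if $p_\rho\in J$ for some $\rho$ and, for all $I'$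 with $\sqrt{I'}=J$, all $q\in B_0(\mathbb Z)$ and all $Q,Q'\in B_0$ on lines of irrational slope through the origin: (i) if $Q,Q'$ are in the same two-dimensional $\sigma$, then $\mathrm{Lift}_{Q'}(q)=\theta_{\gamma,\mathfrak D}(\mathrm{Lift}_Q(q))$ in $R_{\sigma,\sigma,I'}$ for $\gamma$ a path from $Q$ to $Q'$ in the interior of $\sigma$; (ii) if $Q\in\sigma_-$, $Q'\in\sigma_+$ with $\rho=\sigma_-\cap\sigma_+$ are in components of $B\setminus(\mathrm{Supp}_{I'}(\mathfrak D)\cup\rho)$ adjacent to $\rho$, then $(\mathrm{Lift}_Q(q),\mathrm{Lift}_{Q'}(q))\in R_{\rho,I'}$. **Fans.** Let $\Sigma_I$ be the coarsening of $\Sigma$ whose rays are the $\rho$ with $p_\rho\in\sqrt I$. For a closed point $x\in\operatorname{Spec}k[P]/I$ let $\Sigma_x$ be its refinement obtained by adding the rays $\rho$ such that $z^{p_\rho}$ vanishes at $x$. Let $k[\Sigma_x]$ be the $k$-algebra with basis $z^m$, $m\in B(\mathbb Z)$, and $z^mz^{m'}=z^{m+m'}$ if $m,m'$ lie in a common cone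 of $\Sigma_x$, $z^mz^{m'}=0$ otherwise. Let $\mathbb V_p=\mathbb A^2_{x_1x_2}\cup\mathbb A^2_{x_2x_3}\cup\dots\cup\mathbb A^2_{x_px_1}\subset\mathbb A^p$. **Theorem.** Suppose that $\Sigma_I$ has at least two rays, that all cones of $\Sigma_I$ are strictly convex, that $\mathfrak D$ is a consistent scattering diagram, and that $\Sigma_x$ has at least three rays for every closed point $x\in\operatorname{Spec}k[P]/I$. Let $X_I=\operatorname{Spec}\Gamma(X^o_{I,\mathfrak D},\mathcal O)$, with structure morphism $f_I:X_I\to\operatorname{Spec}k[P]/I$. Then: 1. The canonical morphism $X^o_{I,\mathfrak D}\to X_I$ is an open immersion. The morphism $f_I$ is flat. Its fibre over a closed point $x$ has dimension $2$ and is isomorphic over $k$ to $\operatorname{Spec}k[\Sigma_x]$; if every two-dimensional cone of $\Sigma_x$ is integral affine isomorphic to the first quadrant, it is also isomorphic to $\mathbb V_p$, where $p$ is the number of rays of $\Sigma_x$. 2. There is a basis $\{\vartheta_q: q\in B(\mathbb Z)\}$ of the (free) $k[P]/I$-module $\Gamma(X_I,\mathcal O_{X_I})$ such that $\vartheta_0=1$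 and, for every $q\in B_0(\mathbb Z)$ and every ray $\rho=\sigma_-\cap\sigma_+$ of $\Sigma$, the restriction of $\vartheta_q$ to $U_{\rho,I}$ is the pair $(\mathrm{Lift}_{Q^-}(q),\mathrm{Lift}_{Q^+}(q))\in R_{\rho,I}$, for all points $Q^\pm\in\sigma_\pm$ on lines of irrational slope through the origin that lie in components of $B\setminus(\mathrm{Supp}_I(\mathfrak D)\cup\rho)$ adjacent to $\rho$. -/

import Mathlib

open CategoryTheory AlgebraicGeometry Opposite
open CategoryTheory.Limits (coequalizer coequalizer.π coequalizer.desc)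

universe u

noncomputable section

namespace MirrorFamily

/-! ### Toric monoids, monoid ideals and quotients of monoid algebras -/

section Monoids

variable {L : Type u} [AddCommGroup L]

/-- `P` is a toric monoid with group completion the lattice `L`: a finitely generated and saturated
submonoid generating `L`; equivalently `P` is the set of lattice points of a rational polyhedral
cone that spans `L ⊗ ℝ`. -/
structure IsToric (P : AddSubmonoid L) : Prop where
  fg : P.FG
  saturated : ∀ (m : ℕ) (x : L), m ≠ 0 → m • x ∈ P → x ∈ P
  generates : AddSubgroup.closure (P : Set L) = ⊤

/-- The elements of a monoid ideal of `P`, as a subset of the ambient lattice. -/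
def elems {P : AddSubmonoid L} (I : AddSemigroupIdeal P) : Set L := Subtype.val '' (I : Set P)

/-- The radical `√I` of a monoid ideal. -/
def radical {P : AddSubmonoid L} (I : AddSemigroupIdeal P) : AddSemigroupIdeal P where
  carrier := {p | ∃ m : ℕ, m ≠ 0 ∧ m • p ∈ I}
  vadd_mem' := by
    rintro c p ⟨m, hm, h⟩
    refine ⟨m, hm, ?_⟩
    rw [vadd_eq_add, smul_add]
    exact AddSemigroupIdeal.add_mem I _ h

variable (k : Type u) [Field k] {M M' : Type u} [AddCommMonoid M] [AddCommMonoid M']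

/-- The ideal of `k[S]` generated by the monomials `z^s`, `s ∈ T`. -/
def monIdeal (S : AddSubmonoid M) (T : Set M) : Ideal (AddMonoidAlgebra k S) :=
  Ideal.span {x | ∃ s : S, (s : M) ∈ T ∧ x = AddMonoidAlgebra.single s 1}

/-- `k[S]/T`: the monoid algebra of `S` modulo the monomials with exponent in `T`. -/
abbrev MonAlg (S : AddSubmonoid M) (T : Set M) : Type u := AddMonoidAlgebra k S ⧸ monIdeal k S T

/-- The class of `c z^s` in `k[S]/T`. -/
def mono (S : AddSubmonoid M) (T : Set M) (s : S) (c : k) : MonAlg k S T :=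
  Ideal.Quotient.mk _ (AddMonoidAlgebra.single s c)

variable {k}

lemma mono_eq_zero {S : AddSubmonoid M} {T : Set M} {s : S} (h : (s : M) ∈ T) (c : k) :
    mono k S T s c = 0 := by
  rw [mono, Ideal.Quotient.eq_zero_iff_mem]
  have : (AddMonoidAlgebra.single s c : AddMonoidAlgebra k S)
      = AddMonoidAlgebra.single 0 c * AddMonoidAlgebra.single s 1 := by
    rw [AddMonoidAlgebra.single_mul_single]; simp
  rw [this]
  exact Ideal.mul_mem_left _ _ (Ideal.subset_span ⟨s, h, rfl⟩)

lemma mono_mul {S : AddSubmonoid M} {T : Set M} (s t : S) (c d : k) :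
    mono k S T s c * mono k S T t d = mono k S T (s + t) (c * d) := by
  rw [mono, mono, mono, ← map_mul, AddMonoidAlgebra.single_mul_single]

lemma mono_pow {S : AddSubmonoid M} {T : Set M} (s : S) (c : k) (m : ℕ) :
    mono k S T s c ^ m = mono k S T (m • s) (c ^ m) := by
  rw [mono, mono, ← map_pow, AddMonoidAlgebra.single_pow]

lemma mono_zero_one {S : AddSubmonoid M} {T : Set M} : mono k S T 0 1 = 1 := by
  rw [mono, ← AddMonoidAlgebra.one_def, map_one]

lemma mono_smul {S : AddSubmonoid M} {T : Set M} (s : S) : mono k S T s 0 = 0 := by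
  rw [mono, AddMonoidAlgebra.single_zero, map_zero]

/-- The algebra map out of `k[S]/T` given by `z^s ↦ g s`. -/
def MonAlg.lift {S : AddSubmonoid M} {T : Set M} {A : Type u} [CommRing A] [Algebra k A]
    (g : Multiplicative S →* A) (hg : ∀ s : S, (s : M) ∈ T → g (Multiplicative.ofAdd s) = 0) :
    MonAlg k S T →ₐ[k] A :=
  Ideal.Quotient.liftₐ _ (AddMonoidAlgebra.lift k A S g) (by
    intro a ha
    have : monIdeal k S T ≤ RingHom.ker (AddMonoidAlgebra.lift k A S g) := by
      rw [monIdeal, Ideal.span_le]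
      rintro _ ⟨s, hs, rfl⟩
      simp [RingHom.mem_ker, hg s hs]
    exact RingHom.mem_ker.mp (this ha))

lemma MonAlg.lift_mono {S : AddSubmonoid M} {T : Set M} {A : Type u} [CommRing A] [Algebra k A]
    (g : Multiplicative S →* A) (hg : ∀ s : S, (s : M) ∈ T → g (Multiplicative.ofAdd s) = 0)
    (s : S) : MonAlg.lift (k := k) g hg (mono k S T s 1) = g (Multiplicative.ofAdd s) := by
  change AddMonoidAlgebra.lift k A S g (AddMonoidAlgebra.single s 1) = _
  simp

lemma MonAlg.hom_ext {S : AddSubmonoid M} {T : Set M} {A : Type u} [CommRing A] [Algebra k A]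
    {f g : MonAlg k S T →ₐ[k] A} (h : ∀ s : S, f (mono k S T s 1) = g (mono k S T s 1)) :
    f = g := by
  apply Ideal.Quotient.algHom_ext
  apply (AddMonoidAlgebra.lift k A S).symm.injective
  ext s
  exact h s

/-- The algebra map `k[S]/T → k[S']/T'` given by `z^s ↦ z^{f s}`. -/
def MonAlg.map {S : AddSubmonoid M} {T : Set M} {S' : AddSubmonoid M'} {T' : Set M'}
    (f : M →+ M') (hS : ∀ s ∈ S, f s ∈ S') (hT : ∀ s ∈ S, s ∈ T → f s ∈ T') :
    MonAlg k S T →ₐ[k] MonAlg k S' T' :=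
  MonAlg.lift
    { toFun := fun s => mono k S' T' ⟨f s.toAdd, hS _ s.toAdd.2⟩ 1
      map_one' := by
        rw [← mono_zero_one]; congr 1; ext; simp
      map_mul' := by
        intro s t
        rw [mono_mul, one_mul]; congr 1; ext; simp }
    (fun s hs => mono_eq_zero (hT _ s.2 hs) 1)

lemma MonAlg.map_mono {S : AddSubmonoid M} {T : Set M} {S' : AddSubmonoid M'} {T' : Set M'}
    (f : M →+ M') (hS : ∀ s ∈ S, f s ∈ S') (hT : ∀ s ∈ S, s ∈ T → f s ∈ T') (s : S) :
    MonAlg.map (k := k) (T := T) (T' := T') f hS hT (mono k S T s 1)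
      = mono k S' T' ⟨f s, hS _ s.2⟩ 1 :=
  MonAlg.lift_mono _ _ s

/-- Given an algebra map `h : k[S]/T → A`, a unit `w` of `A` and a homomorphism `N : M → ℤ`, the
algebra map given by `z^s ↦ h(z^s) w^{N s}`. -/
def MonAlg.twist {S : AddSubmonoid M} {T : Set M} {A : Type u} [CommRing A] [Algebra k A]
    (h : MonAlg k S T →ₐ[k] A) (w : Aˣ) (N : M →+ ℤ) : MonAlg k S T →ₐ[k] A :=
  MonAlg.lift
    { toFun := fun s => h (mono k S T s.toAdd 1) * ((w ^ N s.toAdd : Aˣ) : A)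
      map_one' := by
        rw [toAdd_one, mono_zero_one]; simp
      map_mul' := by
        intro s t
        rw [toAdd_mul, ← mul_one (1 : k), ← mono_mul, map_mul]
        simp only [mul_one, AddSubmonoid.coe_add, map_add, zpow_add, Units.val_mul]
        ring }
    (fun s hs => by
      change h (mono k S T s 1) * _ = 0
      rw [mono_eq_zero hs, map_zero, zero_mul])

lemma MonAlg.twist_mono {S : AddSubmonoid M} {T : Set M} {A : Type u} [CommRing A] [Algebra k A]
    (h : MonAlg k S T →ₐ[k] A) (w : Aˣ) (N : M →+ ℤ) (s : S) :
    MonAlg.twist h w N (mono k S T s 1) = h (mono k S T s 1) * ((w ^ N s : Aˣ) : A) :=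
  MonAlg.lift_mono _ _ s

/-- The class in `k[S]/T` of a formal sum `∑ c_s z^s`, all but finitely many of whose terms have
exponent in `T`. -/
def ofCoeff (S : AddSubmonoid M) (T : Set M) (c : M → k) : MonAlg k S T :=
  ∑ᶠ s : S, mono k S T s (c s)

end Monoids

/-! ### The integral affine manifold `B` and multivalued piecewise linear functions

The rays `ρ_i` of `Σ` are indexed by `i : ZMod n`; the maximal cone `σ_i = σ_{i,i+1}` is spanned by
the primitive generators `v_i`, `v_{i+1}` of `ρ_i`, `ρ_{i+1}`. The lattices of integral tangent
vectors along `σ_i` and along `ρ_i` are both identified with `ℤ × ℤ` by means of the basis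
`(v_i, v_{i+1})`; the affine structure is given by `v_{i-1} + d_i v_i + v_{i+1} = 0` along `ρ_i`. -/

section Affine

variable {n : ℕ} (d : ZMod n → ℤ)

/-- The identification of `Λ_{σ_i}` with `Λ_{ρ_{i+1}}`, from coordinates with respect to
`(v_i, v_{i+1})` to coordinates with respect to `(v_{i+1}, v_{i+2})`;
here `v_i = -d_{i+1} v_{i+1} - v_{i+2}`. -/
def glueΛ (i : ZMod n) : (ℤ × ℤ) ≃+ (ℤ × ℤ) where
  toFun m := (m.2 - d (i + 1) * m.1, -m.1)
  invFun m := (-m.2, m.1 - d (i + 1) * m.2)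
  left_inv m := by ext <;> simp
  right_inv m := by ext <;> simp
  map_add' x y := by ext <;> simp <;> ring

/-- Nonzero integral points of `B`: the point `a v_i + b v_{i+1}` of `σ_i`, where `a > 0` so that
every point is listed once. -/
structure B0Z (n : ℕ) where
  cone : ZMod n
  a : ℕ
  b : ℕ
  pos : 0 < a

/-- The integral points of `B`; `none` is the origin. -/
abbrev BZ (n : ℕ) := Option (B0Z n)

/-- The integral point `a v_i + b v_{i+1}` of the closed cone `σ_i`. -/
def pt (i : ZMod n) (a b : ℕ) : BZ n :=
  if ha : 0 < a then some ⟨i, a, b, ha⟩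
  else if hb : 0 < b then some ⟨i + 1, b, 0, hb⟩ else none

/-- The generators `v_i, v_{i+1}, v_{i+2}, …`, developed counterclockwise into `Λ_{σ_i}`. -/
def dev (i : ZMod n) : ℕ → ℤ × ℤ
  | 0 => (1, 0)
  | 1 => (0, 1)
  | t + 2 => -(d (i + ((t + 1 : ℕ) : ZMod n)) • dev i (t + 1)) - dev i t

/-- The integral point `m` lies in the union of the `l` consecutive cones
`σ_i, …, σ_{i+l-1}`, and developing this union into `Λ_{σ_i}` sends `m` to `x`. -/
def Develops (i : ZMod n) (l : ℕ) (m : BZ n) (x : ℤ × ℤ) : Prop :=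
  ∃ (t a b : ℕ), t < l ∧ m = pt (i + (t : ZMod n)) a b ∧ x = a • dev d i t + b • dev d i (t + 1)

/-- The union of `σ_i, …, σ_{i+l-1}` is a maximal cone of the coarsening of `Σ` whose rays are the
`ρ_j`, `j ∈ F`. -/
def IsMaxCone (F : Set (ZMod n)) (i : ZMod n) (l : ℕ) : Prop :=
  0 < l ∧ i ∈ F ∧ i + (l : ZMod n) ∈ F ∧ ∀ t : ℕ, 0 < t → t < l → i + (t : ZMod n) ∉ F

/-- The union of `σ_i, …, σ_{i+l-1}` is a strictly convex cone: its integral points, developed into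
`Λ_{σ_i}`, are closed under addition and contain no pair of opposite nonzero vectors. -/
def IsStrictlyConvex (i : ZMod n) (l : ℕ) : Prop :=
  (∀ m m' x x', Develops d i l m x → Develops d i l m' x' → ∃ m'', Develops d i l m'' (x + x')) ∧
  ∀ m m' x, Develops d i l m x → Develops d i l m' (-x) → x = 0

/-- The union of `σ_i, …, σ_{i+l-1}` is integral affine isomorphic to the first quadrant. -/
def IsQuadrant (i : ZMod n) (l : ℕ) : Prop :=
  ∃ g : (ℤ × ℤ) ≃+ (ℤ × ℤ), ∀ x, (∃ m, Develops d i l m x) ↔ 0 ≤ (g x).1 ∧ 0 ≤ (g x).2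

/-- The relations of `k[Σ_F]`, where `Σ_F` is the coarsening of `Σ` with rays `ρ_j`, `j ∈ F`:
`z^0 = 1`; `z^m z^{m'} = z^{m+m'}` if `m`, `m'` lie in a common cone of `Σ_F`; and
`z^m z^{m'} = 0` if they do not. -/
def fanRelations (k : Type u) [Field k] (F : Set (ZMod n)) : Set (MvPolynomial (BZ n) k) :=
  {f | f = MvPolynomial.X none - 1 ∨
    (∃ m m' m'' i l x x', IsMaxCone F i l ∧ Develops d i l m x ∧ Develops d i l m' x' ∧
      Develops d i l m'' (x + x') ∧
      f = MvPolynomial.X m * MvPolynomial.X m' - MvPolynomial.X m'') ∨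
    (∃ m m', (¬ ∃ i l x x', IsMaxCone F i l ∧ Develops d i l m x ∧ Develops d i l m' x') ∧
      f = MvPolynomial.X m * MvPolynomial.X m')}

/-- The `k`-algebra `k[Σ_F]` spanned by the symbols `z^m`, `m ∈ B(ℤ)`, with the multiplication of
`fanRelations`. -/
abbrev FanAlg (k : Type u) [Field k] (F : Set (ZMod n)) : Type u :=
  MvPolynomial (BZ n) k ⧸ Ideal.span (fanRelations d k F)

/-- The coordinate ring of the `p`-vertex
`𝔸²_{x_1,x_2} ∪ 𝔸²_{x_2,x_3} ∪ ⋯ ∪ 𝔸²_{x_p,x_1} ⊂ 𝔸^p`. -/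
abbrev VertexAlg (k : Type u) [Field k] (p : ℕ) : Type u :=
  MvPolynomial (ZMod p) k ⧸
    ⨅ i : ZMod p, Ideal.span
      ((fun j => (MvPolynomial.X j : MvPolynomial (ZMod p) k)) '' {j | j ≠ i ∧ j ≠ i + 1})

end Affine

section PiecewiseLinear

variable {n : ℕ} {L : Type u} [AddCommGroup L]

/-- A `P`-convex `Σ`-piecewise linear multivalued function on `B`: for every `i`, a continuous
function `φ_i` on `Λ_{ρ_i}`, linear with values in `L = P^gp` on both sides of the line spanned by
`ρ_i`; `neg i` is its linear extension from `σ_{i-1}`, `pos i` that from `σ_i`. -/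
structure PLFun (n : ℕ) (P : AddSubmonoid L) where
  neg : ZMod n → (ℤ × ℤ) →+ L
  pos : ZMod n → (ℤ × ℤ) →+ L
  agree : ∀ i, neg i (1, 0) = pos i (1, 0)
  convex : ∀ i, pos i (0, 1) - neg i (0, 1) ∈ P

variable {P : AddSubmonoid L} (φ : PLFun n P)

namespace PLFun

/-- The bending parameter `p_{ρ_i,φ}`. -/
def bend (i : ZMod n) : P := ⟨φ.pos i (0, 1) - φ.neg i (0, 1), φ.convex i⟩

/-- `φ_{ρ_i}` as a function on `Λ_{ρ_i}`. -/
def val (i : ZMod n) (m : ℤ × ℤ) : L := if 0 ≤ m.2 then φ.pos i m else φ.neg i m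

lemma pos_eq (i : ZMod n) (m : ℤ × ℤ) : φ.pos i m = φ.neg i m + m.2 • (φ.bend i : L) := by
  have h : m = m.1 • ((1, 0) : ℤ × ℤ) + m.2 • ((0, 1) : ℤ × ℤ) := by ext <;> simp
  have h1 : φ.pos i m = m.1 • φ.pos i (1, 0) + m.2 • φ.pos i (0, 1) := by
    conv_lhs => rw [h]
    rw [map_add, map_zsmul, map_zsmul]
  have h2 : φ.neg i m = m.1 • φ.neg i (1, 0) + m.2 • φ.neg i (0, 1) := by
    conv_lhs => rw [h]
    rw [map_add, map_zsmul, map_zsmul]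
  rw [h1, h2, φ.agree, bend, smul_sub]
  abel

lemma val_eq_neg (i : ZMod n) (m : ℤ × ℤ) :
    φ.val i m = φ.neg i m + m.2.toNat • (φ.bend i : L) := by
  unfold val
  split_ifs with h
  · rw [pos_eq, ← natCast_zsmul, Int.toNat_of_nonneg h]
  · rw [Int.toNat_of_nonpos (by omega)]; simp

lemma val_eq_pos (i : ZMod n) (m : ℤ × ℤ) :
    φ.val i m = φ.pos i m + (-m.2).toNat • (φ.bend i : L) := by
  unfold val
  split_ifs with h
  · rw [Int.toNat_of_nonpos (by omega)]; simp
  · rw [pos_eq, ← natCast_zsmul, Int.toNat_of_nonneg (by omega), neg_smul]; abel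

end PLFun

/-! The stalks of the local system `𝒫` at `σ_i` and at `ρ_i` are both identified with
`(ℤ × ℤ) × L` by the trivialization over `U_i`, in which the section `φ` is `m ↦ (m, φ_i m)`;
`q.1` is `r(q)`. -/

/-- The identification of `𝒫_{σ_i}` with `𝒫_{ρ_{i+1}}`: the gluing
`(m, p) ↦ (m, p + φ_{i+1}(m) - φ_i(m))` over `U_i ∩ U_{i+1} ⊃ Int σ_i`. -/
def transport (d : ZMod n → ℤ) (φ : PLFun n P) (i : ZMod n) :
    ((ℤ × ℤ) × L) ≃+ ((ℤ × ℤ) × L) where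
  toFun q := (glueΛ d i q.1, q.2 + φ.neg (i + 1) (glueΛ d i q.1) - φ.pos i q.1)
  invFun q := ((glueΛ d i).symm q.1, q.2 - φ.neg (i + 1) q.1 + φ.pos i ((glueΛ d i).symm q.1))
  left_inv q := by
    ext1
    · simp
    · simp only [AddEquiv.symm_apply_apply]; abel
  right_inv q := by
    ext1
    · simp
    · simp only [AddEquiv.apply_symm_apply]; abel
  map_add' x y := by
    ext1
    · simp
    · simp only [Prod.fst_add, Prod.snd_add, map_add]; abel

/-- `q ↦ q - φ_{σ_i}(r(q))`. -/
def htPos (i : ZMod n) : ((ℤ × ℤ) × L) →+ L :=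
  AddMonoidHom.snd _ _ - (φ.pos i).comp (AddMonoidHom.fst _ _)

/-- `q ↦ q - φ_{σ_{i-1}}(r(q))`, in the stalk at `ρ_i`. -/
def htNeg (i : ZMod n) : ((ℤ × ℤ) × L) →+ L :=
  AddMonoidHom.snd _ _ - (φ.neg i).comp (AddMonoidHom.fst _ _)

/-- `P_{φ_{σ_i}}`. -/
def monCone (i : ZMod n) : AddSubmonoid ((ℤ × ℤ) × L) := P.comap (htPos φ i)

lemma val_add_mem (i : ZMod n) (m m' : ℤ × ℤ) :
    φ.val i m + φ.val i m' - φ.val i (m + m') ∈ P := by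
  have h : φ.val i m + φ.val i m' - φ.val i (m + m')
      = (m.2.toNat + m'.2.toNat - (m + m').2.toNat) • (φ.bend i : L) := by
    have h0 : (m + m').2.toNat ≤ m.2.toNat + m'.2.toNat := by
      rw [Prod.snd_add]; omega
    rw [φ.val_eq_neg, φ.val_eq_neg, φ.val_eq_neg, map_add, sub_nsmul _ h0, add_smul]
    abel
  rw [h]
  exact P.nsmul_mem (φ.bend i).2 _

/-- `P_{φ_{ρ_i}}`, the set of all `p + φ_{ρ_i}(m)` with `p ∈ P` and `m ∈ Λ_{ρ_i}`. -/
def monRay (i : ZMod n) : AddSubmonoid ((ℤ × ℤ) × L) where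
  carrier := {q | q.2 - φ.val i q.1 ∈ P}
  zero_mem' := by simp [PLFun.val]
  add_mem' := by
    intro a b ha hb
    have := P.add_mem (P.add_mem ha hb) (val_add_mem φ i a.1 b.1)
    have h : (a + b).2 - φ.val i (a + b).1
        = a.2 - φ.val i a.1 + (b.2 - φ.val i b.1)
          + (φ.val i a.1 + φ.val i b.1 - φ.val i (a.1 + b.1)) := by
      rw [Prod.snd_add, Prod.fst_add]; abel
    change (a + b).2 - φ.val i (a + b).1 ∈ P
    rw [h]; exact this

lemma monRay_htPos (i : ZMod n) {q : (ℤ × ℤ) × L} (h : q ∈ monRay φ i) : htPos φ i q ∈ P := by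
  have h' : q.2 - φ.val i q.1 ∈ P := h
  have : htPos φ i q = q.2 - φ.val i q.1 + (-q.1.2).toNat • (φ.bend i : L) := by
    rw [φ.val_eq_pos]; simp only [htPos, AddMonoidHom.sub_apply, AddMonoidHom.coe_snd,
      AddMonoidHom.comp_apply, AddMonoidHom.coe_fst]; abel
  rw [this]
  exact P.add_mem h' (P.nsmul_mem (φ.bend i).2 _)

lemma monRay_htNeg (i : ZMod n) {q : (ℤ × ℤ) × L} (h : q ∈ monRay φ i) : htNeg φ i q ∈ P := by
  have h' : q.2 - φ.val i q.1 ∈ P := h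
  have : htNeg φ i q = q.2 - φ.val i q.1 + (q.1.2).toNat • (φ.bend i : L) := by
    rw [φ.val_eq_neg]; simp only [htNeg, AddMonoidHom.sub_apply, AddMonoidHom.coe_snd,
      AddMonoidHom.comp_apply, AddMonoidHom.coe_fst]; abel
  rw [this]
  exact P.add_mem h' (P.nsmul_mem (φ.bend i).2 _)

lemma htPos_transport_symm (d : ZMod n → ℤ) (i : ZMod n) (q : (ℤ × ℤ) × L) :
    htPos φ i ((transport d φ i).symm q) = htNeg φ (i + 1) q := by
  change q.2 - φ.neg (i + 1) q.1 + φ.pos i ((glueΛ d i).symm q.1)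
    - φ.pos i ((glueΛ d i).symm q.1) = q.2 - φ.neg (i + 1) q.1
  abel

variable (I : AddSemigroupIdeal P)

/-- `I_{σ_i,σ_i}`. -/
def idCone (i : ZMod n) : Set ((ℤ × ℤ) × L) := {q | q ∈ monCone φ i ∧ htPos φ i q ∈ elems I}

/-- `I_{ρ_i,σ_i}`. -/
def idPos (i : ZMod n) : Set ((ℤ × ℤ) × L) := {q | q ∈ monRay φ i ∧ htPos φ i q ∈ elems I}

/-- `I_{ρ_i,σ_{i-1}}`. -/
def idNeg (i : ZMod n) : Set ((ℤ × ℤ) × L) := {q | q ∈ monRay φ i ∧ htNeg φ i q ∈ elems I}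

/-- `I_{ρ_i,ρ_i}`. -/
def idRay (i : ZMod n) : Set ((ℤ × ℤ) × L) := idPos φ I i ∪ idNeg φ I i

variable (k : Type u) [Field k]

/-- `k[P]/I`. -/
abbrev Base : Type u := MonAlg k P (elems I)

/-- `R_{σ_i,σ_i,I}`. -/
abbrev RCone (i : ZMod n) : Type u := MonAlg k (monCone φ i) (idCone φ I i)

/-- `R_{ρ_i,σ_i,I}`. -/
abbrev RPos (i : ZMod n) : Type u := MonAlg k (monRay φ i) (idPos φ I i)

/-- `R_{ρ_i,σ_{i-1},I}`. -/
abbrev RNeg (i : ZMod n) : Type u := MonAlg k (monRay φ i) (idNeg φ I i)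

/-- `R_{ρ_i,ρ_i,I}`. -/
abbrev RRay (i : ZMod n) : Type u := MonAlg k (monRay φ i) (idRay φ I i)

/-- The canonical surjection `R_{ρ_i,σ_i,I} → R_{ρ_i,ρ_i,I}`. -/
def posToRay (i : ZMod n) : RPos φ I k i →ₐ[k] RRay φ I k i :=
  MonAlg.map (AddMonoidHom.id _) (fun _ h => h) (fun _ _ h => Or.inl h)

/-- The canonical surjection `R_{ρ_i,σ_{i-1},I} → R_{ρ_i,ρ_i,I}`. -/
def negToRay (i : ZMod n) : RNeg φ I k i →ₐ[k] RRay φ I k i :=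
  MonAlg.map (AddMonoidHom.id _) (fun _ h => h) (fun _ _ h => Or.inr h)

/-- The canonical inclusion `R_{ρ_i,σ_i,I} → R_{σ_i,σ_i,I}`. -/
def posToCone (i : ZMod n) : RPos φ I k i →ₐ[k] RCone φ I k i :=
  MonAlg.map (AddMonoidHom.id _) (fun _ h => monRay_htPos φ i h)
    (fun _ _ h => ⟨monRay_htPos φ i h.1, h.2⟩)

/-- The canonical inclusion `R_{ρ_{i+1},σ_i,I} → R_{σ_i,σ_i,I}`. -/
def negToCone (d : ZMod n → ℤ) (i : ZMod n) : RNeg φ I k (i + 1) →ₐ[k] RCone φ I k i :=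
  MonAlg.map (transport d φ i).symm.toAddMonoidHom
    (fun q h => by
      change htPos φ i ((transport d φ i).symm q) ∈ P
      rw [htPos_transport_symm]
      exact monRay_htNeg φ (i + 1) h)
    (fun q _ h => by
      refine ⟨?_, ?_⟩
      · change htPos φ i ((transport d φ i).symm q) ∈ P
        rw [htPos_transport_symm]
        exact monRay_htNeg φ (i + 1) h.1
      · change htPos φ i ((transport d φ i).symm q) ∈ elems I
        rw [htPos_transport_symm]
        exact h.2)

variable {I k}

lemma posToRay_mono (i : ZMod n) (q : monRay φ i) :
    posToRay φ I k i (mono k _ _ q 1) = mono k (monRay φ i) (idRay φ I i) q 1 :=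
  MonAlg.map_mono _ _ _ q

lemma negToRay_mono (i : ZMod n) (q : monRay φ i) :
    negToRay φ I k i (mono k _ _ q 1) = mono k (monRay φ i) (idRay φ I i) q 1 :=
  MonAlg.map_mono _ _ _ q

lemma posToCone_mono (i : ZMod n) (q : monRay φ i) :
    posToCone φ I k i (mono k _ _ q 1)
      = mono k (monCone φ i) (idCone φ I i) ⟨q, monRay_htPos φ i q.2⟩ 1 :=
  MonAlg.map_mono _ _ _ q

lemma transport_symm_mem (d : ZMod n → ℤ) (i : ZMod n) (q : monRay φ (i + 1)) :
    (transport d φ i).symm q ∈ monCone φ i := by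
  change htPos φ i ((transport d φ i).symm q) ∈ P
  rw [htPos_transport_symm]
  exact monRay_htNeg φ (i + 1) q.2

lemma negToCone_mono (d : ZMod n → ℤ) (i : ZMod n) (q : monRay φ (i + 1)) :
    negToCone φ I k d i (mono k _ _ q 1)
      = mono k (monCone φ i) (idCone φ I i)
        ⟨(transport d φ i).symm q, transport_symm_mem φ d i q⟩ 1 :=
  MonAlg.map_mono _ _ _ q

end PiecewiseLinear

/-! ### Scattering diagrams -/

section Scattering

variable {n : ℕ} {L : Type u} [AddCommGroup L] {P : AddSubmonoid L} (φ : PLFun n P)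

/-! A ray in `B` of rational slope with endpoint the origin is given by `i : ZMod n` and `s ≥ 0`
rational: it is the ray of slope `s` in `σ_i`, spanned by `s.den v_i + s.num v_{i+1}`. For `s = 0`
it is `ρ_i`; for `s > 0` it lies in the interior of `σ_i`. Let `τ` be the smallest cone containing
it. -/

/-- `P_{φ_τ}`. -/
def tauMon (i : ZMod n) (s : ℚ≥0) : AddSubmonoid ((ℤ × ℤ) × L) :=
  if s = 0 then monRay φ i else monCone φ i

/-- `I_{τ,τ}`. -/
def tauIdeal (I : AddSemigroupIdeal P) (i : ZMod n) (s : ℚ≥0) : Set ((ℤ × ℤ) × L) :=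
  if s = 0 then idRay φ I i else idCone φ I i

/-- A ray `(𝔡, f_𝔡)` for the data `(B, Σ)`, `P`, `φ`, `J`, with `f_𝔡 = ∑ c_q z^q`. -/
structure ScatRay (k : Type u) [Field k] (J : AddSemigroupIdeal P) where
  cone : ZMod n
  slope : ℚ≥0
  coeff : ((ℤ × ℤ) × L) → k
  coeff_zero : coeff 0 = 1
  coeff_supp : ∀ q, coeff q ≠ 0 → q ∈ tauMon φ cone slope
  /-- `f_𝔡` lies in the completion of `k[P_{φ_τ}]` with respect to `J_{τ,τ}`, whose topology is
  defined by the ideals `I_{τ,τ}` with `√I = J`. -/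
  summable : ∀ I : AddSemigroupIdeal P, radical I = J →
    {q | coeff q ≠ 0 ∧ q ∉ tauIdeal φ I cone slope}.Finite
  /-- Either the ray is outgoing: the nonconstant exponents have `r(q)` a positive multiple of minus
  the generator of the ray; or it is incoming: they have `r(q)` a positive multiple of it. -/
  direction :
    (∀ q, q ≠ 0 → coeff q ≠ 0 →
      ∃ l : ℕ, l ≠ 0 ∧ q.1 = (-(l * slope.den : ℤ), -(l * slope.num : ℤ))) ∨
    (∀ q, q ≠ 0 → coeff q ≠ 0 →
      ∃ l : ℕ, l ≠ 0 ∧ q.1 = ((l * slope.den : ℤ), (l * slope.num : ℤ)))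
  /-- `f_𝔡 ≡ 1 mod J` unless the ray is a `ρ_i` with bending parameter in `J`. -/
  congr_one : (slope ≠ 0 ∨ φ.bend cone ∉ J) →
    ∀ q, q ≠ 0 → coeff q ≠ 0 → q ∈ tauIdeal φ J cone slope

variable {φ} {k : Type u} [Field k] {J : AddSemigroupIdeal P}

/-- `f_𝔡 ≢ 1 mod I_{τ,τ}`. -/
def ScatRay.Nontrivial (r : ScatRay φ k J) (I : AddSemigroupIdeal P) : Prop :=
  ∃ q, q ≠ 0 ∧ r.coeff q ≠ 0 ∧ q ∉ tauIdeal φ I r.cone r.slope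

variable (φ k J) in
/-- A scattering diagram for the data `(B, Σ)`, `P`, `φ`, `J`. -/
structure ScatteringDiagram where
  rays : Set (ScatRay φ k J)
  finite : ∀ I : AddSemigroupIdeal P, radical I = J → {r ∈ rays | r.Nontrivial I}.Finite

namespace ScatteringDiagram

variable (D : ScatteringDiagram φ k J)

/-- The elements of the diagram supported on a given ray of `B`. -/
def on (i : ZMod n) (s : ℚ≥0) : Set (ScatRay φ k J) :=
  {r ∈ D.rays | r.cone = i ∧ r.slope = s}

variable (I : AddSemigroupIdeal P)

/-- `f_ρ ∈ R_{ρ,ρ,I}` for `ρ = ρ_i`: the product of the `f_𝔡` with `𝔡 = ρ`. -/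
def fRay (i : ZMod n) : RRay φ I k i :=
  ∏ᶠ r ∈ D.on i 0, ofCoeff (monRay φ i) (idRay φ I i) r.coeff

/-- The product in `R_{σ_i,σ_i,I}` of the `f_𝔡` supported on the ray of slope `s` in `σ_i`. -/
def fCone (i : ZMod n) (s : ℚ≥0) : RCone φ I k i :=
  ∏ᶠ r ∈ D.on i s, ofCoeff (monCone φ i) (idCone φ I i) r.coeff

lemma isUnit_fCone {I : AddSemigroupIdeal P} (hI : radical I = J) (i : ZMod n) {s : ℚ≥0}
    (hs : s ≠ 0) : IsUnit (D.fCone I i s) := by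
  unfold fCone
  refine finprod_mem_induction (p := IsUnit) isUnit_one (fun _ _ h h' => h.mul h') ?_
  rintro r ⟨-, hi, hr⟩
  subst hi
  have hs' : r.slope ≠ 0 := hr ▸ hs
  have hfin := r.summable I hI
  have hcong := r.congr_one (Or.inl hs')
  simp only [tauIdeal, if_neg hs'] at hfin hcong
  set S := monCone φ r.cone
  set T := idCone φ I r.cone
  have hfin' : (Function.support fun q : S => mono k S T q (r.coeff q)).Finite := by
    refine (hfin.preimage (f := ((↑) : S → (ℤ × ℤ) × L)) Subtype.val_injective.injOn).subset ?_
    intro q hq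
    refine ⟨fun h => hq ?_, fun h => hq (mono_eq_zero h _)⟩
    simp only [h]; exact mono_smul _
  classical
  have hsum : ofCoeff S T r.coeff
      = ∑ q ∈ insert 0 hfin'.toFinset, mono k S T q (r.coeff q) :=
    finsum_eq_sum_of_support_subset _ (by intro q hq; simp [hq])
  rw [hsum, ← Finset.add_sum_erase _ _ (Finset.mem_insert_self _ _)]
  have h0 : mono k S T 0 (r.coeff ((0 : S) : (ℤ × ℤ) × L)) = 1 := by
    rw [AddSubmonoid.coe_zero, r.coeff_zero, mono_zero_one]
  rw [h0]
  refine IsNilpotent.isUnit_one_add (isNilpotent_sum ?_)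
  intro q hq
  have hq0 : (q : (ℤ × ℤ) × L) ≠ 0 := by
    have := Finset.ne_of_mem_erase hq
    simpa using this
  by_cases hc : r.coeff q = 0
  · rw [hc, mono_smul]; exact IsNilpotent.zero
  · obtain ⟨hqS, p, hp, hpq⟩ := hcong q hq0 hc
    rw [← hI] at hp
    obtain ⟨m, hm, hmp⟩ := hp
    refine ⟨m, ?_⟩
    rw [mono_pow]
    apply mono_eq_zero
    refine ⟨(m • q).2, m • p, hmp, ?_⟩
    rw [AddSubmonoidClass.coe_nsmul, AddSubmonoidClass.coe_nsmul, map_nsmul, hpq]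

variable {I} (hI : radical I = J)

/-- The wall-crossing automorphism `z^q ↦ z^q f^{⟨n, r(q)⟩}` of `R_{σ_i,σ_i,I}` for a path crossing
counterclockwise the ray of slope `s > 0` in `σ_i`: here `n` is primitive, vanishes on the ray and
is negative on the direction of the path. -/
def thetaRay (i : ZMod n) (s : ℚ≥0) : RCone φ I k i →ₐ[k] RCone φ I k i :=
  if hs : s ≠ 0 then
    MonAlg.twist (AlgHom.id k _) (D.isUnit_fCone hI i hs).unit
      (((s.num : ℤ) • AddMonoidHom.fst ℤ ℤ - (s.den : ℤ) • AddMonoidHom.snd ℤ ℤ).comp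
        (AddMonoidHom.fst (ℤ × ℤ) L))
  else AlgHom.id k _

lemma finite_walls (hI : radical I = J) (i : ZMod n) :
    {s : ℚ≥0 | s ≠ 0 ∧ ∃ r ∈ D.on i s, r.Nontrivial I}.Finite := by
  refine ((D.finite I hI).image fun r => r.slope).subset ?_
  rintro s ⟨-, r, ⟨hr, -, hs⟩, hr'⟩
  exact ⟨r, ⟨hr, hr'⟩, hs⟩

/-- The slopes of the rays in `Supp_I(𝔇)` that meet the interior of `σ_i`. -/
def walls (i : ZMod n) : Finset ℚ≥0 := (D.finite_walls hI i).toFinset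

open scoped Classical in
/-- `θ_{γ,𝔇} = θ_{γ,𝔡_m} ∘ ⋯ ∘ θ_{γ,𝔡_1}` for a path `γ` in the interior of `σ_i` which runs
counterclockwise and crosses exactly the rays in `𝔇_I` with slope in `A`. -/
def theta (i : ZMod n) (A : Set ℚ≥0) : RCone φ I k i →ₐ[k] RCone φ I k i :=
  (((D.walls hI i).filter (· ∈ A)).sort (· ≤ ·)).foldl
    (fun g s => (D.thetaRay hI i s).comp g) (AlgHom.id k _)

/-! ### The glued space -/

lemma base_mem_monRay (φ : PLFun n P) (i : ZMod n) {p : L} (hp : p ∈ P) :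
    AddMonoidHom.inr (ℤ × ℤ) L p ∈ monRay φ i := by
  change p - φ.val i 0 ∈ P
  simpa [PLFun.val] using hp

variable (I) in
/-- The map `R_{ρ_i,σ_i,I} → (R_{ρ_i,ρ_i,I})_{f_ρ}`, `z^q ↦ z^q f_ρ^{⟨n_ρ, r(q)⟩}`, where `n_ρ`
annihilates `ρ_i` and is positive on `σ_i`. -/
def posToLoc (i : ZMod n) : RPos φ I k i →ₐ[k] Localization.Away (D.fRay I i) :=
  MonAlg.twist ((IsScalarTower.toAlgHom k (RRay φ I k i) _).comp (posToRay φ I k i))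
    (IsLocalization.Away.algebraMap_isUnit (S := Localization.Away (D.fRay I i)) (D.fRay I i)).unit
    ((AddMonoidHom.snd ℤ ℤ).comp (AddMonoidHom.fst (ℤ × ℤ) L))

variable (I) in
/-- The map `R_{ρ_i,σ_{i-1},I} → (R_{ρ_i,ρ_i,I})_{f_ρ}`. -/
def negToLoc (i : ZMod n) : RNeg φ I k i →ₐ[k] Localization.Away (D.fRay I i) :=
  (IsScalarTower.toAlgHom k (RRay φ I k i) _).comp (negToRay φ I k i)

variable (I) in
/-- `R_{ρ_i,I}`, the fibre product of `R_{ρ_i,σ_{i-1},I}` and `R_{ρ_i,σ_i,I}` over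
`(R_{ρ_i,ρ_i,I})_{f_ρ}`. -/
abbrev RGlued (i : ZMod n) : Subalgebra k (RNeg φ I k i × RPos φ I k i) :=
  AlgHom.equalizer ((D.negToLoc I i).comp (AlgHom.fst k _ _))
    ((D.posToLoc I i).comp (AlgHom.snd k _ _))

variable (I) in
/-- `ψ_{ρ_i,+} : R_{ρ_i,I} → R_{σ_i,σ_i,I}`. -/
def psiPos (i : ZMod n) : D.RGlued I i →ₐ[k] RCone φ I k i :=
  (posToCone φ I k i).comp ((AlgHom.snd k _ _).comp (D.RGlued I i).val)

variable (I) in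
/-- `ψ_{ρ_{i+1},-} : R_{ρ_{i+1},I} → R_{σ_i,σ_i,I}`. -/
def psiNeg (d : ZMod n → ℤ) (i : ZMod n) : D.RGlued I (i + 1) →ₐ[k] RCone φ I k i :=
  (negToCone φ I k d i).comp ((AlgHom.fst k _ _).comp (D.RGlued I (i + 1)).val)

lemma base_mem_idPos (φ : PLFun n P) (I : AddSemigroupIdeal P) (i : ZMod n) :
    ∀ p ∈ P, p ∈ elems I → AddMonoidHom.inr (ℤ × ℤ) L p ∈ idPos φ I i :=
  fun p hp h => ⟨base_mem_monRay φ i hp, by simpa [htPos] using h⟩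

lemma base_mem_idNeg (φ : PLFun n P) (I : AddSemigroupIdeal P) (i : ZMod n) :
    ∀ p ∈ P, p ∈ elems I → AddMonoidHom.inr (ℤ × ℤ) L p ∈ idNeg φ I i :=
  fun p hp h => ⟨base_mem_monRay φ i hp, by simpa [htNeg] using h⟩

/-- The structure map `k[P]/I → R_{ρ_i,σ_i,I}`. -/
def basePos (φ : PLFun n P) (I : AddSemigroupIdeal P) (k : Type u) [Field k] (i : ZMod n) :
    Base (P := P) I k →ₐ[k] RPos φ I k i :=
  MonAlg.map (AddMonoidHom.inr (ℤ × ℤ) L) (fun _ hp => base_mem_monRay φ i hp)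
    (base_mem_idPos φ I i)

/-- The structure map `k[P]/I → R_{ρ_i,σ_{i-1},I}`. -/
def baseNeg (φ : PLFun n P) (I : AddSemigroupIdeal P) (k : Type u) [Field k] (i : ZMod n) :
    Base (P := P) I k →ₐ[k] RNeg φ I k i :=
  MonAlg.map (AddMonoidHom.inr (ℤ × ℤ) L) (fun _ hp => base_mem_monRay φ i hp)
    (base_mem_idNeg φ I i)

lemma basePos_mono (φ : PLFun n P) (I : AddSemigroupIdeal P) (i : ZMod n) (p : P) :
    basePos φ I k i (mono k P (elems I) p 1)
      = mono k (monRay φ i) (idPos φ I i) ⟨(0, (p : L)), base_mem_monRay φ i p.2⟩ 1 :=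
  MonAlg.map_mono _ _ _ p

lemma baseNeg_mono (φ : PLFun n P) (I : AddSemigroupIdeal P) (i : ZMod n) (p : P) :
    baseNeg φ I k i (mono k P (elems I) p 1)
      = mono k (monRay φ i) (idNeg φ I i) ⟨(0, (p : L)), base_mem_monRay φ i p.2⟩ 1 :=
  MonAlg.map_mono _ _ _ p

/-- The structure map `k[P]/I → R_{σ_i,σ_i,I}`. -/
def baseCone (φ : PLFun n P) (I : AddSemigroupIdeal P) (k : Type u) [Field k] (i : ZMod n) :
    Base (P := P) I k →ₐ[k] RCone φ I k i :=
  (posToCone φ I k i).comp (basePos φ I k i)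

lemma baseCone_mono (φ : PLFun n P) (I : AddSemigroupIdeal P) (i : ZMod n) (p : P) :
    baseCone φ I k i (mono k P (elems I) p 1)
      = mono k (monCone φ i) (idCone φ I i)
        ⟨(0, (p : L)), monRay_htPos φ i (base_mem_monRay φ i p.2)⟩ 1 := by
  rw [baseCone, AlgHom.comp_apply, basePos_mono, posToCone_mono]

variable (I) in
/-- The structure map `k[P]/I → R_{ρ_i,I}`. -/
def baseGlued (i : ZMod n) : Base (P := P) I k →ₐ[k] D.RGlued I i :=
  AlgHom.codRestrict ((baseNeg φ I k i).prod (basePos φ I k i)) _ (by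
    intro x
    rw [AlgHom.mem_equalizer]
    have : ((D.negToLoc I i).comp (AlgHom.fst k _ _)).comp
          ((baseNeg φ I k i).prod (basePos φ I k i))
        = ((D.posToLoc I i).comp (AlgHom.snd k _ _)).comp
          ((baseNeg φ I k i).prod (basePos φ I k i)) := by
      apply MonAlg.hom_ext
      intro p
      change D.negToLoc I i (baseNeg φ I k i (mono k P (elems I) p 1))
        = D.posToLoc I i (basePos φ I k i (mono k P (elems I) p 1))
      rw [baseNeg_mono, basePos_mono, posToLoc, MonAlg.twist_mono, negToLoc, AlgHom.comp_apply,
        AlgHom.comp_apply, negToRay_mono, posToRay_mono]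
      simp
    exact DFunLike.congr_fun this x)

lemma theta_base (i : ZMod n) (A : Set ℚ≥0) :
    (D.theta hI i A).comp (baseCone φ I k i) = baseCone φ I k i := by
  have h1 : ∀ s, (D.thetaRay hI i s).comp (baseCone φ I k i) = baseCone φ I k i := by
    intro s
    unfold thetaRay
    split_ifs with hs
    · apply MonAlg.hom_ext
      intro p
      rw [AlgHom.comp_apply, baseCone_mono, MonAlg.twist_mono]
      simp
    · rfl
  have h2 : ∀ (l : List ℚ≥0) (g : RCone φ I k i →ₐ[k] RCone φ I k i),
      g.comp (baseCone φ I k i) = baseCone φ I k i →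
      (l.foldl (fun g s => (D.thetaRay hI i s).comp g) g).comp (baseCone φ I k i)
        = baseCone φ I k i := by
    intro l
    induction l with
    | nil => intro g hg; exact hg
    | cons s l ih =>
      intro g hg
      refine ih _ ?_
      rw [AlgHom.comp_assoc, hg, h1]
  exact h2 _ _ rfl

lemma psi_base (d : ZMod n → ℤ) (i : ZMod n) :
    ((D.theta hI i Set.univ).comp (D.psiPos I i)).comp (D.baseGlued I i)
      = (D.psiNeg I d i).comp (D.baseGlued I (i + 1)) := by
  have h1 : (D.psiPos I i).comp (D.baseGlued I i) = baseCone φ I k i := rfl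
  rw [AlgHom.comp_assoc, h1, theta_base]
  apply MonAlg.hom_ext
  intro p
  change posToCone φ I k i (basePos φ I k i (mono k P (elems I) p 1))
    = negToCone φ I k d i (baseNeg φ I k (i + 1) (mono k P (elems I) p 1))
  rw [basePos_mono, posToCone_mono, baseNeg_mono, negToCone_mono]
  refine congrArg (fun s => mono k (monCone φ i) (idCone φ I i) s 1) (Subtype.ext ?_)
  change ((0 : ℤ × ℤ), (p : L)) = (transport d φ i).symm (0, (p : L))
  rw [AddEquiv.eq_symm_apply]
  simp [transport]

variable (I) in
/-- `U_{ρ_i,I} = Spec R_{ρ_i,I}`. -/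
def U (i : ZMod n) : LocallyRingedSpace.{u} :=
  (Spec (CommRingCat.of (D.RGlued I i))).toLocallyRingedSpace

/-- `Spec R_{σ_i,σ_i,I}`. -/
def UCone (φ : PLFun n P) (k : Type u) [Field k] (I : AddSemigroupIdeal P) (i : ZMod n) :
    LocallyRingedSpace.{u} :=
  (Spec (CommRingCat.of (RCone φ I k i))).toLocallyRingedSpace

/-- The open immersion `Spec R_{σ_i,σ_i,I} → U_{ρ_i,I}`, twisted by `θ_{γ,𝔇}` for a path `γ` from a
point close to `ρ_i` to a point close to `ρ_{i+1}`. -/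
def toU (i : ZMod n) : UCone φ k I i ⟶ D.U I i :=
  (Spec.map (CommRingCat.ofHom
    (((D.theta hI i Set.univ).comp (D.psiPos I i) : D.RGlued I i →ₐ[k] RCone φ I k i) :
      D.RGlued I i →+* RCone φ I k i))).toLRSHom

variable (I) in
/-- The open immersion `Spec R_{σ_i,σ_i,I} → U_{ρ_{i+1},I}`. -/
def toUSucc (d : ZMod n → ℤ) (i : ZMod n) : UCone φ k I i ⟶ D.U I (i + 1) :=
  (Spec.map (CommRingCat.ofHom
    ((D.psiNeg I d i : D.RGlued I (i + 1) →ₐ[k] RCone φ I k i) :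
      D.RGlued I (i + 1) →+* RCone φ I k i))).toLRSHom

variable (I) in
/-- The structure morphism `U_{ρ_i,I} → Spec k[P]/I`. -/
def baseU (i : ZMod n) :
    D.U I i ⟶ (Spec (CommRingCat.of (Base (P := P) I k))).toLocallyRingedSpace :=
  (Spec.map (CommRingCat.ofHom
    ((D.baseGlued I i : Base (P := P) I k →ₐ[k] D.RGlued I i) :
      Base (P := P) I k →+* D.RGlued I i))).toLRSHom

lemma toU_base (d : ZMod n → ℤ) (i : ZMod n) :
    D.toU hI i ≫ D.baseU I i = D.toUSucc I d i ≫ D.baseU I (i + 1) := by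
  have h : ∀ {A B C : CommRingCat.{u}} (f : A ⟶ B) (g : B ⟶ C),
      (Spec.map g).toLRSHom ≫ (Spec.map f).toLRSHom = (Spec.map (f ≫ g)).toLRSHom := by
    intro A B C f g
    rw [Spec.map_comp]; rfl
  refine (h _ _).trans (Eq.trans ?_ (h _ _).symm)
  refine congrArg (fun f => (Spec.map f).toLRSHom) ?_
  refine CommRingCat.hom_ext (RingHom.ext fun x => ?_)
  exact DFunLike.congr_fun (D.psi_base hI d i) x

/-- `X°_{I,𝔇}`: the quotient, in the category of locally ringed spaces, of the disjoint union of the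
`U_{ρ_i,I}` by the equivalence relation generated by identifying, for every `i`, the open subset
`Spec R_{σ_i,σ_i,I}` of `U_{ρ_i,I}` with that of `U_{ρ_{i+1},I}` by means of `θ_{γ,𝔇}`. -/
def Xo (d : ZMod n → ℤ) : LocallyRingedSpace.{u} :=
  coequalizer (Limits.Sigma.desc fun i => D.toU hI i ≫ Limits.Sigma.ι (D.U I) i)
    (Limits.Sigma.desc fun i => D.toUSucc I d i ≫ Limits.Sigma.ι (D.U I) (i + 1))

/-- The chart `U_{ρ_i,I} → X°_{I,𝔇}`. -/
def chart (d : ZMod n → ℤ) (i : ZMod n) : D.U I i ⟶ D.Xo hI d :=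
  Limits.Sigma.ι (D.U I) i ≫ coequalizer.π _ _

/-- The structure morphism `X°_{I,𝔇} → Spec k[P]/I`. -/
def structureMap (d : ZMod n → ℤ) :
    D.Xo hI d ⟶ (Spec (CommRingCat.of (Base (P := P) I k))).toLocallyRingedSpace :=
  coequalizer.desc
    (Limits.Sigma.desc fun i => D.baseU I i) (by
    apply Limits.Sigma.hom_ext
    intro i
    simp only [Limits.colimit.ι_desc_assoc, Limits.Cofan.mk_ι_app, Category.assoc,
      Limits.colimit.ι_desc]
    exact D.toU_base hI d i)

/-- `Γ(X°_{I,𝔇}, 𝒪)`. -/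
def Functions (d : ZMod n → ℤ) : CommRingCat.{u} := LocallyRingedSpace.Γ.obj (op (D.Xo hI d))

/-- The ring map `k[P]/I → Γ(X°_{I,𝔇}, 𝒪)` given by the structure morphism. -/
def baseToFunctions (d : ZMod n → ℤ) :
    CommRingCat.of (Base (P := P) I k) ⟶ D.Functions hI d :=
  (Scheme.ΓSpecIso _).inv ≫ LocallyRingedSpace.Γ.map (D.structureMap hI d).op

instance (d : ZMod n → ℤ) : Algebra (Base (P := P) I k) (D.Functions hI d) :=
  (D.baseToFunctions hI d).hom.toAlgebra

/-- The restriction `Γ(X°_{I,𝔇}, 𝒪) → R_{ρ_i,I}` of functions to the chart `U_{ρ_i,I}`. -/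
def restrict (d : ZMod n → ℤ) (i : ZMod n) : D.Functions hI d →+* D.RGlued I i :=
  (LocallyRingedSpace.Γ.map (D.chart hI d i).op ≫ (Scheme.ΓSpecIso _).hom).hom

/-- `X_I = Spec Γ(X°_{I,𝔇}, 𝒪)`. -/
def X (d : ZMod n → ℤ) : Scheme.{u} := Spec (D.Functions hI d)

/-- The canonical morphism `X°_{I,𝔇} → X_I`. -/
def toX (d : ZMod n → ℤ) : D.Xo hI d ⟶ (D.X hI d).toLocallyRingedSpace := (D.Xo hI d).toΓSpec

/-- `f_I : X_I → Spec k[P]/I`. -/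
def fI (d : ZMod n → ℤ) : D.X hI d ⟶ Spec (CommRingCat.of (Base (P := P) I k)) :=
  Spec.map (D.baseToFunctions hI d)

end ScatteringDiagram

/-! ### Broken lines

The endpoint `Q` of a broken line is taken in the interior of a cone `σ_i`, on a line through the
origin of irrational slope. A broken line is cut into legs at the points where it bends and at the
points where it crosses a ray of `Σ`, so that each leg is a line segment in one cone `σ_i` (the first
one is a half-line). A broken line has no segment contained in a line through the origin: it could
not have got there by bending, and it would run into the origin. -/

/-- The polynomial of the terms of `f_𝔡` with exponent outside `I_{τ,τ}`. -/
def ScatRay.trunc (r : ScatRay φ k J) (I : AddSemigroupIdeal P) :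
    AddMonoidAlgebra k ((ℤ × ℤ) × L) :=
  ∑ᶠ q ∈ {q | q ∉ tauIdeal φ I r.cone r.slope}, AddMonoidAlgebra.single q (r.coeff q)

namespace ScatteringDiagram

variable (D : ScatteringDiagram φ k J)

/-- `c z^e` is a nonzero term of the formal power series `∏ f_𝔡^N`, where the product is over the
`𝔡` supported on the ray of slope `s` in `σ_i`. (The coefficient can be computed modulo `I_{τ,τ}`
for any `I` with `√I = J` and `e ∉ I_{τ,τ}`.) -/
def IsTerm (i : ZMod n) (s : ℚ≥0) (N : ℕ) (c : k) (e : (ℤ × ℤ) × L) : Prop :=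
  c ≠ 0 ∧ ∃ I : AddSemigroupIdeal P, radical I = J ∧ e ∉ tauIdeal φ I i s ∧
    (∏ᶠ r ∈ D.on i s, r.trunc I ^ N).coeff e = c

/-- What can happen to the monomial when a broken line crosses `ρ_i`, with `N = ⟨n, r(q)⟩`: either
it goes straight on, or it is multiplied by a term `c z^e` of `∏ f_𝔡^N` that changes the
direction. -/
def Crosses (i : ZMod n) (N : ℕ) (c : k) (e : (ℤ × ℤ) × L) : Prop :=
  (c = 1 ∧ e = 0) ∨ (D.IsTerm i 0 N c e ∧ e.1 ≠ 0)

end ScatteringDiagram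

/-- A leg of a broken line: the cone `σ_i` containing it, its endpoint in coordinates with respect to
`(v_i, v_{i+1})`, and its monomial `coeff · z^expo`, with `expo ∈ 𝒫_{σ_i}`. -/
@[ext]
structure Leg (n : ℕ) (L : Type u) (k : Type u) where
  cone : ZMod n
  endpt : ℝ × ℝ
  coeff : k
  expo : (ℤ × ℤ) × L

/-- The velocity `-r(q)` of a leg with exponent `q`. -/
def Leg.velocity (l : Leg n L k) : ℝ × ℝ := (-(l.expo.1.1 : ℝ), -(l.expo.1.2 : ℝ))

/-- The endpoint of the leg is a point of `σ_i ∖ {0}`. -/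
def Leg.InCone (l : Leg n L k) : Prop := 0 ≤ l.endpt.1 ∧ 0 ≤ l.endpt.2 ∧ l.endpt ≠ 0

/-- The leg `l'`, which lasts for the time `t`, can follow the leg `l`. -/
inductive Leg.Next (D : ScatteringDiagram φ k J) (d : ZMod n → ℤ) (l l' : Leg n L k) : Prop
  /-- The broken line crosses `ρ_{i+1}` from `σ_i` to `σ_{i+1}`. -/
  | counterclockwise (N : ℕ) (c : k) (e : (ℤ × ℤ) × L) (t : ℝ)
      (hcone : l'.cone = l.cone + 1)
      (hend : l.endpt.1 = 0)
      (hN : l.expo.1.1 = N) (hN0 : 0 < N)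
      (hbend : D.Crosses (l.cone + 1) N c e)
      (hcoeff : l'.coeff = l.coeff * c)
      (hexpo : l'.expo = transport d φ l.cone l.expo + e)
      (ht : 0 < t) (hline : l'.endpt = (l.endpt.2, 0) + t • l'.velocity)
      (hin : l'.InCone)
  /-- The broken line crosses `ρ_i` from `σ_i` to `σ_{i-1}`. -/
  | clockwise (N : ℕ) (c : k) (e : (ℤ × ℤ) × L) (t : ℝ)
      (hcone : l.cone = l'.cone + 1)
      (hend : l.endpt.2 = 0)
      (hN : l.expo.1.2 = N) (hN0 : 0 < N)
      (hbend : D.Crosses l.cone N c e)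
      (hcoeff : l'.coeff = l.coeff * c)
      (hexpo : transport d φ l'.cone l'.expo = l.expo + e)
      (ht : 0 < t) (hline : l'.endpt = (0, l.endpt.1) + t • l'.velocity)
      (hin : l'.InCone)
  /-- The broken line bends at the ray of slope `s` in the interior of `σ_i`. -/
  | interior (s : ℚ≥0) (N : ℕ) (c : k) (e : (ℤ × ℤ) × L) (t : ℝ)
      (hcone : l'.cone = l.cone)
      (hs : s ≠ 0) (hend : 0 < l.endpt.1) (hend' : l.endpt.2 = s * l.endpt.1)
      (hN : ((s.num : ℤ) * l.expo.1.1 - (s.den : ℤ) * l.expo.1.2).natAbs = N)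
      (hbend : D.IsTerm l.cone s N c e) (hdir : e.1 ≠ 0)
      (hcoeff : l'.coeff = l.coeff * c)
      (hexpo : l'.expo = l.expo + e)
      (ht : 0 < t) (hline : l'.endpt = l.endpt + t • l'.velocity)
      (hin : l'.InCone)

/-- The broken lines for `q ∈ B_0(ℤ)` with endpoint the point `Q` of `σ_i`. -/
structure BrokenLine (D : ScatteringDiagram φ k J) (d : ZMod n → ℤ) (q : B0Z n) (i : ZMod n)
    (Q : ℝ × ℝ) where
  first : Leg n L k
  rest : List (Leg n L k)
  /-- The first leg is a half-line in a cone containing `q`, with monomial `z^{φ_σ(q)}`. -/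
  first_mono : first.coeff = 1 ∧ ∃ a b : ℕ, pt first.cone a b = some q ∧
    first.expo = (((a : ℤ), (b : ℤ)), φ.pos first.cone ((a : ℤ), (b : ℤ)))
  first_inCone : first.InCone
  chain : List.IsChain (Leg.Next D d) (first :: rest)
  last_cone : ((first :: rest).getLast (List.cons_ne_nil _ _)).cone = i
  last_endpt : ((first :: rest).getLast (List.cons_ne_nil _ _)).endpt = Q

namespace BrokenLine

variable {D : ScatteringDiagram φ k J} {d : ZMod n → ℤ} {q : B0Z n} {i : ZMod n} {Q : ℝ × ℝ}

/-- The last leg. -/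
def last (β : BrokenLine D d q i Q) : Leg n L k :=
  (β.first :: β.rest).getLast (List.cons_ne_nil _ _)

open scoped Classical in
/-- `Mono(γ)`, as an element of `R_{σ_i,σ_i,I}`. (The exponent always lies in `P_{φ_{σ_i}}`.) -/
def Mono (β : BrokenLine D d q i Q) (I : AddSemigroupIdeal P) : RCone φ I k i :=
  if h : β.last.expo ∈ monCone φ i then mono k _ _ ⟨_, h⟩ β.last.coeff else 0

end BrokenLine

namespace ScatteringDiagram

variable (D : ScatteringDiagram φ k J) (d : ZMod n → ℤ)

/-- `Lift_Q(q)`, for a point `Q` in the interior of `σ_i`. -/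
def Lift (I : AddSemigroupIdeal P) (i : ZMod n) (Q : ℝ × ℝ) (q : B0Z n) : RCone φ I k i :=
  ∑ᶠ β : BrokenLine D d q i Q, β.Mono I

/-- `Q` is a point in the interior of a cone `σ_i` such that the line joining it to the origin has
irrational slope. -/
def IsIrrational (Q : ℝ × ℝ) : Prop := 0 < Q.1 ∧ 0 < Q.2 ∧ Irrational (Q.2 / Q.1)

/-- `Q ∈ σ_{i-1}` and `Q' ∈ σ_i`, where `j = i - 1`, lie in connected components of the
complement of `Supp_I(𝔇) ∪ ρ_i` whose closures contain `ρ_i`. -/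
def Adjacent {I : AddSemigroupIdeal P} (hI : radical I = J) (j : ZMod n) (Q Q' : ℝ × ℝ) : Prop :=
  (∀ s ∈ D.walls hI j, (s : ℝ) < Q.2 / Q.1) ∧ ∀ s ∈ D.walls hI (j + 1), Q'.2 / Q'.1 < s

/-- Consistency of a scattering diagram. -/
structure IsConsistent : Prop where
  exists_bend : ∃ i, φ.bend i ∈ J
  /-- For `Q`, `Q'` in the same cone `σ_i`; the path from `Q` to `Q'` runs counterclockwise. -/
  cone : ∀ (I : AddSemigroupIdeal P) (hI : radical I = J) (q : B0Z n) (i : ZMod n) (Q Q' : ℝ × ℝ),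
    IsIrrational Q → IsIrrational Q' → Q.2 / Q.1 ≤ Q'.2 / Q'.1 →
    D.Lift d I i Q' q
      = D.theta hI i {s | Q.2 / Q.1 < s ∧ (s : ℝ) < Q'.2 / Q'.1} (D.Lift d I i Q q)
  /-- For `Q`, `Q'` on the two sides of `ρ_{i+1}`. -/
  ray : ∀ (I : AddSemigroupIdeal P) (hI : radical I = J) (q : B0Z n) (i : ZMod n) (Q Q' : ℝ × ℝ),
    IsIrrational Q → IsIrrational Q' → D.Adjacent hI i Q Q' →
    ∃ x : D.RGlued I (i + 1),
      D.psiNeg I d i x = D.Lift d I i Q q ∧ D.psiPos I (i + 1) x = D.Lift d I (i + 1) Q' q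

end ScatteringDiagram

/-! ### The fans `Σ_I` and `Σ_x` -/

/-- The rays of `Σ_I`. -/
def raysI (φ : PLFun n P) (I : AddSemigroupIdeal P) : Set (ZMod n) := {i | φ.bend i ∈ radical I}

/-- The rays of `Σ_x`: those of `Σ_I`, and the `ρ_i` such that `z^{p_{ρ_i,φ}}` vanishes at `x`. -/
def raysAt (φ : PLFun n P) (I : AddSemigroupIdeal P) (k : Type u) [Field k]
    (x : PrimeSpectrum (Base (P := P) I k)) : Set (ZMod n) :=
  {i | φ.bend i ∈ radical I ∨ mono k P (elems I) (φ.bend i) 1 ∈ x.asIdeal}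

end Scattering

end MirrorFamily

/-!
# The mirror family of a consistent scattering diagram

Write `A = k[P]/I` and `𝔍 ⊆ A` for the ideal generated by the monomials in `J = √I`, which is
nilpotent. Every argument below works to first order in `𝔍` and is then iterated.

**Functions as Laurent polynomials.** The ring attached to a two-dimensional cone is the ring of
Laurent polynomials in two variables over `A`, and the ring `R_{ρ,I}` attached to a ray consists
of the pairs of Laurent polynomials whose rows at height `r` are related by the factor `(z^{p_ρ}
f_ρ)^{|r|}` (`RayModel`, `rayModel_glued`). A global function on `X°` is therefore a Laurent
polynomial on each cone. Crossing a wall inside a cone changes nothing modulo `𝔍`; at a ray,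
either `z^{p_ρ} ∈ 𝔍` or `f_ρ ≡ 1`. So, to first order, the coefficients on adjacent cones are
related as those of a piecewise linear function with bending parameters `z^{p_ρ}` (`PLRel`,
`ConeAtlas`, `atlas`). A coefficient at an exponent outside a cone that does not vanish to first
order can be followed from cone to cone, across rays with `z^{p_ρ} ∉ 𝔍` only, until it becomes the
coefficient at an integral point (`PLRel.path_ccw`, `PLRel.path_cw`). To first order, a function
is thus determined by its coefficients at the integral points of `B`.

**Theta functions.** Consistency says exactly that the sums over broken lines agree on the charts,
so that they glue to global functions (`exists_theta`). A broken line that crosses a ray or bends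
either picks up an element of `J` or ends with an exponent pointing out of the cone of its
endpoint (`Leg.Next.step`). Hence only finitely many broken lines matter modulo `I`
(`finite_brokenLines`), and modulo `𝔍` the coefficients of `ϑ_q` at the integral points are `1` at
`q` and `0` elsewhere (`isDual_thetaFun`). As `𝔍` is nilpotent, the theta functions form a basis
(`ConeAtlas.IsDual.basis`), and the family is free, hence flat.

**The open immersion.** Near `ρ` the function `ϑ_{v_ρ}` is invertible, and multiplication by its
powers moves exponents towards `ρ`. It follows that the ring of functions near `ρ` is the
localization of the ring of global functions at `ϑ_{v_ρ}` (`RayChart.isLocalization`), so that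
every chart is open in the spectrum. It remains to see that two charts meet in the spectrum no
more than they do in `X°`. If `ϑ_{v_ρ}` and `ϑ_{v_ρ'}` are both invertible at a point, then `ρ'`
is reached from `ρ`, in one of the two directions, without passing a ray whose `z^{p}` vanishes at
the point; as at least three of them vanish, only one direction is possible, and the point lies in
the torus of the first cone in that direction (`RayChart.dichotomy`). Proceeding cone by cone, the
two charts are identified in `X°` near the point (`mem_range_inclCone_of_run`, `chart_agree`),
which gives `isOpenImmersion_toX`. It suffices to count vanishing `z^{p}` at closed points, as `A`
is a Jacobson ring (`three_le_of_isPrime`).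

**The closed fibres.** Over a closed point the relations between adjacent cones hold exactly.
Where `z^{p_ρ}` does not vanish, a function on one cone is determined by that on the next, so that
the cones merge to the maximal cones of `Σ_x`, on each of which the theta functions are multiples
of monomials or zero. After a character of each torus is chosen suitably, which uses roots in `k`,
the multiples agree on common edges (`ConeAtlas.IsDual.exists_twist`), and rescaled theta
functions form a basis with the multiplication of `k[Σ_x]` (`ConeAtlas.IsDual.fanModel`,
`FanModel.equivFanAlg`). Such an algebra is embedded in a product of Laurent polynomial rings in
two variables and has dimension two (`FanModel.ringKrullDim_eq`). If all cones are quadrants, the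
theta functions of the rays generate it with the relations of the vertex
(`FanModel.nonempty_equivVertexAlg`).
-/

namespace MirrorFamily

/-! ### Laurent polynomials in two variables -/

/-- Laurent polynomials in two variables over `A`. -/
abbrev Laurent (A : Type*) [CommRing A] : Type _ := AddMonoidAlgebra A (ℤ × ℤ)

section LaurentLemmas

variable {A : Type*} [CommRing A]

lemma laurent_coeff_mul (x y : Laurent A) (m : ℤ × ℤ) :
    (x * y).coeff m = x.coeff.sum fun m' r => r * y.coeff (m - m') := by
  induction x using AddMonoidAlgebra.induction_linear with
  | zero => simp
  | add a b ha hb =>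
    rw [add_mul, AddMonoidAlgebra.coeff_add, Finsupp.add_apply, ha, hb,
      AddMonoidAlgebra.coeff_add, Finsupp.sum_add_index']
    · simp
    · intro m' r r'; ring
  | single m' r =>
    rw [AddMonoidAlgebra.coeff_single, Finsupp.sum_single_index (by simp)]
    exact AddMonoidAlgebra.coeff_single_mul_eq_mul_coeff _ fun _ _ => by
      rw [eq_sub_iff_add_eq, add_comm]

lemma laurent_coeff_single_mul (m' : ℤ × ℤ) (r : A) (y : Laurent A) (m : ℤ × ℤ) :
    (AddMonoidAlgebra.single m' r * y).coeff m = r * y.coeff (m - m') :=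
  AddMonoidAlgebra.coeff_single_mul_eq_mul_coeff _ fun _ _ => by
    rw [eq_sub_iff_add_eq, add_comm]

lemma laurent_coeff_one (m : ℤ × ℤ) : (1 : Laurent A).coeff m = if m = 0 then 1 else 0 := by
  rw [AddMonoidAlgebra.one_def, AddMonoidAlgebra.coeff_single, Finsupp.single_apply]
  simp only [eq_comm]

lemma laurent_coeff_single (m m' : ℤ × ℤ) (a : A) :
    (AddMonoidAlgebra.single m a : Laurent A).coeff m' = if m' = m then a else 0 := by
  rw [AddMonoidAlgebra.coeff_single, Finsupp.single_apply]
  simp only [eq_comm]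

/-- The Laurent polynomials with coefficients in `K`. -/
def coeffIn (K : Ideal A) : Ideal (Laurent A) where
  carrier := {x | ∀ m, x.coeff m ∈ K}
  zero_mem' := by simp
  add_mem' := by
    intro a b ha hb m
    exact K.add_mem (ha m) (hb m)
  smul_mem' := by
    intro c x hx m
    rw [smul_eq_mul, laurent_coeff_mul]
    exact K.sum_mem fun m' _ => K.mul_mem_left _ (hx _)

lemma mem_coeffIn {K : Ideal A} {x : Laurent A} : x ∈ coeffIn K ↔ ∀ m, x.coeff m ∈ K := Iff.rfl

lemma mul_mem_coeffIn {K K' : Ideal A} {x y : Laurent A} (hx : x ∈ coeffIn K)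
    (hy : y ∈ coeffIn K') : x * y ∈ coeffIn (K * K') := by
  intro m
  rw [laurent_coeff_mul]
  exact Ideal.sum_mem _ fun m' _ => Ideal.mul_mem_mul (hx _) (hy _)

lemma pow_sub_pow_mem {R : Type*} [CommRing R] {I : Ideal R} {x y : R} (h : x - y ∈ I) (m : ℕ) :
    x ^ m - y ^ m ∈ I :=
  I.mem_of_dvd (sub_dvd_pow_sub_pow x y m) h

lemma pow_sub_one_mem {R : Type*} [CommRing R] {I : Ideal R} {x : R} (h : x - 1 ∈ I) (m : ℕ) :
    x ^ m - 1 ∈ I := by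
  simpa using pow_sub_pow_mem h m

/-- The Laurent polynomials whose exponents have second coordinate `0`. -/
def rowZero (A : Type*) [CommRing A] : Subring (Laurent A) where
  carrier := {x | ∀ m, m.2 ≠ 0 → x.coeff m = 0}
  zero_mem' := by simp
  one_mem' := by
    intro m hm
    rw [laurent_coeff_one, if_neg]
    rintro rfl
    exact hm rfl
  add_mem' := by
    intro a b ha hb m hm
    simp [ha m hm, hb m hm]
  neg_mem' := by
    intro a ha m hm
    simp [ha m hm]
  mul_mem' := by
    intro a b ha hb m hm
    rw [laurent_coeff_mul]
    refine Finset.sum_eq_zero fun m' _ => ?_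
    by_cases h : m'.2 = 0
    · simp only [hb (m - m') (by simpa [h] using hm), mul_zero]
    · simp only [ha m' h, zero_mul]

lemma coeff_rowZero_mul {f x y : Laurent A} (hf : f ∈ rowZero A) (r : ℤ)
    (h : ∀ m : ℤ × ℤ, m.2 = r → x.coeff m = y.coeff m) (m : ℤ × ℤ) (hm : m.2 = r) :
    (f * x).coeff m = (f * y).coeff m := by
  rw [laurent_coeff_mul, laurent_coeff_mul]
  refine Finset.sum_congr rfl fun m' _ => ?_
  by_cases h' : m'.2 = 0
  · simp only [h (m - m') (by simp [h', hm])]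
  · simp only [hf m' h', zero_mul]

end LaurentLemmas

/-! ### Combinatorics of the cyclic set of rays -/

section Cyclic

variable {n : ℕ}

lemma exists_eq_add_natCast [NeZero n] (j i : ZMod n) : ∃ x : ℕ, 1 ≤ x ∧ x ≤ n ∧ i = j + (x : ZMod n) := by
  have hn : 0 < n := Nat.pos_of_neZero n
  by_cases h : i = j
  · exact ⟨n, hn, le_rfl, by simp [h]⟩
  · refine ⟨(i - j).val, ?_, (ZMod.val_lt _).le, by simp⟩
    rw [Nat.one_le_iff_ne_zero, Ne, ZMod.val_eq_zero, sub_eq_zero]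
    exact h

/-- `s` consecutive indices outside a nonempty set `F` leave room for the elements of `F`. -/
lemma run_add_ncard_le [NeZero n] {F : Set (ZMod n)} (hF : F.Nonempty) {j : ZMod n} {s : ℕ}
    (h : ∀ r : ℕ, 1 ≤ r → r ≤ s → j + (r : ZMod n) ∉ F) : s + F.ncard ≤ n := by
  have hsub : F ⊆ (fun x : ℕ => j + (x : ZMod n)) '' (Finset.Icc (s + 1) n : Set ℕ) := by
    intro i hi
    obtain ⟨x, hx1, hxn, rfl⟩ := exists_eq_add_natCast j i
    refine ⟨x, ?_, rfl⟩
    simp only [Finset.coe_Icc, Set.mem_Icc]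
    refine ⟨?_, hxn⟩
    by_contra hlt
    exact h x hx1 (by omega) hi
  have h1 := Set.ncard_le_ncard hsub ((Finset.finite_toSet _).image _)
  have h2 := Set.ncard_image_le (f := fun x : ℕ => j + (x : ZMod n))
    (Finset.finite_toSet (Finset.Icc (s + 1) n))
  rw [Set.ncard_coe_finset, Nat.card_Icc] at h2
  have h3 : 0 < F.ncard := hF.ncard_pos
  omega

lemma natCast_ne_zero_of_lt {s : ℕ} (h0 : 0 < s) (h : s < n) : (s : ZMod n) ≠ 0 := by
  rw [Ne, ZMod.natCast_eq_zero_iff]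
  exact fun hd => absurd (Nat.le_of_dvd h0 hd) (by omega)

lemma pt_pos_left {j : ZMod n} {a b : ℕ} (ha : 0 < a) : pt j a b = some ⟨j, a, b, ha⟩ := by
  simp [pt, ha]

lemma pt_zero_left {j : ZMod n} {b : ℕ} : pt j 0 b = pt (j + 1) b 0 := by
  by_cases hb : 0 < b
  · simp [pt, hb]
  · simp [pt, hb]

lemma pt_zero {j : ZMod n} : pt j 0 0 = none := by simp [pt]

lemma pt_eq_none {j : ZMod n} {a b : ℕ} : pt j a b = none ↔ a = 0 ∧ b = 0 := by
  unfold pt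
  split_ifs <;> simp <;> omega

lemma pt_eq_some {j : ZMod n} {a b : ℕ} {q : B0Z n} : pt j a b = some q ↔
    (q.cone = j ∧ q.a = a ∧ q.b = b) ∨ (a = 0 ∧ q.cone = j + 1 ∧ q.a = b ∧ q.b = 0) := by
  rcases q with ⟨c, a', b', h'⟩
  unfold pt
  split_ifs with h1 h2
  · simp only [Option.some.injEq, B0Z.mk.injEq]; grind
  · simp only [Option.some.injEq, B0Z.mk.injEq]; grind
  · simp only [false_iff]; grind

lemma pt_surjective (q : BZ n) : ∃ (j : ZMod n) (a b : ℕ), pt j a b = q := by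
  rcases q with _ | ⟨c, a, b, h⟩
  · exact ⟨0, 0, 0, pt_zero⟩
  · exact ⟨c, a, b, pt_pos_left h⟩

end Cyclic

/-! ### Piecewise linear relations between coefficients on adjacent cones -/

section PLRel

variable {n : ℕ} {A : Type*} [CommRing A] (d : ZMod n → ℤ) (t : ZMod n → A)

lemma glueΛ_apply (j : ZMod n) (m : ℤ × ℤ) : glueΛ d j m = (m.2 - d (j + 1) * m.1, -m.1) := rfl

lemma glueΛ_symm_apply (j : ZMod n) (m : ℤ × ℤ) :
    (glueΛ d j).symm m = (-m.2, m.1 - d (j + 1) * m.2) := rfl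

/-- A family of coefficients `u j m`, for `m` a tangent vector on `σ_j`, is piecewise linear modulo
`N`: on the two sides of every ray it differs by the power of `t` by which the linear extensions of
`φ` differ. -/
structure PLRel (N : Ideal A) (u : ZMod n → ℤ × ℤ → A) : Prop where
  le : ∀ j m, m.1 ≤ 0 → u j m - t (j + 1) ^ (-m.1).toNat * u (j + 1) (glueΛ d j m) ∈ N
  ge : ∀ j m, 0 ≤ m.1 → u (j + 1) (glueΛ d j m) - t (j + 1) ^ m.1.toNat * u j m ∈ N

variable {d t} {N : Ideal A} {u : ZMod n → ℤ × ℤ → A} {F : Set (ZMod n)}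

lemma PLRel.mono {N' : Ideal A} (h : PLRel d t N u) (hN : N ≤ N') : PLRel d t N' u :=
  ⟨fun j m hm => hN (h.le j m hm), fun j m hm => hN (h.ge j m hm)⟩

lemma PLRel.step_ccw (h : PLRel d t N u) (hF : ∀ s ∈ F, ∀ j m, t s * u j m ∈ N) {j : ZMod n}
    {m : ℤ × ℤ} (hm : m.1 < 0) (hu : u j m ∉ N) : j + 1 ∉ F ∧ u (j + 1) (glueΛ d j m) ∉ N := by
  have h1 := h.le j m hm.le
  obtain ⟨x, hx⟩ : ∃ x, (-m.1).toNat = x + 1 := ⟨(-m.1).toNat - 1, by omega⟩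
  have h2 : t (j + 1) * u (j + 1) (glueΛ d j m) ∉ N := by
    intro h2
    rw [hx, pow_succ, mul_assoc] at h1
    exact hu ((Submodule.sub_mem_iff_left _ (N.mul_mem_left _ h2)).mp h1)
  exact ⟨fun h3 => h2 (hF _ h3 _ _), fun h3 => h2 (N.mul_mem_left _ h3)⟩

lemma PLRel.step_cw (h : PLRel d t N u) (hF : ∀ s ∈ F, ∀ j m, t s * u j m ∈ N) {j : ZMod n}
    {m : ℤ × ℤ} (hm : m.2 < 0) (hu : u (j + 1) m ∉ N) :
    j + 1 ∉ F ∧ u j ((glueΛ d j).symm m) ∉ N := by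
  have h0 : ((glueΛ d j).symm m).1 = -m.2 := rfl
  have h1 := h.ge j ((glueΛ d j).symm m) (by omega)
  rw [AddEquiv.apply_symm_apply, h0] at h1
  obtain ⟨x, hx⟩ : ∃ x, (-m.2).toNat = x + 1 := ⟨(-m.2).toNat - 1, by omega⟩
  have h2 : t (j + 1) * u j ((glueΛ d j).symm m) ∉ N := by
    intro h2
    rw [hx, pow_succ, mul_assoc] at h1
    exact hu ((Submodule.sub_mem_iff_left _ (N.mul_mem_left _ h2)).mp h1)
  exact ⟨fun h3 => h2 (hF _ h3 _ _), fun h3 => h2 (N.mul_mem_left _ h3)⟩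

/-- A coefficient of an exponent `m` on the far side of `v_{j+1}` comes, counterclockwise, from the
coefficient at a point of one of the following cones, with no ray of `F` in between. -/
lemma PLRel.path_ccw [NeZero n] (h : PLRel d t N u) (hF : ∀ s ∈ F, ∀ j m, t s * u j m ∈ N)
    (hne : F.Nonempty) {j : ZMod n} {m : ℤ × ℤ} (hm : m.1 < 0) (hu : u j m ∉ N) :
    ∃ s : ℕ, 1 ≤ s ∧ (∀ r : ℕ, 1 ≤ r → r ≤ s → j + (r : ZMod n) ∉ F) ∧
      ∃ a b : ℕ, 0 < b ∧ u (j + (s : ZMod n)) ((a : ℤ), (b : ℤ)) ∉ N := by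
  obtain ⟨i, hi⟩ := hne
  obtain ⟨x, hx, -, rfl⟩ := exists_eq_add_natCast j i
  obtain ⟨k, rfl⟩ : ∃ k, x = k + 1 := ⟨x - 1, by omega⟩
  clear hx
  induction k generalizing j m with
  | zero => exact absurd (by simpa using hi) (h.step_ccw hF hm hu).1
  | succ k ih =>
    obtain ⟨h1, h2⟩ := h.step_ccw hF hm hu
    have hpos : 0 < (glueΛ d j m).2 := by rw [glueΛ_apply]; simpa using hm
    by_cases h3 : (glueΛ d j m).1 < 0
    · obtain ⟨s, -, hrun, a, b, hb, hab⟩ := ih h3 h2 (by convert hi using 1; push_cast; ring_nf)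
      refine ⟨s + 1, by omega, fun r hr1 hr2 => ?_, a, b, hb, ?_⟩
      · rcases Nat.exists_eq_add_of_le' hr1 with ⟨r, rfl⟩
        rcases Nat.eq_zero_or_pos r with rfl | hr
        · simpa using h1
        · convert hrun r hr (by omega) using 1; push_cast; ring_nf
      · convert hab using 2; push_cast; ring_nf
    · refine ⟨1, le_rfl, fun r hr1 hr2 => ?_, (glueΛ d j m).1.toNat, (glueΛ d j m).2.toNat,
        by omega, ?_⟩
      · obtain rfl : r = 1 := by omega
        simpa using h1
      · rw [Int.toNat_of_nonneg (by omega), Int.toNat_of_nonneg (by omega)]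
        simpa using h2

/-- The clockwise counterpart of `PLRel.path_ccw`. -/
lemma PLRel.path_cw [NeZero n] (h : PLRel d t N u) (hF : ∀ s ∈ F, ∀ j m, t s * u j m ∈ N)
    (hne : F.Nonempty) {j : ZMod n} {m : ℤ × ℤ} (hm : m.2 < 0) (hu : u j m ∉ N) :
    ∃ (i : ZMod n) (s : ℕ), j = i + (s : ZMod n) ∧ 1 ≤ s ∧
      (∀ r : ℕ, 1 ≤ r → r ≤ s → i + (r : ZMod n) ∉ F) ∧
      ∃ a b : ℕ, 0 < a ∧ u i ((a : ℤ), (b : ℤ)) ∉ N := by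
  obtain ⟨i, hi⟩ := hne
  obtain ⟨x, -, -, rfl⟩ := exists_eq_add_natCast i j
  induction x generalizing m with
  | zero =>
    have := (h.step_cw (j := i - 1) hF hm (by simpa using hu)).1
    exact absurd (by simpa using hi) this
  | succ x ih =>
    have hj : i + ((x + 1 : ℕ) : ZMod n) = i + (x : ZMod n) + 1 := by push_cast; ring
    rw [hj] at hu ⊢
    obtain ⟨h1, h2⟩ := h.step_cw hF hm hu
    set m' := (glueΛ d (i + (x : ZMod n))).symm m with hm'
    have hpos : 0 < m'.1 := by rw [hm', glueΛ_symm_apply]; simpa using hm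
    by_cases h3 : m'.2 < 0
    · obtain ⟨i', s, hs, -, hrun, a, b, ha, hab⟩ := ih h3 h2
      refine ⟨i', s + 1, by rw [hs]; push_cast; ring, by omega, fun r hr1 hr2 => ?_, a, b, ha, hab⟩
      rcases Nat.lt_or_ge s r with hr | hr
      · obtain rfl : r = s + 1 := by omega
        convert h1 using 1; rw [hs]; push_cast; ring_nf
      · exact hrun r hr1 hr
    · refine ⟨i + (x : ZMod n), 1, by simp, le_rfl, fun r hr1 hr2 => ?_, m'.1.toNat, m'.2.toNat,
        by omega, ?_⟩
      · obtain rfl : r = 1 := by omega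
        simpa using h1
      · rw [Int.toNat_of_nonneg (by omega), Int.toNat_of_nonneg (by omega)]
        exact h2

end PLRel

/-! ### Bases of rings of piecewise Laurent polynomials -/

section Basis

variable {n : ℕ} {A : Type*} [CommRing A] (d : ZMod n → ℤ) (t : ZMod n → A) (F : Set (ZMod n))
  (𝔍 : Ideal A) (Γ : Type*) [CommRing Γ] [Algebra A Γ]

/-- A ring `Γ` of functions given on each cone `σ_j` by a Laurent polynomial, such that the
coefficients on adjacent cones are related, to first order in `𝔍`, by the piecewise linear function
with bending parameters `t`. -/
structure ConeAtlas where
  y : ZMod n → Γ →ₐ[A] Laurent A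
  inj : ∀ g, (∀ j, y j g = 0) → g = 0
  rel : ∀ (K : Ideal A) (g : Γ), (∀ j, y j g ∈ coeffIn K) →
    PLRel d t (𝔍 * K) fun j m => (y j g).coeff m
  t_mem : ∀ s ∈ F, t s ∈ 𝔍

variable {d t F 𝔍 Γ} (𝒜 : ConeAtlas d t F 𝔍 Γ)

namespace ConeAtlas

/-- The coefficient of a function at an integral point `q` of `B`, taken on a cone containing
`q`. -/
def own : BZ n → Γ →ₗ[A] A
  | none => ((Finsupp.lapply 0).comp
      (AddMonoidAlgebra.coeffLinearEquiv A).toLinearMap).comp (𝒜.y 0).toLinearMap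
  | some q => ((Finsupp.lapply ((q.a : ℤ), (q.b : ℤ))).comp
      (AddMonoidAlgebra.coeffLinearEquiv A).toLinearMap).comp (𝒜.y q.cone).toLinearMap

lemma own_none (g : Γ) : 𝒜.own none g = (𝒜.y 0 g).coeff 0 := rfl

lemma own_some (q : B0Z n) (g : Γ) :
    𝒜.own (some q) g = (𝒜.y q.cone g).coeff ((q.a : ℤ), (q.b : ℤ)) := rfl

lemma y_none (j : ZMod n) [NeZero n] {K : Ideal A} {g : Γ} (hg : ∀ j, 𝒜.y j g ∈ coeffIn K) :
    (𝒜.y j g).coeff 0 - 𝒜.own none g ∈ 𝔍 * K := by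
  obtain ⟨x, -, -, rfl⟩ := exists_eq_add_natCast 0 j
  induction x with
  | zero => simp [own_none]
  | succ x ih =>
    have h := (𝒜.rel K g hg).le (0 + (x : ZMod n)) 0 le_rfl
    simp only [Prod.fst_zero, neg_zero, Int.toNat_zero, pow_zero, one_mul, map_zero] at h
    have h2 := Ideal.sub_mem _ ih h
    rw [sub_sub_sub_cancel_left] at h2
    convert h2 using 6; push_cast; ring_nf

/-- The coefficient at an integral point does not depend, to first order, on the cone on which it is
taken. -/
lemma own_pt [NeZero n] {K : Ideal A} {g : Γ} (hg : ∀ j, 𝒜.y j g ∈ coeffIn K) (j : ZMod n)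
    (a b : ℕ) : (𝒜.y j g).coeff ((a : ℤ), (b : ℤ)) - 𝒜.own (pt j a b) g ∈ 𝔍 * K := by
  rcases Nat.eq_zero_or_pos a with rfl | ha
  · rcases Nat.eq_zero_or_pos b with rfl | hb
    · rw [pt_zero]
      exact 𝒜.y_none j hg
    · rw [pt_zero_left, pt_pos_left hb, own_some]
      simpa [glueΛ_apply] using (𝒜.rel K g hg).le j ((0 : ℤ), (b : ℤ)) le_rfl
  · simp [pt_pos_left ha, own_some]

lemma kill {K : Ideal A} {g : Γ} (hg : ∀ j, 𝒜.y j g ∈ coeffIn K) :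
    ∀ s ∈ F, ∀ j m, t s * (𝒜.y j g).coeff m ∈ 𝔍 * K :=
  fun s hs j m => Ideal.mul_mem_mul (𝒜.t_mem s hs) (hg j m)

lemma top_mem (g : Γ) (j : ZMod n) : 𝒜.y j g ∈ coeffIn (⊤ : Ideal A) := fun _ => trivial

/-- A function is determined, to first order, by its coefficients at the integral points. -/
lemma mem_of_own [NeZero n] (hF : F.Nonempty) {K : Ideal A} {g : Γ}
    (hg : ∀ j, 𝒜.y j g ∈ coeffIn K) (h0 : ∀ q, 𝒜.own q g ∈ 𝔍 * K) (j : ZMod n) :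
    𝒜.y j g ∈ coeffIn (𝔍 * K) := by
  have hnat : ∀ (j : ZMod n) (a b : ℕ), (𝒜.y j g).coeff ((a : ℤ), (b : ℤ)) ∈ 𝔍 * K :=
    fun j a b => (Submodule.sub_mem_iff_left _ (h0 _)).mp (𝒜.own_pt hg j a b)
  intro m
  by_contra hm
  by_cases h1 : m.1 < 0
  · obtain ⟨s, -, -, a, b, -, h⟩ := (𝒜.rel K g hg).path_ccw (𝒜.kill hg) hF h1 hm
    exact h (hnat _ _ _)
  by_cases h2 : m.2 < 0
  · obtain ⟨i, s, -, -, -, a, b, -, h⟩ := (𝒜.rel K g hg).path_cw (𝒜.kill hg) hF h2 hm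
    exact h (hnat _ _ _)
  · refine hm ?_
    have := hnat j m.1.toNat m.2.toNat
    rwa [Int.toNat_of_nonneg (by omega), Int.toNat_of_nonneg (by omega)] at this

lemma finite_own (g : Γ) [NeZero n] : {q | 𝒜.own q g ≠ 0}.Finite := by
  have hfin : (⋃ j : ZMod n, (fun m : ℤ × ℤ => pt j m.1.toNat m.2.toNat) ''
      ((𝒜.y j g).coeff.support : Set (ℤ × ℤ))).Finite :=
    Set.finite_iUnion fun j => (Finset.finite_toSet _).image _
  refine (hfin.insert none).subset ?_
  rintro (_ | q) hq
  · exact Set.mem_insert _ _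
  · refine Set.mem_insert_of_mem _ (Set.mem_iUnion.mpr ⟨q.cone, ((q.a : ℤ), (q.b : ℤ)), ?_, ?_⟩)
    · exact Finsupp.mem_support_iff.mpr hq
    · simp [pt_pos_left q.pos]

variable {𝒜} {ϑ : BZ n → Γ}

open scoped Classical in
variable (𝒜 ϑ) in
/-- The functions `ϑ_q` have, modulo `𝔍`, coefficient `1` at `q` and `0` at the other integral
points. -/
def IsDual : Prop := ∀ q q', 𝒜.own q' (ϑ q) - (if q' = q then 1 else 0) ∈ 𝔍

open Finsupp in
lemma IsDual.own_linearCombination (hϑ : 𝒜.IsDual ϑ) {K : Ideal A} {a : BZ n →₀ A}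
    (ha : ∀ q, a q ∈ K) (q : BZ n) :
    𝒜.own q (linearCombination A ϑ a) - a q ∈ 𝔍 * K := by
  classical
  have h : 𝒜.own q (linearCombination A ϑ a) - a q
      = a.sum fun q' c => c * (𝒜.own q (ϑ q') - (if q = q' then 1 else 0)) := by
    rw [linearCombination_apply, map_finsuppSum]
    simp only [mul_sub, map_smul, smul_eq_mul, mul_ite, mul_one, mul_zero]
    rw [Finsupp.sum_sub, Finsupp.sum_ite_eq]
    congr 1
    split_ifs with h
    · rfl
    · simpa using h
  rw [h]
  refine Ideal.sum_mem _ fun q' _ => ?_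
  change a q' * _ ∈ _
  rw [mul_comm (a q')]
  refine Ideal.mul_mem_mul ?_ (ha q')
  convert hϑ q' q

lemma coeffIn_linearCombination {K : Ideal A} {a : BZ n →₀ A} (ha : ∀ q, a q ∈ K) (j : ZMod n) :
    𝒜.y j (Finsupp.linearCombination A ϑ a) ∈ coeffIn K := by
  rw [Finsupp.linearCombination_apply, map_finsuppSum]
  refine Ideal.sum_mem _ fun q _ => ?_
  intro m
  simp only [map_smul, AddMonoidAlgebra.coeff_smul, Finsupp.smul_apply, smul_eq_mul]
  exact K.mul_mem_right _ (ha q)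

lemma IsDual.exists_approx [NeZero n] (hϑ : 𝒜.IsDual ϑ) (hF : F.Nonempty) {K : Ideal A} {g : Γ}
    (hg : ∀ j, 𝒜.y j g ∈ coeffIn K) : ∃ a : BZ n →₀ A, (∀ q, a q ∈ K) ∧
      ∀ j, 𝒜.y j (g - Finsupp.linearCombination A ϑ a) ∈ coeffIn (𝔍 * K) := by
  let a : BZ n →₀ A := Finsupp.ofSupportFinite (fun q => 𝒜.own q g) (𝒜.finite_own g)
  have haq : ∀ q, a q = 𝒜.own q g := fun q => rfl
  have ha : ∀ q, a q ∈ K := by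
    rintro (_ | q)
    · exact hg _ _
    · exact hg _ _
  refine ⟨a, ha, 𝒜.mem_of_own hF (fun j => ?_) fun q => ?_⟩
  · rw [map_sub]
    exact Ideal.sub_mem _ (hg j) (coeffIn_linearCombination ha j)
  · rw [map_sub, ← neg_mem_iff, neg_sub, ← haq]
    exact hϑ.own_linearCombination ha q

lemma IsDual.linearIndependent (hϑ : 𝒜.IsDual ϑ) {M : ℕ} (hM : 𝔍 ^ M = ⊥) :
    LinearIndependent A ϑ := by
  rw [linearIndependent_iff]
  intro a ha
  have key : ∀ i : ℕ, ∀ q, a q ∈ 𝔍 ^ i := by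
    intro i
    induction i with
    | zero => simp
    | succ i ih =>
      intro q
      have := hϑ.own_linearCombination ih q
      rwa [ha, map_zero, zero_sub, neg_mem_iff, ← pow_succ'] at this
  ext q
  simpa [hM] using key M q

lemma IsDual.top_le_span [NeZero n] (hϑ : 𝒜.IsDual ϑ) (hF : F.Nonempty) {M : ℕ}
    (hM : 𝔍 ^ M = ⊥) : ⊤ ≤ Submodule.span A (Set.range ϑ) := by
  intro g _
  have key : ∀ i : ℕ, ∃ a : BZ n →₀ A,
      ∀ j, 𝒜.y j (g - Finsupp.linearCombination A ϑ a) ∈ coeffIn (𝔍 ^ i) := by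
    intro i
    induction i with
    | zero => exact ⟨0, fun j m => by simp⟩
    | succ i ih =>
      obtain ⟨a, ha⟩ := ih
      obtain ⟨b, -, hb⟩ := hϑ.exists_approx hF ha
      exact ⟨a + b, by simpa only [map_add, pow_succ', sub_sub] using hb⟩
  obtain ⟨a, ha⟩ := key M
  have h0 : g - Finsupp.linearCombination A ϑ a = 0 := by
    refine 𝒜.inj _ fun j => ?_
    ext m
    simpa [hM] using ha j m
  rw [sub_eq_zero] at h0
  rw [h0, ← Finsupp.range_linearCombination]
  exact LinearMap.mem_range_self _ _

/-- The theta functions form a basis. -/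
def IsDual.basis [NeZero n] (hϑ : 𝒜.IsDual ϑ) (hF : F.Nonempty) {M : ℕ} (hM : 𝔍 ^ M = ⊥) :
    Module.Basis (BZ n) A Γ :=
  Module.Basis.mk (hϑ.linearIndependent hM) (hϑ.top_le_span hF hM)

lemma IsDual.basis_apply [NeZero n] (hϑ : 𝒜.IsDual ϑ) (hF : F.Nonempty) {M : ℕ}
    (hM : 𝔍 ^ M = ⊥) (q : BZ n) : hϑ.basis hF hM q = ϑ q := by
  simp [basis]

/-- The coordinates with respect to the theta functions agree modulo `𝔍` with the coefficients at
the integral points. -/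
lemma IsDual.own_sub_repr [NeZero n] (hϑ : 𝒜.IsDual ϑ) (hF : F.Nonempty) {M : ℕ}
    (hM : 𝔍 ^ M = ⊥) (g : Γ) (q : BZ n) : 𝒜.own q g - (hϑ.basis hF hM).repr g q ∈ 𝔍 := by
  have h := hϑ.own_linearCombination (K := ⊤) (a := (hϑ.basis hF hM).repr g) (fun _ => trivial) q
  have h2 : Finsupp.linearCombination A ϑ ((hϑ.basis hF hM).repr g) = g := by
    conv_rhs => rw [← (hϑ.basis hF hM).linearCombination_repr g]
    congr 1
    ext q; simp [basis]
  rwa [h2, Ideal.mul_top] at h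

end ConeAtlas
end Basis
end MirrorFamily

namespace MirrorFamily

/-! ### Functions near a ray -/

section RayModel

variable {A : Type*} [CommRing A]

lemma coeff_rowZero_mul_mem {f x : Laurent A} (hf : f ∈ rowZero A) {K : Ideal A} (r : ℤ)
    (h : ∀ m : ℤ × ℤ, m.2 = r → x.coeff m ∈ K) (m : ℤ × ℤ) (hm : m.2 = r) :
    (f * x).coeff m ∈ K := by
  rw [laurent_coeff_mul]
  refine Ideal.sum_mem _ fun m' _ => ?_
  by_cases h' : m'.2 = 0
  · exact K.mul_mem_left _ (h _ (by simp [h', hm]))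
  · simp [hf m' h']

/-- The ring `R` of functions near a ray: pairs of Laurent polynomials `(N x, P x)`, one on each
side of the ray, such that the row of `N x` at height `r ≥ 0` is `(t f)^r` times that of `P x`, and
the row of `P x` at height `-r ≤ 0` is `(t f)^r` times that of `N x`. -/
structure RayModel (t : A) (f : Laurent A) {R : Type*} [CommRing R] (N P : R →+* Laurent A) :
    Prop where
  f_mem : f ∈ rowZero A
  nonneg : ∀ x (m : ℤ × ℤ), 0 ≤ m.2 →
    (N x).coeff m = t ^ m.2.toNat * (f ^ m.2.toNat * P x).coeff m
  nonpos : ∀ x (m : ℤ × ℤ), m.2 ≤ 0 →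
    (P x).coeff m = t ^ (-m.2).toNat * (f ^ (-m.2).toNat * N x).coeff m
  inj : ∀ x, N x = 0 → P x = 0 → x = 0
  lift : ∀ Z : Laurent A, ∃ x, (∀ m : ℤ × ℤ, 0 ≤ m.2 → (P x).coeff m = Z.coeff m) ∧
    ∀ m : ℤ × ℤ, m.2 ≤ 0 → (N x).coeff m = Z.coeff m

variable {t : A} {f : Laurent A} {R : Type*} [CommRing R] {N P : R →+* Laurent A}

namespace RayModel

variable (h : RayModel t f N P)

include h

lemma mem_of_rows {K : Ideal A} {x : R} (hP : ∀ m : ℤ × ℤ, 0 ≤ m.2 → (P x).coeff m ∈ K)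
    (hN : ∀ m : ℤ × ℤ, m.2 < 0 → (N x).coeff m ∈ K) : N x ∈ coeffIn K ∧ P x ∈ coeffIn K := by
  refine ⟨fun m => ?_, fun m => ?_⟩
  · by_cases hm : m.2 < 0
    · exact hN m hm
    · rw [h.nonneg x m (by omega)]
      exact K.mul_mem_left _ (coeff_rowZero_mul_mem (pow_mem h.f_mem _) m.2
        (fun m' hm' => hP m' (by omega)) m rfl)
  · by_cases hm : m.2 < 0
    · rw [h.nonpos x m hm.le]
      exact K.mul_mem_left _ (coeff_rowZero_mul_mem (pow_mem h.f_mem _) m.2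
        (fun m' hm' => hN m' (by omega)) m rfl)
    · exact hP m (by omega)

lemma eq_of_rows {x y : R} (hP : ∀ m : ℤ × ℤ, 0 ≤ m.2 → (P x).coeff m = (P y).coeff m)
    (hN : ∀ m : ℤ × ℤ, m.2 < 0 → (N x).coeff m = (N y).coeff m) : x = y := by
  rw [← sub_eq_zero]
  obtain ⟨h1, h2⟩ := h.mem_of_rows (K := ⊥) (x := x - y)
    (fun m hm => by simp [hP m hm]) (fun m hm => by simp [hN m hm])
  refine h.inj _ ?_ ?_
  · ext m; simpa using h1 m
  · ext m; simpa using h2 m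

lemma row_zero (x : R) (a : ℤ) : (N x).coeff (a, 0) = (P x).coeff (a, 0) := by
  simpa using h.nonneg x (a, 0) le_rfl

lemma eq_of_rows' {x y : R} (hP : ∀ m : ℤ × ℤ, 0 < m.2 → (P x).coeff m = (P y).coeff m)
    (hN : ∀ m : ℤ × ℤ, m.2 ≤ 0 → (N x).coeff m = (N y).coeff m) : x = y := by
  refine h.eq_of_rows (fun m hm => ?_) fun m hm => hN m hm.le
  rcases hm.eq_or_lt with h0 | h0
  · obtain ⟨a, b⟩ := m
    obtain rfl : b = 0 := h0.symm
    rw [← h.row_zero, ← h.row_zero]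
    exact hN _ le_rfl
  · exact hP m h0

lemma lift_nonneg {Z : Laurent A} (hZ : ∀ m : ℤ × ℤ, m.2 < 0 → Z.coeff m = 0) :
    ∃ x, P x = Z ∧ ∀ m : ℤ × ℤ, m.2 < 0 → (N x).coeff m = 0 := by
  obtain ⟨x, hx1, hx2⟩ := h.lift Z
  refine ⟨x, ?_, fun m hm => by rw [hx2 m hm.le, hZ m hm]⟩
  ext m
  by_cases hm : m.2 < 0
  · rw [h.nonpos x m hm.le, hZ m hm, coeff_rowZero_mul (y := 0) (pow_mem h.f_mem _) m.2
      (fun m' hm' => by simp [hx2 m' (by omega), hZ m' (by omega)]) m rfl]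
    simp
  · exact hx1 m (by omega)

lemma lift_nonpos {Z : Laurent A} (hZ : ∀ m : ℤ × ℤ, 0 < m.2 → Z.coeff m = 0) :
    ∃ x, N x = Z ∧ ∀ m : ℤ × ℤ, 0 < m.2 → (P x).coeff m = 0 := by
  obtain ⟨x, hx1, hx2⟩ := h.lift Z
  refine ⟨x, ?_, fun m hm => by rw [hx1 m hm.le, hZ m hm]⟩
  ext m
  by_cases hm : 0 < m.2
  · rw [h.nonneg x m hm.le, hZ m hm, coeff_rowZero_mul (y := 0) (pow_mem h.f_mem _) m.2
      (fun m' hm' => by simp [hx1 m' (by omega), hZ m' (by omega)]) m rfl]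
    simp
  · exact hx2 m (by omega)

end RayModel

/-- All exponents of `x` have second coordinate `r`. -/
def InRow (r : ℤ) (x : Laurent A) : Prop := ∀ m : ℤ × ℤ, m.2 ≠ r → x.coeff m = 0

lemma InRow.mul {r s : ℤ} {x y : Laurent A} (hx : InRow r x) (hy : InRow s y) :
    InRow (r + s) (x * y) := by
  intro m hm
  rw [laurent_coeff_mul]
  refine Finset.sum_eq_zero fun m' _ => ?_
  by_cases h : m'.2 = r
  · simp only [hy (m - m') (by rw [Prod.snd_sub]; omega), mul_zero]
  · simp only [hx m' h, zero_mul]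

lemma InRow.pow {r : ℤ} {x : Laurent A} (hx : InRow r x) (M : ℕ) : InRow (M * r) (x ^ M) := by
  induction M with
  | zero =>
    intro m hm
    rw [pow_zero, laurent_coeff_one, if_neg]
    rintro rfl
    simp at hm
  | succ M ih =>
    have := ih.mul hx
    rw [← pow_succ] at this
    convert this using 1
    push_cast; ring

lemma inRow_single (m : ℤ × ℤ) (a : A) : InRow m.2 (AddMonoidAlgebra.single m a : Laurent A) := by
  intro m' hm'
  rw [laurent_coeff_single, if_neg]
  rintro rfl
  exact hm' rfl

lemma RayModel.exists_pos (h : RayModel t f N P) {m : ℤ × ℤ} (hm : 0 ≤ m.2) :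
    ∃ X, P X = AddMonoidAlgebra.single m 1 ∧ InRow m.2 (N X) := by
  obtain ⟨X, hX, hX'⟩ := h.lift_nonneg (Z := AddMonoidAlgebra.single m 1)
    fun m' hm' => inRow_single m 1 m' (by omega)
  refine ⟨X, hX, fun m' hm' => ?_⟩
  by_cases h0 : 0 ≤ m'.2
  · rw [h.nonneg _ _ h0, hX, coeff_rowZero_mul (y := 0) (pow_mem h.f_mem _) m'.2
      (fun m'' hm'' => inRow_single m 1 m'' (by omega)) m' rfl]
    simp
  · exact hX' m' (by omega)

lemma RayModel.exists_neg (h : RayModel t f N P) {m : ℤ × ℤ} (hm : m.2 ≤ 0) :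
    ∃ X, N X = AddMonoidAlgebra.single m 1 ∧ InRow m.2 (P X) := by
  obtain ⟨X, hX, hX'⟩ := h.lift_nonpos (Z := AddMonoidAlgebra.single m 1)
    fun m' hm' => inRow_single m 1 m' (by omega)
  refine ⟨X, hX, fun m' hm' => ?_⟩
  by_cases h0 : m'.2 ≤ 0
  · rw [h.nonpos _ _ h0, hX, coeff_rowZero_mul (y := 0) (pow_mem h.f_mem _) m'.2
      (fun m'' hm'' => inRow_single m 1 m'' (by omega)) m' rfl]
    simp
  · exact hX' m' (by omega)

lemma exists_row_bound (x : Laurent A) (ℓ : ℤ × ℤ →+ ℤ) :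
    ∃ M : ℕ, ∀ m, (M : ℤ) < ℓ m → x.coeff m = 0 := by
  refine ⟨x.coeff.support.sup fun m => (ℓ m).toNat, fun m hm => ?_⟩
  by_contra hne
  have := Finset.le_sup (f := fun m => (ℓ m).toNat) (Finsupp.mem_support_iff.mpr hne)
  omega

/-- The functions on the cone following the ray are obtained by inverting the monomial `X` of
exponent `(0, 1)`. -/
lemma RayModel.isLocalization_pos (h : RayModel t f N P) {X : R}
    (hX : P X = AddMonoidAlgebra.single (0, 1) 1) (hX' : InRow 1 (N X)) :
    @IsLocalization.Away R _ X (Laurent A) _ P.toAlgebra := by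
  let _ := P.toAlgebra
  have hmap : ∀ x, algebraMap R (Laurent A) x = P x := fun _ => rfl
  have hpow : ∀ M : ℕ, P (X ^ M) = AddMonoidAlgebra.single (0, (M : ℤ)) 1 := by
    intro M
    rw [map_pow, hX, AddMonoidAlgebra.single_pow]
    simp
  refine IsLocalization.Away.mk X ?_ (fun Y => ?_) (fun a b hab => ?_)
  · rw [hmap, hX]
    refine IsUnit.of_mul_eq_one (AddMonoidAlgebra.single (0, -1) 1) ?_
    rw [AddMonoidAlgebra.single_mul_single, AddMonoidAlgebra.one_def]
    simp [← Prod.zero_eq_mk]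
  -- a high power of `X` moves all of `Y` into the rows of nonnegative height, where it lifts
  · obtain ⟨M, hM⟩ := exists_row_bound Y (-AddMonoidHom.snd ℤ ℤ)
    obtain ⟨x, hx, -⟩ := h.lift_nonneg (Z := AddMonoidAlgebra.single (0, (M : ℤ)) 1 * Y)
      (fun m hm => by
        rw [laurent_coeff_single_mul, one_mul]
        exact hM _ (by simp; omega))
    refine ⟨M, x, ?_⟩
    rw [hmap, hmap, hx, ← map_pow, hpow, mul_comm]
  -- a function vanishing on this side has on the other side only rows of negative height, which a
  -- high power of `X` moves to rows of nonnegative height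
  · rw [hmap, hmap] at hab
    obtain ⟨M, hM⟩ := exists_row_bound (N (a - b)) (-AddMonoidHom.snd ℤ ℤ)
    refine ⟨M, h.eq_of_rows (fun m _ => by rw [map_mul, map_mul, hab]) fun m hm => ?_⟩
    rw [← sub_eq_zero, ← Finsupp.sub_apply, ← AddMonoidAlgebra.coeff_sub, ← map_sub, ← mul_sub,
      map_mul, laurent_coeff_mul]
    refine Finset.sum_eq_zero fun m' hm' => ?_
    have hrow : m'.2 = M := by
      by_contra hne
      refine Finsupp.mem_support_iff.mp hm' ?_
      rw [map_pow]
      exact hX'.pow M m' (by simpa using hne)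
    simp only [hM (m - m') (by simp [hrow]; omega), mul_zero]

/-- The functions on the cone preceding the ray are obtained by inverting the monomial `X` of
exponent `(0, -1)`. -/
lemma RayModel.isLocalization_neg (h : RayModel t f N P) {X : R}
    (hX : N X = AddMonoidAlgebra.single (0, -1) 1) (hX' : InRow (-1) (P X)) :
    @IsLocalization.Away R _ X (Laurent A) _ N.toAlgebra := by
  let _ := N.toAlgebra
  have hmap : ∀ x, algebraMap R (Laurent A) x = N x := fun _ => rfl
  have hpow : ∀ M : ℕ, N (X ^ M) = AddMonoidAlgebra.single (0, -(M : ℤ)) 1 := by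
    intro M
    rw [map_pow, hX, AddMonoidAlgebra.single_pow]
    simp
  refine IsLocalization.Away.mk X ?_ (fun Y => ?_) (fun a b hab => ?_)
  · rw [hmap, hX]
    refine IsUnit.of_mul_eq_one (AddMonoidAlgebra.single (0, 1) 1) ?_
    rw [AddMonoidAlgebra.single_mul_single, AddMonoidAlgebra.one_def]
    simp [← Prod.zero_eq_mk]
  · obtain ⟨M, hM⟩ := exists_row_bound Y (AddMonoidHom.snd ℤ ℤ)
    obtain ⟨x, hx, -⟩ := h.lift_nonpos (Z := AddMonoidAlgebra.single (0, -(M : ℤ)) 1 * Y)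
      (fun m hm => by
        rw [laurent_coeff_single_mul, one_mul]
        exact hM _ (by simp; omega))
    refine ⟨M, x, ?_⟩
    rw [hmap, hmap, hx, ← map_pow, hpow, mul_comm]
  · rw [hmap, hmap] at hab
    obtain ⟨M, hM⟩ := exists_row_bound (P (a - b)) (AddMonoidHom.snd ℤ ℤ)
    refine ⟨M, h.eq_of_rows' (fun m hm => ?_) fun m _ => by rw [map_mul, map_mul, hab]⟩
    rw [← sub_eq_zero, ← Finsupp.sub_apply, ← AddMonoidAlgebra.coeff_sub, ← map_sub, ← mul_sub,
      map_mul, laurent_coeff_mul]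
    refine Finset.sum_eq_zero fun m' hm' => ?_
    have hrow : m'.2 = -M := by
      by_contra hne
      refine Finsupp.mem_support_iff.mp hm' ?_
      rw [map_pow]
      exact hX'.pow M m' (by simpa using hne)
    simp only [hM (m - m') (by simp [hrow]; omega), mul_zero]

end RayModel
end MirrorFamily

namespace MirrorFamily

/-! ### Theta functions near a ray -/

section Runs

variable {n : ℕ}

lemma nonempty_of_two_le {F : Set (ZMod n)} (hF : 2 ≤ F.ncard) : F.Nonempty :=
  Set.nonempty_of_ncard_ne_zero (by omega)

lemma add_natCast_eq_self {j : ZMod n} {s : ℕ} (h0 : 0 < s) (h : s < n) : j + (s : ZMod n) ≠ j := by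
  rw [Ne, add_eq_left]
  exact natCast_ne_zero_of_lt h0 h

/-- Concatenation of runs. -/
lemma run_append {F : Set (ZMod n)} {j : ZMod n} {r s : ℕ}
    (h1 : ∀ x : ℕ, 1 ≤ x → x ≤ r → j + (x : ZMod n) ∉ F)
    (h2 : ∀ x : ℕ, 1 ≤ x → x ≤ s → j + (r : ZMod n) + (x : ZMod n) ∉ F) :
    ∀ x : ℕ, 1 ≤ x → x ≤ r + s → j + (x : ZMod n) ∉ F := by
  intro x hx1 hx2
  by_cases hx : x ≤ r
  · exact h1 x hx1 hx
  · have := h2 (x - r) (by omega) (by omega)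
    rwa [add_assoc, ← Nat.cast_add, Nat.add_sub_cancel' (by omega)] at this

lemma run_le [NeZero n] {F F' : Set (ZMod n)} (hF : 2 ≤ F.ncard) (hsub : F ⊆ F') {c : ZMod n} {s : ℕ}
    (hrun : ∀ r : ℕ, 1 ≤ r → r ≤ s → c + (r : ZMod n) ∉ F') : s + 2 ≤ n := by
  have h1 := run_add_ncard_le (F := F) (nonempty_of_two_le hF)
    (fun r h1 h2 h3 => hrun r h1 h2 (hsub h3))
  omega

lemma two_le_of_ncard [NeZero n] {F : Set (ZMod n)} (hF : 2 ≤ F.ncard) : 2 ≤ n := by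
  have := run_add_ncard_le (F := F) (nonempty_of_two_le hF) (j := 0) (s := 0)
    (fun r h1 h2 => by omega)
  omega

lemma add_one_ne_self (hn : 2 ≤ n) (j : ZMod n) : j + 1 ≠ j := by
  simpa using add_natCast_eq_self (j := j) (s := 1) (by omega) (by omega)

end Runs

section Localization

variable {n : ℕ} {A : Type*} [CommRing A] {d : ZMod n → ℤ} {t : ZMod n → A}
  {F : Set (ZMod n)} {𝔍 : Ideal A} {Γ : Type*} [CommRing Γ] [Algebra A Γ]
  {𝒜 : ConeAtlas d t F 𝔍 Γ} {ϑ : BZ n → Γ}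

namespace ConeAtlas

lemma plRel (𝒜 : ConeAtlas d t F 𝔍 Γ) {𝔞 : Ideal A} (h𝔞 : 𝔍 ≤ 𝔞) (g : Γ) :
    PLRel d t 𝔞 fun j m => (𝒜.y j g).coeff m :=
  (𝒜.rel ⊤ g (𝒜.top_mem g)).mono (by rwa [Ideal.mul_top])

lemma subset_zeros (𝒜 : ConeAtlas d t F 𝔍 Γ) {𝔞 : Ideal A} (h𝔞 : 𝔍 ≤ 𝔞) : F ⊆ {s | t s ∈ 𝔞} :=
  fun s hs => h𝔞 (𝒜.t_mem s hs)

lemma own_pt_mem [NeZero n] (𝒜 : ConeAtlas d t F 𝔍 Γ) {𝔞 : Ideal A} (h𝔞 : 𝔍 ≤ 𝔞) (g : Γ) (j : ZMod n)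
    (a b : ℕ) : (𝒜.y j g).coeff ((a : ℤ), (b : ℤ)) - 𝒜.own (pt j a b) g ∈ 𝔞 := by
  have := 𝒜.own_pt (𝒜.top_mem g) j a b
  rw [Ideal.mul_top] at this
  exact h𝔞 this

end ConeAtlas

namespace ConeAtlas.IsDual

variable [NeZero n] (hϑ : 𝒜.IsDual ϑ) {𝔞 : Ideal A} (h𝔞 : 𝔍 ≤ 𝔞) {q : BZ n} {c : ZMod n} {m : ℤ × ℤ}
include hϑ h𝔞

open scoped Classical in
lemma coeff_pt (c : ZMod n) (a b : ℕ) :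
    (𝒜.y c (ϑ q)).coeff ((a : ℤ), (b : ℤ)) - (if pt c a b = q then 1 else 0) ∈ 𝔞 := by
  have h1 := 𝒜.own_pt_mem h𝔞 (ϑ q) c a b
  have h2 := h𝔞 (hϑ q (pt c a b))
  have := 𝔞.add_mem h1 h2
  rwa [sub_add_sub_cancel] at this

lemma eq_of_notMem {a b : ℕ} (hm : (𝒜.y c (ϑ q)).coeff ((a : ℤ), (b : ℤ)) ∉ 𝔞) :
    pt c a b = q := by
  by_contra hne
  have := hϑ.coeff_pt h𝔞 (q := q) c a b
  rw [if_neg hne, sub_zero] at this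
  exact hm this

lemma eq_of_notMem' (hm : (𝒜.y c (ϑ q)).coeff m ∉ 𝔞) (h1 : 0 ≤ m.1) (h2 : 0 ≤ m.2) :
    pt c m.1.toNat m.2.toNat = q := by
  refine hϑ.eq_of_notMem h𝔞 ?_
  rwa [Int.toNat_of_nonneg h1, Int.toNat_of_nonneg h2]

/-- If `ϑ_q` has, modulo `𝔞`, an exponent on `σ_c` beyond the ray `ρ_{c+1}`, then `q` lies
counterclockwise from `σ_c`, with no ray in between whose bending parameter lies in `𝔞`. -/
lemma ccw (hne : F.Nonempty) (hm : (𝒜.y c (ϑ q)).coeff m ∉ 𝔞) (h1 : m.1 < 0) :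
    ∃ s : ℕ, 1 ≤ s ∧ (∀ r : ℕ, 1 ≤ r → r ≤ s → c + (r : ZMod n) ∉ {s | t s ∈ 𝔞}) ∧
      ∃ a b : ℕ, 0 < b ∧ pt (c + (s : ZMod n)) a b = q := by
  obtain ⟨s, hs, hrun, a, b, hb, hab⟩ := (𝒜.plRel h𝔞 (ϑ q)).path_ccw (F := {s | t s ∈ 𝔞})
    (fun s hs j m => 𝔞.mul_mem_right _ hs) (hne.mono (𝒜.subset_zeros h𝔞)) h1 hm
  exact ⟨s, hs, hrun, a, b, hb, hϑ.eq_of_notMem h𝔞 hab⟩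

/-- The clockwise counterpart of `ccw`. -/
lemma cw (hne : F.Nonempty) (hm : (𝒜.y c (ϑ q)).coeff m ∉ 𝔞) (h2 : m.2 < 0) :
    ∃ (i : ZMod n) (s : ℕ), c = i + (s : ZMod n) ∧ 1 ≤ s ∧
      (∀ r : ℕ, 1 ≤ r → r ≤ s → i + (r : ZMod n) ∉ {s | t s ∈ 𝔞}) ∧
      ∃ a b : ℕ, 0 < a ∧ pt i a b = q := by
  obtain ⟨i, s, hi, hs, hrun, a, b, ha, hab⟩ := (𝒜.plRel h𝔞 (ϑ q)).path_cw (F := {s | t s ∈ 𝔞})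
    (fun s hs j m => 𝔞.mul_mem_right _ hs) (hne.mono (𝒜.subset_zeros h𝔞)) h2 hm
  exact ⟨i, s, hi, hs, hrun, a, b, ha, hϑ.eq_of_notMem h𝔞 hab⟩

end ConeAtlas.IsDual

section Near

variable [NeZero n] (hϑ : 𝒜.IsDual ϑ) (hF : 2 ≤ F.ncard) {𝔞 : Ideal A} (h𝔞 : 𝔍 ≤ 𝔞) {j : ZMod n}
include hϑ hF h𝔞

open scoped Classical in
/-- On the cone `σ_j`, the theta function `ϑ_q` of a point `q ∈ σ_j` not on `ρ_{j+1}` is, modulo `𝔞`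
and up to terms with exponents beyond `ρ_j`, the monomial `z^q`: any other exponent would lead, across
rays with bending parameters outside `𝔞`, once around `B`, but at least two rays block the way. -/
lemma ConeAtlas.IsDual.coeff_same_pos {a b : ℕ} (ha : 0 < a) {m : ℤ × ℤ} (hm : 0 ≤ m.2) :
    (𝒜.y j (ϑ (pt j a b))).coeff m - (if m = ((a : ℤ), (b : ℤ)) then 1 else 0) ∈ 𝔞 := by
  by_cases h1 : 0 ≤ m.1
  · have := hϑ.coeff_pt h𝔞 (q := pt j a b) j m.1.toNat m.2.toNat
    rw [Int.toNat_of_nonneg h1, Int.toNat_of_nonneg hm] at this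
    convert this using 3
    rw [pt_pos_left ha, pt_eq_some]
    obtain ⟨x, y⟩ := m
    simp only [Prod.mk.injEq] at *
    constructor
    · rintro ⟨rfl, rfl⟩; left; simp
    · rintro (⟨-, h1, h2⟩ | ⟨-, h2, -⟩)
      · omega
      · exact absurd h2.symm (add_one_ne_self (two_le_of_ncard hF) j)
  · rw [if_neg (by rintro rfl; simp at h1), sub_zero]
    by_contra hc
    obtain ⟨s, hs, hrun, a', b', hb, he⟩ :=
      hϑ.ccw h𝔞 (nonempty_of_two_le hF) hc (by omega)
    have hsn := run_le hF (𝒜.subset_zeros h𝔞) hrun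
    rw [pt_pos_left ha, pt_eq_some] at he
    rcases he with ⟨h1, -, -⟩ | ⟨-, h1, -, -⟩
    · exact add_natCast_eq_self (by omega) (by omega) h1.symm
    · refine add_natCast_eq_self (j := j) (s := s + 1) (by omega) (by omega) ?_
      push_cast
      rw [← add_assoc]
      exact h1.symm

/-- On the cone `σ_j`, the theta function of a point of `σ_{j+1}` not on `ρ_{j+2}` has, modulo `𝔞`,
no exponents on the side of `σ_j` of the ray `ρ_{j+1}`. -/
lemma ConeAtlas.IsDual.coeff_prev_pos {a b : ℕ} (ha : 0 < a) {m : ℤ × ℤ} (hm : 0 < m.1) :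
    (𝒜.y j (ϑ (pt (j + 1) a b))).coeff m ∈ 𝔞 := by
  have hn := two_le_of_ncard hF
  have h1 := add_one_ne_self hn j
  by_contra hc
  by_cases h2 : 0 ≤ m.2
  · have he := hϑ.eq_of_notMem' h𝔞 hc hm.le h2
    rw [pt_pos_left ha, pt_eq_some] at he
    rcases he with ⟨h, -, -⟩ | ⟨h, -⟩
    · exact h1 h
    · omega
  · obtain ⟨i, s, hi, hs, hrun, a', b', ha', he⟩ :=
      hϑ.cw h𝔞 (nonempty_of_two_le hF) hc (by omega)
    have hsn := run_le hF (𝒜.subset_zeros h𝔞) hrun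
    rw [pt_pos_left ha, pt_eq_some] at he
    rcases he with ⟨h, -, -⟩ | ⟨h, -⟩
    · refine add_natCast_eq_self (j := i) (s := s + 1) (by omega) (by omega) ?_
      push_cast
      rw [← add_assoc, ← hi]; exact h
    · omega

open scoped Classical in
/-- The counterpart of `coeff_same_pos` on the other side: on `σ_j`, the terms of `ϑ_q` that are not
beyond `ρ_{j+1}` reduce to `z^q`. -/
lemma ConeAtlas.IsDual.coeff_same_neg {a b : ℕ} (ha : 0 < a) {m : ℤ × ℤ} (hm : 0 ≤ m.1) :
    (𝒜.y j (ϑ (pt j a b))).coeff m - (if m = ((a : ℤ), (b : ℤ)) then 1 else 0) ∈ 𝔞 := by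
  by_cases h1 : 0 ≤ m.2
  · exact hϑ.coeff_same_pos hF h𝔞 ha h1
  · rw [if_neg (by rintro rfl; simp at h1), sub_zero]
    by_contra hc
    obtain ⟨i, s, hi, hs, hrun, a', b', ha', he⟩ :=
      hϑ.cw h𝔞 (nonempty_of_two_le hF) hc (by omega)
    have hsn := run_le hF (𝒜.subset_zeros h𝔞) hrun
    rw [pt_pos_left ha, pt_eq_some] at he
    rcases he with ⟨h, -, -⟩ | ⟨h, -⟩
    · exact add_natCast_eq_self (j := i) (s := s) (by omega) (by omega) (hi.symm.trans h)
    · omega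

/-- On the cone `σ_{j+1}`, the theta function of an interior point of `σ_j` has, modulo `𝔞`, no
exponents on the side of `σ_{j+1}` of the ray `ρ_{j+1}`. -/
lemma ConeAtlas.IsDual.coeff_next_pos {a b : ℕ} (ha : 0 < a) (hb : 0 < b) {m : ℤ × ℤ}
    (hm : 0 < m.2) : (𝒜.y (j + 1) (ϑ (pt j a b))).coeff m ∈ 𝔞 := by
  have hn := two_le_of_ncard hF
  have h1 := add_one_ne_self hn j
  by_contra hc
  by_cases h2 : 0 ≤ m.1
  · have he := hϑ.eq_of_notMem' h𝔞 hc h2 hm.le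
    rw [pt_pos_left ha, pt_eq_some] at he
    rcases he with ⟨h, -, -⟩ | ⟨-, -, -, h⟩
    · exact h1 h.symm
    · simp only at h; omega
  · obtain ⟨s, hs, hrun, a', b', hb', he⟩ :=
      hϑ.ccw h𝔞 (nonempty_of_two_le hF) hc (by omega)
    have hsn := run_le hF (𝒜.subset_zeros h𝔞) hrun
    rw [pt_pos_left ha, pt_eq_some] at he
    rcases he with ⟨h, -, -⟩ | ⟨-, -, -, h⟩
    · refine add_natCast_eq_self (j := j) (s := s + 1) (by omega) (by omega) ?_
      push_cast
      rw [add_comm (s : ZMod n), ← add_assoc]; exact h.symm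
    · simp only at h; omega

end Near

/-- A chart of `Γ` near the ray `ρ_{j+1}`: the restriction `res` to the ring `R` of functions near
the ray is, on the cone `σ_{j+1}`, the given Laurent polynomial, and, on the cone `σ_j`, the given
Laurent polynomial to first order in `𝔍`. -/
structure RayChart (𝒜 : ConeAtlas d t F 𝔍 Γ) (j : ZMod n) (f : Laurent A) {R : Type*} [CommRing R]
    (N P : R →+* Laurent A) (res : Γ →+* R) : Prop where
  model : RayModel (t (j + 1)) f N P
  pos : ∀ g, P (res g) = 𝒜.y (j + 1) g
  neg : ∀ (K : Ideal A) (g : Γ), (∀ i, 𝒜.y i g ∈ coeffIn K) →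
    ∀ m, (N (res g)).coeff (glueΛ d j m) - (𝒜.y j g).coeff m ∈ 𝔍 * K

lemma single_coeff_eq_ite (m m' : ℤ × ℤ) [Decidable (m = m')] :
    (AddMonoidAlgebra.single m' (1 : A)).coeff m = if m = m' then 1 else 0 := by
  rw [laurent_coeff_single]
  congr

lemma glueΛ_symm_fst (j : ZMod n) (m : ℤ × ℤ) : ((glueΛ d j).symm m).1 = -m.2 := rfl

section Ray

variable {j : ZMod n} {f : Laurent A} {R : Type*} [CommRing R] {N P : R →+* Laurent A}
  {res : Γ →+* R} (H : RayChart 𝒜 j f N P res)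
include H

lemma RayChart.neg' {K : Ideal A} {g : Γ} (hg : ∀ i, 𝒜.y i g ∈ coeffIn K) (m : ℤ × ℤ) :
    (N (res g)).coeff m - (𝒜.y j g).coeff ((glueΛ d j).symm m) ∈ 𝔍 * K := by
  simpa using H.neg K g hg ((glueΛ d j).symm m)

variable [NeZero n] (hϑ : 𝒜.IsDual ϑ) (hF : 2 ≤ F.ncard)
include hϑ hF

/-- Near `ρ_{j+1}`, the function `ϑ_{v_{j+1}}` is, modulo `𝔍`, the monomial with exponent
`v_{j+1}`. -/
lemma RayChart.theta_sub_mem :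
    N (res (ϑ (pt (j + 1) 1 0))) - AddMonoidAlgebra.single (1, 0) 1 ∈ coeffIn 𝔍 ∧
    P (res (ϑ (pt (j + 1) 1 0))) - AddMonoidAlgebra.single (1, 0) 1 ∈ coeffIn 𝔍 := by
  classical
  obtain ⟨e, he, he'⟩ := H.model.lift (AddMonoidAlgebra.single (1, 0) 1)
  obtain ⟨e₁, he₁, he₁'⟩ := H.model.exists_pos (m := (1, 0)) le_rfl
  have hN1 : N e₁ = AddMonoidAlgebra.single (1, 0) 1 := by
    ext ⟨a, b⟩
    by_cases hb : b = 0
    · subst hb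
      rw [H.model.row_zero, he₁]
    · rw [he₁' _ hb, inRow_single (1, 0) 1 _ hb]
  have key := H.model.mem_of_rows (K := 𝔍) (x := res (ϑ (pt (j + 1) 1 0)) - e₁) (fun m hm => ?_)
    (fun m hm => ?_)
  · rwa [map_sub, map_sub, hN1, he₁] at key
  · rw [map_sub, he₁, H.pos, AddMonoidAlgebra.coeff_sub, Finsupp.sub_apply, single_coeff_eq_ite]
    exact hϑ.coeff_same_pos (j := j + 1) hF le_rfl one_pos hm
  · rw [map_sub, hN1, AddMonoidAlgebra.coeff_sub, Finsupp.sub_apply,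
      inRow_single (1, 0) 1 m hm.ne, sub_zero]
    have h1 := H.neg' (𝒜.top_mem (ϑ (pt (j + 1) 1 0))) m
    rw [Ideal.mul_top] at h1
    refine (Submodule.sub_mem_iff_left _ ?_).mp h1
    exact hϑ.coeff_prev_pos hF le_rfl one_pos (by rw [glueΛ_symm_fst]; omega)

/-- The function `ϑ_{v_{j+1}}` is invertible near `ρ_{j+1}`, since it differs from the invertible
monomial with exponent `v_{j+1}` by a nilpotent function. -/
lemma RayChart.isUnit {M : ℕ} (hM : 𝔍 ^ M = ⊥) : IsUnit (res (ϑ (pt (j + 1) 1 0))) := by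
  obtain ⟨h1, h2⟩ := H.theta_sub_mem hϑ hF
  set x := res (ϑ (pt (j + 1) 1 0))
  have hex : ∀ a : ℤ, ∃ e, N e = AddMonoidAlgebra.single (a, 0) 1 ∧
      P e = AddMonoidAlgebra.single (a, 0) 1 := by
    intro a
    obtain ⟨e, he, he'⟩ := H.model.exists_pos (m := (a, 0)) le_rfl
    refine ⟨e, ?_, he⟩
    ext ⟨c, b⟩
    by_cases hb : b = 0
    · subst hb
      rw [H.model.row_zero, he]
    · rw [he' _ hb, inRow_single (a, 0) 1 _ hb]
  obtain ⟨e, hNe, hPe⟩ := hex 1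
  obtain ⟨e', hNe', hPe'⟩ := hex (-1)
  have hone : e * e' = 1 := by
    rw [← sub_eq_zero]
    refine H.model.inj _ ?_ ?_
    · rw [map_sub, map_mul, hNe, hNe', map_one, AddMonoidAlgebra.single_mul_single,
        AddMonoidAlgebra.one_def]
      simp [← Prod.zero_eq_mk]
    · rw [map_sub, map_mul, hPe, hPe', map_one, AddMonoidAlgebra.single_mul_single,
        AddMonoidAlgebra.one_def]
      simp [← Prod.zero_eq_mk]
  have hpow : ∀ {y : Laurent A}, y ∈ coeffIn 𝔍 → y ^ M = 0 := by
    intro y hy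
    have : ∀ i : ℕ, y ^ i ∈ coeffIn (𝔍 ^ i) := by
      intro i
      induction i with
      | zero => intro m; simp
      | succ i ih => rw [pow_succ, pow_succ]; exact mul_mem_coeffIn ih hy
    ext m
    simpa [hM] using this M m
  have hnil : IsNilpotent (x - e) := by
    refine ⟨M, H.model.inj _ ?_ ?_⟩
    · rw [map_pow, map_sub, hNe]; exact hpow h1
    · rw [map_pow, map_sub, hPe]; exact hpow h2
  have hu : IsUnit e := IsUnit.of_mul_eq_one e' hone
  have := hnil.isUnit_add_left_of_commute hu (Commute.all _ _)
  rwa [add_sub_cancel] at this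

omit [NeZero n] H hϑ hF in
lemma pow_coeff_sub_mem {y x : Laurent A} {K : Ideal A} {v : ℤ × ℤ}
    (hy : y - AddMonoidAlgebra.single v 1 ∈ coeffIn 𝔍) (hx : x ∈ coeffIn K) (M : ℕ) (m : ℤ × ℤ) :
    (y ^ M * x).coeff m - x.coeff (m - M • v) ∈ 𝔍 * K := by
  have h1 := mul_mem_coeffIn (pow_sub_pow_mem hy M) hx m
  rwa [sub_mul, AddMonoidAlgebra.coeff_sub, Finsupp.sub_apply, AddMonoidAlgebra.single_pow, one_pow,
    laurent_coeff_single_mul, one_mul] at h1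

open scoped Classical in
/-- After multiplication by a power of `ϑ_{v_{j+1}}`, a function near `ρ_{j+1}` with coefficients in
`K` is, up to coefficients in `𝔍 K`, the restriction of a global function. The power moves all
exponents into `σ_j ∪ σ_{j+1}`, where every monomial is to first order a theta function. -/
lemma RayChart.exists_approx {K : Ideal A} {x : R} (hxN : N x ∈ coeffIn K)
    (hxP : P x ∈ coeffIn K) : ∃ (M : ℕ) (g : Γ),
      N (res (ϑ (pt (j + 1) 1 0)) ^ M * x - res g) ∈ coeffIn (𝔍 * K) ∧
      P (res (ϑ (pt (j + 1) 1 0)) ^ M * x - res g) ∈ coeffIn (𝔍 * K) := by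
  obtain ⟨hϑN, hϑP⟩ := H.theta_sub_mem hϑ hF
  set S : Finset (ℤ × ℤ) := (N x).coeff.support ∪ (P x).coeff.support with hS
  -- large enough for `m + M v_{j+1}` to lie in `σ_{j+1}` off its far edge if `m.2 ≥ 0`, and in the
  -- interior of `σ_j` if `m.2 < 0`, for all exponents `m` of `x`
  set M : ℕ := S.sup (fun m => (1 - m.1).toNat + (1 - m.1 + d (j + 1) * m.2).toNat) with hMdef
  have hM : ∀ m ∈ S, 1 ≤ m.1 + M ∧ 1 ≤ m.1 + M - d (j + 1) * m.2 := by
    intro m hm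
    have := Finset.le_sup (f := fun m : ℤ × ℤ => (1 - m.1).toNat + (1 - m.1 + d (j + 1) * m.2).toNat) hm
    rw [← hMdef] at this
    omega
  -- the integral point `m + M v_{j+1}`
  set q : ℤ × ℤ → BZ n := fun m => if 0 ≤ m.2 then pt (j + 1) (m.1 + M).toNat m.2.toNat
    else pt j (-m.2).toNat (m.1 + M - d (j + 1) * m.2).toNat with hq
  set a : ℤ × ℤ → A := fun m => if 0 ≤ m.2 then (P x).coeff m else (N x).coeff m with ha
  have haK : ∀ m, a m ∈ K := by
    intro m
    simp only [ha]
    split_ifs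
    · exact hxP m
    · exact hxN m
  set g : Γ := ∑ m ∈ S, a m • ϑ (q m) with hg
  have hgy : ∀ i μ, (𝒜.y i g).coeff μ = ∑ m ∈ S, a m * (𝒜.y i (ϑ (q m))).coeff μ := by
    intro i μ
    rw [hg, map_sum, AddMonoidAlgebra.coeff_sum, Finsupp.finsetSum_apply]
    simp
  have hgK : ∀ i, 𝒜.y i g ∈ coeffIn K := by
    intro i μ
    rw [hgy]
    exact Ideal.sum_mem _ fun m _ => K.mul_mem_right _ (haK m)
  refine ⟨M, g, H.model.mem_of_rows (fun μ hμ => ?_) (fun μ hμ => ?_)⟩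
  · have h1 := pow_coeff_sub_mem hϑP hxP M μ
    have h2 : (𝒜.y (j + 1) g).coeff μ - (P x).coeff (μ - M • (1, 0)) ∈ 𝔍 * K := by
      have h3 : (P x).coeff (μ - M • (1, 0))
          = ∑ m ∈ S, a m * (if μ - M • (1, 0) = m then 1 else 0) := by
        simp only [mul_ite, mul_one, mul_zero, Finset.sum_ite_eq]
        split_ifs with h
        · simp [ha, hμ]
        · by_contra hne
          exact h (Finset.mem_union_right _ (Finsupp.mem_support_iff.mpr hne))
      rw [h3, hgy, ← Finset.sum_sub_distrib]
      refine Ideal.sum_mem _ fun m hm => ?_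
      rw [← mul_sub, mul_comm (a m)]
      refine Ideal.mul_mem_mul ?_ (haK m)
      obtain ⟨hm1, hm2⟩ := hM m hm
      by_cases h0 : 0 ≤ m.2
      · have := hϑ.coeff_same_pos (j := j + 1) hF le_rfl (a := (m.1 + M).toNat) (b := m.2.toNat)
          (by omega) hμ
        simp only [hq, if_pos h0]
        convert this using 3
        rw [Int.toNat_of_nonneg (by omega), Int.toNat_of_nonneg h0, sub_eq_iff_eq_add]
        simp [Prod.ext_iff]
      · simp only [hq, if_neg h0]
        rw [if_neg, sub_zero]
        · rcases hμ.eq_or_lt with hμ0 | hμ0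
          · -- on the ray itself the two cones give the same coefficient
            have h4 := H.neg' (𝒜.top_mem (ϑ (pt j (-m.2).toNat (m.1 + M - d (j + 1) * m.2).toNat))) μ
            have h5 := hϑ.coeff_same_neg (j := j) hF le_rfl (a := (-m.2).toNat)
              (b := (m.1 + M - d (j + 1) * m.2).toNat) (by omega)
              (m := (glueΛ d j).symm μ) (by rw [glueΛ_symm_fst]; omega)
            rw [if_neg, sub_zero] at h5
            · rw [Ideal.mul_top] at h4
              have h6 := (Submodule.sub_mem_iff_left _ h5).mp h4
              obtain ⟨μ1, μ2⟩ := μ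
              obtain rfl : μ2 = 0 := hμ0.symm
              rwa [H.model.row_zero, H.pos] at h6
            · rw [glueΛ_symm_apply, Prod.mk.injEq]; omega
          · exact hϑ.coeff_next_pos hF le_rfl (by omega) (by omega) hμ0
        · rintro rfl
          simp at h0; omega
    rw [map_sub, map_mul, map_pow, H.pos g, AddMonoidAlgebra.coeff_sub, Finsupp.sub_apply]
    have := Ideal.sub_mem _ h1 h2
    rwa [sub_sub_sub_cancel_right] at this
  · have h1 := pow_coeff_sub_mem hϑN hxN M μ
    set μ' := (glueΛ d j).symm μ with hμ'
    have hμ'1 : μ'.1 = -μ.2 := rfl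
    have hμ'2 : μ'.2 = μ.1 - d (j + 1) * μ.2 := rfl
    have h2 : (𝒜.y j g).coeff μ' - (N x).coeff (μ - M • (1, 0)) ∈ 𝔍 * K := by
      have h3 : (N x).coeff (μ - M • (1, 0))
          = ∑ m ∈ S, a m * (if μ - M • (1, 0) = m then 1 else 0) := by
        simp only [mul_ite, mul_one, mul_zero, Finset.sum_ite_eq]
        split_ifs with h
        · simp [ha, hμ]
        · by_contra hne
          exact h (Finset.mem_union_left _ (Finsupp.mem_support_iff.mpr hne))
      rw [h3, hgy, ← Finset.sum_sub_distrib]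
      refine Ideal.sum_mem _ fun m hm => ?_
      rw [← mul_sub, mul_comm (a m)]
      refine Ideal.mul_mem_mul ?_ (haK m)
      obtain ⟨hm1, hm2⟩ := hM m hm
      by_cases h0 : 0 ≤ m.2
      · simp only [hq, if_pos h0]
        rw [if_neg, sub_zero]
        · exact hϑ.coeff_prev_pos hF le_rfl (by omega) (by omega)
        · rintro rfl
          simp at h0; omega
      · have := hϑ.coeff_same_neg (j := j) hF le_rfl (a := (-m.2).toNat)
          (b := (m.1 + M - d (j + 1) * m.2).toNat) (by omega) (m := μ') (by omega)
        simp only [hq, if_neg h0]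
        convert this using 3
        rw [Int.toNat_of_nonneg (by omega), Int.toNat_of_nonneg (by omega), sub_eq_iff_eq_add]
        simp only [Prod.ext_iff, hμ'1, hμ'2, Prod.fst_add, Prod.snd_add, nsmul_eq_mul]
        simp only [Prod.fst_mul, Prod.snd_mul, Prod.fst_natCast, Prod.snd_natCast, mul_one,
          mul_zero, add_zero]
        constructor
        · rintro ⟨h5, h6⟩; rw [h5, h6]; exact ⟨rfl, by ring⟩
        · rintro ⟨h5, h6⟩
          have h7 : μ.2 = m.2 := by omega
          rw [h7] at h6
          exact ⟨by linarith, h7⟩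
    have h4 := H.neg' hgK μ
    rw [map_sub, map_mul, map_pow, AddMonoidAlgebra.coeff_sub, Finsupp.sub_apply]
    have := Ideal.sub_mem _ (Ideal.sub_mem _ h1 h2) h4
    convert this using 1
    ring

end Ray

end Localization
end MirrorFamily

namespace MirrorFamily

/-! ### The functions near a ray as a localization -/

section Injectivity

variable {n : ℕ} {A : Type*} [CommRing A] {d : ZMod n → ℤ} {t : ZMod n → A}
  {F : Set (ZMod n)} {𝔍 : Ideal A} {Γ : Type*} [CommRing Γ] [Algebra A Γ]
  {𝒜 : ConeAtlas d t F 𝔍 Γ} {ϑ : BZ n → Γ}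

/-- If all exponents of `y` on which `ℓ` is nonnegative have coefficient in `𝔍`, then
multiplication by high powers of `y` moves, modulo `𝔍`, all exponents to where `ℓ ≤ 0`. -/
lemma pow_mul_coeff_mem {y g : Laurent A} {K : Ideal A} (ℓ : ℤ × ℤ →+ ℤ)
    (hy : ∀ m, 0 ≤ ℓ m → y.coeff m ∈ 𝔍) (hg : g ∈ coeffIn K) {M : ℕ}
    (hM : ∀ m, (M : ℤ) < ℓ m → g.coeff m = 0) {m : ℤ × ℤ} (hm : 0 < ℓ m) :
    (y ^ M * g).coeff m ∈ 𝔍 * K := by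
  have key : ∀ i : ℕ, ∀ m, -(i : ℤ) < ℓ m → (y ^ i).coeff m ∈ 𝔍 := by
    intro i
    induction i with
    | zero =>
      intro m hm
      rw [pow_zero, laurent_coeff_one, if_neg]
      · exact zero_mem _
      · rintro rfl; simp at hm
    | succ i ih =>
      intro m hm
      rw [pow_succ, laurent_coeff_mul]
      refine Ideal.sum_mem _ fun m' _ => ?_
      by_cases h : -(i : ℤ) < ℓ m'
      · exact Ideal.mul_mem_right _ _ (ih m' h)
      · refine Ideal.mul_mem_left _ _ (hy _ ?_)
        rw [map_sub]; push_cast at hm; omega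
  rw [laurent_coeff_mul]
  refine Ideal.sum_mem _ fun m' _ => ?_
  by_cases h : -(M : ℤ) < ℓ m'
  · exact Ideal.mul_mem_mul (key M m' h) (hg _)
  · simp only [hM (m - m') (by rw [map_sub]; omega), mul_zero, zero_mem]

lemma y_mul_mem {K : Ideal A} {g : Γ} {j : ZMod n} (hg : 𝒜.y j g ∈ coeffIn K) (x : Γ) :
    𝒜.y j (x * g) ∈ coeffIn K := by
  rw [map_mul]
  exact Ideal.mul_mem_left _ _ hg

variable [NeZero n] (hϑ : 𝒜.IsDual ϑ) (hF : 2 ≤ F.ncard)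
include hϑ hF

/-- Away from its own cones, and as long as no ray of `F` is crossed counterclockwise, `ϑ_{v_i}` has
its exponents on the near side. -/
lemma theta_coeff_mem_ccw {i c : ZMod n} {r : ℕ} (hc : c = i + (r : ZMod n)) (hr : 1 ≤ r)
    (hrun : ∀ x : ℕ, 1 ≤ x → x ≤ r → i + (x : ZMod n) ∉ F) {m : ℤ × ℤ} (hm : 0 ≤ m.2) :
    (𝒜.y c (ϑ (pt i 1 0))).coeff m ∈ 𝔍 := by
  by_contra hne
  have hrn := run_le hF subset_rfl hrun
  by_cases h1 : 0 ≤ m.1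
  · have he := hϑ.eq_of_notMem' le_rfl hne h1 hm
    rw [pt_pos_left one_pos, pt_eq_some] at he
    rcases he with ⟨h, -, -⟩ | ⟨-, h, -, -⟩
    · exact add_natCast_eq_self (by omega) (by omega) (hc.symm.trans h.symm)
    · refine add_natCast_eq_self (j := i) (s := r + 1) (by omega) (by omega) ?_
      push_cast
      rw [← add_assoc, ← hc]; exact h.symm
  · obtain ⟨s, hs, hrun', a', b', hb', he⟩ :=
      hϑ.ccw le_rfl (nonempty_of_two_le hF) hne (by omega)
    have hrun'' := run_append hrun (s := s) fun x h1 h2 h3 =>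
      hrun' x h1 h2 (𝒜.subset_zeros le_rfl (hc ▸ h3))
    have hsn := run_le hF subset_rfl hrun''
    rw [pt_pos_left one_pos, pt_eq_some] at he
    rcases he with ⟨-, -, h⟩ | ⟨-, h, -, -⟩
    · simp only at h; omega
    · refine add_natCast_eq_self (j := i) (s := r + s + 1) (by omega) (by omega) ?_
      push_cast
      rw [← add_assoc, ← add_assoc, ← hc]; exact h.symm

/-- The clockwise counterpart of `theta_coeff_mem_ccw`. -/
lemma theta_coeff_mem_cw {j c : ZMod n} {r : ℕ} (hc : j = c + (r : ZMod n)) (hr : 1 ≤ r)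
    (hrun : ∀ x : ℕ, 1 ≤ x → x ≤ r → c + (x : ZMod n) ∉ F) {m : ℤ × ℤ} (hm : 0 ≤ m.1) :
    (𝒜.y c (ϑ (pt (j + 1) 1 0))).coeff m ∈ 𝔍 := by
  by_contra hne
  have hrn := run_le hF subset_rfl hrun
  by_cases h1 : 0 ≤ m.2
  · have he := hϑ.eq_of_notMem' le_rfl hne hm h1
    rw [pt_pos_left one_pos, pt_eq_some] at he
    rcases he with ⟨h, -, -⟩ | ⟨-, h, -, -⟩
    · refine add_natCast_eq_self (j := c) (s := r + 1) (by omega) (by omega) ?_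
      push_cast
      rw [← add_assoc, ← hc]; exact h
    · exact add_natCast_eq_self (j := c) (s := r) (by omega) (by omega)
        (hc.symm.trans (add_right_cancel h))
  · obtain ⟨i', s, hi', hs, hrun', a', b', ha', he⟩ :=
      hϑ.cw le_rfl (nonempty_of_two_le hF) hne (by omega)
    have hrun'' := run_append (F := F) (fun x h1 h2 h3 =>
      hrun' x h1 h2 (𝒜.subset_zeros le_rfl h3)) (hi' ▸ hrun)
    have hsn := run_le hF subset_rfl hrun''
    rw [pt_pos_left one_pos, pt_eq_some] at he
    rcases he with ⟨h, -, -⟩ | ⟨h, -⟩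
    · refine add_natCast_eq_self (j := i') (s := s + r + 1) (by omega) (by omega) ?_
      push_cast
      rw [← add_assoc, ← add_assoc, ← hi', ← hc]; exact h
    · omega

variable {j : ZMod n} {f : Laurent A} {R : Type*} [CommRing R] {N P : R →+* Laurent A}
  {res : Γ →+* R} (H : RayChart 𝒜 j f N P res)
include H

/-- A function that vanishes near `ρ_{j+1}` becomes smaller, after multiplication by a power of
`ϑ_{v_{j+1}}`, on all cones reached counterclockwise without crossing a ray of `F`. From one cone to
the next, the exponents on the near side are controlled by the piecewise linear relations, and
multiplication by `ϑ_{v_{j+1}}` moves the others to the near side. -/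
lemma RayChart.exists_pow_mul_ccw {K : Ideal A} {g : Γ} (hg : ∀ i, 𝒜.y i g ∈ coeffIn K)
    (h0 : res g = 0) (r : ℕ)
    (hrun : ∀ x : ℕ, 1 ≤ x → x ≤ r → j + 1 + (x : ZMod n) ∉ F) :
    ∃ M : ℕ, 𝒜.y (j + 1 + (r : ZMod n)) (ϑ (pt (j + 1) 1 0) ^ M * g) ∈ coeffIn (𝔍 * K) := by
  induction r with
  | zero =>
    refine ⟨0, ?_⟩
    rw [pow_zero, one_mul, Nat.cast_zero, add_zero, ← H.pos, h0, map_zero]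
    exact zero_mem _
  | succ r ih =>
    obtain ⟨M, hM⟩ := ih fun x h1 h2 => hrun x h1 (by omega)
    set g₁ := ϑ (pt (j + 1) 1 0) ^ M * g with hg₁
    have hg₁K : ∀ i, 𝒜.y i g₁ ∈ coeffIn K := fun i => y_mul_mem (hg i) _
    have hc : j + 1 + ((r + 1 : ℕ) : ZMod n) = j + 1 + (r : ZMod n) + 1 := by push_cast; ring
    obtain ⟨M₁, hM₁⟩ := exists_row_bound (𝒜.y (j + 1 + ((r + 1 : ℕ) : ZMod n)) g₁)
      (AddMonoidHom.snd ℤ ℤ)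
    refine ⟨M₁ + M, ?_⟩
    rw [pow_add, mul_assoc, ← hg₁]
    intro m
    by_cases hm : 0 < m.2
    · rw [map_mul, map_pow]
      exact pow_mul_coeff_mem (AddMonoidHom.snd ℤ ℤ)
        (fun m hm => theta_coeff_mem_ccw hϑ hF rfl (by omega) hrun hm) (hg₁K _) hM₁ hm
    · have h1 := (𝒜.rel K (ϑ (pt (j + 1) 1 0) ^ M₁ * g₁) (fun i => y_mul_mem (hg₁K i) _)).ge
        (j + 1 + (r : ZMod n)) ((glueΛ d (j + 1 + (r : ZMod n))).symm m) (by rw [glueΛ_symm_fst]; omega)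
      rw [AddEquiv.apply_symm_apply, ← hc] at h1
      exact (Submodule.sub_mem_iff_left _ (Ideal.mul_mem_left _ _ (y_mul_mem hM _ _))).mp h1

/-- The clockwise counterpart of `exists_pow_mul_ccw`. -/
lemma RayChart.exists_pow_mul_cw {K : Ideal A} {g : Γ} (hg : ∀ i, 𝒜.y i g ∈ coeffIn K)
    (h0 : res g = 0) (r : ℕ) (c : ZMod n) (hc : j = c + (r : ZMod n))
    (hrun : ∀ x : ℕ, 1 ≤ x → x ≤ r → c + (x : ZMod n) ∉ F) :
    ∃ M : ℕ, 𝒜.y c (ϑ (pt (j + 1) 1 0) ^ M * g) ∈ coeffIn (𝔍 * K) := by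
  induction r generalizing c with
  | zero =>
    refine ⟨0, ?_⟩
    obtain rfl : j = c := by simpa using hc
    intro m
    have := H.neg K g hg m
    rw [h0, map_zero, AddMonoidAlgebra.coeff_zero, Finsupp.zero_apply, zero_sub,
      neg_mem_iff] at this
    rwa [pow_zero, one_mul]
  | succ r ih =>
    obtain ⟨M, hM⟩ := ih (c + 1) (by rw [hc]; push_cast; ring) fun x h1 h2 => by
      have := hrun (x + 1) (by omega) (by omega)
      push_cast at this
      rwa [add_comm (x : ZMod n), ← add_assoc] at this
    set g₁ := ϑ (pt (j + 1) 1 0) ^ M * g with hg₁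
    have hg₁K : ∀ i, 𝒜.y i g₁ ∈ coeffIn K := fun i => y_mul_mem (hg i) _
    obtain ⟨M₁, hM₁⟩ := exists_row_bound (𝒜.y c g₁) (AddMonoidHom.fst ℤ ℤ)
    refine ⟨M₁ + M, ?_⟩
    rw [pow_add, mul_assoc, ← hg₁]
    intro m
    by_cases hm : 0 < m.1
    · rw [map_mul, map_pow]
      exact pow_mul_coeff_mem (AddMonoidHom.fst ℤ ℤ)
        (fun m hm => theta_coeff_mem_cw hϑ hF hc (by omega) hrun hm) (hg₁K _) hM₁ hm
    · have h1 := (𝒜.rel K (ϑ (pt (j + 1) 1 0) ^ M₁ * g₁) (fun i => y_mul_mem (hg₁K i) _)).le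
        c m (by omega)
      exact (Submodule.sub_mem_iff_left _ (Ideal.mul_mem_left _ _ (y_mul_mem hM _ _))).mp h1

/-- A function that vanishes near `ρ_{j+1}` becomes smaller on every cone after multiplication by a
power of `ϑ_{v_{j+1}}`: either `ϑ_{v_{j+1}}` vanishes on the cone modulo `𝔍`, or one of its exponents
there leads to `ρ_{j+1}` without crossing a ray of `F`. -/
lemma RayChart.exists_pow_mul {K : Ideal A} {g : Γ} (hg : ∀ i, 𝒜.y i g ∈ coeffIn K)
    (h0 : res g = 0) (c : ZMod n) :
    ∃ M : ℕ, 𝒜.y c (ϑ (pt (j + 1) 1 0) ^ M * g) ∈ coeffIn (𝔍 * K) := by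
  by_cases hc : 𝒜.y c (ϑ (pt (j + 1) 1 0)) ∈ coeffIn 𝔍
  · refine ⟨1, ?_⟩
    rw [pow_one, map_mul]
    exact mul_mem_coeffIn hc (hg c)
  · rw [mem_coeffIn, not_forall] at hc
    obtain ⟨m, hm⟩ := hc
    by_cases h1 : 0 ≤ m.1
    · by_cases h2 : 0 ≤ m.2
      · have he := hϑ.eq_of_notMem' le_rfl hm h1 h2
        rw [pt_pos_left one_pos, pt_eq_some] at he
        rcases he with ⟨h, -, -⟩ | ⟨-, h, -, -⟩
        · have := H.exists_pow_mul_ccw hϑ hF hg h0 0 fun x h1 h2 => by omega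
          obtain rfl : j + 1 = c := h
          simpa using this
        · exact H.exists_pow_mul_cw hϑ hF hg h0 0 c (by simpa using h) fun x h1 h2 => by omega
      · obtain ⟨i', s, hi', hs, hrun', a', b', ha', he⟩ :=
          hϑ.cw le_rfl (nonempty_of_two_le hF) hm (by omega)
        rw [pt_pos_left one_pos, pt_eq_some] at he
        rcases he with ⟨h, -, -⟩ | ⟨h, -⟩
        · obtain rfl : j + 1 = i' := h
          subst hi'
          exact H.exists_pow_mul_ccw hϑ hF hg h0 s fun x h1 h2 h3 =>
            hrun' x h1 h2 (𝒜.subset_zeros le_rfl h3)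
        · omega
    · obtain ⟨s, hs, hrun', a', b', hb', he⟩ :=
        hϑ.ccw le_rfl (nonempty_of_two_le hF) hm (by omega)
      rw [pt_pos_left one_pos, pt_eq_some] at he
      rcases he with ⟨-, -, h⟩ | ⟨-, h, -, -⟩
      · simp only at h; omega
      · exact H.exists_pow_mul_cw hϑ hF hg h0 s c (add_right_cancel h) fun x h1 h2 h3 =>
            hrun' x h1 h2 (𝒜.subset_zeros le_rfl h3)

/-- The functions near the ray `ρ_{j+1}` are obtained from the global functions by inverting
`ϑ_{v_{j+1}}`. -/
theorem RayChart.isLocalization {M : ℕ} (hM : 𝔍 ^ M = ⊥) :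
    @IsLocalization.Away Γ _ (ϑ (pt (j + 1) 1 0)) R _ res.toAlgebra := by
  let _ := res.toAlgebra
  have hmap : ∀ x, algebraMap Γ R x = res x := fun _ => rfl
  set v := ϑ (pt (j + 1) 1 0) with hv
  have hzero : ∀ {x : Laurent A}, x ∈ coeffIn (𝔍 ^ M) → x = 0 := by
    intro x hx
    ext m
    simpa [hM] using hx m
  refine IsLocalization.Away.mk v (H.isUnit hϑ hF hM) (fun x => ?_) (fun a b hab => ?_)
  -- surjectivity: approximate modulo higher and higher powers of the nilpotent ideal `𝔍`
  · have key : ∀ i : ℕ, ∃ (r : ℕ) (g : Γ), N (res v ^ r * x - res g) ∈ coeffIn (𝔍 ^ i) ∧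
        P (res v ^ r * x - res g) ∈ coeffIn (𝔍 ^ i) := by
      intro i
      induction i with
      | zero => exact ⟨0, 0, fun m => by simp, fun m => by simp⟩
      | succ i ih =>
        obtain ⟨r, g, h1, h2⟩ := ih
        obtain ⟨r', g', h1', h2'⟩ := H.exists_approx hϑ hF h1 h2
        have he : res v ^ (r' + r) * x - res (v ^ r' * g + g')
            = res v ^ r' * (res v ^ r * x - res g) - res g' := by
          rw [map_add, map_mul, map_pow]; ring
        refine ⟨r' + r, v ^ r' * g + g', ?_, ?_⟩
        · rw [he, pow_succ']; exact h1'
        · rw [he, pow_succ']; exact h2'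
    obtain ⟨r, g, h1, h2⟩ := key M
    refine ⟨r, g, ?_⟩
    rw [hmap, hmap, mul_comm, ← sub_eq_zero]
    exact H.model.inj _ (hzero h1) (hzero h2)
  -- injectivity, again by induction on the powers of `𝔍`
  · rw [hmap, hmap, ← sub_eq_zero, ← map_sub] at hab
    have key : ∀ i : ℕ, ∃ r : ℕ, ∀ c, 𝒜.y c (v ^ r * (a - b)) ∈ coeffIn (𝔍 ^ i) := by
      intro i
      induction i with
      | zero => exact ⟨0, fun c m => by simp⟩
      | succ i ih =>
        obtain ⟨r, hr⟩ := ih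
        choose s hs using H.exists_pow_mul hϑ hF hr (by rw [map_mul, hab, mul_zero])
        refine ⟨Finset.univ.sup s + r, fun c => ?_⟩
        have hle : s c ≤ Finset.univ.sup s := Finset.le_sup (Finset.mem_univ c)
        have he : v ^ (Finset.univ.sup s + r) * (a - b)
            = v ^ (Finset.univ.sup s - s c) * (v ^ s c * (v ^ r * (a - b))) := by
          rw [← mul_assoc, ← mul_assoc, ← pow_add, ← pow_add]
          congr 2; omega
        rw [he, pow_succ']
        exact y_mul_mem (hs c) _
    obtain ⟨r, hr⟩ := key M
    refine ⟨r, ?_⟩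
    rw [← sub_eq_zero, ← mul_sub]
    exact 𝒜.inj _ fun c => hzero (hr c)

end Injectivity

/-! ### Overlaps of the charts -/

section Dichotomy

variable {n : ℕ} [NeZero n]

/-- Two complementary runs outside `F` leave at most two elements for `F`. -/
lemma ncard_le_two_of_runs {F : Set (ZMod n)} (hF : 3 ≤ F.ncard) {i e : ZMod n} {r s : ℕ}
    (he : e = i + (r : ZMod n) + 1) (hi : i = e + (s : ZMod n) + 1)
    (h1 : ∀ x : ℕ, 1 ≤ x → x ≤ r → i + (x : ZMod n) ∉ F)
    (h2 : ∀ x : ℕ, 1 ≤ x → x ≤ s → e + (x : ZMod n) ∉ F) : False := by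
  have hne : F.Nonempty := Set.nonempty_of_ncard_ne_zero (by omega)
  have hr := run_add_ncard_le hne h1
  have hs := run_add_ncard_le hne h2
  have hrs : r + s + 2 = n := by
    have h0 : ((r + s + 2 : ℕ) : ZMod n) = 0 := by
      have : e = e + ((r + s + 2 : ℕ) : ZMod n) := by
        conv_lhs => rw [he, hi]
        push_cast; ring
      simpa using this
    rw [ZMod.natCast_eq_zero_iff] at h0
    obtain ⟨k, hk⟩ := h0
    have : k < 2 := by
      by_contra hk2
      have : n * 2 ≤ n * k := Nat.mul_le_mul_left _ (by omega)
      omega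
    interval_cases k <;> omega
  have hsub : F ⊆ {i, e} := by
    intro x hx
    obtain ⟨y, hy1, hyn, rfl⟩ := exists_eq_add_natCast i x
    rcases lt_trichotomy y (r + 1) with h | rfl | h
    · exact absurd hx (h1 y hy1 (by omega))
    · right; rw [Set.mem_singleton_iff, he]; push_cast; ring
    · rcases hyn.eq_or_lt with rfl | hyn
      · left; simp
      · refine absurd hx ?_
        have := h2 (y - (r + 1)) (by omega) (by omega)
        rw [he, add_assoc (i + _), add_assoc i] at this
        convert this using 2
        rw [Nat.cast_sub (by omega)]; push_cast; ring_nf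
  have := Set.ncard_le_ncard hsub (Set.toFinite _)
  have := Set.ncard_insert_le i {e}
  rw [Set.ncard_singleton] at this
  omega

variable {A : Type*} [CommRing A] {d : ZMod n → ℤ} {t : ZMod n → A}
  {F : Set (ZMod n)} {𝔍 : Ideal A} {Γ : Type*} [CommRing Γ] [Algebra A Γ]
  {𝒜 : ConeAtlas d t F 𝔍 Γ} {ϑ : BZ n → Γ} (hϑ : 𝒜.IsDual ϑ) (hF : 2 ≤ F.ncard)
  {j : ZMod n} {f : Laurent A} {R : Type*} [CommRing R] {N P : R →+* Laurent A}
  {res : Γ →+* R} (H : RayChart 𝒜 j f N P res)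
include hϑ hF H

/-- Where `ϑ_{v_{j+1}}` and another `ϑ_{v_e}` are both invertible, one is on the cone following
`ρ_{j+1}` or on the cone preceding it, and no `t_s` vanishes for the rays `ρ_s` passed on the way to
`ρ_e`. -/
theorem RayChart.dichotomy {𝔞 : Ideal A} (h𝔞 : 𝔍 ≤ 𝔞) (h3 : 3 ≤ {s | t s ∈ 𝔞}.ncard)
    {𝔮 : Ideal R} (h𝔮 : ∀ x, N x ∈ coeffIn 𝔞 → P x ∈ coeffIn 𝔞 → x ∈ 𝔮) {e : ZMod n}
    (he : e ≠ j + 1) (hmem : res (ϑ (pt e 1 0)) ∉ 𝔮) {X Y : R}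
    (hX : P X = AddMonoidAlgebra.single (0, 1) 1) (hX' : InRow 1 (N X))
    (hY : N Y = AddMonoidAlgebra.single (0, -1) 1) (hY' : InRow (-1) (P Y)) :
    (X ∉ 𝔮 ∧ ∃ r : ℕ, e = j + 1 + (r : ZMod n) + 1 ∧
      ∀ x : ℕ, 1 ≤ x → x ≤ r → t (j + 1 + (x : ZMod n)) ∉ 𝔞) ∨
    (Y ∉ 𝔮 ∧ ∃ r : ℕ, j + 1 = e + (r : ZMod n) + 1 ∧
      ∀ x : ℕ, 1 ≤ x → x ≤ r → t (e + (x : ZMod n)) ∉ 𝔞) := by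
  set x := res (ϑ (pt e 1 0)) with hx
  have hne := nonempty_of_two_le hF
  -- an exponent on the far side leads counterclockwise to `v_e`
  have hpos : ∀ m : ℤ × ℤ, (0 < m.2 ∨ m.1 < 0) → (P x).coeff m ∉ 𝔞 → ∃ r : ℕ,
      e = j + 1 + (r : ZMod n) + 1 ∧
      ∀ x : ℕ, 1 ≤ x → x ≤ r → t (j + 1 + (x : ZMod n)) ∉ 𝔞 := by
    intro m hm hc
    rw [hx, H.pos] at hc
    by_cases h1 : 0 ≤ m.1
    · have he' := hϑ.eq_of_notMem' h𝔞 hc h1 (by omega)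
      rw [pt_pos_left one_pos, pt_eq_some] at he'
      rcases he' with ⟨h, -, -⟩ | ⟨-, h, -, -⟩
      · exact absurd h he
      · exact ⟨0, by simpa using h, fun x h1 h2 => by omega⟩
    · obtain ⟨s, hs, hrun, a', b', hb', he'⟩ := hϑ.ccw h𝔞 hne hc (by omega)
      rw [pt_pos_left one_pos, pt_eq_some] at he'
      rcases he' with ⟨-, -, h⟩ | ⟨-, h, -, -⟩
      · simp only at h; omega
      · exact ⟨s, h, hrun⟩
  -- on the other side, an exponent leads clockwise to `v_e`
  have hneg : ∀ m : ℤ × ℤ, (m.2 < 0 ∨ (m.2 = 0 ∧ m.1 < 0)) → (N x).coeff m ∉ 𝔞 → ∃ r : ℕ,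
      j + 1 = e + (r : ZMod n) + 1 ∧
      ∀ x : ℕ, 1 ≤ x → x ≤ r → t (e + (x : ZMod n)) ∉ 𝔞 := by
    intro m hm hc
    have h0 := H.neg' (𝒜.top_mem (ϑ (pt e 1 0))) m
    rw [Ideal.mul_top] at h0
    have hc' : (𝒜.y j (ϑ (pt e 1 0))).coeff ((glueΛ d j).symm m) ∉ 𝔞 :=
      fun h => hc ((Submodule.sub_mem_iff_left _ h).mp (h𝔞 h0))
    have h1 : ((glueΛ d j).symm m).1 = -m.2 := rfl
    have h2 : ((glueΛ d j).symm m).2 = m.1 - d (j + 1) * m.2 := rfl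
    by_cases h3 : 0 ≤ ((glueΛ d j).symm m).2
    · have he' := hϑ.eq_of_notMem' h𝔞 hc' (by omega) h3
      rw [pt_pos_left one_pos, pt_eq_some] at he'
      rcases he' with ⟨h, -, -⟩ | ⟨h4, -⟩
      · exact ⟨0, by simpa using h.symm, fun x h1 h2 => by omega⟩
      · rcases hm with hm | ⟨hm, hm'⟩
        · omega
        · rw [hm, mul_zero, sub_zero] at h2
          omega
    · obtain ⟨i', s, hi', hs, hrun', a', b', ha', he'⟩ := hϑ.cw h𝔞 hne hc' (by omega)
      rw [pt_pos_left one_pos, pt_eq_some] at he'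
      rcases he' with ⟨h, -, -⟩ | ⟨h, -⟩
      · obtain rfl : e = i' := h
        exact ⟨s, by rw [hi'], hrun'⟩
      · omega
  -- on the line through `ρ_{j+1}` there are no exponents: they would lead to `v_e` both ways
  -- around, and then at most two of the `t_s` would vanish
  have hrow0 : ∀ a : ℤ, (P x).coeff (a, 0) ∈ 𝔞 := by
    intro a
    by_contra hc
    by_cases ha : 0 ≤ a
    · rw [hx, H.pos] at hc
      have he' := hϑ.eq_of_notMem' h𝔞 hc ha le_rfl
      rw [pt_pos_left one_pos, pt_eq_some] at he'
      rcases he' with ⟨h, -, -⟩ | ⟨-, -, h, -⟩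
      · exact he h
      · simp at h
    · obtain ⟨r, hr1, hr2⟩ := hpos (a, 0) (Or.inr (by simpa using ha)) hc
      rw [← H.model.row_zero] at hc
      obtain ⟨s, hs1, hs2⟩ := hneg (a, 0) (Or.inr ⟨rfl, by simpa using ha⟩) hc
      exact ncard_le_two_of_runs h3 hr1 hs1 hr2 hs2
  -- split `x` into its parts in positive and in negative rows, up to an element of `𝔮`
  have hPX : ∀ z, P (X * z) = AddMonoidAlgebra.single (0, 1) 1 * P z := fun z => by
    rw [map_mul, hX]
  have hNY : ∀ z, N (Y * z) = AddMonoidAlgebra.single (0, -1) 1 * N z := fun z => by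
    rw [map_mul, hY]
  let up : Laurent A := .ofCoeff ((P x).coeff.filter fun m => 0 < m.2)
  let dn : Laurent A := .ofCoeff ((N x).coeff.filter fun m => m.2 < 0)
  have hup : ∀ m, up.coeff m = if 0 < m.2 then (P x).coeff m else 0 := fun m =>
    Finsupp.filter_apply _ _ _
  have hdn : ∀ m, dn.coeff m = if m.2 < 0 then (N x).coeff m else 0 := fun m =>
    Finsupp.filter_apply _ _ _
  obtain ⟨z, hz, hz'⟩ := H.model.lift_nonneg (Z := AddMonoidAlgebra.single (0, -1) 1 * up)
    (fun m hm => by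
      rw [laurent_coeff_single_mul, hup, if_neg (by simp; omega), mul_zero])
  obtain ⟨w, hw, hw'⟩ := H.model.lift_nonpos (Z := AddMonoidAlgebra.single (0, 1) 1 * dn)
    (fun m hm => by
      rw [laurent_coeff_single_mul, hdn, if_neg (by simp; omega), mul_zero])
  have hcancel : ∀ (a b : ℤ × ℤ) (u : Laurent A), a + b = 0 →
      AddMonoidAlgebra.single a 1 * (AddMonoidAlgebra.single b 1 * u) = u := by
    intro a b u hab
    rw [← mul_assoc, AddMonoidAlgebra.single_mul_single, hab, mul_one, ← AddMonoidAlgebra.one_def,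
      one_mul]
  have hPXz : P (X * z) = up := by rw [hPX, hz]; exact hcancel _ _ _ rfl
  have hNYw : N (Y * w) = dn := by rw [hNY, hw]; exact hcancel _ _ _ rfl
  have hNXz : ∀ m : ℤ × ℤ, m.2 ≤ 0 → (N (X * z)).coeff m = 0 := by
    intro m hm
    rw [map_mul, laurent_coeff_mul]
    refine Finset.sum_eq_zero fun m' _ => ?_
    by_cases h : m'.2 = 1
    · simp only [hz' (m - m') (by simp; omega), mul_zero]
    · simp only [hX' m' h, zero_mul]
  have hPYw : ∀ m : ℤ × ℤ, 0 ≤ m.2 → (P (Y * w)).coeff m = 0 := by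
    intro m hm
    rw [map_mul, laurent_coeff_mul]
    refine Finset.sum_eq_zero fun m' _ => ?_
    by_cases h : m'.2 = -1
    · simp only [hw' (m - m') (by simp; omega), mul_zero]
    · simp only [hY' m' h, zero_mul]
  have hdiff : x - X * z - Y * w ∈ 𝔮 := by
    refine (fun h : _ ∧ _ => h𝔮 _ h.1 h.2) (H.model.mem_of_rows (K := 𝔞)
      (x := x - X * z - Y * w) (fun m hm => ?_) (fun m hm => ?_))
    · rw [map_sub, map_sub, hPXz, AddMonoidAlgebra.coeff_sub, Finsupp.sub_apply,
        AddMonoidAlgebra.coeff_sub, Finsupp.sub_apply, hPYw m hm, sub_zero, hup]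
      split_ifs with h
      · simp
      · obtain ⟨a, b⟩ := m
        obtain rfl : b = 0 := le_antisymm (not_lt.mp h) hm
        simpa using hrow0 a
    · rw [map_sub, map_sub, hNYw, AddMonoidAlgebra.coeff_sub, Finsupp.sub_apply,
        AddMonoidAlgebra.coeff_sub, Finsupp.sub_apply, hNXz m hm.le, sub_zero, hdn, if_pos hm, sub_self]
      exact 𝔞.zero_mem
  by_cases hA : X * z ∈ 𝔮
  · have hB : Y * w ∉ 𝔮 := by
      intro hB
      refine hmem ?_
      have := 𝔮.add_mem (𝔮.add_mem hdiff hA) hB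
      have hx' : x = (x - X * z - Y * w) + X * z + Y * w := by ring
      rwa [← hx'] at this
    right
    refine ⟨fun h => hB (𝔮.mul_mem_right _ h), ?_⟩
    by_contra hno
    refine hB (h𝔮 _ ?_ ?_)
    all_goals
      obtain ⟨h1, h2⟩ := H.model.mem_of_rows (K := 𝔞) (x := Y * w)
        (fun m hm => by rw [hPYw m hm]; exact zero_mem _)
        (fun m hm => by
          rw [hNYw, hdn, if_pos hm]
          by_contra hc
          exact hno (hneg m (Or.inl hm) hc))
    · exact h1
    · exact h2
  · left
    refine ⟨fun h => hA (𝔮.mul_mem_right _ h), ?_⟩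
    by_contra hno
    refine hA (h𝔮 _ ?_ ?_)
    all_goals
      obtain ⟨h1, h2⟩ := H.model.mem_of_rows (K := 𝔞) (x := X * z)
        (fun m hm => by
          rw [hPXz, hup]
          split_ifs with h
          · by_contra hc
            exact hno (hpos m (Or.inl h) hc)
          · exact zero_mem _)
        (fun m hm => by rw [hNXz m hm.le]; exact zero_mem _)
    · exact h1
    · exact h2

end Dichotomy
end MirrorFamily

namespace MirrorFamily

/-! ### Quotients of monoid algebras as Laurent polynomials -/

section MonAlg

variable {k : Type u} [Field k]

section Lift

variable {M : Type u} [AddCommGroup M] {S : AddSubmonoid M} {T : Set M}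

lemma mono_eq_smul (s : S) (c : k) : mono k S T s c = c • mono k S T s 1 := by
  rw [mono, mono, ← Ideal.Quotient.mkₐ_eq_mk k, ← map_smul, AddMonoidAlgebra.smul_single,
    smul_eq_mul, mul_one]

lemma MonAlg.linear_ext {V : Type*} [AddCommMonoid V] [Module k V] {f g : MonAlg k S T →ₗ[k] V}
    (h : ∀ s, f (mono k S T s 1) = g (mono k S T s 1)) : f = g := by
  refine LinearMap.ext fun x => ?_
  obtain ⟨x, rfl⟩ := Ideal.Quotient.mk_surjective x
  induction x using AddMonoidAlgebra.induction_linear with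
  | zero => simp
  | add a b ha hb => rw [map_add, map_add, map_add, ha, hb]
  | single s c =>
    change f (mono k S T s c) = g (mono k S T s c)
    rw [mono_eq_smul, map_smul, map_smul, h]

lemma MonAlg.induction_on {p : MonAlg k S T → Prop} (x : MonAlg k S T) (h0 : p 0)
    (hadd : ∀ x y, p x → p y → p (x + y)) (hmono : ∀ s c, p (mono k S T s c)) : p x := by
  obtain ⟨x, rfl⟩ := Ideal.Quotient.mk_surjective x
  induction x using AddMonoidAlgebra.induction_linear with
  | zero => simpa using h0
  | add a b ha hb => rw [map_add]; exact hadd _ _ ha hb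
  | single s c => exact hmono s c

lemma mem_monIdeal {x : AddMonoidAlgebra k S} (hx : x ∈ monIdeal k S T) {s : S}
    (hs : x.coeff s ≠ 0) : ∃ s' s'' : S, (s' : M) ∈ T ∧ s = s'' + s' := by
  have h : monIdeal k S T = Ideal.span (AddMonoidAlgebra.of' k S '' {s | (s : M) ∈ T}) := by
    rw [monIdeal]
    congr 1
    ext y
    simp only [Set.mem_ofPred_eq, Set.mem_image, AddMonoidAlgebra.of'_apply, eq_comm]
  rw [h, AddMonoidAlgebra.mem_ideal_span_of'_image] at hx
  obtain ⟨s', h1, s'', h2⟩ := hx s (Finsupp.mem_support_iff.mpr hs)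
  exact ⟨s', s'', h1, h2⟩

/-- The linear map out of `k[S]/T` given by `z^s ↦ g s`. -/
lemma MonAlg.exists_linear_lift {V : Type*} [AddCommGroup V] [Module k V] (g : S → V)
    (hg : ∀ s s' : S, (s : M) ∈ T → g (s' + s) = 0) :
    ∃ G : MonAlg k S T →ₗ[k] V, ∀ s c, G (mono k S T s c) = c • g s := by
  let G₀ : AddMonoidAlgebra k S →ₗ[k] V :=
    (Finsupp.linearCombination k g).comp (AddMonoidAlgebra.coeffLinearEquiv k).toLinearMap
  let π : AddMonoidAlgebra k S →ₗ[k] MonAlg k S T := (Ideal.Quotient.mkₐ k _).toLinearMap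
  have hπ : Function.Surjective π := Ideal.Quotient.mk_surjective
  have hker : LinearMap.ker π ≤ LinearMap.ker G₀ := by
    intro x hx
    have hx' : x ∈ monIdeal k S T := Ideal.Quotient.eq_zero_iff_mem.mp hx
    change x.coeff.sum _ = 0
    refine Finset.sum_eq_zero fun s hs => ?_
    obtain ⟨s', s'', h1, rfl⟩ := mem_monIdeal hx' (Finsupp.mem_support_iff.mp hs)
    simp [hg s' s'' h1]
  refine ⟨(LinearMap.ker π).liftQ G₀ hker ∘ₗ (π.quotKerEquivOfSurjective hπ).symm.toLinearMap,
    fun s c => ?_⟩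
  have h1 : (π.quotKerEquivOfSurjective hπ).symm (mono k S T s c)
      = Submodule.Quotient.mk (AddMonoidAlgebra.single s c) := by
    rw [LinearEquiv.symm_apply_eq]; rfl
  rw [LinearMap.comp_apply, LinearEquiv.coe_coe, h1, Submodule.liftQ_apply]
  change (AddMonoidAlgebra.single s c : AddMonoidAlgebra k S).coeff.sum _ = _
  rw [AddMonoidAlgebra.coeff_single, Finsupp.sum_single_index] <;> simp

open scoped Classical in
/-- Elements of `k[S]/T` are finite sums of monomials with exponent outside `T`, and are determined
by their coefficients. -/
lemma MonAlg.eq_zero_of_coeff {V : Type*} [AddCommGroup V] [Module k V] (F : MonAlg k S T →ₗ[k] V)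
    (h : ∀ s : S, (s : M) ∉ T → ∃ c : V →ₗ[k] k, ∀ s' : S, c (F (mono k S T s' 1))
      = if s' = s then 1 else 0) : Function.Injective F := by
  rw [injective_iff_map_eq_zero]
  intro x hx
  obtain ⟨x, rfl⟩ := Ideal.Quotient.mk_surjective x
  have key : ∀ s : S, (s : M) ∉ T → x.coeff s = 0 := by
    intro s hs
    obtain ⟨c, hc⟩ := h s hs
    have h1 : ∀ y : AddMonoidAlgebra k S,
        c (F (Ideal.Quotient.mk (monIdeal k S T) y)) = y.coeff s := by
      intro y
      induction y using AddMonoidAlgebra.induction_linear with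
      | zero => simp
      | add a b ha hb => rw [map_add, map_add, map_add, ha, hb]; simp
      | single s' r =>
        change c (F (mono k S T s' r)) = _
        rw [mono_eq_smul, map_smul, map_smul, hc, AddMonoidAlgebra.coeff_single,
          Finsupp.single_apply]
        split_ifs <;> simp
    rw [← h1, hx, map_zero]
  rw [Ideal.Quotient.eq_zero_iff_mem, ← x.sum_coeff_single]
  refine Ideal.sum_mem _ fun s hs => ?_
  have hsT : (s : M) ∈ T := by
    by_contra h'
    exact Finsupp.mem_support_iff.mp hs (key s h')
  exact Ideal.Quotient.eq_zero_iff_mem.mp (mono_eq_zero hsT (x.coeff s))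

end Lift

section Base

variable {L : Type u} [AddCommGroup L] {P : AddSubmonoid L} {I : AddSemigroupIdeal P}

lemma mem_elems {p : P} : (p : L) ∈ elems I ↔ p ∈ I := by
  simp [elems]

lemma add_mem_elems {x y : L} (hx : x ∈ P) (hy : y ∈ elems I) : x + y ∈ elems I := by
  obtain ⟨y, hy, rfl⟩ := hy
  exact ⟨⟨x, hx⟩ + y, AddSemigroupIdeal.add_mem I _ hy, rfl⟩

variable (I k) in
/-- The monomial `z^p` of `k[P]/I`. -/
def zA (p : P) : Base (P := P) I k := mono k P (elems I) p 1

lemma zA_zero : zA k I (0 : P) = 1 := mono_zero_one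

lemma zA_add (p q : P) : zA k I (p + q) = zA k I p * zA k I q := by
  rw [zA, zA, zA, mono_mul, one_mul]

lemma zA_nsmul (p : P) (r : ℕ) : zA k I (r • p) = zA k I p ^ r := by
  rw [zA, zA, mono_pow, one_pow]

lemma zA_eq_zero {p : P} (h : (p : L) ∈ elems I) : zA k I p = 0 := mono_eq_zero h 1

open scoped Classical in
/-- The coefficient of a monomial outside `I`. -/
lemma exists_coeff_base {p : P} (hp : (p : L) ∉ elems I) :
    ∃ c : Base (P := P) I k →ₗ[k] k, ∀ p', c (zA k I p') = if p' = p then 1 else 0 := by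
  obtain ⟨G, hG⟩ := MonAlg.exists_linear_lift (k := k) (S := P) (T := elems I)
    (fun p' => if p' = p then (1 : k) else 0) (fun s s' hs => if_neg (by
      rintro rfl
      exact hp (add_mem_elems s'.2 hs)))
  exact ⟨G, fun p' => by rw [zA, hG, one_smul]⟩

/-- Let `ψ : ℤ² → P^gp` be linear and let `S` be a monoid of exponents `q` with `q - ψ(r(q)) ∈ P`.
This is the map from a quotient of `k[S]` to Laurent polynomials over `k[P]/I` given by
`z^q ↦ z^{q - ψ(r(q))} z^{r(q)}`. -/
def toLaurent (ψ : (ℤ × ℤ) × L →+ L) {S : AddSubmonoid ((ℤ × ℤ) × L)} {T : Set ((ℤ × ℤ) × L)}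
    (hS : ∀ q ∈ S, ψ q ∈ P) (hT : ∀ q ∈ S, q ∈ T → ψ q ∈ elems I) :
    MonAlg k S T →ₐ[k] Laurent (Base (P := P) I k) :=
  MonAlg.lift
    { toFun := fun s => AddMonoidAlgebra.single s.toAdd.1.1 (zA k I ⟨ψ s.toAdd, hS _ s.toAdd.2⟩)
      map_one' := by
        rw [AddMonoidAlgebra.one_def, ← zA_zero (I := I) (k := k)]
        congr 2
        ext; simp
      map_mul' := fun s t => by
        rw [AddMonoidAlgebra.single_mul_single, ← zA_add]
        congr 2
        ext; simp }
    (fun s hs => by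
      change AddMonoidAlgebra.single _ (zA k I ⟨ψ s, hS _ s.2⟩) = _
      rw [zA_eq_zero (hT _ s.2 hs), AddMonoidAlgebra.single_zero])

section toLaurent

variable {ψ : (ℤ × ℤ) × L →+ L} {S : AddSubmonoid ((ℤ × ℤ) × L)} {T : Set ((ℤ × ℤ) × L)}
  {hS : ∀ q ∈ S, ψ q ∈ P} {hT : ∀ q ∈ S, q ∈ T → ψ q ∈ elems I}

lemma toLaurent_mono (s : S) : toLaurent (k := k) ψ hS hT (mono k S T s 1)
    = AddMonoidAlgebra.single s.1.1 (zA k I ⟨ψ s, hS _ s.2⟩) :=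
  MonAlg.lift_mono _ _ s

lemma toLaurent_injective (hψ : ∀ q q' : (ℤ × ℤ) × L, q.1 = q'.1 → ψ q = ψ q' → q = q')
    (hT' : ∀ q ∈ S, ψ q ∈ elems I → q ∈ T) :
    Function.Injective (toLaurent (k := k) ψ hS hT) := by
  refine MonAlg.eq_zero_of_coeff (toLaurent (k := k) ψ hS hT).toLinearMap fun s hs => ?_
  obtain ⟨c, hc⟩ := exists_coeff_base (k := k) (I := I) (p := ⟨ψ s, hS _ s.2⟩)
    (fun h => hs (hT' _ s.2 h))
  refine ⟨c ∘ₗ (Finsupp.lapply s.1.1 ∘ₗ (AddMonoidAlgebra.coeffLinearEquiv k).toLinearMap),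
    fun s' => ?_⟩
  change c ((toLaurent (k := k) ψ hS hT (mono k S T s' 1)).coeff s.1.1) = _
  rw [toLaurent_mono, laurent_coeff_single]
  by_cases h : s' = s
  · subst h; simp [hc]
  · rw [if_neg h]
    split_ifs with h1
    · rw [hc, if_neg]
      intro h2
      exact h (Subtype.ext (hψ _ _ h1.symm (congrArg Subtype.val h2)))
    · exact map_zero c

end toLaurent
end Base
end MonAlg
end MirrorFamily

namespace MirrorFamily

section Laur

open ScatteringDiagram

variable {k : Type u} [Field k] {n : ℕ} {L : Type u} [AddCommGroup L] {P : AddSubmonoid L}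
  {I : AddSemigroupIdeal P}

lemma htNeg_eq (φ : PLFun n P) (i : ZMod n) (q : (ℤ × ℤ) × L) :
    htNeg φ i q = htPos φ i q + q.1.2 • (φ.bend i : L) := by
  change q.2 - φ.neg i q.1 = q.2 - φ.pos i q.1 + _
  rw [φ.pos_eq]; abel

lemma htPos_inj (φ : PLFun n P) (i : ZMod n) (q q' : (ℤ × ℤ) × L) (h : q.1 = q'.1)
    (h' : htPos φ i q = htPos φ i q') : q = q' := by
  refine Prod.ext h ?_
  change q.2 - φ.pos i q.1 = q'.2 - φ.pos i q'.1 at h'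
  rwa [h, sub_left_inj] at h'

lemma htNeg_inj (φ : PLFun n P) (i : ZMod n) (q q' : (ℤ × ℤ) × L) (h : q.1 = q'.1)
    (h' : htNeg φ i q = htNeg φ i q') : q = q' := by
  refine Prod.ext h ?_
  change q.2 - φ.neg i q.1 = q'.2 - φ.neg i q'.1 at h'
  rwa [h, sub_left_inj] at h'

variable (φ : PLFun n P) (I k)

/-- `z^{p_ρ}` for `ρ = ρ_i`. -/
def tA (i : ZMod n) : Base (P := P) I k := zA k I (φ.bend i)

/-- `R_{σ_i,σ_i,I}` as a ring of Laurent polynomials. -/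
def laurCone (i : ZMod n) : RCone φ I k i →ₐ[k] Laurent (Base (P := P) I k) :=
  toLaurent (htPos φ i) (fun _ h => h) (fun _ _ h => h.2)

/-- `R_{ρ_i,σ_i,I}` as a ring of Laurent polynomials. -/
def laurPos (i : ZMod n) : RPos φ I k i →ₐ[k] Laurent (Base (P := P) I k) :=
  toLaurent (htPos φ i) (fun _ h => monRay_htPos φ i h) (fun _ _ h => h.2)

/-- `R_{ρ_i,σ_{i-1},I}` as a ring of Laurent polynomials. -/
def laurNeg (i : ZMod n) : RNeg φ I k i →ₐ[k] Laurent (Base (P := P) I k) :=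
  toLaurent (htNeg φ i) (fun _ h => monRay_htNeg φ i h) (fun _ _ h => h.2)

lemma laurCone_mono (i : ZMod n) (s : monCone φ i) : laurCone k I φ i (mono k _ _ s 1)
    = AddMonoidAlgebra.single s.1.1 (zA k I ⟨htPos φ i s, s.2⟩) := toLaurent_mono s

lemma laurPos_mono (i : ZMod n) (s : monRay φ i) : laurPos k I φ i (mono k _ _ s 1)
    = AddMonoidAlgebra.single s.1.1 (zA k I ⟨htPos φ i s, monRay_htPos φ i s.2⟩) :=
  toLaurent_mono s

lemma laurNeg_mono (i : ZMod n) (s : monRay φ i) : laurNeg k I φ i (mono k _ _ s 1)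
    = AddMonoidAlgebra.single s.1.1 (zA k I ⟨htNeg φ i s, monRay_htNeg φ i s.2⟩) :=
  toLaurent_mono s

lemma laurCone_injective (i : ZMod n) : Function.Injective (laurCone k I φ i) :=
  toLaurent_injective (htPos_inj φ i) fun _ h h' => ⟨h, h'⟩

lemma laurPos_injective (i : ZMod n) : Function.Injective (laurPos k I φ i) :=
  toLaurent_injective (htPos_inj φ i) fun _ h h' => ⟨h, h'⟩

lemma laurNeg_injective (i : ZMod n) : Function.Injective (laurNeg k I φ i) :=
  toLaurent_injective (htNeg_inj φ i) fun _ h h' => ⟨h, h'⟩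

lemma laurCone_surjective (i : ZMod n) : Function.Surjective (laurCone k I φ i) := by
  intro x
  change x ∈ (laurCone k I φ i).range
  induction x using AddMonoidAlgebra.induction_linear with
  | zero => exact zero_mem _
  | add a b ha hb => exact add_mem ha hb
  | single m a =>
    induction a using MonAlg.induction_on with
    | h0 => simp
    | hadd a b ha hb => rw [AddMonoidAlgebra.single_add]; exact add_mem ha hb
    | hmono p c =>
      have h : htPos φ i (m, (p : L) + φ.pos i m) = p := add_sub_cancel_right _ _
      have hp : (m, (p : L) + φ.pos i m) ∈ monCone φ i := by
        change htPos φ i _ ∈ P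
        rw [h]; exact p.2
      refine ⟨mono k _ _ ⟨_, hp⟩ c, ?_⟩
      rw [mono_eq_smul p, mono_eq_smul]
      change laurCone k I φ i (c • _) = _
      rw [map_smul, laurCone_mono, ← AddMonoidAlgebra.smul_single]
      congr 3
      exact Subtype.ext h

variable {k I}

lemma laurCone_posToCone (i : ZMod n) (x : RPos φ I k i) :
    laurCone k I φ i (posToCone φ I k i x) = laurPos k I φ i x := by
  have : (laurCone k I φ i).comp (posToCone φ I k i) = laurPos k I φ i := by
    refine MonAlg.hom_ext fun s => ?_
    rw [AlgHom.comp_apply, posToCone_mono, laurCone_mono, laurPos_mono]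
  exact DFunLike.congr_fun this x

/-- The change of coordinates from `σ_i` to `ρ_{i+1}` on Laurent polynomials. -/
def reglue (A : Type*) [CommRing A] (d : ZMod n → ℤ) (i : ZMod n) : Laurent A ≃ₐ[A] Laurent A :=
  AddMonoidAlgebra.domCongr A A (glueΛ d i)

lemma reglue_single {A : Type*} [CommRing A] (d : ZMod n → ℤ) (i : ZMod n) (m : ℤ × ℤ) (a : A) :
    reglue A d i (AddMonoidAlgebra.single m a) = AddMonoidAlgebra.single (glueΛ d i m) a := by
  simp [reglue]

lemma reglue_coeff {A : Type*} [CommRing A] (d : ZMod n → ℤ) (i : ZMod n) (x : Laurent A)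
    (m : ℤ × ℤ) : (reglue A d i x).coeff (glueΛ d i m) = x.coeff m := by
  induction x using AddMonoidAlgebra.induction_linear with
  | zero => simp
  | add a b ha hb => simp [ha, hb]
  | single m' a =>
    rw [reglue_single, laurent_coeff_single, laurent_coeff_single]
    simp only [EmbeddingLike.apply_eq_iff_eq]

lemma reglue_laurCone (d : ZMod n → ℤ) (i : ZMod n) (x : RNeg φ I k (i + 1)) :
    reglue _ d i (laurCone k I φ i (negToCone φ I k d i x)) = laurNeg k I φ (i + 1) x := by
  have : (((reglue (Base (P := P) I k) d i).toAlgHom.restrictScalars k).comp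
      (laurCone k I φ i)).comp (negToCone φ I k d i) = laurNeg k I φ (i + 1) := by
    refine MonAlg.hom_ext fun s => ?_
    rw [AlgHom.comp_apply, negToCone_mono, AlgHom.comp_apply, laurCone_mono, laurNeg_mono]
    refine (reglue_single d i _ _).trans ?_
    congr 1
    · exact (glueΛ d i).apply_symm_apply _
    · congr 1
      exact Subtype.ext (htPos_transport_symm φ d i s)
  exact DFunLike.congr_fun this x

lemma laurPos_base (i : ZMod n) (a : Base (P := P) I k) :
    laurPos k I φ i (basePos φ I k i a) = algebraMap _ _ a := by
  have : (laurPos k I φ i).comp (basePos φ I k i)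
      = (Algebra.ofId (Base (P := P) I k) (Laurent (Base (P := P) I k))).restrictScalars k := by
    refine MonAlg.hom_ext fun s => ?_
    rw [AlgHom.comp_apply, basePos_mono, laurPos_mono]
    change _ = algebraMap (Base (P := P) I k) (Laurent (Base (P := P) I k)) _
    rw [AddMonoidAlgebra.coe_algebraMap, Function.comp_apply]
    change AddMonoidAlgebra.single 0 _ = AddMonoidAlgebra.single 0 (zA k I s)
    congr 2
    ext
    simp [htPos]
  exact DFunLike.congr_fun this a

lemma laurNeg_base (i : ZMod n) (a : Base (P := P) I k) :
    laurNeg k I φ i (baseNeg φ I k i a) = algebraMap _ _ a := by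
  have : (laurNeg k I φ i).comp (baseNeg φ I k i)
      = (Algebra.ofId (Base (P := P) I k) (Laurent (Base (P := P) I k))).restrictScalars k := by
    refine MonAlg.hom_ext fun s => ?_
    rw [AlgHom.comp_apply, baseNeg_mono, laurNeg_mono]
    change _ = algebraMap (Base (P := P) I k) (Laurent (Base (P := P) I k)) _
    rw [AddMonoidAlgebra.coe_algebraMap, Function.comp_apply]
    change AddMonoidAlgebra.single 0 _ = AddMonoidAlgebra.single 0 (zA k I s)
    congr 2
    ext
    simp [htNeg]
  exact DFunLike.congr_fun this a

lemma laurCone_base (i : ZMod n) (a : Base (P := P) I k) :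
    laurCone k I φ i (baseCone φ I k i a) = algebraMap _ _ a := by
  rw [baseCone, AlgHom.comp_apply, laurCone_posToCone, laurPos_base]

/-! ### The functions attached to a ray -/

/-- The exponents of `P_{φ_ρ}` that are tangent to `ρ = ρ_i`. -/
def monZero (i : ZMod n) : AddSubmonoid ((ℤ × ℤ) × L) :=
  monRay φ i ⊓ AddMonoidHom.mker ((AddMonoidHom.snd ℤ ℤ).comp (AddMonoidHom.fst (ℤ × ℤ) L))

lemma snd_of_mem_monZero {i : ZMod n} {q : (ℤ × ℤ) × L} (h : q ∈ monZero φ i) : q.1.2 = 0 := h.2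

lemma mem_idPos_of_monZero {i : ZMod n} {q : (ℤ × ℤ) × L} (h : q ∈ monZero φ i)
    (h' : q ∈ idRay φ I i) : q ∈ idPos φ I i := by
  rcases h' with h' | h'
  · exact h'
  · refine ⟨h'.1, ?_⟩
    have := h'.2
    rwa [htNeg_eq, snd_of_mem_monZero φ h, zero_smul, add_zero] at this

lemma mem_idNeg_of_monZero {i : ZMod n} {q : (ℤ × ℤ) × L} (h : q ∈ monZero φ i)
    (h' : q ∈ idRay φ I i) : q ∈ idNeg φ I i := by
  refine ⟨h.1, ?_⟩
  rw [htNeg_eq, snd_of_mem_monZero φ h, zero_smul, add_zero]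
  exact (mem_idPos_of_monZero φ h h').2

variable (I k) in
/-- The subring of `R_{ρ_i,ρ_i,I}` spanned by the monomials tangent to `ρ_i`. -/
abbrev RZero (i : ZMod n) : Type u := MonAlg k (monZero φ i) (idRay φ I i)

variable (I k) in
/-- The inclusion of the functions tangent to `ρ_i`. -/
def zeroPos (i : ZMod n) : RZero k I φ i →ₐ[k] RPos φ I k i :=
  MonAlg.map (AddMonoidHom.id _) (fun _ h => h.1) fun _ h h' => mem_idPos_of_monZero φ h h'

variable (I k) in
/-- The inclusion of the functions tangent to `ρ_i`. -/
def zeroNeg (i : ZMod n) : RZero k I φ i →ₐ[k] RNeg φ I k i :=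
  MonAlg.map (AddMonoidHom.id _) (fun _ h => h.1) fun _ h h' => mem_idNeg_of_monZero φ h h'

variable (I k) in
/-- The inclusion of the functions tangent to `ρ_i`. -/
def zeroRay (i : ZMod n) : RZero k I φ i →ₐ[k] RRay φ I k i :=
  MonAlg.map (AddMonoidHom.id _) (fun _ h => h.1) fun _ _ h' => h'

lemma zeroPos_mono (i : ZMod n) (s : monZero φ i) :
    zeroPos k I φ i (mono k _ _ s 1) = mono k (monRay φ i) (idPos φ I i) ⟨s, s.2.1⟩ 1 :=
  MonAlg.map_mono _ _ _ s

lemma zeroNeg_mono (i : ZMod n) (s : monZero φ i) :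
    zeroNeg k I φ i (mono k _ _ s 1) = mono k (monRay φ i) (idNeg φ I i) ⟨s, s.2.1⟩ 1 :=
  MonAlg.map_mono _ _ _ s

lemma zeroRay_mono (i : ZMod n) (s : monZero φ i) :
    zeroRay k I φ i (mono k _ _ s 1) = mono k (monRay φ i) (idRay φ I i) ⟨s, s.2.1⟩ 1 :=
  MonAlg.map_mono _ _ _ s

lemma negToRay_zeroNeg (i : ZMod n) (x : RZero k I φ i) :
    negToRay φ I k i (zeroNeg k I φ i x) = zeroRay k I φ i x := by
  have : (negToRay φ I k i).comp (zeroNeg k I φ i) = zeroRay k I φ i := by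
    refine MonAlg.hom_ext fun s => ?_
    rw [AlgHom.comp_apply, zeroNeg_mono, negToRay_mono, zeroRay_mono]
  exact DFunLike.congr_fun this x

variable (I k) in
/-- The functions tangent to `ρ_i` as Laurent polynomials. -/
def laurZero (i : ZMod n) : RZero k I φ i →ₐ[k] Laurent (Base (P := P) I k) :=
  (laurPos k I φ i).comp (zeroPos k I φ i)

lemma laurZero_mono (i : ZMod n) (s : monZero φ i) : laurZero k I φ i (mono k _ _ s 1)
    = AddMonoidAlgebra.single s.1.1 (zA k I ⟨htPos φ i s, monRay_htPos φ i s.2.1⟩) := by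
  rw [laurZero, AlgHom.comp_apply, zeroPos_mono, laurPos_mono]

lemma laurNeg_zeroNeg (i : ZMod n) (x : RZero k I φ i) :
    laurNeg k I φ i (zeroNeg k I φ i x) = laurZero k I φ i x := by
  have : (laurNeg k I φ i).comp (zeroNeg k I φ i) = laurZero k I φ i := by
    refine MonAlg.hom_ext fun s => ?_
    rw [AlgHom.comp_apply, zeroNeg_mono, laurNeg_mono, laurZero_mono]
    congr 2
    ext
    change htNeg φ i s = htPos φ i s
    rw [htNeg_eq, snd_of_mem_monZero φ s.2, zero_smul, add_zero]
  exact DFunLike.congr_fun this x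

lemma laurZero_mem (i : ZMod n) (x : RZero k I φ i) : laurZero k I φ i x ∈ rowZero _ := by
  induction x using MonAlg.induction_on with
  | h0 => rw [map_zero]; exact zero_mem _
  | hadd x y hx hy => rw [map_add]; exact add_mem hx hy
  | hmono s c =>
    intro m hm
    rw [mono_eq_smul, map_smul, laurZero_mono, AddMonoidAlgebra.coeff_smul, Finsupp.smul_apply,
      laurent_coeff_single, if_neg, smul_zero]
    rintro rfl
    exact hm (snd_of_mem_monZero φ s.2)

end Laur

section OfCoeff

variable {k : Type u} [Field k] {M : Type u} [AddCommGroup M] {S : AddSubmonoid M} {T : Set M}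

lemma ofCoeff_eq_one_add {c : M → k} (h0 : c 0 = 1)
    (hfin : {q : M | c q ≠ 0 ∧ q ∉ T}.Finite) : ∃ F : Finset S, (∀ s ∈ F, s ≠ 0 ∧ c s ≠ 0 ∧
      (s : M) ∉ T) ∧ ofCoeff S T c = 1 + ∑ s ∈ F, mono k S T s (c s) := by
  classical
  have hfin' : {s : S | c s ≠ 0 ∧ (s : M) ∉ T}.Finite :=
    hfin.preimage (f := ((↑) : S → M)) Subtype.val_injective.injOn
  have hsum : ofCoeff S T c = ∑ q ∈ insert 0 hfin'.toFinset, mono k S T q (c q) := by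
    refine finsum_eq_sum_of_support_subset _ fun q hq => ?_
    have : c q ≠ 0 ∧ (q : M) ∉ T := by
      refine ⟨fun h => hq ?_, fun h => hq (mono_eq_zero h _)⟩
      simp only [h]; exact mono_smul _
    simp [this]
  refine ⟨(insert 0 hfin'.toFinset).erase 0, fun s hs => ?_, ?_⟩
  · have h1 := Finset.ne_of_mem_erase hs
    have h2 := Finset.mem_of_mem_erase hs
    simp only [Finset.mem_insert, h1, false_or, Set.Finite.mem_toFinset] at h2
    exact ⟨h1, h2⟩
  · rw [hsum, ← Finset.add_sum_erase _ _ (Finset.mem_insert_self _ _), AddSubmonoid.coe_zero, h0,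
      mono_zero_one]

lemma ofCoeff_eq_one {c : M → k} (h0 : c 0 = 1) (h : ∀ q, q ≠ 0 → c q ≠ 0 → q ∈ T) :
    ofCoeff S T c = 1 := by
  have hfin : {q : M | c q ≠ 0 ∧ q ∉ T}.Finite := by
    refine (Set.finite_singleton 0).subset ?_
    rintro q ⟨h1, h2⟩
    by_contra h3
    exact h2 (h q h3 h1)
  obtain ⟨F, hF, h1⟩ := ofCoeff_eq_one_add (S := S) h0 hfin
  rw [h1, Finset.sum_eq_zero, add_zero]
  intro s hs
  obtain ⟨hs0, hs1, hs2⟩ := hF s hs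
  exact absurd (h s (by simpa using hs0) hs1) hs2

/-- A Laurent polynomial with constant term `1` whose other exponents lie in an open half plane is
a nonzerodivisor. -/
lemma one_add_mem_nonZeroDivisors {A : Type*} [CommRing A] {x : Laurent A} (ℓ : ℤ × ℤ →+ ℤ)
    (hx : ∀ m, x.coeff m ≠ 0 → 0 < ℓ m) : 1 + x ∈ nonZeroDivisors (Laurent A) := by
  rw [mem_nonZeroDivisors_iff_right]
  intro u hu
  by_contra hne
  have hne' : u.coeff.support.Nonempty := by
    rw [Finset.nonempty_iff_ne_empty, Ne, Finsupp.support_eq_empty]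
    intro h
    exact hne (by ext m; simp [h])
  obtain ⟨m, hm, hmin⟩ := u.coeff.support.exists_min_image ℓ hne'
  have h1 : ((1 + x) * u).coeff m = u.coeff m := by
    rw [add_mul, one_mul, AddMonoidAlgebra.coeff_add, Finsupp.add_apply, laurent_coeff_mul,
      Finsupp.sum, Finset.sum_eq_zero, add_zero]
    intro m' hm'
    have h2 := hx m' (Finsupp.mem_support_iff.mp hm')
    by_cases h3 : u.coeff (m - m') = 0
    · rw [h3, mul_zero]
    · have := hmin _ (Finsupp.mem_support_iff.mpr h3)
      rw [map_sub] at this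
      omega
  rw [mul_comm, hu] at h1
  exact Finsupp.mem_support_iff.mp hm (by simpa using h1.symm)

end OfCoeff
end MirrorFamily

namespace MirrorFamily

/-! ### Wall functions as Laurent polynomials -/

section RowIncl

variable {k : Type u} [Field k] {M : Type u} [AddCommGroup M] {S S' : AddSubmonoid M} {T : Set M}

/-- A series of monomials may be summed in a smaller monoid algebra containing its exponents. -/
lemma map_ofCoeff (hS : S ≤ S') {c : M → k} (hc : ∀ q, c q ≠ 0 → q ∈ S)
    (hfin : {q : M | c q ≠ 0 ∧ q ∉ T}.Finite) :
    MonAlg.map (k := k) (S := S) (S' := S') (T := T) (T' := T) (AddMonoidHom.id M)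
      (fun _ h => hS h) (fun _ _ h => h) (ofCoeff S T c) = ofCoeff S' T c := by
  set G : MonAlg k S T →ₐ[k] MonAlg k S' T := MonAlg.map (AddMonoidHom.id M)
      (fun _ h => hS h) (fun _ _ h => h) with hG
  have hmono : ∀ (s : S) (c : k), G (mono k S T s c) = mono k S' T ⟨s, hS s.2⟩ c := by
    intro s c
    rw [mono_eq_smul, map_smul, hG, MonAlg.map_mono, ← mono_eq_smul]
    rfl
  have hfin' : (Function.support fun s : S => mono k S T s (c s)).Finite := by
    refine (hfin.preimage (f := ((↑) : S → M)) Subtype.val_injective.injOn).subset fun q hq =>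
      ⟨fun h => hq ?_, fun h => hq (mono_eq_zero h _)⟩
    simp only [h]; exact mono_smul _
  have h0 : G (ofCoeff S T c) = ∑ᶠ s : S, G (mono k S T s (c s)) :=
    AddMonoidHom.map_finsum (G : MonAlg k S T →+* MonAlg k S' T).toAddMonoidHom hfin'
  have h1 : ∀ s : S, G (mono k S T s (c s))
      = (fun s' : S' => mono k S' T s' (c s')) (AddSubmonoid.inclusion hS s) := fun s => hmono _ _
  rw [h0, finsum_congr h1,
    ← finsum_mem_range (f := fun s' : S' => mono k S' T s' (c s'))
      (g := AddSubmonoid.inclusion hS) (Set.inclusion_injective hS), ofCoeff]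
  refine finsum_congr fun s => ?_
  by_cases hs : (s : M) ∈ S
  · exact finsum_eq_single _ (⟨⟨s, hs⟩, rfl⟩ : s ∈ Set.range (AddSubmonoid.inclusion hS))
      fun h h' => absurd rfl h'
  · have : c s = 0 := by_contra fun h => hs (hc _ h)
    rw [this, mono_smul, finsum_zero]

end RowIncl

section FZero

open ScatteringDiagram

variable {k : Type u} [Field k] {n : ℕ} {L : Type u} [AddCommGroup L] {P : AddSubmonoid L}
  {φ : PLFun n P} {J : AddSemigroupIdeal P} (D : ScatteringDiagram φ k J) (I : AddSemigroupIdeal P)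

/-- `f_ρ`, for `ρ = ρ_i`, as a function tangent to `ρ`. -/
def fZero (i : ZMod n) : RZero k I φ i :=
  ∏ᶠ r ∈ D.on i 0, ofCoeff (monZero φ i) (idRay φ I i) r.coeff

/-- `f_ρ`, for `ρ = ρ_i`, as a Laurent polynomial. -/
def fLaur (i : ZMod n) : Laurent (Base (P := P) I k) := laurZero k I φ i (fZero D I i)

variable {D I}

lemma mem_monZero_of_on {i : ZMod n} {r : ScatRay φ k J} (hr : r ∈ D.on i 0) {q : (ℤ × ℤ) × L}
    (hq : r.coeff q ≠ 0) : q ∈ monZero φ i := by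
  obtain ⟨-, rfl, hs⟩ := hr
  refine ⟨?_, ?_⟩
  · have := r.coeff_supp q hq
    rwa [tauMon, if_pos hs] at this
  · change q.1.2 = 0
    by_cases h0 : q = 0
    · subst h0; rfl
    · rcases r.direction with h | h <;> obtain ⟨l, -, h⟩ := h q h0 hq <;> simp [h, hs]

lemma finite_coeff_on (hI : radical I = J) {i : ZMod n} {r : ScatRay φ k J} (hr : r ∈ D.on i 0) :
    {q | r.coeff q ≠ 0 ∧ q ∉ idRay φ I i}.Finite := by
  obtain ⟨-, rfl, hs⟩ := hr
  have := r.summable I hI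
  rwa [tauIdeal, if_pos hs] at this

lemma finite_on (hI : radical I = J) (i : ZMod n) :
    (D.on i 0 ∩ {r | ofCoeff (monZero φ i) (idRay φ I i) r.coeff ≠ 1}).Finite := by
  refine (D.finite I hI).subset ?_
  rintro r ⟨⟨hr, rfl, hs⟩, hne⟩
  refine ⟨hr, ?_⟩
  by_contra hnt
  refine hne (ofCoeff_eq_one r.coeff_zero fun q h0 hq => ?_)
  by_contra hq'
  exact hnt ⟨q, h0, hq, by rwa [tauIdeal, if_pos hs]⟩

lemma zeroRay_fZero (hI : radical I = J) (i : ZMod n) :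
    zeroRay k I φ i (fZero D I i) = D.fRay I i := by
  have h1 : zeroRay k I φ i (fZero D I i) = ∏ᶠ r ∈ D.on i 0,
      zeroRay k I φ i (ofCoeff (monZero φ i) (idRay φ I i) r.coeff) :=
    MonoidHom.map_finprod_mem' ((zeroRay k I φ i : RZero k I φ i →+* RRay φ I k i) :
      RZero k I φ i →* RRay φ I k i) (finite_on hI i)
  rw [h1, fRay]
  refine finprod_mem_congr rfl fun r hr => ?_
  exact map_ofCoeff (inf_le_left : monZero φ i ≤ monRay φ i) (fun q hq => mem_monZero_of_on hr hq) (finite_coeff_on hI hr)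

lemma laurZero_ofCoeff (hI : radical I = J) {i : ZMod n} {r : ScatRay φ k J} (hr : r ∈ D.on i 0) :
    ∃ F : Finset (monZero φ i), (∀ s ∈ F, s ≠ 0 ∧ r.coeff s ≠ 0 ∧
      (s : (ℤ × ℤ) × L) ∉ idRay φ I i) ∧
      laurZero k I φ i (ofCoeff (monZero φ i) (idRay φ I i) r.coeff) = 1 + ∑ s ∈ F,
        AddMonoidAlgebra.single s.1.1
          (r.coeff s • zA k I ⟨htPos φ i s, monRay_htPos φ i s.2.1⟩) := by
  obtain ⟨F, hF, h⟩ := ofCoeff_eq_one_add (S := monZero φ i) r.coeff_zero (finite_coeff_on hI hr)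
  refine ⟨F, hF, ?_⟩
  rw [h, map_add, map_one, map_sum]
  congr 1
  refine Finset.sum_congr rfl fun s _ => ?_
  rw [mono_eq_smul, map_smul, laurZero_mono, AddMonoidAlgebra.smul_single]

lemma fLaur_mem_rowZero (i : ZMod n) : fLaur D I i ∈ rowZero _ := laurZero_mem φ i _

/-- The function `f_ρ` is not a zero divisor: in each of its factors, all exponents of the
nonconstant terms lie in one open half line. -/
lemma fLaur_mem_nonZeroDivisors (hI : radical I = J) (i : ZMod n) :
    fLaur D I i ∈ nonZeroDivisors (Laurent (Base (P := P) I k)) := by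
  rw [fLaur, fZero]
  refine finprod_mem_induction
    (p := fun x => laurZero k I φ i x ∈ nonZeroDivisors (Laurent (Base (P := P) I k))) ?_ ?_ ?_
  · rw [map_one]; exact one_mem _
  · intro x y hx hy
    rw [map_mul]; exact mul_mem hx hy
  · intro r hr
    obtain ⟨F, hF, h⟩ := laurZero_ofCoeff hI hr
    rw [h]
    obtain ⟨ℓ, hℓ⟩ : ∃ ℓ : ℤ × ℤ →+ ℤ, ∀ q, q ≠ 0 → r.coeff q ≠ 0 → 0 < ℓ q.1 := by
      have hs := hr.2.2
      rcases r.direction with h | h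
      · refine ⟨-AddMonoidHom.fst ℤ ℤ, fun q h0 hq => ?_⟩
        obtain ⟨l, hl, hq⟩ := h q h0 hq
        rw [hq]; simpa [hs] using Nat.pos_of_ne_zero hl
      · refine ⟨AddMonoidHom.fst ℤ ℤ, fun q h0 hq => ?_⟩
        obtain ⟨l, hl, hq⟩ := h q h0 hq
        rw [hq]; simpa [hs] using Nat.pos_of_ne_zero hl
    refine one_add_mem_nonZeroDivisors ℓ fun m hm => ?_
    rw [AddMonoidAlgebra.coeff_sum, Finsupp.finsetSum_apply] at hm
    obtain ⟨s, hs, hm⟩ := Finset.exists_ne_zero_of_sum_ne_zero hm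
    rw [laurent_coeff_single] at hm
    split_ifs at hm with hms
    · rw [hms]
      exact hℓ _ (by simpa using (hF s hs).1) (hF s hs).2.1
    · exact absurd rfl hm

variable (k I) in
/-- The ideal of `k[P]/I` generated by the monomials in `J`. -/
def idealOf (K : AddSemigroupIdeal P) : Ideal (Base (P := P) I k) :=
  Ideal.span {x | ∃ p ∈ K, x = zA k I p}

lemma zA_mem_idealOf {K : AddSemigroupIdeal P} {p : P} (hp : (p : L) ∈ elems K) :
    zA k I p ∈ idealOf k I K := Ideal.subset_span ⟨p, mem_elems.mp hp, rfl⟩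

lemma fLaur_sub_one_mem (hI : radical I = J) {i : ZMod n} (hi : φ.bend i ∉ J) :
    fLaur D I i - 1 ∈ coeffIn (idealOf k I J) := by
  rw [fLaur, fZero]
  refine finprod_mem_induction
    (p := fun x => laurZero k I φ i x - 1 ∈ coeffIn (idealOf k I J)) ?_ ?_ ?_
  · rw [map_one, sub_self]; exact zero_mem _
  · intro x y hx hy
    have : laurZero k I φ i (x * y) - 1 = (laurZero k I φ i x - 1) * laurZero k I φ i y
        + (laurZero k I φ i y - 1) := by rw [map_mul]; ring
    rw [this]
    exact add_mem (Ideal.mul_mem_right _ _ hx) hy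
  · intro r hr
    obtain ⟨F, hF, h⟩ := laurZero_ofCoeff hI hr
    rw [h, add_sub_cancel_left]
    refine Ideal.sum_mem _ fun s hs => ?_
    intro m
    rw [laurent_coeff_single]
    split_ifs with hm
    · refine Submodule.smul_of_tower_mem (idealOf k I J) (r.coeff s) (zA_mem_idealOf ?_)
      have h1 := r.congr_one (Or.inr (by rw [hr.2.1]; exact hi)) s (by simpa using (hF s hs).1)
        (hF s hs).2.1
      rw [tauIdeal, if_pos hr.2.2, hr.2.1] at h1
      exact (mem_idPos_of_monZero φ s.2 h1).2
    · exact zero_mem _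

end FZero

section Model

open ScatteringDiagram

variable {k : Type u} [Field k] {n : ℕ} {L : Type u} [AddCommGroup L] {P : AddSubmonoid L}
  (φ : PLFun n P) {I : AddSemigroupIdeal P}

lemma htNeg_of_nonneg {i : ZMod n} {q : (ℤ × ℤ) × L} (h : 0 ≤ q.1.2) :
    htNeg φ i q = htPos φ i q + q.1.2.toNat • (φ.bend i : L) := by
  rw [htNeg_eq, ← natCast_zsmul, Int.toNat_of_nonneg h]

lemma htPos_of_nonpos {i : ZMod n} {q : (ℤ × ℤ) × L} (h : q.1.2 ≤ 0) :
    htPos φ i q = htNeg φ i q + (-q.1.2).toNat • (φ.bend i : L) := by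
  rw [htNeg_eq, ← natCast_zsmul, Int.toNat_of_nonneg (by omega), neg_smul]; abel

lemma zA_htNeg {i : ZMod n} {q : (ℤ × ℤ) × L} (hq : q ∈ monRay φ i) (h : 0 ≤ q.1.2) :
    zA k I ⟨htNeg φ i q, monRay_htNeg φ i hq⟩
      = tA k I φ i ^ q.1.2.toNat * zA k I ⟨htPos φ i q, monRay_htPos φ i hq⟩ := by
  rw [tA, ← zA_nsmul, ← zA_add]
  congr 1
  ext
  simp only [htNeg_of_nonneg φ h, AddSubmonoid.coe_add, AddSubmonoidClass.coe_nsmul]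
  abel

lemma zA_htPos {i : ZMod n} {q : (ℤ × ℤ) × L} (hq : q ∈ monRay φ i) (h : q.1.2 ≤ 0) :
    zA k I ⟨htPos φ i q, monRay_htPos φ i hq⟩
      = tA k I φ i ^ (-q.1.2).toNat * zA k I ⟨htNeg φ i q, monRay_htNeg φ i hq⟩ := by
  rw [tA, ← zA_nsmul, ← zA_add]
  congr 1
  ext
  simp only [htPos_of_nonpos φ h, AddSubmonoid.coe_add, AddSubmonoidClass.coe_nsmul]
  abel

/-- The Laurent monomial recording whether `z^q` survives in `R_{ρ,ρ,I}`. -/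
def rayMono (i : ZMod n) (q : monRay φ i) : Laurent (Base (P := P) I k) :=
  AddMonoidAlgebra.single q.1.1 (if 0 ≤ q.1.1.2 then zA k I ⟨htNeg φ i q, monRay_htNeg φ i q.2⟩
    else zA k I ⟨htPos φ i q, monRay_htPos φ i q.2⟩)

lemma rayMono_add (i : ZMod n) (s : monZero φ i) (q : monRay φ i) :
    rayMono (k := k) (I := I) φ i (⟨s, s.2.1⟩ + q)
      = AddMonoidAlgebra.single s.1.1 (zA k I ⟨htPos φ i s, monRay_htPos φ i s.2.1⟩)
        * rayMono φ i q := by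
  have h0 : s.1.1.2 = 0 := snd_of_mem_monZero φ s.2
  have h1 : htNeg φ i s = htPos φ i s := by rw [htNeg_eq, h0, zero_smul, add_zero]
  rw [rayMono, rayMono, AddMonoidAlgebra.single_mul_single]
  simp only [AddSubmonoid.coe_add, Prod.fst_add, Prod.snd_add, h0, zero_add]
  split_ifs with h <;> rw [← zA_add] <;> congr 2 <;> ext
  · simp [h1]
  · simp

variable (k I) in
lemma exists_rayCoeff (i : ZMod n) :
    ∃ O : RRay φ I k i →ₗ[k] Laurent (Base (P := P) I k), ∀ q,
      O (mono k _ _ q 1) = rayMono φ i q := by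
  obtain ⟨O, hO⟩ := MonAlg.exists_linear_lift (k := k) (S := monRay φ i) (T := idRay φ I i)
    (rayMono (k := k) (I := I) φ i) (fun s s' hs => by
      rw [rayMono]
      have key : (0 ≤ (s' + s).1.1.2 → htNeg φ i (s' + s : monRay φ i) ∈ elems I) ∧
          ((s' + s).1.1.2 ≤ 0 → htPos φ i (s' + s : monRay φ i) ∈ elems I) := by
        rcases hs with hs | hs
        · have h1 : htPos φ i (s' + s : monRay φ i) ∈ elems I := by
            rw [AddSubmonoid.coe_add, map_add]; exact add_mem_elems (monRay_htPos φ i s'.2) hs.2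
          refine ⟨fun h => ?_, fun _ => h1⟩
          rw [htNeg_of_nonneg φ h, add_comm]
          exact add_mem_elems (P.nsmul_mem (φ.bend i).2 _) h1
        · have h1 : htNeg φ i (s' + s : monRay φ i) ∈ elems I := by
            rw [AddSubmonoid.coe_add, map_add]; exact add_mem_elems (monRay_htNeg φ i s'.2) hs.2
          refine ⟨fun _ => h1, fun h => ?_⟩
          rw [htPos_of_nonpos φ h, add_comm]
          exact add_mem_elems (P.nsmul_mem (φ.bend i).2 _) h1
      split_ifs with h
      · rw [zA_eq_zero (key.1 h), AddMonoidAlgebra.single_zero]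
      · rw [zA_eq_zero (key.2 (by omega)), AddMonoidAlgebra.single_zero])
  exact ⟨O, fun q => by rw [hO, one_smul]⟩

variable (k I) in
/-- `R_{ρ_i,ρ_i,I}` as a space of Laurent polynomials: the coefficients in the rows on the side of
`σ_i` are those of the image in `R_{ρ_i,σ_{i-1},I}`, and conversely. -/
def rayCoeff (i : ZMod n) : RRay φ I k i →ₗ[k] Laurent (Base (P := P) I k) :=
  (exists_rayCoeff k φ I i).choose

lemma rayCoeff_mono (i : ZMod n) (q : monRay φ i) :
    rayCoeff k φ I i (mono k _ _ q 1) = rayMono φ i q :=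
  (exists_rayCoeff k φ I i).choose_spec q

open scoped Classical in
/-- The space `R_{ρ_i,ρ_i,I}` has the monomials outside `I` on both sides as a basis, and `rayCoeff`
takes them to linearly independent elements. -/
lemma rayCoeff_injective (i : ZMod n) : Function.Injective (rayCoeff k φ I i) := by
  refine MonAlg.eq_zero_of_coeff _ fun s hs => ?_
  have hs1 : htNeg φ i s ∉ elems I := fun h => hs (Or.inr ⟨s.2, h⟩)
  have hs2 : htPos φ i s ∉ elems I := fun h => hs (Or.inl ⟨s.2, h⟩)
  obtain ⟨c, hc⟩ : ∃ c : Base (P := P) I k →ₗ[k] k, ∀ s' : monRay φ i, s'.1.1 = s.1.1 →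
      c (if 0 ≤ s'.1.1.2 then zA k I ⟨htNeg φ i s', monRay_htNeg φ i s'.2⟩
        else zA k I ⟨htPos φ i s', monRay_htPos φ i s'.2⟩) = if s' = s then 1 else 0 := by
    by_cases h : 0 ≤ s.1.1.2
    · obtain ⟨c, hc⟩ := exists_coeff_base (k := k) (I := I)
        (p := ⟨htNeg φ i s, monRay_htNeg φ i s.2⟩) hs1
      refine ⟨c, fun s' h' => ?_⟩
      rw [h', if_pos h, hc]
      congr 1
      refine propext ⟨fun h2 => ?_, fun h2 => by rw [h2]⟩
      exact Subtype.ext (htNeg_inj φ i _ _ h' (congrArg Subtype.val h2))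
    · obtain ⟨c, hc⟩ := exists_coeff_base (k := k) (I := I)
        (p := ⟨htPos φ i s, monRay_htPos φ i s.2⟩) hs2
      refine ⟨c, fun s' h' => ?_⟩
      rw [h', if_neg h, hc]
      congr 1
      refine propext ⟨fun h2 => ?_, fun h2 => by rw [h2]⟩
      exact Subtype.ext (htPos_inj φ i _ _ h' (congrArg Subtype.val h2))
  refine ⟨c ∘ₗ (Finsupp.lapply s.1.1 ∘ₗ (AddMonoidAlgebra.coeffLinearEquiv k).toLinearMap),
    fun s' => ?_⟩
  change c ((rayCoeff k φ I i (mono k _ _ s' 1)).coeff s.1.1) = _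
  rw [rayCoeff_mono, rayMono, laurent_coeff_single]
  by_cases h : s.1.1 = s'.1.1
  · rw [if_pos h, hc s' h.symm]
    congr
  · rw [if_neg h, map_zero, if_neg]
    rintro rfl
    exact h rfl

lemma rayCoeff_zeroRay_mul (i : ZMod n) (y : RZero k I φ i) (z : RRay φ I k i) :
    rayCoeff k φ I i (zeroRay k I φ i y * z) = laurZero k I φ i y * rayCoeff k φ I i z := by
  induction y using MonAlg.induction_on with
  | h0 => simp
  | hadd x y hx hy => rw [map_add, map_add, add_mul, add_mul, map_add, hx, hy]
  | hmono s c =>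
    induction z using MonAlg.induction_on with
    | h0 => simp
    | hadd x y hx hy => rw [mul_add, map_add, map_add, mul_add, hx, hy]
    | hmono q c' =>
      rw [mono_eq_smul s, mono_eq_smul q, map_smul, map_smul, smul_mul_assoc, mul_smul_comm,
        map_smul, map_smul, map_smul, smul_mul_assoc, mul_smul_comm, zeroRay_mono, mono_mul,
        rayCoeff_mono, laurZero_mono, mul_one, rayCoeff_mono, rayMono_add]

/-- A coefficient, as a linear functional over `k`. -/
def lcoeff (A : Type*) [CommRing A] [Algebra k A] (m : ℤ × ℤ) : Laurent A →ₗ[k] A :=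
  Finsupp.lapply m ∘ₗ (AddMonoidAlgebra.coeffLinearEquiv k).toLinearMap

lemma lcoeff_apply {A : Type*} [CommRing A] [Algebra k A] (m : ℤ × ℤ) (x : Laurent A) :
    lcoeff (k := k) A m x = x.coeff m := rfl

lemma rayCoeff_negToRay (i : ZMod n) (x : RNeg φ I k i) {m : ℤ × ℤ} (hm : 0 ≤ m.2) :
    (rayCoeff k φ I i (negToRay φ I k i x)).coeff m = (laurNeg k I φ i x).coeff m := by
  have : lcoeff _ m ∘ₗ rayCoeff k φ I i ∘ₗ (negToRay φ I k i).toLinearMap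
      = lcoeff _ m ∘ₗ (laurNeg k I φ i).toLinearMap := by
    refine MonAlg.linear_ext fun s => ?_
    simp only [LinearMap.comp_apply, lcoeff_apply, AlgHom.toLinearMap_apply]
    rw [negToRay_mono, rayCoeff_mono, laurNeg_mono, rayMono, laurent_coeff_single,
      laurent_coeff_single]
    split_ifs with h1 h2
    · rfl
    · rw [h1] at hm; exact absurd hm h2
    · rfl
  exact DFunLike.congr_fun this x

lemma rayCoeff_posToRay (i : ZMod n) (x : RPos φ I k i) {m : ℤ × ℤ} (hm : m.2 ≤ 0) :
    (rayCoeff k φ I i (posToRay φ I k i x)).coeff m = (laurPos k I φ i x).coeff m := by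
  have : lcoeff _ m ∘ₗ rayCoeff k φ I i ∘ₗ (posToRay φ I k i).toLinearMap
      = lcoeff _ m ∘ₗ (laurPos k I φ i).toLinearMap := by
    refine MonAlg.linear_ext fun s => ?_
    simp only [LinearMap.comp_apply, lcoeff_apply, AlgHom.toLinearMap_apply]
    rw [posToRay_mono, rayCoeff_mono, laurPos_mono, rayMono, laurent_coeff_single,
      laurent_coeff_single]
    split_ifs with h1 h2
    · rw [h1] at hm
      have h0 := le_antisymm hm h2
      rw [zA_htNeg φ s.2 h2, h0]
      simp
    · rfl
    · rfl
  exact DFunLike.congr_fun this x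

lemma rayCoeff_posToRay' (i : ZMod n) (x : RPos φ I k i) {m : ℤ × ℤ} (hm : 0 ≤ m.2) :
    (rayCoeff k φ I i (posToRay φ I k i x)).coeff m
      = tA k I φ i ^ m.2.toNat * (laurPos k I φ i x).coeff m := by
  have : lcoeff _ m ∘ₗ rayCoeff k φ I i ∘ₗ (posToRay φ I k i).toLinearMap
      = LinearMap.mulLeft k (tA k I φ i ^ m.2.toNat) ∘ₗ
        lcoeff _ m ∘ₗ (laurPos k I φ i).toLinearMap := by
    refine MonAlg.linear_ext fun s => ?_
    simp only [LinearMap.comp_apply, lcoeff_apply, AlgHom.toLinearMap_apply,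
      LinearMap.mulLeft_apply]
    rw [posToRay_mono, rayCoeff_mono, laurPos_mono, rayMono, laurent_coeff_single,
      laurent_coeff_single]
    split_ifs with h1 h2
    · rw [zA_htNeg φ s.2 h2, h1]
    · rw [h1] at hm; exact absurd hm h2
    · simp
  exact DFunLike.congr_fun this x

lemma rayCoeff_negToRay' (i : ZMod n) (x : RNeg φ I k i) {m : ℤ × ℤ} (hm : m.2 ≤ 0) :
    (rayCoeff k φ I i (negToRay φ I k i x)).coeff m
      = tA k I φ i ^ (-m.2).toNat * (laurNeg k I φ i x).coeff m := by
  have : lcoeff _ m ∘ₗ rayCoeff k φ I i ∘ₗ (negToRay φ I k i).toLinearMap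
      = LinearMap.mulLeft k (tA k I φ i ^ (-m.2).toNat) ∘ₗ
        lcoeff _ m ∘ₗ (laurNeg k I φ i).toLinearMap := by
    refine MonAlg.linear_ext fun s => ?_
    simp only [LinearMap.comp_apply, lcoeff_apply, AlgHom.toLinearMap_apply,
      LinearMap.mulLeft_apply]
    rw [negToRay_mono, rayCoeff_mono, laurNeg_mono, rayMono, laurent_coeff_single,
      laurent_coeff_single]
    split_ifs with h1 h2
    · rw [h1] at hm ⊢
      rw [le_antisymm hm h2]
      simp
    · rw [zA_htPos φ s.2 (by omega), h1]
    · simp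
  exact DFunLike.congr_fun this x

end Model
end MirrorFamily

namespace MirrorFamily

/-! ### The ring of functions near a ray of the fan -/

section Glued

open ScatteringDiagram

variable {k : Type u} [Field k] {n : ℕ} {L : Type u} [AddCommGroup L] {P : AddSubmonoid L}
  {φ : PLFun n P} {J : AddSemigroupIdeal P} (D : ScatteringDiagram φ k J) {I : AddSemigroupIdeal P}

lemma fRay_mem_nonZeroDivisors (hI : radical I = J) (i : ZMod n) :
    D.fRay I i ∈ nonZeroDivisors (RRay φ I k i) := by
  rw [mem_nonZeroDivisors_iff_right]
  intro z hz
  have h := rayCoeff_zeroRay_mul φ i (fZero D I i) z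
  rw [zeroRay_fZero hI, mul_comm, hz, map_zero] at h
  have h2 := (mem_nonZeroDivisors_iff_right.mp (fLaur_mem_nonZeroDivisors (D := D) hI i)) _
    (by rw [mul_comm]; exact h.symm)
  exact rayCoeff_injective φ i (by rw [h2, map_zero])

lemma algebraMap_loc_injective (hI : radical I = J) (i : ZMod n) :
    Function.Injective (algebraMap (RRay φ I k i) (Localization.Away (D.fRay I i))) :=
  IsLocalization.injective (M := Submonoid.powers (D.fRay I i)) _
    (Submonoid.powers_le.mpr (fRay_mem_nonZeroDivisors D hI i))

/-- The unit `f_ρ` of the localization. -/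
def fUnit (D : ScatteringDiagram φ k J) (I : AddSemigroupIdeal P) (i : ZMod n) :
    (Localization.Away (D.fRay I i))ˣ :=
  (IsLocalization.Away.algebraMap_isUnit (S := Localization.Away (D.fRay I i)) (D.fRay I i)).unit

lemma val_fUnit (i : ZMod n) : (fUnit D I i : Localization.Away (D.fRay I i))
    = algebraMap _ _ (D.fRay I i) := rfl

lemma posToLoc_mono (i : ZMod n) (q : monRay φ i) : D.posToLoc I i (mono k _ _ q 1)
    = algebraMap _ _ (mono k (monRay φ i) (idRay φ I i) q 1) *
      ((fUnit D I i ^ q.1.1.2 : (Localization.Away (D.fRay I i))ˣ) :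
        Localization.Away (D.fRay I i)) := by
  rw [posToLoc, MonAlg.twist_mono, AlgHom.comp_apply, posToRay_mono]
  rfl

lemma negToLoc_apply (i : ZMod n) (x : RNeg φ I k i) :
    D.negToLoc I i x = algebraMap _ _ (negToRay φ I k i x) := rfl

lemma posToLoc_zeroPos (i : ZMod n) (x : RZero k I φ i) :
    D.posToLoc I i (zeroPos k I φ i x) = algebraMap _ _ (zeroRay k I φ i x) := by
  have : (D.posToLoc I i).comp (zeroPos k I φ i)
      = (IsScalarTower.toAlgHom k (RRay φ I k i) (Localization.Away (D.fRay I i))).comp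
        (zeroRay k I φ i) := by
    refine MonAlg.hom_ext fun s => ?_
    rw [AlgHom.comp_apply, zeroPos_mono, posToLoc_mono, AlgHom.comp_apply, zeroRay_mono]
    have : s.1.1.2 = 0 := snd_of_mem_monZero φ s.2
    simp [this]
  exact DFunLike.congr_fun this x

lemma exists_shift (i : ZMod n) (M : ℕ) : ∃ W : RPos φ I k i →ₗ[k] RRay φ I k i, ∀ q,
    W (mono k _ _ q 1) = D.fRay I i ^ (q.1.1.2 + M).toNat
      * mono k (monRay φ i) (idRay φ I i) q 1 := by
  obtain ⟨W, hW⟩ := MonAlg.exists_linear_lift (k := k) (S := monRay φ i) (T := idPos φ I i)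
    (fun q : monRay φ i => D.fRay I i ^ (q.1.1.2 + M).toNat
      * mono k (monRay φ i) (idRay φ I i) q 1) (fun s s' hs => by
      have : ((s' + s : monRay φ i) : (ℤ × ℤ) × L) ∈ idRay φ I i := by
        refine Or.inl ⟨(s' + s).2, ?_⟩
        rw [AddSubmonoid.coe_add, map_add]
        exact add_mem_elems (monRay_htPos φ i s'.2) hs.2
      simp only [mono_eq_zero this, mul_zero])
  exact ⟨W, fun q => by rw [hW, one_smul]⟩

/-- In row `r`, the shifted functions are `f_ρ^{r+M}` times the given ones. -/
def shift (D : ScatteringDiagram φ k J) (i : ZMod n) (M : ℕ) : RPos φ I k i →ₗ[k] RRay φ I k i :=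
  (exists_shift D i M).choose

lemma shift_mono (i : ZMod n) (M : ℕ) (q : monRay φ i) :
    shift (I := I) D i M (mono k _ _ q 1) = D.fRay I i ^ (q.1.1.2 + M).toNat
      * mono k (monRay φ i) (idRay φ I i) q 1 :=
  (exists_shift D i M).choose_spec q

/-- The gluing map `z^q ↦ z^q f_ρ^{⟨n_ρ, r(q)⟩}`, multiplied by a high power of `f_ρ`, takes its
values in `R_{ρ,ρ,I}` and is given there by `shift`. -/
lemma exists_shift_eq (i : ZMod n) (x : RPos φ I k i) : ∃ M₀ : ℕ, ∀ M, M₀ ≤ M →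
    algebraMap _ (Localization.Away (D.fRay I i)) (shift D i M x)
      = algebraMap _ _ (D.fRay I i) ^ M * D.posToLoc I i x := by
  induction x using MonAlg.induction_on with
  | h0 => exact ⟨0, fun M _ => by simp⟩
  | hadd x y hx hy =>
    obtain ⟨M₁, h1⟩ := hx
    obtain ⟨M₂, h2⟩ := hy
    refine ⟨max M₁ M₂, fun M hM => ?_⟩
    rw [map_add, map_add, map_add, h1 M (le_trans (le_max_left _ _) hM),
      h2 M (le_trans (le_max_right _ _) hM), mul_add]
  | hmono q c =>
    refine ⟨(-q.1.1.2).toNat, fun M hM => ?_⟩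
    have h : (q.1.1.2 + M).toNat = q.1.1.2 + M := Int.toNat_of_nonneg (by omega)
    have h1 : algebraMap _ (Localization.Away (D.fRay I i)) (D.fRay I i) ^ (q.1.1.2 + M).toNat
        = algebraMap _ (Localization.Away (D.fRay I i)) (D.fRay I i) ^ M *
          ((fUnit D I i ^ q.1.1.2 : (Localization.Away (D.fRay I i))ˣ) :
            Localization.Away (D.fRay I i)) := by
      rw [← val_fUnit, ← Units.val_pow_eq_pow_val, ← Units.val_pow_eq_pow_val, ← Units.val_mul]
      congr 1
      rw [← zpow_natCast, ← zpow_natCast, h, add_comm, zpow_add]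
    have hsmul : ∀ y : RRay φ I k i, algebraMap _ (Localization.Away (D.fRay I i)) (c • y)
        = c • algebraMap _ _ y := fun y =>
      map_smul (IsScalarTower.toAlgHom k (RRay φ I k i) (Localization.Away (D.fRay I i))) c y
    rw [mono_eq_smul, map_smul (shift D i M), map_smul (D.posToLoc I i), shift_mono,
      posToLoc_mono, hsmul, map_mul, map_pow, h1, mul_smul_comm]
    congr 1
    ring

lemma rayCoeff_shift (hI : radical I = J) (i : ZMod n) (M : ℕ) (x : RPos φ I k i) (m : ℤ × ℤ) :
    (rayCoeff k φ I i (shift D i M x)).coeff m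
      = (fLaur D I i ^ (m.2 + M).toNat * rayCoeff k φ I i (posToRay φ I k i x)).coeff m := by
  have : lcoeff (Base (P := P) I k) m ∘ₗ rayCoeff k φ I i ∘ₗ shift D i M
      = lcoeff (Base (P := P) I k) m ∘ₗ LinearMap.mulLeft k (fLaur D I i ^ (m.2 + M).toNat) ∘ₗ
        rayCoeff k φ I i ∘ₗ (posToRay φ I k i).toLinearMap := by
    refine MonAlg.linear_ext fun q => ?_
    simp only [LinearMap.comp_apply, lcoeff_apply, AlgHom.toLinearMap_apply,
      LinearMap.mulLeft_apply]
    rw [shift_mono, posToRay_mono, ← zeroRay_fZero hI, ← map_pow, rayCoeff_zeroRay_mul, map_pow,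
      rayCoeff_mono, ← fLaur]
    by_cases h : m.2 = q.1.1.2
    · rw [h]
    · have h0 : ∀ r : ℕ, (fLaur D I i ^ r * rayMono φ i q).coeff m = 0 := by
        intro r
        rw [coeff_rowZero_mul (y := 0) (pow_mem (fLaur_mem_rowZero (D := D) (I := I) i) r) m.2 ?_ m rfl]
        · simp
        · intro m' hm'
          rw [rayMono, laurent_coeff_single, if_neg]
          · simp
          · rintro rfl
            exact h hm'.symm
      rw [h0, h0]
  exact DFunLike.congr_fun this x

/-- Cancellation of nonzerodivisors row by row. -/
lemma coeff_eq_of_mul {A : Type*} [CommRing A] {g u v : Laurent A} (hg : g ∈ rowZero A)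
    (hg' : g ∈ nonZeroDivisors (Laurent A)) {r : ℤ}
    (h : ∀ m : ℤ × ℤ, m.2 = r → (g * u).coeff m = (g * v).coeff m) (m : ℤ × ℤ) (hm : m.2 = r) :
    u.coeff m = v.coeff m := by
  let w : Laurent A := .ofCoeff ((u - v).coeff.filter fun m => m.2 = r)
  have hw : ∀ m, w.coeff m = if m.2 = r then (u - v).coeff m else 0 := fun m =>
    Finsupp.filter_apply _ _ _
  have h0 : g * w = 0 := by
    ext m'
    by_cases hm' : m'.2 = r
    · rw [coeff_rowZero_mul (y := u - v) hg r (fun m hm => by rw [hw, if_pos hm]) m' hm', mul_sub]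
      simp [h m' hm']
    · rw [coeff_rowZero_mul (y := 0) hg m'.2 _ m' rfl]
      · simp
      · intro m hm
        rw [hw, if_neg (by omega)]; simp
  have h1 : w = 0 := (mem_nonZeroDivisors_iff_right.mp hg') _ (by rw [mul_comm]; exact h0)
  have h2 := hw m
  rw [if_pos hm, h1] at h2
  exact sub_eq_zero.mp (by simpa using h2.symm)

lemma coeff_mul_C_pow {A : Type*} [CommRing A] (g x y : Laurent A) (c : A) {r : ℤ}
    (hg : g ∈ rowZero A) (h : ∀ m : ℤ × ℤ, m.2 = r → x.coeff m = c * y.coeff m) (m : ℤ × ℤ)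
    (hm : m.2 = r) : (g * x).coeff m = c * (g * y).coeff m := by
  rw [coeff_rowZero_mul (y := c • y) hg r (fun m hm => by rw [h m hm]; simp) m hm]
  simp

variable (I) in
/-- A function near `ρ_i`, as a Laurent polynomial on `σ_{i-1}`, in coordinates adapted to
`ρ_i`. -/
def gluedNeg (D : ScatteringDiagram φ k J) (i : ZMod n) :
    D.RGlued I i →ₐ[k] Laurent (Base (P := P) I k) :=
  (laurNeg k I φ i).comp ((AlgHom.fst k _ _).comp (D.RGlued I i).val)

variable (I) in
/-- A function near `ρ_i`, as a Laurent polynomial on `σ_i`. -/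
def gluedPos (D : ScatteringDiagram φ k J) (i : ZMod n) :
    D.RGlued I i →ₐ[k] Laurent (Base (P := P) I k) :=
  (laurPos k I φ i).comp ((AlgHom.snd k _ _).comp (D.RGlued I i).val)

lemma gluedNeg_mk (i : ZMod n) {x} (h : x ∈ D.RGlued I i) :
    gluedNeg I D i ⟨x, h⟩ = laurNeg k I φ i x.1 := rfl

lemma gluedPos_mk (i : ZMod n) {x} (h : x ∈ D.RGlued I i) :
    gluedPos I D i ⟨x, h⟩ = laurPos k I φ i x.2 := rfl

lemma laurCone_psiPos (i : ZMod n) (x : D.RGlued I i) :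
    laurCone k I φ i (D.psiPos I i x) = gluedPos I D i x := laurCone_posToCone φ i _

lemma reglue_psiNeg (d : ZMod n → ℤ) (i : ZMod n) (x : D.RGlued I (i + 1)) :
    reglue _ d i (laurCone k I φ i (D.psiNeg I d i x)) = gluedNeg I D (i + 1) x :=
  reglue_laurCone φ d i _

/-- The comparison of a function near `ρ_i` on the two sides of `ρ_i`. -/
lemma glued_rows (hI : radical I = J) (i : ZMod n) (x : D.RGlued I i) :
    ∃ M₀ : ℕ, ∀ M : ℕ, M₀ ≤ M → ∀ m : ℤ × ℤ,
      (fLaur D I i ^ M * rayCoeff k φ I i (negToRay φ I k i x.1.1)).coeff m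
        = (fLaur D I i ^ (m.2 + M).toNat * rayCoeff k φ I i (posToRay φ I k i x.1.2)).coeff m := by
  obtain ⟨M₀, hM₀⟩ := exists_shift_eq D i x.1.2
  refine ⟨M₀, fun M hM m => ?_⟩
  have hx : D.negToLoc I i x.1.1 = D.posToLoc I i x.1.2 := x.2
  have h1 := hM₀ M hM
  rw [← hx, negToLoc_apply, ← map_pow, ← map_mul] at h1
  have h2 := algebraMap_loc_injective D hI i h1
  rw [← rayCoeff_shift D hI, h2, ← zeroRay_fZero hI, ← map_pow, rayCoeff_zeroRay_mul, map_pow,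
    fLaur]

lemma gluedNeg_coeff (hI : radical I = J) (i : ZMod n) (x : D.RGlued I i) (m : ℤ × ℤ)
    (hm : 0 ≤ m.2) : (gluedNeg I D i x).coeff m
      = tA k I φ i ^ m.2.toNat * (fLaur D I i ^ m.2.toNat * gluedPos I D i x).coeff m := by
  obtain ⟨M, hM⟩ := glued_rows D hI i x
  change (laurNeg k I φ i x.1.1).coeff m = _ * (_ * laurPos k I φ i x.1.2).coeff m
  rw [← rayCoeff_negToRay φ i x.1.1 hm]
  rw [coeff_eq_of_mul (v := fLaur D I i ^ m.2.toNat *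
    rayCoeff k φ I i (posToRay φ I k i x.1.2)) (pow_mem (fLaur_mem_rowZero (D := D) (I := I) i) M)
    (pow_mem (fLaur_mem_nonZeroDivisors (D := D) hI i) M) (r := m.2) (fun m' hm' => ?_) m rfl]
  · exact coeff_mul_C_pow _ _ _ _ (r := m.2) (pow_mem (fLaur_mem_rowZero (D := D) (I := I) i) _)
      (fun m' hm' => by rw [rayCoeff_posToRay' φ i _ (by omega), hm']) m rfl
  · rw [hM M le_rfl, ← mul_assoc, ← pow_add, hm',
      show (m.2 + (M : ℤ)).toNat = M + m.2.toNat by omega]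

lemma gluedPos_coeff (hI : radical I = J) (i : ZMod n) (x : D.RGlued I i) (m : ℤ × ℤ)
    (hm : m.2 ≤ 0) : (gluedPos I D i x).coeff m
      = tA k I φ i ^ (-m.2).toNat * (fLaur D I i ^ (-m.2).toNat * gluedNeg I D i x).coeff m := by
  obtain ⟨M₀, hM₀⟩ := glued_rows D hI i x
  set M := M₀ + (-m.2).toNat with hMdef
  have hM := hM₀ M (by omega)
  change (laurPos k I φ i x.1.2).coeff m = _ * (_ * laurNeg k I φ i x.1.1).coeff m
  rw [← rayCoeff_posToRay φ i x.1.2 hm]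
  rw [coeff_eq_of_mul (v := fLaur D I i ^ (-m.2).toNat *
    rayCoeff k φ I i (negToRay φ I k i x.1.1)) (pow_mem (fLaur_mem_rowZero (D := D) (I := I) i) (m.2 + M).toNat)
    (pow_mem (fLaur_mem_nonZeroDivisors (D := D) hI i) (m.2 + M).toNat) (r := m.2) (fun m' hm' => ?_) m
    rfl]
  · exact coeff_mul_C_pow _ _ _ _ (r := m.2) (pow_mem (fLaur_mem_rowZero (D := D) (I := I) i) _)
      (fun m' hm' => by rw [rayCoeff_negToRay' φ i _ (by omega), hm']) m rfl
  · rw [← mul_assoc, ← pow_add, show (m.2 + (M : ℤ)).toNat + (-m.2).toNat = M by omega, hM, hm']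

lemma inRow_algebraMap {A : Type*} [CommRing A] (a : A) :
    InRow 0 (algebraMap A (Laurent A) a) := by
  rw [AddMonoidAlgebra.coe_algebraMap]
  exact inRow_single 0 _

lemma inRow_fLaur_pow (i : ZMod n) (r : ℕ) : InRow 0 (fLaur D I i ^ r) := by
  have h := InRow.pow (r := 0) (fLaur_mem_rowZero (D := D) (I := I) i) r
  rwa [mul_zero] at h

lemma negToLoc_base (i : ZMod n) (a : Base (P := P) I k) : D.negToLoc I i (baseNeg φ I k i a)
    = D.posToLoc I i (basePos φ I k i a) := (D.baseGlued I i a).2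

/-- The pair of the monomial `z^m` on `σ_i` and its product with `f_ρ^{⟨n_ρ, m⟩}` on `σ_{i-1}` is a
function near `ρ_i`, for `m` on the side of `σ_i`. -/
lemma exists_glued_of_nonneg (hI : radical I = J) (i : ZMod n) (a : Base (P := P) I k)
    {m : ℤ × ℤ} (hm : 0 ≤ m.2) : ∃ x : D.RGlued I i,
      gluedPos I D i x = AddMonoidAlgebra.single m a ∧ InRow m.2 (gluedNeg I D i x) := by
  have hpos : htPos φ i (m, φ.pos i m) = 0 := sub_self _
  have hq : ((m, φ.pos i m) : (ℤ × ℤ) × L) ∈ monRay φ i := by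
    change φ.pos i m - φ.val i m ∈ P
    rw [PLFun.val, if_pos hm, sub_self]
    exact P.zero_mem
  have hf : D.negToLoc I i (zeroNeg k I φ i (fZero D I i) ^ m.2.toNat)
      = algebraMap _ _ (D.fRay I i) ^ m.2.toNat := by
    rw [map_pow, negToLoc_apply, negToRay_zeroNeg, zeroRay_fZero hI]
  have hmem : ((baseNeg φ I k i a * (zeroNeg k I φ i (fZero D I i) ^ m.2.toNat *
      mono k _ _ ⟨_, hq⟩ 1), basePos φ I k i a * mono k _ _ ⟨_, hq⟩ 1) :
        RNeg φ I k i × RPos φ I k i) ∈ D.RGlued I i := by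
    change D.negToLoc I i (baseNeg φ I k i a * (zeroNeg k I φ i (fZero D I i) ^ m.2.toNat *
        mono k (monRay φ i) (idNeg φ I i) ⟨_, hq⟩ 1))
      = D.posToLoc I i (basePos φ I k i a * mono k (monRay φ i) (idPos φ I i) ⟨_, hq⟩ 1)
    rw [map_mul, map_mul, map_mul, hf, negToLoc_base, negToLoc_apply, negToRay_mono, posToLoc_mono]
    have h : ((fUnit D I i ^ m.2 : (Localization.Away (D.fRay I i))ˣ) :
        Localization.Away (D.fRay I i)) = algebraMap _ _ (D.fRay I i) ^ m.2.toNat := by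
      rw [← val_fUnit, ← Units.val_pow_eq_pow_val, ← zpow_natCast, Int.toNat_of_nonneg hm]
    rw [h]
    ring
  refine ⟨⟨_, hmem⟩, ?_, ?_⟩
  · rw [gluedPos_mk, map_mul, laurPos_base, laurPos_mono, AddMonoidAlgebra.coe_algebraMap,
      Function.comp_apply, AddMonoidAlgebra.single_mul_single]
    have : zA k I ⟨htPos φ i (m, φ.pos i m), monRay_htPos φ i hq⟩ = 1 := by
      rw [← zA_zero]; congr 1; exact Subtype.ext hpos
    rw [this]; simp
  · rw [gluedNeg_mk, map_mul, map_mul, laurNeg_base, map_pow, laurNeg_zeroNeg, laurNeg_mono]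
    have h := (inRow_algebraMap a).mul ((inRow_fLaur_pow D (I := I) i m.2.toNat).mul
      (inRow_single m (zA k I ⟨htNeg φ i (m, φ.pos i m), monRay_htNeg φ i hq⟩)))
    rwa [zero_add, zero_add] at h

/-- The counterpart of `exists_glued_of_nonneg` on the side of `σ_{i-1}`. -/
lemma exists_glued_of_nonpos (hI : radical I = J) (i : ZMod n) (a : Base (P := P) I k)
    {m : ℤ × ℤ} (hm : m.2 ≤ 0) : ∃ x : D.RGlued I i,
      gluedNeg I D i x = AddMonoidAlgebra.single m a ∧ InRow m.2 (gluedPos I D i x) := by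
  have hneg : htNeg φ i (m, φ.neg i m) = 0 := sub_self _
  have hq : ((m, φ.neg i m) : (ℤ × ℤ) × L) ∈ monRay φ i := by
    change φ.neg i m - φ.val i m ∈ P
    rw [PLFun.val_eq_neg, Int.toNat_of_nonpos hm]
    simp
  have hf : D.posToLoc I i (zeroPos k I φ i (fZero D I i) ^ (-m.2).toNat)
      = algebraMap _ _ (D.fRay I i) ^ (-m.2).toNat := by
    rw [map_pow, posToLoc_zeroPos, zeroRay_fZero hI]
  have hmem : ((baseNeg φ I k i a * mono k _ _ ⟨_, hq⟩ 1,
      basePos φ I k i a * (zeroPos k I φ i (fZero D I i) ^ (-m.2).toNat *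
      mono k _ _ ⟨_, hq⟩ 1)) : RNeg φ I k i × RPos φ I k i) ∈ D.RGlued I i := by
    change D.negToLoc I i (baseNeg φ I k i a * mono k (monRay φ i) (idNeg φ I i) ⟨_, hq⟩ 1)
      = D.posToLoc I i (basePos φ I k i a * (zeroPos k I φ i (fZero D I i) ^ (-m.2).toNat *
        mono k (monRay φ i) (idPos φ I i) ⟨_, hq⟩ 1))
    rw [map_mul, map_mul, map_mul, hf, negToLoc_base, negToLoc_apply, negToRay_mono, posToLoc_mono]
    have h : algebraMap _ _ (D.fRay I i) ^ (-m.2).toNat *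
        ((fUnit D I i ^ m.2 : (Localization.Away (D.fRay I i))ˣ) :
        Localization.Away (D.fRay I i)) = 1 := by
      rw [← val_fUnit, ← Units.val_pow_eq_pow_val, ← zpow_natCast,
        Int.toNat_of_nonneg (by omega : 0 ≤ -m.2), ← Units.val_mul, ← zpow_add]
      simp
    rw [mul_left_comm _ _ ((fUnit D I i ^ m.2 : (Localization.Away (D.fRay I i))ˣ) :
        Localization.Away (D.fRay I i)), h, mul_one]
  refine ⟨⟨_, hmem⟩, ?_, ?_⟩
  · rw [gluedNeg_mk, map_mul, laurNeg_base, laurNeg_mono, AddMonoidAlgebra.coe_algebraMap,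
      Function.comp_apply, AddMonoidAlgebra.single_mul_single]
    have : zA k I ⟨htNeg φ i (m, φ.neg i m), monRay_htNeg φ i hq⟩ = 1 := by
      rw [← zA_zero]; congr 1; exact Subtype.ext hneg
    rw [this]; simp
  · rw [gluedPos_mk, map_mul, map_mul, laurPos_base, map_pow, laurPos_mono]
    have h := (inRow_algebraMap a).mul ((inRow_fLaur_pow D (I := I) i (-m.2).toNat).mul
      (inRow_single m (zA k I ⟨htPos φ i (m, φ.neg i m), monRay_htPos φ i hq⟩)))
    rwa [zero_add, zero_add] at h

/-- The fibre product `R_{ρ,I}` is the ring of pairs of Laurent polynomials described by `RayModel`.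
Since `f_ρ` is not a zero divisor, the condition over the localization can be read off row by row.
-/
theorem rayModel_glued (hI : radical I = J) (i : ZMod n) :
    RayModel (R := D.RGlued I i) (tA k I φ i) (fLaur D I i)
      (gluedNeg I D i : D.RGlued I i →+* Laurent (Base (P := P) I k))
      (gluedPos I D i : D.RGlued I i →+* Laurent (Base (P := P) I k)) where
  f_mem := fLaur_mem_rowZero i
  nonneg := gluedNeg_coeff D hI i
  nonpos := gluedPos_coeff D hI i
  inj x hN hP := by
    refine Subtype.ext (Prod.ext ?_ ?_)
    · exact laurNeg_injective k I φ i (hN.trans (map_zero (laurNeg k I φ i)).symm)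
    · exact laurPos_injective k I φ i (hP.trans (map_zero (laurPos k I φ i)).symm)
  lift Z := by
    change ∃ x, (∀ m : ℤ × ℤ, 0 ≤ m.2 → (gluedPos I D i x).coeff m = Z.coeff m) ∧
      ∀ m : ℤ × ℤ, m.2 ≤ 0 → (gluedNeg I D i x).coeff m = Z.coeff m
    induction Z using AddMonoidAlgebra.induction_linear with
    | zero => exact ⟨0, fun m _ => by simp, fun m _ => by simp⟩
    | add a b ha hb =>
      obtain ⟨x, hx, hx'⟩ := ha
      obtain ⟨y, hy, hy'⟩ := hb
      refine ⟨x + y, fun m hm => ?_, fun m hm => ?_⟩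
      · rw [map_add, AddMonoidAlgebra.coeff_add, Finsupp.add_apply, hx m hm, hy m hm]; simp
      · rw [map_add, AddMonoidAlgebra.coeff_add, Finsupp.add_apply, hx' m hm, hy' m hm]; simp
    | single m a =>
      by_cases hm : 0 ≤ m.2
      · obtain ⟨x, hx, hx'⟩ := exists_glued_of_nonneg D hI i a hm
        refine ⟨x, fun m' _ => by rw [hx], fun m' hm' => ?_⟩
        by_cases h : m'.2 = m.2
        · rw [gluedNeg_coeff D hI i x m' (by omega), hx, h, show m.2 = 0 by omega]
          simp
        · rw [hx' m' h, inRow_single m a m' h]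
      · obtain ⟨x, hx, hx'⟩ := exists_glued_of_nonpos D hI i a (not_le.mp hm).le
        refine ⟨x, fun m' hm' => ?_, fun m' _ => by rw [hx]⟩
        have h : m'.2 ≠ m.2 := by omega
        rw [hx' m' h, inRow_single m a m' h]

end Glued
end MirrorFamily

namespace MirrorFamily

/-! ### Morphisms to affine schemes -/

section Glob

/-- The spectrum as a locally ringed space. -/
abbrev specL (R : CommRingCat.{u}) : LocallyRingedSpace.{u} := (Spec R).toLocallyRingedSpace

/-- The morphism of spectra induced by a ring map. -/
def specMapL {R S : CommRingCat.{u}} (β : R ⟶ S) : specL S ⟶ specL R := (Spec.map β).toLRSHom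

lemma specMapL_comp {R S T : CommRingCat.{u}} (β : R ⟶ S) (γ : S ⟶ T) :
    specMapL (β ≫ γ) = specMapL γ ≫ specMapL β := by
  rw [specMapL, Spec.map_comp]; rfl

lemma specMapL_injective {R S : CommRingCat.{u}} {β γ : R ⟶ S} (h : specMapL β = specMapL γ) :
    β = γ :=
  Spec.map_injective (Scheme.Hom.ext' h)

/-- The identification of `R` with the global functions on its spectrum. -/
def specInv (R : CommRingCat.{u}) : R ⟶ LocallyRingedSpace.Γ.obj (op (specL R)) :=
  (Scheme.ΓSpecIso R).inv

/-- The identification of the global functions on the spectrum of `R` with `R`. -/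
def specHom (R : CommRingCat.{u}) : LocallyRingedSpace.Γ.obj (op (specL R)) ⟶ R :=
  (Scheme.ΓSpecIso R).hom

lemma specInv_hom (R : CommRingCat.{u}) : specInv R ≫ specHom R = 𝟙 R :=
  (Scheme.ΓSpecIso R).inv_hom_id

lemma specHom_inv (R : CommRingCat.{u}) : specHom R ≫ specInv R = 𝟙 _ :=
  (Scheme.ΓSpecIso R).hom_inv_id

/-- The ring map `R → Γ(X, 𝒪)` given by a morphism `X → Spec R` of locally ringed spaces. -/
def glob {X : LocallyRingedSpace.{u}} {R : CommRingCat.{u}} (f : X ⟶ specL R) :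
    R ⟶ LocallyRingedSpace.Γ.obj (op X) :=
  specInv R ≫ LocallyRingedSpace.Γ.map f.op

lemma glob_ext {X : LocallyRingedSpace.{u}} {R : CommRingCat.{u}}
    {f g : X ⟶ specL R} (h : glob f = glob g) : f = g :=
  (ΓSpec.locallyRingedSpaceAdjunction.homEquiv X (.op R)).symm.injective <|
    Opposite.unop_injective h

lemma glob_comp {X Y : LocallyRingedSpace.{u}} {R : CommRingCat.{u}} (h : X ⟶ Y)
    (f : Y ⟶ specL R) :
    glob (h ≫ f) = glob f ≫ LocallyRingedSpace.Γ.map h.op := by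
  rw [glob, glob, op_comp, Functor.map_comp, Category.assoc]

lemma glob_specMapL {R S : CommRingCat.{u}} (β : R ⟶ S) :
    glob (specMapL β) = β ≫ specInv S :=
  (Scheme.ΓSpecIso_inv_naturality β).symm

/-- The canonical morphism to the spectrum of the ring of global functions. -/
def toSpecG (X : LocallyRingedSpace.{u}) : X ⟶ specL (LocallyRingedSpace.Γ.obj (op X)) := X.toΓSpec

lemma glob_toSpecG (X : LocallyRingedSpace.{u}) : glob (toSpecG X) = 𝟙 _ :=
  ΓSpec.left_triangle X

lemma exists_glob {X : LocallyRingedSpace.{u}} {R : CommRingCat.{u}}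
    (α : R ⟶ LocallyRingedSpace.Γ.obj (op X)) :
    ∃ f : X ⟶ specL R, glob f = α := by
  refine ⟨toSpecG X ≫ specMapL α, ?_⟩
  have h := glob_toSpecG X
  rw [glob] at h
  rw [glob_comp, glob_specMapL, Category.assoc, h, Category.comp_id]

end Glob

namespace ScatteringDiagram

variable {k : Type u} [Field k] {n : ℕ} {L : Type u} [AddCommGroup L] {P : AddSubmonoid L}
  {φ : PLFun n P} {J : AddSemigroupIdeal P} (D : ScatteringDiagram φ k J) {I : AddSemigroupIdeal P}
  (hI : radical I = J) (d : ZMod n → ℤ)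

variable (I) in
/-- The ring of functions near `ρ_i`, as an object of the category of rings. -/
abbrev catGlued (i : ZMod n) : CommRingCat.{u} := CommRingCat.of (D.RGlued I i)

variable (φ k I) in
/-- The ring of functions on the cone `σ_i`, as an object of the category of rings. -/
abbrev catCone (i : ZMod n) : CommRingCat.{u} := CommRingCat.of (RCone φ I k i)

/-- The ring of functions on `X°`. -/
abbrev catFun : CommRingCat.{u} := LocallyRingedSpace.Γ.obj (op (D.Xo hI d))

/-- The chart as a morphism out of a spectrum. -/
def chartL (i : ZMod n) : specL (D.catGlued I i) ⟶ D.Xo hI d := D.chart hI d i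

/-- The canonical morphism to the spectrum of the ring of functions. -/
def toXL : D.Xo hI d ⟶ specL (D.catFun hI d) := toSpecG _

/-- Restriction to a chart as a morphism of rings. -/
def restrictHom (i : ZMod n) : D.catFun hI d ⟶ D.catGlued I i :=
  LocallyRingedSpace.Γ.map (D.chartL hI d i).op ≫ specHom _

/-- The ring map `θ ∘ ψ_{ρ_i,+}`. -/
def homU (i : ZMod n) : D.catGlued I i ⟶ catCone k φ I i :=
  CommRingCat.ofHom
    (((D.theta hI i Set.univ).comp (D.psiPos I i) : D.RGlued I i →ₐ[k] RCone φ I k i) :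
      D.RGlued I i →+* RCone φ I k i)

variable (I) in
/-- The ring map `ψ_{ρ_{i+1},-}`. -/
def homUSucc (i : ZMod n) : D.catGlued I (i + 1) ⟶ catCone k φ I i :=
  CommRingCat.ofHom
    ((D.psiNeg I d i : D.RGlued I (i + 1) →ₐ[k] RCone φ I k i) :
      D.RGlued I (i + 1) →+* RCone φ I k i)

lemma homU_apply (i : ZMod n) (x : D.RGlued I i) :
    (D.homU hI i).hom x = D.theta hI i Set.univ (D.psiPos I i x) := rfl

lemma homUSucc_apply (i : ZMod n) (x : D.RGlued I (i + 1)) :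
    (D.homUSucc I d i).hom x = D.psiNeg I d i x := rfl

lemma chart_toX (i : ZMod n) :
    D.chartL hI d i ≫ D.toXL hI d = specMapL (D.restrictHom hI d i) := by
  apply glob_ext
  have h : glob (D.toXL hI d) = 𝟙 _ := glob_toSpecG _
  rw [glob_specMapL, glob_comp, h, restrictHom, Category.assoc, specHom_inv, Category.id_comp,
    Category.comp_id]

lemma sigma_ι_desc {ι : Type} (U : ι → LocallyRingedSpace.{u}) {Z : LocallyRingedSpace.{u}}
    (f : ∀ i, U i ⟶ Z) (i : ι) : Limits.Sigma.ι U i ≫ Limits.Sigma.desc f = f i := by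
  simp

lemma toU_chart (i : ZMod n) :
    specMapL (D.homU hI i) ≫ D.chartL hI d i
      = specMapL (D.homUSucc I d i) ≫ D.chartL hI d (i + 1) := by
  have h := Limits.coequalizer.condition
    (Limits.Sigma.desc fun i => D.toU hI i ≫ Limits.Sigma.ι (D.U I) i)
    (Limits.Sigma.desc fun i => D.toUSucc I d i ≫ Limits.Sigma.ι (D.U I) (i + 1))
  have h2 := congrArg (fun f => Limits.Sigma.ι (fun i => UCone φ k I i) i ≫ f) h
  simp only [← Category.assoc, sigma_ι_desc] at h2
  simp only [Category.assoc] at h2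
  exact h2

lemma chart_structureMap (i : ZMod n) : D.chartL hI d i ≫ D.structureMap hI d
    = specMapL (CommRingCat.ofHom ((D.baseGlued I i : Base (P := P) I k →ₐ[k] D.RGlued I i) :
      Base (P := P) I k →+* D.RGlued I i)) := by
  have h : coequalizer.π (Limits.Sigma.desc fun i => D.toU hI i ≫ Limits.Sigma.ι (D.U I) i)
    (Limits.Sigma.desc fun i => D.toUSucc I d i ≫ Limits.Sigma.ι (D.U I) (i + 1))
      ≫ D.structureMap hI d = Limits.Sigma.desc fun i => D.baseU I i :=
    Limits.coequalizer.π_desc _ _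
  have h2 := congrArg (fun f => Limits.Sigma.ι (D.U I) i ≫ f) h
  simp only [sigma_ι_desc] at h2
  exact (Category.assoc _ _ _).trans h2

lemma Xo_hom_ext {Z : LocallyRingedSpace.{u}} {f g : D.Xo hI d ⟶ Z}
    (h : ∀ i, D.chartL hI d i ≫ f = D.chartL hI d i ≫ g) : f = g := by
  apply Limits.coequalizer.hom_ext
  apply Limits.Sigma.hom_ext
  intro i
  exact (Category.assoc _ _ _).symm.trans ((h i).trans (Category.assoc _ _ _))

lemma exists_Xo_desc {Z : LocallyRingedSpace.{u}} (f : ∀ i, specL (D.catGlued I i) ⟶ Z)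
    (hf : ∀ i, specMapL (D.homU hI i) ≫ f i = specMapL (D.homUSucc I d i) ≫ f (i + 1)) :
    ∃ F : D.Xo hI d ⟶ Z, ∀ i, D.chartL hI d i ≫ F = f i := by
  let f' : ∀ i, D.U I i ⟶ Z := f
  have hf' : ∀ i, D.toU hI i ≫ f' i = D.toUSucc I d i ≫ f' (i + 1) := hf
  let F : D.Xo hI d ⟶ Z := coequalizer.desc (Limits.Sigma.desc f') (by
      apply Limits.Sigma.hom_ext
      intro i
      simp only [Limits.colimit.ι_desc_assoc, Limits.Cofan.mk_ι_app, Category.assoc,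
        Limits.colimit.ι_desc]
      exact hf' i)
  refine ⟨F, fun i => ?_⟩
  have h : coequalizer.π (Limits.Sigma.desc fun i => D.toU hI i ≫ Limits.Sigma.ι (D.U I) i)
    (Limits.Sigma.desc fun i => D.toUSucc I d i ≫ Limits.Sigma.ι (D.U I) (i + 1))
      ≫ F = Limits.Sigma.desc f' := Limits.coequalizer.π_desc _ _
  have h2 := congrArg (fun f => Limits.Sigma.ι (D.U I) i ≫ f) h
  simp only [sigma_ι_desc] at h2
  exact (Category.assoc _ _ _).trans h2

lemma glob_restrictHom {R : CommRingCat.{u}} (f : D.Xo hI d ⟶ specL R) (i : ZMod n)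
    {β : R ⟶ D.catGlued I i} (h : D.chartL hI d i ≫ f = specMapL β) :
    (glob f : R ⟶ D.catFun hI d) ≫ D.restrictHom hI d i = β := by
  have h2 := congrArg glob h
  rw [glob_comp, glob_specMapL] at h2
  have h3 := congrArg (fun f => f ≫ specHom _) h2
  simp only [Category.assoc, specInv_hom, Category.comp_id] at h3
  exact h3

lemma restrict_base (i : ZMod n) (a : Base (P := P) I k) :
    D.restrict hI d i (algebraMap _ (D.Functions hI d) a) = D.baseGlued I i a :=
  RingHom.congr_fun (congrArg CommRingCat.Hom.hom
    (D.glob_restrictHom hI d (D.structureMap hI d) i (D.chart_structureMap hI d i))) a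

lemma restrictHom_compat (i : ZMod n) : D.restrictHom hI d i ≫ D.homU hI i
    = D.restrictHom hI d (i + 1) ≫ D.homUSucc I d i := by
  have h := congrArg (fun f => f ≫ D.toXL hI d) (D.toU_chart hI d i)
  simp only [Category.assoc, chart_toX] at h
  apply specMapL_injective
  rw [specMapL_comp, specMapL_comp, h]

lemma restrict_compat (i : ZMod n) (g : D.Functions hI d) :
    D.theta hI i Set.univ (D.psiPos I i (D.restrict hI d i g))
      = D.psiNeg I d i (D.restrict hI d (i + 1) g) :=
  RingHom.congr_fun (congrArg CommRingCat.Hom.hom (D.restrictHom_compat hI d i)) g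

/-- The families of functions on the charts that agree on the overlaps. -/
def families : Subring (∀ i, D.RGlued I i) where
  carrier := {x | ∀ i, D.theta hI i Set.univ (D.psiPos I i (x i)) = D.psiNeg I d i (x (i + 1))}
  mul_mem' ha hb i := by simp only [Pi.mul_apply, map_mul, ha i, hb i]
  one_mem' i := by simp
  add_mem' ha hb i := by simp only [Pi.add_apply, map_add, ha i, hb i]
  zero_mem' i := by simp
  neg_mem' ha i := by simp only [Pi.neg_apply, map_neg, ha i]

/-- The projection of a compatible family to a chart. -/
def familiesProj (i : ZMod n) : CommRingCat.of (D.families hI d) ⟶ D.catGlued I i :=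
  CommRingCat.ofHom ((Pi.evalRingHom (fun i => D.RGlued I i) i).comp (D.families hI d).subtype)

lemma exists_families_hom : ∃ G : CommRingCat.of (D.families hI d) ⟶ D.catFun hI d,
    ∀ i, G ≫ D.restrictHom hI d i = D.familiesProj hI d i := by
  obtain ⟨F, hF⟩ := D.exists_Xo_desc hI d (fun i => specMapL (D.familiesProj hI d i)) (fun i => by
    rw [← specMapL_comp, ← specMapL_comp]
    congr 1
    exact CommRingCat.hom_ext (RingHom.ext fun x => x.2 i))
  exact ⟨glob F, fun i => D.glob_restrictHom hI d F i (hF i)⟩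

lemma exists_restrict_eq (x : ∀ i, D.RGlued I i)
    (hx : ∀ i, D.theta hI i Set.univ (D.psiPos I i (x i)) = D.psiNeg I d i (x (i + 1))) :
    ∃ g : D.Functions hI d, ∀ i, D.restrict hI d i g = x i := by
  obtain ⟨G, hG⟩ := D.exists_families_hom hI d
  refine ⟨G.hom ⟨x, hx⟩, fun i => ?_⟩
  exact RingHom.congr_fun (congrArg CommRingCat.Hom.hom (hG i)) ⟨x, hx⟩

lemma hom_Functions_ext {R : CommRingCat.{u}} {α β : R ⟶ D.catFun hI d}
    (h : ∀ i, α ≫ D.restrictHom hI d i = β ≫ D.restrictHom hI d i) : α = β := by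
  obtain ⟨f, rfl⟩ := exists_glob (X := D.Xo hI d) α
  obtain ⟨g, rfl⟩ := exists_glob (X := D.Xo hI d) β
  congr 1
  apply D.Xo_hom_ext
  intro i
  apply glob_ext
  rw [glob_comp, glob_comp]
  have h2 := congrArg (fun f => f ≫ specInv _) (h i)
  simp only [restrictHom, Category.assoc, specHom_inv, Category.comp_id] at h2
  exact h2

lemma restrict_injective {g h : D.Functions hI d}
    (hgh : ∀ i, D.restrict hI d i g = D.restrict hI d i h) : g = h := by
  obtain ⟨G, hG⟩ := D.exists_families_hom hI d
  let ρ : D.catFun hI d ⟶ CommRingCat.of (D.families hI d) :=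
    CommRingCat.ofHom ((RingHom.pi fun i => (D.restrictHom hI d i).hom).codRestrict
      (D.families hI d) fun g i => D.restrict_compat hI d i g)
  have key : ρ ≫ G = 𝟙 (D.catFun hI d) := by
    apply D.hom_Functions_ext
    intro i
    rw [Category.assoc, hG, Category.id_comp]
    rfl
  have hρ : ρ.hom g = ρ.hom h := Subtype.ext (funext hgh)
  have h4 := fun x => RingHom.congr_fun (congrArg CommRingCat.Hom.hom key) x
  exact (h4 g).symm.trans ((congrArg G.hom hρ).trans (h4 h))

end ScatteringDiagram
end MirrorFamily

namespace MirrorFamily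

/-! ### Wall crossing modulo `J` -/

section Theta

open ScatteringDiagram

variable {k : Type u} [Field k] {n : ℕ} {L : Type u} [AddCommGroup L] {P : AddSubmonoid L}
  {φ : PLFun n P} {J : AddSemigroupIdeal P} (D : ScatteringDiagram φ k J) {I : AddSemigroupIdeal P}
  (hI : radical I = J) (d : ZMod n → ℤ)

variable (k I) in
/-- `k[P]/I` is Noetherian. -/
lemma isNoetherianRing_base (hP : P.FG) : IsNoetherianRing (Base (P := P) I k) := by
  have : AddMonoid.FG P := (AddMonoid.fg_iff_addSubmonoid_fg P).mpr hP
  have h : Algebra.FiniteType k (AddMonoidAlgebra k P) := inferInstance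
  have : IsNoetherianRing (AddMonoidAlgebra k P) := Algebra.FiniteType.isNoetherianRing k _
  infer_instance

lemma exists_idealOf_pow (hP : P.FG) (hI : radical I = J) : ∃ M : ℕ, idealOf k I J ^ M = ⊥ := by
  have := isNoetherianRing_base k (I := I) hP
  have hle : idealOf k I J ≤ nilradical (Base (P := P) I k) := by
    rw [idealOf, Ideal.span_le]
    rintro _ ⟨p, hp, rfl⟩
    rw [← hI] at hp
    obtain ⟨m, -, hm⟩ := hp
    refine ⟨m, ?_⟩
    rw [← zA_nsmul]
    exact zA_eq_zero (mem_elems.mpr hm)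
  obtain ⟨M, hM⟩ := IsNoetherianRing.isNilpotent_nilradical (Base (P := P) I k)
  exact ⟨M, le_bot_iff.mp ((Ideal.pow_right_mono hle M).trans (le_of_eq hM))⟩

lemma ideal_pow_succ' {A : Type*} [CommRing A] (K : Ideal A) (r : ℕ) : K ^ (r + 1) = K * K ^ r :=
  pow_succ' K r

variable (k φ) in
/-- The functions on `σ_i` whose Laurent coefficients lie in `K`. -/
def coneLevel (i : ZMod n) (K : Ideal (Base (P := P) I k)) : Ideal (RCone φ I k i) :=
  (coeffIn K).comap (laurCone k I φ i)

include hI in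
/-- The wall functions in the interior of a cone are `1` modulo `J`. -/
lemma fCone_sub_one_mem (i : ZMod n) {s : ℚ≥0} (hs : s ≠ 0) :
    D.fCone I i s - 1 ∈ coneLevel k φ i (idealOf k I J) := by
  rw [fCone]
  refine finprod_mem_induction
    (p := fun x => x - 1 ∈ coneLevel k φ i (idealOf k I J)) ?_ ?_ ?_
  · rw [sub_self]; exact zero_mem _
  · intro x y hx hy
    have : x * y - 1 = (x - 1) * y + (y - 1) := by ring
    rw [this]
    exact add_mem (Ideal.mul_mem_right _ _ hx) hy
  · rintro r ⟨-, rfl, rfl⟩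
    have hfin := r.summable I hI
    have hcong := r.congr_one (Or.inl hs)
    rw [tauIdeal, if_neg hs] at hcong
    simp only [tauIdeal, if_neg hs] at hfin
    obtain ⟨F, hF, h⟩ := ofCoeff_eq_one_add (S := monCone φ r.cone) r.coeff_zero hfin
    rw [h, add_sub_cancel_left]
    refine Ideal.sum_mem _ fun q hq => ?_
    rw [mono_eq_smul]
    refine Submodule.smul_of_tower_mem _ _ ?_
    change laurCone k I φ r.cone _ ∈ coeffIn _
    rw [laurCone_mono]
    intro m
    rw [laurent_coeff_single]
    split_ifs
    · exact zA_mem_idealOf (hcong q (by simpa using (hF q hq).1) (hF q hq).2.1).2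
    · exact zero_mem _

lemma zpow_sub_one_mem {A : Type*} [CommRing A] {𝔠 : Ideal A} {w : Aˣ} (hw : (w : A) - 1 ∈ 𝔠)
    (N : ℤ) : ((w ^ N : Aˣ) : A) - 1 ∈ 𝔠 := by
  have h : Units.map (Ideal.Quotient.mk 𝔠 : A →* A ⧸ 𝔠) w = 1 := by
    ext
    exact (Ideal.Quotient.eq (x := (w : A)) (y := 1)).mpr hw
  have h2 : Units.map (Ideal.Quotient.mk 𝔠 : A →* A ⧸ 𝔠) (w ^ N) = 1 := by
    rw [map_zpow, h, one_zpow]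
  exact (Ideal.Quotient.eq (y := 1)).mp (congrArg Units.val h2)

lemma twist_sub_mem {M : Type u} [AddCommGroup M] {S : AddSubmonoid M} {T : Set M} {A : Type u}
    [CommRing A] [Algebra k A] {𝔠 : Ideal A} (h : MonAlg k S T →ₐ[k] A) {w : Aˣ}
    (hw : (w : A) - 1 ∈ 𝔠) (N : M →+ ℤ) (x : MonAlg k S T) :
    MonAlg.twist h w N x - h x ∈ 𝔠 := by
  refine MonAlg.induction_on (p := fun x => MonAlg.twist h w N x - h x ∈ 𝔠) x ?_ ?_ ?_
  · simp
  · intro x y hx hy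
    rw [map_add, map_add, add_sub_add_comm]
    exact add_mem hx hy
  · intro s c
    rw [mono_eq_smul, map_smul, map_smul, ← smul_sub, MonAlg.twist_mono, ← mul_sub_one]
    exact Submodule.smul_of_tower_mem _ _ (Ideal.mul_mem_left _ _ (zpow_sub_one_mem hw _))

lemma thetaRay_sub_mem (i : ZMod n) (s : ℚ≥0) (x : RCone φ I k i) :
    D.thetaRay hI i s x - x ∈ coneLevel k φ i (idealOf k I J) := by
  unfold thetaRay
  split_ifs with hs
  · have hw : (((D.isUnit_fCone hI i hs).unit : (RCone φ I k i)ˣ) : RCone φ I k i) - 1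
        ∈ coneLevel k φ i (idealOf k I J) := fCone_sub_one_mem D hI i hs
    have h := twist_sub_mem (AlgHom.id k (RCone φ I k i)) hw
    simp only [AlgHom.id_apply] at h
    apply h
  · simp

lemma theta_sub_mem_coneLevel (i : ZMod n) (T : Set ℚ≥0) (x : RCone φ I k i) :
    D.theta hI i T x - x ∈ coneLevel k φ i (idealOf k I J) := by
  have key : ∀ (l : List ℚ≥0) (g : RCone φ I k i →ₐ[k] RCone φ I k i),
      (∀ x, g x - x ∈ coneLevel k φ i (idealOf k I J)) →
      ∀ x, l.foldl (fun g s => (D.thetaRay hI i s).comp g) g x - x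
        ∈ coneLevel k φ i (idealOf k I J) := by
    intro l
    induction l with
    | nil => intro g hg; exact hg
    | cons s l ih =>
      intro g hg
      refine ih _ fun x => ?_
      rw [AlgHom.comp_apply]
      have := add_mem (thetaRay_sub_mem D hI i s (g x)) (hg x)
      rwa [sub_add_sub_cancel] at this
  exact key _ _ (fun x => by simp) x

lemma theta_baseCone (i : ZMod n) (T : Set ℚ≥0) (a : Base (P := P) I k) :
    D.theta hI i T (baseCone φ I k i a) = baseCone φ I k i a :=
  DFunLike.congr_fun (D.theta_base hI i T) a

/-- Wall crossing is the identity modulo `J`. -/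
lemma theta_sub_mem {i : ZMod n} (T : Set ℚ≥0) {K : Ideal (Base (P := P) I k)}
    {x : RCone φ I k i} (hx : laurCone k I φ i x ∈ coeffIn K) :
    laurCone k I φ i (D.theta hI i T x - x) ∈ coeffIn (idealOf k I J * K) := by
  classical
  choose z hz using fun m : ℤ × ℤ =>
    laurCone_surjective k I φ i (AddMonoidAlgebra.single m (1 : Base (P := P) I k))
  have hsum : x = ∑ m ∈ (laurCone k I φ i x).coeff.support,
      baseCone φ I k i ((laurCone k I φ i x).coeff m) * z m := by
    apply laurCone_injective k I φ i
    rw [map_sum]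
    conv_lhs => rw [← (laurCone k I φ i x).sum_coeff_single]
    refine Finset.sum_congr rfl fun m _ => ?_
    rw [map_mul, laurCone_base, hz, AddMonoidAlgebra.coe_algebraMap, Function.comp_apply,
      AddMonoidAlgebra.single_mul_single]
    simp
  rw [hsum, map_sum, ← Finset.sum_sub_distrib, map_sum]
  refine Ideal.sum_mem _ fun m _ => ?_
  rw [map_mul, theta_baseCone, ← mul_sub, map_mul, laurCone_base, mul_comm (idealOf k I J)]
  refine mul_mem_coeffIn (fun m' => ?_) (theta_sub_mem_coneLevel D hI i T (z m))
  rw [AddMonoidAlgebra.coe_algebraMap, Function.comp_apply, laurent_coeff_single]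
  split_ifs
  · exact hx m
  · exact zero_mem _

lemma eq_zero_of_mem_levels {i : ZMod n} (hP : P.FG) (hI : radical I = J) {x : RCone φ I k i}
    (h : ∀ r : ℕ, laurCone k I φ i x ∈ coeffIn (idealOf k I J ^ r)) : x = 0 := by
  obtain ⟨M, hM⟩ := exists_idealOf_pow (k := k) hP hI
  apply laurCone_injective k I φ i
  rw [map_zero]
  ext m
  have := h M m
  rw [hM] at this
  simpa using this

/-- Wall crossing is bijective, being the identity modulo a nilpotent ideal. -/
lemma theta_bijective (hP : P.FG) (i : ZMod n) (T : Set ℚ≥0) :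
    Function.Bijective (D.theta hI i T) := by
  constructor
  · rw [injective_iff_map_eq_zero]
    intro x hx
    refine eq_zero_of_mem_levels hP hI fun r => ?_
    induction r with
    | zero => simp [coeffIn, Submodule.mem_mk]
    | succ r ih =>
      have h := theta_sub_mem D hI T ih
      rw [hx, zero_sub, map_neg, neg_mem_iff] at h
      rwa [ideal_pow_succ']
  · intro y
    have key : ∀ r : ℕ, ∃ x, laurCone k I φ i (D.theta hI i T x - y)
        ∈ coeffIn (idealOf k I J ^ r) := by
      intro r
      induction r with
      | zero => exact ⟨0, by simp [coeffIn, Submodule.mem_mk]⟩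
      | succ r ih =>
        obtain ⟨x, hx⟩ := ih
        refine ⟨x - (D.theta hI i T x - y), ?_⟩
        have h := theta_sub_mem D hI T hx
        have h2 : D.theta hI i T (x - (D.theta hI i T x - y)) - y
            = -(D.theta hI i T (D.theta hI i T x - y) - (D.theta hI i T x - y)) := by
          rw [map_sub]; ring
        rw [h2, map_neg, neg_mem_iff, ideal_pow_succ']
        exact h
    obtain ⟨M, hM⟩ := exists_idealOf_pow (k := k) hP hI
    obtain ⟨x, hx⟩ := key M
    refine ⟨x, ?_⟩
    rw [← sub_eq_zero]
    apply laurCone_injective k I φ i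
    rw [map_zero]
    ext m
    have := hx m
    rw [hM] at this
    simpa using this

end Theta

/-! ### The atlas of the ring of functions -/

section Atlas

open ScatteringDiagram

variable {k : Type u} [Field k] {n : ℕ} {L : Type u} [AddCommGroup L] {P : AddSubmonoid L}
  {φ : PLFun n P} {J : AddSemigroupIdeal P} (D : ScatteringDiagram φ k J) {I : AddSemigroupIdeal P}
  (hI : radical I = J) (d : ZMod n → ℤ)

lemma gluedPos_base (i : ZMod n) (a : Base (P := P) I k) :
    gluedPos I D i (D.baseGlued I i a) = algebraMap _ _ a := laurPos_base φ i a

/-- A function on `X°`, restricted to the torus of `σ_j` through the chart of `ρ_j`. -/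
def yMap (j : ZMod n) :
    D.Functions hI d →ₐ[Base (P := P) I k] Laurent (Base (P := P) I k) where
  toRingHom := ((gluedPos I D j : D.RGlued I j →+* _)).comp (D.restrict hI d j)
  commutes' a := by
    change gluedPos I D j (D.restrict hI d j (algebraMap _ _ a)) = _
    rw [D.restrict_base, gluedPos_base]

lemma yMap_apply (j : ZMod n) (g : D.Functions hI d) :
    yMap D hI d j g = gluedPos I D j (D.restrict hI d j g) := rfl

lemma laurCone_psiPos_restrict (j : ZMod n) (g : D.Functions hI d) :
    laurCone k I φ j (D.psiPos I j (D.restrict hI d j g)) = yMap D hI d j g :=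
  laurCone_psiPos D j _

lemma gluedNeg_restrict (j : ZMod n) (g : D.Functions hI d) :
    gluedNeg I D (j + 1) (D.restrict hI d (j + 1) g) = reglue _ d j
      (laurCone k I φ j (D.theta hI j Set.univ (D.psiPos I j (D.restrict hI d j g)))) := by
  rw [D.restrict_compat, reglue_psiNeg]

lemma gluedNeg_restrict_sub_mem (j : ZMod n) (g : D.Functions hI d)
    {K : Ideal (Base (P := P) I k)} (hg : yMap D hI d j g ∈ coeffIn K) (m : ℤ × ℤ) :
    (gluedNeg I D (j + 1) (D.restrict hI d (j + 1) g)).coeff (glueΛ d j m)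
      - (yMap D hI d j g).coeff m ∈ idealOf k I J * K := by
  rw [gluedNeg_restrict, reglue_coeff]
  have h := theta_sub_mem D hI Set.univ (i := j) (K := K)
    (x := D.psiPos I j (D.restrict hI d j g)) (by rwa [laurCone_psiPos_restrict]) m
  rw [map_sub, laurCone_psiPos_restrict] at h
  simpa using h

lemma tA_mem_or (hI : radical I = J) (i : ZMod n) : tA k I φ i ∈ idealOf k I J ∨
    fLaur D I i - 1 ∈ coeffIn (idealOf k I J) := by
  by_cases h : φ.bend i ∈ J
  · exact Or.inl (zA_mem_idealOf (mem_elems.mpr h))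
  · exact Or.inr (fLaur_sub_one_mem hI h)

lemma pow_mul_coeff_sub_mem {A : Type*} [CommRing A] {t : A} {f X : Laurent A} {𝔍 K : Ideal A}
    (h : t ∈ 𝔍 ∨ f - 1 ∈ coeffIn 𝔍) (hX : X ∈ coeffIn K) (r : ℕ) (m : ℤ × ℤ) :
    t ^ r * (f ^ r * X).coeff m - t ^ r * X.coeff m ∈ 𝔍 * K := by
  have h1 : (f ^ r * X).coeff m - X.coeff m = ((f ^ r - 1) * X).coeff m := by
    rw [sub_mul, one_mul]; simp
  rw [← mul_sub, h1]
  rcases h with h | h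
  · rcases Nat.eq_zero_or_pos r with rfl | hr
    · simp
    · exact Ideal.mul_mem_mul (Ideal.pow_mem_of_mem _ h r hr) (Ideal.mul_mem_left _ _ hX m)
  · exact Ideal.mul_mem_left _ _ (mul_mem_coeffIn (pow_sub_one_mem h r) hX m)

lemma psiPos_restrict_eq_zero {g : D.Functions hI d} (i : ZMod n) (hg : yMap D hI d i g = 0) :
    D.psiPos I i (D.restrict hI d i g) = 0 := by
  rw [← laurCone_psiPos_restrict] at hg
  exact (map_eq_zero_iff _ (laurCone_injective k I φ i)).mp hg

lemma gluedNeg_restrict_eq_zero {g : D.Functions hI d} (i : ZMod n) (hg : yMap D hI d i g = 0) :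
    gluedNeg I D (i + 1) (D.restrict hI d (i + 1) g) = 0 := by
  rw [gluedNeg_restrict, psiPos_restrict_eq_zero D hI d i hg, map_zero, map_zero, map_zero]

lemma glued_inj (hI : radical I = J) (i : ZMod n) (x : D.RGlued I i)
    (h1 : gluedNeg I D i x = 0) (h2 : gluedPos I D i x = 0) : x = 0 := by
  have h := (rayModel_glued D hI i).inj x
  simp only [RingHom.coe_coe] at h
  exact h h1 h2

lemma restrict_eq_zero {g : D.Functions hI d} (hg : ∀ j, yMap D hI d j g = 0) (i : ZMod n) :
    D.restrict hI d (i + 1) g = 0 := by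
  have h1 := gluedNeg_restrict_eq_zero D hI d i (hg i)
  have h2 := hg (i + 1)
  rw [yMap_apply] at h2
  generalize D.restrict hI d (i + 1) g = x at h1 h2 ⊢
  exact glued_inj D hI (i + 1) x h1 h2

lemma yMap_injective {g : D.Functions hI d} (hg : ∀ j, yMap D hI d j g = 0) : g = 0 := by
  refine D.restrict_injective hI d fun j => ?_
  have h := restrict_eq_zero D hI d hg (j - 1)
  rw [sub_add_cancel] at h
  rw [h, map_zero]

/-- The functions on `X°` through their restrictions to the tori of the cones. -/
def atlas : ConeAtlas d (tA k I φ) (raysI φ I) (idealOf k I J) (D.Functions hI d) where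
  y := yMap D hI d
  inj g hg := yMap_injective D hI d hg
  rel K g hg := by
    have hN : ∀ j, gluedNeg I D (j + 1) (D.restrict hI d (j + 1) g) ∈ coeffIn K := by
      intro j m
      have h := gluedNeg_restrict_sub_mem D hI d j g (hg j) ((glueΛ d j).symm m)
      rw [AddEquiv.apply_symm_apply] at h
      exact (Submodule.sub_mem_iff_left _ (hg j _)).mp (Ideal.mul_le_right h)
    constructor
    · intro j m hm
      have h4 : (glueΛ d j m).2 = -m.1 := rfl
      have h1 := gluedNeg_restrict_sub_mem D hI d j g (hg j) m
      rw [gluedNeg_coeff D hI _ _ _ (by rw [glueΛ_apply]; simpa using hm), ← yMap_apply, h4] at h1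
      have h2 := pow_mul_coeff_sub_mem (tA_mem_or D hI (j + 1)) (hg (j + 1)) (-m.1).toNat
        (glueΛ d j m)
      have h3 := sub_mem h2 h1
      rwa [sub_sub_sub_cancel_left] at h3
    · intro j m hm
      have h1 := gluedNeg_restrict_sub_mem D hI d j g (hg j) m
      have h2 := pow_mul_coeff_sub_mem (tA_mem_or D hI (j + 1)) (hN j) m.1.toNat (glueΛ d j m)
      have h3 := gluedPos_coeff D hI (j + 1) (D.restrict hI d (j + 1) g) (glueΛ d j m)
        (by rw [glueΛ_apply]; simpa using hm)
      have h4 : -(glueΛ d j m).2 = m.1 := neg_neg _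
      rw [h4] at h3
      rw [← yMap_apply] at h3
      rw [← h3] at h2
      have h5 := add_mem h2 (Ideal.mul_mem_left _ (tA k I φ (j + 1) ^ m.1.toNat) h1)
      rw [mul_sub, sub_add_sub_cancel] at h5
      exact h5
  t_mem s hs := zA_mem_idealOf (mem_elems.mpr (hI ▸ hs))

lemma atlas_y : (atlas D hI d).y = yMap D hI d := rfl

lemma rayChart (j : ZMod n) : RayChart (atlas D hI d) j (fLaur D I (j + 1)) (R := D.RGlued I (j + 1))
    (gluedNeg I D (j + 1) : D.RGlued I (j + 1) →+* Laurent (Base (P := P) I k))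
    (gluedPos I D (j + 1) : D.RGlued I (j + 1) →+* Laurent (Base (P := P) I k))
    (D.restrict hI d (j + 1)) where
  model := rayModel_glued D hI (j + 1)
  pos _ := rfl
  neg _ g hg m := gluedNeg_restrict_sub_mem D hI d j g (hg j) m

end Atlas
end MirrorFamily

namespace MirrorFamily

/-! ### Terms of wall functions -/

section SuppIn

variable {k : Type u} [Field k] {M : Type u} [AddCommGroup M]

/-- All exponents of `x` lie in `A`. -/
def SuppIn (A : Set M) (x : AddMonoidAlgebra k M) : Prop := ∀ m, x.coeff m ≠ 0 → m ∈ A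

lemma SuppIn.mul {A B C : Set M} {x y : AddMonoidAlgebra k M} (hx : SuppIn A x) (hy : SuppIn B y)
    (h : ∀ a ∈ A, ∀ b ∈ B, a + b ∈ C) : SuppIn C (x * y) := by
  classical
  intro m hm
  have h1 := AddMonoidAlgebra.support_coeff_mul_subset x y (Finsupp.mem_support_iff.mpr hm)
  obtain ⟨a, ha, b, hb, rfl⟩ := Finset.mem_add.mp h1
  exact h a (hx a (Finsupp.mem_support_iff.mp ha)) b (hy b (Finsupp.mem_support_iff.mp hb))

lemma SuppIn.mul_self {S : AddSubmonoid M} {x y : AddMonoidAlgebra k M} (hx : SuppIn (S : Set M) x)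
    (hy : SuppIn (S : Set M) y) : SuppIn (S : Set M) (x * y) :=
  hx.mul hy fun _ ha _ hb => S.add_mem ha hb

lemma SuppIn.add {A : Set M} {x y : AddMonoidAlgebra k M} (hx : SuppIn A x) (hy : SuppIn A y) :
    SuppIn A (x + y) := by
  intro m hm
  by_contra h
  refine hm ?_
  rw [AddMonoidAlgebra.coeff_add, Finsupp.add_apply, not_not.mp fun h' => h (hx m h'),
    not_not.mp fun h' => h (hy m h'), add_zero]

lemma SuppIn.one {S : AddSubmonoid M} : SuppIn (S : Set M) (1 : AddMonoidAlgebra k M) := by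
  classical
  intro m hm
  rw [AddMonoidAlgebra.one_def, AddMonoidAlgebra.coeff_single, Finsupp.single_apply] at hm
  split_ifs at hm with h
  · exact h ▸ S.zero_mem
  · exact absurd rfl hm

/-- The pairs of elements with exponents in `S` which agree outside the ideal `T` of `S`. -/
def agreeing (S : AddSubmonoid M) (T : Set M) (hT : ∀ a ∈ S, ∀ b ∈ T, a + b ∈ T) :
    Submonoid (AddMonoidAlgebra k M × AddMonoidAlgebra k M) where
  carrier := {p | SuppIn (S : Set M) p.1 ∧ SuppIn (S : Set M) p.2 ∧ SuppIn T (p.1 - p.2)}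
  one_mem' := ⟨.one, .one, by intro m hm; simp at hm⟩
  mul_mem' := by
    rintro ⟨x, y⟩ ⟨x', y'⟩ ⟨h1, h2, h3⟩ ⟨h1', h2', h3'⟩
    refine ⟨h1.mul_self h1', h2.mul_self h2', ?_⟩
    have : x * x' - y * y' = x' * (x - y) + y * (x' - y') := by ring
    change SuppIn T (x * x' - y * y')
    rw [this]
    exact (h1'.mul h3 hT).add (h2.mul h3' hT)

end SuppIn

section Terms

variable {k : Type u} [Field k] {n : ℕ} {L : Type u} [AddCommGroup L] {P : AddSubmonoid L}
  {φ : PLFun n P} {J : AddSemigroupIdeal P} {D : ScatteringDiagram φ k J} {I : AddSemigroupIdeal P}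

lemma radical_inf {I' : AddSemigroupIdeal P} (hI : radical I = J) (hI' : radical I' = J) :
    radical (I ⊓ I' : AddSemigroupIdeal P) = J := by
  ext p
  constructor
  · rintro ⟨m, hm, h⟩
    rw [← hI]
    exact ⟨m, hm, h.1⟩
  · intro h
    obtain ⟨m, hm, h1⟩ : p ∈ radical I := hI ▸ h
    obtain ⟨m', hm', h2⟩ : p ∈ radical I' := hI' ▸ h
    refine ⟨m + m', by omega, ?_, ?_⟩
    · rw [add_smul, add_comm]
      exact AddSemigroupIdeal.add_mem I _ h1
    · rw [add_smul]
      exact AddSemigroupIdeal.add_mem I' _ h2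

lemma zero_notMem_of_radical (hI : radical I = J) (h0 : (0 : P) ∉ J) : (0 : P) ∉ I := fun h =>
  h0 (hI ▸ ⟨1, one_ne_zero, by simpa using h⟩)

lemma add_mem_tauIdeal (i : ZMod n) (s : ℚ≥0) {a b : (ℤ × ℤ) × L} (ha : a ∈ tauMon φ i s)
    (hb : b ∈ tauIdeal φ I i s) : a + b ∈ tauIdeal φ I i s := by
  unfold tauMon at ha
  unfold tauIdeal at hb ⊢
  split_ifs at * with h
  · rcases hb with hb | hb
    · refine Or.inl ⟨add_mem ha hb.1, ?_⟩
      rw [map_add]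
      exact add_mem_elems (monRay_htPos φ i ha) hb.2
    · refine Or.inr ⟨add_mem ha hb.1, ?_⟩
      rw [map_add]
      exact add_mem_elems (monRay_htNeg φ i ha) hb.2
  · refine ⟨add_mem ha hb.1, ?_⟩
    rw [map_add]
    exact add_mem_elems ha hb.2

lemma tauIdeal_mono {I' : AddSemigroupIdeal P} (h : I ≤ I') (i : ZMod n) (s : ℚ≥0) :
    tauIdeal φ I i s ⊆ tauIdeal φ I' i s := by
  have he : elems I ⊆ elems I' := Set.image_mono h
  unfold tauIdeal
  split_ifs
  · rintro q (hq | hq)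
    · exact Or.inl ⟨hq.1, he hq.2⟩
    · exact Or.inr ⟨hq.1, he hq.2⟩
  · exact fun q hq => ⟨hq.1, he hq.2⟩

lemma tauMon_htPos {i : ZMod n} {s : ℚ≥0} {q : (ℤ × ℤ) × L} (hq : q ∈ tauMon φ i s) :
    htPos φ i q ∈ P := by
  unfold tauMon at hq
  split_ifs at hq
  · exact monRay_htPos φ i hq
  · exact hq

lemma zero_mem_tauIdeal {i : ZMod n} {s : ℚ≥0} (h0 : (0 : P) ∉ I) : 0 ∉ tauIdeal φ I i s := by
  have h : (0 : L) ∉ elems I := fun h => h0 (mem_elems.mp h)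
  unfold tauIdeal
  split_ifs
  · rintro (hq | hq)
    · exact h (by simpa using hq.2)
    · exact h (by simpa using hq.2)
  · intro hq
    exact h (by simpa using hq.2)

lemma ScatRay.coeff_trunc (hI : radical I = J) (r : ScatRay φ k J) (q : (ℤ × ℤ) × L)
    [Decidable (q ∈ tauIdeal φ I r.cone r.slope)] :
    (r.trunc I).coeff q = if q ∈ tauIdeal φ I r.cone r.slope then 0 else r.coeff q := by
  classical
  rw [trunc, finsum_mem_eq_sum_of_subset (t := (r.summable I hI).toFinset),
    AddMonoidAlgebra.coeff_sum, Finsupp.finsetSum_apply]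
  · simp only [AddMonoidAlgebra.coeff_single, Finsupp.single_apply]
    rw [Finset.sum_ite_eq' (r.summable I hI).toFinset q]
    by_cases h : q ∈ tauIdeal φ I r.cone r.slope
    · simp [h]
    · by_cases h' : r.coeff q = 0
      · simp [h']
      · simp [h, h']
  · rintro q ⟨hq, hq'⟩
    simp only [Set.Finite.coe_toFinset, Set.mem_ofPred_eq]
    refine ⟨fun h => hq' ?_, hq⟩
    simp [h]
  · intro q hq
    simp only [Set.Finite.coe_toFinset, Set.mem_ofPred_eq] at hq
    exact hq.2

lemma ScatRay.trunc_eq_one (hI : radical I = J) (h0 : (0 : P) ∉ J) {r : ScatRay φ k J}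
    (hr : ¬ r.Nontrivial I) : r.trunc I = 1 := by
  classical
  ext q
  rw [r.coeff_trunc hI, AddMonoidAlgebra.one_def, AddMonoidAlgebra.coeff_single,
    Finsupp.single_apply]
  by_cases hq : 0 = q
  · subst hq
    rw [if_neg (zero_mem_tauIdeal (zero_notMem_of_radical hI h0)), if_pos rfl, r.coeff_zero]
  · rw [if_neg hq]
    split_ifs with h
    · rfl
    · by_contra h'
      exact hr ⟨q, Ne.symm hq, h', h⟩

variable (φ J) in
/-- A monoid containing the exponents of the functions `f_𝔡` supported on the ray of slope `s` in
`σ_i`: they are tangent to the ray, and lie over `J` unless the ray is a `ρ_i` with bending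
parameter in `J`. -/
def termMon (i : ZMod n) (s : ℚ≥0) : AddSubmonoid ((ℤ × ℤ) × L) where
  carrier := {q | q ∈ tauMon φ i s ∧ (s.num : ℤ) * q.1.1 = s.den * q.1.2 ∧
    ((s ≠ 0 ∨ φ.bend i ∉ J) → q = 0 ∨ htPos φ i q ∈ elems J)}
  zero_mem' := ⟨zero_mem _, by simp, fun _ => Or.inl rfl⟩
  add_mem' := by
    rintro a b ⟨ha, ha', ha''⟩ ⟨hb, hb', hb''⟩
    refine ⟨add_mem ha hb, ?_, fun h => ?_⟩
    · simp only [Prod.fst_add, Prod.snd_add, mul_add, ha', hb']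
    · rcases hb'' h with rfl | hb''
      · rw [add_zero]; exact ha'' h
      · refine Or.inr ?_
        rw [map_add]
        exact add_mem_elems (tauMon_htPos ha) hb''

lemma ScatRay.coeff_mem_termMon (r : ScatRay φ k J) {q : (ℤ × ℤ) × L} (hq : r.coeff q ≠ 0) :
    q ∈ termMon φ J r.cone r.slope := by
  refine ⟨r.coeff_supp q hq, ?_, fun h => ?_⟩
  · by_cases h0 : q = 0
    · simp [h0]
    · rcases r.direction with h | h <;> obtain ⟨l, -, hl⟩ := h q h0 hq <;> rw [hl] <;>
        simp only <;> ring
  · by_cases h0 : q = 0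
    · exact Or.inl h0
    · have := r.congr_one h q h0 hq
      unfold tauIdeal at this
      split_ifs at this with hs
      · rcases this with h1 | h1
        · exact Or.inr h1.2
        · refine Or.inr ?_
          have h2 : q.1.2 = 0 := by
            rcases r.direction with h | h <;> obtain ⟨l, -, hl⟩ := h q h0 hq <;> rw [hl] <;>
              simp [hs]
          have h3 := htNeg_eq φ r.cone q
          rw [h2, zero_smul, add_zero] at h3
          rw [← h3]
          exact h1.2
      · exact Or.inr this.2

lemma suppIn_termProd (hI : radical I = J) (i : ZMod n) (s : ℚ≥0) (N : ℕ) :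
    SuppIn (termMon φ J i s : Set ((ℤ × ℤ) × L)) (∏ᶠ r ∈ D.on i s, r.trunc I ^ N) := by
  classical
  refine finprod_mem_induction (p := SuppIn (termMon φ J i s : Set ((ℤ × ℤ) × L)))
    SuppIn.one (fun x y hx hy => SuppIn.mul_self hx hy) ?_
  rintro r ⟨-, rfl, rfl⟩
  have h1 : SuppIn (termMon φ J r.cone r.slope : Set ((ℤ × ℤ) × L)) (r.trunc I) := by
    intro q hq
    rw [r.coeff_trunc hI] at hq
    split_ifs at hq
    · exact absurd rfl hq
    · exact r.coeff_mem_termMon hq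
  induction N with
  | zero => rw [pow_zero]; exact SuppIn.one
  | succ N ih => rw [pow_succ]; exact ih.mul_self h1

/-- Passing to a smaller ideal does not change the coefficients outside the larger one. -/
lemma coeff_termProd_eq {I' : AddSemigroupIdeal P} (hI : radical I = J) (hI' : radical I' = J)
    (hle : I ≤ I') (h0 : (0 : P) ∉ J) {i : ZMod n} {s : ℚ≥0} (N : ℕ) {e : (ℤ × ℤ) × L}
    (he : e ∉ tauIdeal φ I' i s) :
    (∏ᶠ r ∈ D.on i s, r.trunc I ^ N).coeff e = (∏ᶠ r ∈ D.on i s, r.trunc I' ^ N).coeff e := by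
  classical
  have hfin : {r ∈ D.on i s | r.Nontrivial I}.Finite :=
    (D.finite I hI).subset fun r hr => ⟨hr.1.1, hr.2⟩
  have hnt : ∀ r : ScatRay φ k J, r.Nontrivial I' → r.Nontrivial I := fun r ⟨q, h, h', h''⟩ =>
    ⟨q, h, h', fun hq => h'' (tauIdeal_mono hle _ _ hq)⟩
  have hsub : ((hfin.toFinset : Finset _) : Set (ScatRay φ k J)) ⊆ D.on i s := by
    intro r hr
    simp only [Set.Finite.coe_toFinset, Set.mem_ofPred_eq] at hr
    exact hr.1
  have hsupp : ∀ I'' : AddSemigroupIdeal P, radical I'' = J →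
      (∀ r : ScatRay φ k J, r.Nontrivial I'' → r.Nontrivial I) →
      D.on i s ∩ Function.mulSupport (fun r => r.trunc I'' ^ N) ⊆ hfin.toFinset := by
    rintro I'' hI'' hnt'' r ⟨hr, hr'⟩
    simp only [Set.Finite.coe_toFinset, Set.mem_ofPred_eq]
    refine ⟨hr, hnt'' r (by_contra fun h => hr' ?_)⟩
    change r.trunc I'' ^ N = 1
    rw [ScatRay.trunc_eq_one hI'' h0 h, one_pow]
  rw [finprod_mem_eq_prod_of_subset _ (hsupp I hI fun _ h => h) hsub,
    finprod_mem_eq_prod_of_subset _ (hsupp I' hI' hnt) hsub]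
  have hmem : (∏ r ∈ hfin.toFinset, ((r.trunc I ^ N, r.trunc I' ^ N) :
      AddMonoidAlgebra k ((ℤ × ℤ) × L) × AddMonoidAlgebra k ((ℤ × ℤ) × L))) ∈
      agreeing (k := k) (tauMon φ i s) (tauIdeal φ I' i s)
        (fun _ ha _ hb => add_mem_tauIdeal i s ha hb) := by
    refine Submonoid.prod_mem _ fun r hr => ?_
    obtain ⟨-, rfl, rfl⟩ := hsub hr
    have hm : (r.trunc I, r.trunc I') ∈ agreeing (k := k) (tauMon φ r.cone r.slope)
        (tauIdeal φ I' r.cone r.slope) (fun _ ha _ hb => add_mem_tauIdeal _ _ ha hb) := ?_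
    · exact Submonoid.pow_mem _ hm N
    refine ⟨?_, ?_, ?_⟩
    · intro q hq
      rw [r.coeff_trunc hI] at hq
      split_ifs at hq
      · exact absurd rfl hq
      · exact r.coeff_supp q hq
    · intro q hq
      rw [r.coeff_trunc hI'] at hq
      split_ifs at hq
      · exact absurd rfl hq
      · exact r.coeff_supp q hq
    · intro q hq
      by_contra h
      refine hq ?_
      rw [AddMonoidAlgebra.coeff_sub, Finsupp.sub_apply, r.coeff_trunc hI, r.coeff_trunc hI',
        if_neg h, if_neg fun h' => h (tauIdeal_mono hle _ _ h'), sub_self]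
  have h3 := hmem.2.2
  rw [Prod.fst_prod, Prod.snd_prod] at h3
  by_contra hne
  refine he (h3 e ?_)
  rw [AddMonoidAlgebra.coeff_sub, Finsupp.sub_apply]
  exact sub_ne_zero.mpr hne

lemma IsTerm.coeff_eq (hI : radical I = J) (h0 : (0 : P) ∉ J) {i : ZMod n} {s : ℚ≥0} {N : ℕ}
    {c : k} {e : (ℤ × ℤ) × L} (h : D.IsTerm i s N c e) (he : e ∉ tauIdeal φ I i s) :
    (∏ᶠ r ∈ D.on i s, r.trunc I ^ N).coeff e = c := by
  obtain ⟨-, I', hI', he', hc⟩ := h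
  rw [← hc, ← coeff_termProd_eq (radical_inf hI hI') hI inf_le_left h0 N he,
    coeff_termProd_eq (radical_inf hI hI') hI' inf_le_right h0 N he']

lemma IsTerm.mem {i : ZMod n} {s : ℚ≥0} {N : ℕ} {c : k} {e : (ℤ × ℤ) × L}
    (h : D.IsTerm i s N c e) : e ∈ termMon φ J i s := by
  obtain ⟨hc, I', hI', he', rfl⟩ := h
  exact suppIn_termProd hI' i s N e hc

lemma IsTerm.ne_zero {i : ZMod n} {s : ℚ≥0} {N : ℕ} {c : k} {e : (ℤ × ℤ) × L}
    (h : D.IsTerm i s N c e) (he : e ≠ 0) : N ≠ 0 := by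
  classical
  rintro rfl
  obtain ⟨hc, I', hI', he', rfl⟩ := h
  refine hc ?_
  simp only [pow_zero, finprod_mem_one]
  rw [AddMonoidAlgebra.one_def, AddMonoidAlgebra.coeff_single, Finsupp.single_apply,
    if_neg (Ne.symm he)]

lemma IsTerm.mem_walls (hI : radical I = J) (h0 : (0 : P) ∉ J) {i : ZMod n} {s : ℚ≥0} {N : ℕ}
    {c : k} {e : (ℤ × ℤ) × L} (h : D.IsTerm i s N c e) (he : e ∉ tauIdeal φ I i s) (hs : s ≠ 0)
    (h1 : e ≠ 0) : s ∈ D.walls hI i := by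
  classical
  rw [ScatteringDiagram.walls, Set.Finite.mem_toFinset]
  refine ⟨hs, ?_⟩
  by_contra! hne
  have h2 := IsTerm.coeff_eq hI h0 h he
  have h3 : ∏ᶠ r ∈ D.on i s, r.trunc I ^ N = 1 := by
    rw [← finprod_mem_one (D.on i s)]
    refine finprod_mem_congr rfl fun r hr => ?_
    rw [ScatRay.trunc_eq_one hI h0 (hne r hr), one_pow]
  rw [h3, AddMonoidAlgebra.one_def, AddMonoidAlgebra.coeff_single, Finsupp.single_apply,
    if_neg (Ne.symm h1)] at h2
  exact h.1 h2.symm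

lemma finite_isTerm (hI : radical I = J) (h0 : (0 : P) ∉ J) (i : ZMod n) (s : ℚ≥0) (N : ℕ) :
    {p : k × ((ℤ × ℤ) × L) | D.IsTerm i s N p.1 p.2 ∧ p.2 ∉ tauIdeal φ I i s}.Finite := by
  set x := ∏ᶠ r ∈ D.on i s, r.trunc I ^ N with hx
  refine (x.coeff.support.finite_toSet.image fun e => (x.coeff e, e)).subset ?_
  rintro ⟨c, e⟩ ⟨h, he⟩
  have hc := IsTerm.coeff_eq hI h0 h he
  refine ⟨e, ?_, ?_⟩
  · rw [Finset.mem_coe, Finsupp.mem_support_iff, hx, hc]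
    exact h.1
  · exact Prod.ext hc rfl

end Terms
end MirrorFamily

namespace MirrorFamily

/-! ### Broken lines -/

section Lines

open ScatteringDiagram

variable {k : Type u} [Field k] {n : ℕ} {L : Type u} [AddCommGroup L] {P : AddSubmonoid L}
  {φ : PLFun n P} {J : AddSemigroupIdeal P} {D : ScatteringDiagram φ k J} {I : AddSemigroupIdeal P}
  {d : ZMod n → ℤ}

lemma ideal_pow_zero {A : Type*} [CommRing A] (K : Ideal A) : K ^ 0 = ⊤ := by
  rw [pow_zero, Ideal.one_eq_top]

lemma htNeg_transport (i : ZMod n) (q : (ℤ × ℤ) × L) :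
    htNeg φ (i + 1) (transport d φ i q) = htPos φ i q := by
  rw [← htPos_transport_symm, AddEquiv.symm_apply_apply]

lemma htPos_transport (i : ZMod n) (q : (ℤ × ℤ) × L) :
    htPos φ (i + 1) (transport d φ i q) = htPos φ i q + q.1.1 • (φ.bend (i + 1) : L) := by
  have h := htNeg_eq φ (i + 1) (transport d φ i q)
  have h2 : (transport d φ i q).1.2 = -q.1.1 := rfl
  rw [htNeg_transport, h2, neg_smul] at h
  rw [h]; abel

lemma termMon_snd {i : ZMod n} {e : (ℤ × ℤ) × L} (he : e ∈ termMon φ J i 0) : e.1.2 = 0 := by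
  have := he.2.1
  simpa using this.symm

lemma htNeg_termMon {i : ZMod n} {e : (ℤ × ℤ) × L} (he : e ∈ termMon φ J i 0) :
    htNeg φ i e = htPos φ i e := by
  rw [htNeg_eq, termMon_snd he, zero_smul, add_zero]

lemma htPos_mem_of_tauIdeal {i : ZMod n} {s : ℚ≥0} {e : (ℤ × ℤ) × L} (he : e ∈ termMon φ J i s)
    (h : e ∈ tauIdeal φ I i s) : htPos φ i e ∈ elems I := by
  unfold tauIdeal at h
  split_ifs at h with hs
  · subst hs
    rcases h with h | h
    · exact h.2
    · rw [← htNeg_termMon he]; exact h.2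
  · exact h.2

lemma Crosses.mem {i : ZMod n} {N : ℕ} {c : k} {e : (ℤ × ℤ) × L} (h : D.Crosses i N c e) :
    e ∈ termMon φ J i 0 := by
  rcases h with ⟨-, rfl⟩ | ⟨h, -⟩
  · exact zero_mem _
  · exact IsTerm.mem h

variable (φ) in
/-- The height `q - φ(r(q))` of the exponent of a leg. -/
def Leg.height (l : Leg n L k) : L := htPos φ l.cone l.expo

/-- What remains of a leg when its endpoint is forgotten. -/
def Leg.type (l : Leg n L k) : ZMod n × k × ((ℤ × ℤ) × L) := (l.cone, l.coeff, l.expo)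

lemma nsmul_bend_add_mem {i : ZMod n} {N : ℕ} {e : (ℤ × ℤ) × L} (he : e ∈ termMon φ J i 0) :
    N • (φ.bend i : L) + htPos φ i e ∈ P :=
  add_mem (nsmul_mem (φ.bend i).2 _) (tauMon_htPos he.1)

lemma nsmul_bend_add_mem_or {i : ZMod n} {N : ℕ} (hN : 0 < N) {e : (ℤ × ℤ) × L}
    (he : e ∈ termMon φ J i 0) :
    N • (φ.bend i : L) + htPos φ i e ∈ elems J ∨ φ.bend i ∉ J := by
  by_cases h : φ.bend i ∈ J
  · left
    obtain ⟨N, rfl⟩ := Nat.exists_eq_add_of_lt hN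
    have h1 : (0 + N + 1) • (φ.bend i : L) + htPos φ i e
        = (N • (φ.bend i : L) + htPos φ i e) + φ.bend i := by
      rw [zero_add, succ_nsmul]; abel
    rw [h1]
    exact add_mem_elems (nsmul_bend_add_mem he) (mem_elems.mpr h)
  · exact Or.inr h

/-- The height increases along a broken line, by an element of `J` unless the line crosses a ray
with bending parameter outside `J` and does not bend there. -/
lemma Leg.Next.step {l l' : Leg n L k} (h : Leg.Next D d l l') : ∃ p ∈ P,
    l'.height φ = l.height φ + p ∧ (p ∈ elems J ∨
      (l.endpt.1 = 0 ∧ l'.endpt.2 ≠ 0 ∧ φ.bend (l.cone + 1) ∉ J ∧ l'.cone = l.cone + 1 ∧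
        l'.expo.1.2 < 0) ∨
      (l.endpt.2 = 0 ∧ l'.endpt.1 ≠ 0 ∧ φ.bend l.cone ∉ J ∧ l.cone = l'.cone + 1 ∧
        l'.expo.1.1 < 0)) := by
  rcases h with ⟨N, c, e, t, hcone, hend, hN, hN0, hbend, hcoeff, hexpo, ht, hline, hin⟩ |
    ⟨N, c, e, t, hcone, hend, hN, hN0, hbend, hcoeff, hexpo, ht, hline, hin⟩ |
    ⟨s, N, c, e, t, hcone, hs, hend, hend', hN, hbend, hdir, hcoeff, hexpo, ht, hline, hin⟩
  · have he := Crosses.mem hbend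
    refine ⟨_, nsmul_bend_add_mem (N := N) he, ?_, ?_⟩
    · rw [Leg.height, hcone, hexpo, map_add, htPos_transport, hN, natCast_zsmul, Leg.height]
      abel
    · refine (nsmul_bend_add_mem_or hN0 he).imp_right fun h => Or.inl ⟨hend, ?_, h, hcone, ?_⟩
      all_goals
        have h1 : l'.expo.1.2 = -(N : ℤ) := by
          rw [hexpo, Prod.fst_add, Prod.snd_add, termMon_snd he, add_zero, ← hN]
          rfl
      · rw [hline]
        simp only [Leg.velocity, Prod.snd_add, Prod.smul_snd, h1, zero_add, smul_eq_mul]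
        push_cast
        rw [neg_neg]
        positivity
      · omega
  · have he := Crosses.mem hbend
    refine ⟨_, nsmul_bend_add_mem (N := N) he, ?_, ?_⟩
    · rw [Leg.height, ← htNeg_transport (d := d), hexpo, map_add, ← hcone, htNeg_termMon he, htNeg_eq,
        hN, natCast_zsmul, Leg.height]
      abel
    · refine (nsmul_bend_add_mem_or hN0 he).imp_right fun h => Or.inr ⟨hend, ?_, h, hcone, ?_⟩
      all_goals
        have h1 : l'.expo.1.1 = -(N : ℤ) := by
          have h2 : -l'.expo.1.1 = (l.expo + e).1.2 := by rw [← hexpo]; rfl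
          rw [Prod.fst_add, Prod.snd_add, termMon_snd he, hN] at h2
          omega
      · rw [hline]
        simp only [Leg.velocity, Prod.fst_add, Prod.smul_fst, h1, zero_add, smul_eq_mul]
        push_cast
        rw [neg_neg]
        positivity
      · omega
  · have he := IsTerm.mem hbend
    refine ⟨htPos φ l.cone e, tauMon_htPos he.1, ?_, Or.inl ?_⟩
    · rw [Leg.height, hcone, hexpo, map_add, Leg.height]
    · rcases he.2.2 (Or.inl hs) with rfl | h
      · exact absurd rfl hdir
      · exact h

section Finite

/-- The last leg of a chain. -/
abbrev lastLeg (l : Leg n L k) (rest : List (Leg n L k)) : Leg n L k :=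
  (l :: rest).getLast (List.cons_ne_nil _ _)

omit [Field k] [AddCommGroup L] in
lemma lastLeg_cons (l l' : Leg n L k) (rest : List (Leg n L k)) :
    lastLeg l (l' :: rest) = lastLeg l' rest :=
  List.getLast_cons (List.cons_ne_nil _ _)

/-- The number of cones, counterclockwise and clockwise, up to a fixed element of `F`. -/
lemma exists_distances [NeZero n] {F : Set (ZMod n)} (hF : F.Nonempty) : ∃ u v : ZMod n → ℕ,
    (∀ c, u c < n ∧ (c + 1 ∉ F → u (c + 1) + 1 ≤ u c)) ∧
    ∀ c, v c < n ∧ (c + 1 ∉ F → v c + 1 ≤ v (c + 1)) := by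
  obtain ⟨f, hf⟩ := hF
  have key : ∀ x : ZMod n, x + 1 ≠ 0 → x.val + 1 ≤ (x + 1).val := by
    intro x hx
    have h1 := ZMod.val_add x 1
    have h2 : (x.val + 1 : ℕ) ≠ n := by
      intro h
      refine hx ?_
      rw [← ZMod.natCast_zmod_val x, ← Nat.cast_one, ← Nat.cast_add, h, ZMod.natCast_self]
    have h3 := x.val_lt
    rcases Nat.lt_or_ge 1 n with hn | hn
    · have : Fact (1 < n) := ⟨hn⟩
      rw [ZMod.val_one, Nat.mod_eq_of_lt (by omega)] at h1
      omega
    · exfalso; omega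
  refine ⟨fun c => (f - c - 1).val, fun c => (c - f).val, fun c => ⟨ZMod.val_lt _, fun hc => ?_⟩,
    fun c => ⟨ZMod.val_lt _, fun hc => ?_⟩⟩
  · have h := key (f - (c + 1) - 1) (fun h => hc ?_)
    · have e : f - (c + 1) = f - c - 1 := by ring
      change (f - (c + 1) - 1).val + 1 ≤ _
      rw [sub_add_cancel, e] at h
      rw [e]
      exact h
    · have : c + 1 = f := by
        rw [sub_add_cancel] at h
        exact (sub_eq_zero.mp h).symm
      exact this ▸ hf
  · have h := key (c - f) (fun h => hc ?_)
    · have e : c - f + 1 = c + 1 - f := by ring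
      rwa [e] at h
    · have : c + 1 = f := by
        rw [← sub_eq_zero, ← h]; ring
      exact this ▸ hf

/-- The number of legs is bounded in terms of the order of vanishing of the last monomial. -/
lemma exists_length_bound [NeZero n] {F : Set (ZMod n)} (hF : F.Nonempty)
    (hFJ : ∀ i, i ∈ F → φ.bend i ∈ J) (rest : List (Leg n L k)) (l : Leg n L k)
    (hchain : List.IsChain (Leg.Next D d) (l :: rest)) (hl : l.endpt ≠ 0) :
    ∃ (r : ℕ) (p : P), (lastLeg l rest).height φ = l.height φ + p ∧ zA k I p ∈ idealOf k I J ^ r ∧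
      rest.length ≤ r * n + n := by
  classical
  obtain ⟨u, v, hu, hv⟩ := exists_distances hF
  -- between two legs that pick up an element of `J`, the line only crosses rays outside `F`, always
  -- in the same direction; `run` bounds the number of such crossings still possible
  let run : Leg n L k → ℕ := fun l =>
    if l.endpt.1 = 0 then u l.cone else if l.endpt.2 = 0 then v l.cone else 0
  have hrun : ∀ l, run l < n := by
    intro l
    simp only [run]
    split_ifs
    · exact (hu _).1
    · exact (hv _).1
    · exact Nat.pos_of_ne_zero (NeZero.ne n)
  suffices h : ∃ (r : ℕ) (p : P), (lastLeg l rest).height φ = l.height φ + p ∧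
      zA k I p ∈ idealOf k I J ^ r ∧ rest.length ≤ r * n + run l by
    obtain ⟨r, p, h1, h2, h3⟩ := h
    exact ⟨r, p, h1, h2, h3.trans (by have := hrun l; omega)⟩
  induction rest generalizing l with
  | nil => exact ⟨0, 0, by simp, by rw [ideal_pow_zero]; trivial, by simp⟩
  | cons l' rest ih =>
    rw [List.isChain_cons_cons] at hchain
    obtain ⟨hnext, hchain⟩ := hchain
    have hl' : l'.endpt ≠ 0 := by
      cases hnext with
      | counterclockwise _ _ _ _ _ _ _ _ _ _ _ _ _ hin => exact hin.2.2
      | clockwise _ _ _ _ _ _ _ _ _ _ _ _ _ hin => exact hin.2.2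
      | interior _ _ _ _ _ _ _ _ _ _ _ _ _ _ _ _ hin => exact hin.2.2
    obtain ⟨r, p', h1, h2, h3⟩ := ih l' hchain hl'
    obtain ⟨p, hp, hh, hcase⟩ := hnext.step
    have hlast : (lastLeg l (l' :: rest)).height φ
        = l.height φ + ((⟨p, hp⟩ + p' : P) : L) := by
      rw [lastLeg_cons, h1, hh]
      simp only [AddSubmonoid.coe_add]
      abel
    have hpl := hrun l'
    rw [List.length_cons]
    rcases hcase with hJ | ⟨h0, h0', hb, hc, -⟩ | ⟨h0, h0', hb, hc, -⟩
    · refine ⟨r + 1, _, hlast, ?_, by rw [add_mul]; omega⟩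
      rw [zA_add, ideal_pow_succ']
      exact Ideal.mul_mem_mul (zA_mem_idealOf hJ) h2
    all_goals
      refine ⟨r, _, hlast, by rw [zA_add]; exact Ideal.mul_mem_left _ _ h2, ?_⟩
      suffices run l' + 1 ≤ run l by omega
    · have h5 := (hu l.cone).2 fun h => hb (hFJ _ h)
      simp only [run, if_pos h0, if_neg h0', hc]
      split_ifs <;> omega
    · have h6 : l.endpt.1 ≠ 0 := fun h => hl (Prod.ext h h0)
      rw [hc] at hb
      have h5 := (hv l'.cone).2 fun h => hb (hFJ _ h)
      simp only [run, if_neg h6, if_pos h0, if_neg h0', hc]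
      split_ifs <;> omega

lemma finite_chains {α : Type*} {R : α → α → Prop} (hR : ∀ x, {y | R x y}.Finite) (B : ℕ) (x : α) :
    {M : List α | List.IsChain R (x :: M) ∧ M.length ≤ B}.Finite := by
  induction B generalizing x with
  | zero =>
    refine (Set.finite_singleton []).subset ?_
    rintro M ⟨-, hM⟩
    exact List.length_eq_zero_iff.mp (by omega)
  | succ B ih =>
    refine ((Set.finite_singleton []).union
      ((hR x).biUnion fun y _ => (ih y).image (List.cons y))).subset ?_
    rintro (_ | ⟨y, M⟩) ⟨h, hM⟩
    · exact Or.inl rfl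
    · rw [List.isChain_cons_cons] at h
      refine Or.inr (Set.mem_biUnion h.1 ⟨M, ⟨h.2, ?_⟩, rfl⟩)
      rw [List.length_cons] at hM
      omega

/-- Up to their endpoints, only finitely many legs outside `I` can follow a given one. -/
lemma finite_next (hI : radical I = J) (h0 : (0 : P) ∉ J) (x : ZMod n × k × ((ℤ × ℤ) × L)) :
    {y | ∃ l l' : Leg n L k, Leg.Next D d l l' ∧ l.type = x ∧ l'.type = y ∧ l.height φ ∈ P ∧
      l'.height φ ∉ elems I}.Finite := by
  have key : ∀ (i : ZMod n) (N : ℕ), {p : k × ((ℤ × ℤ) × L) | (p.1 = 1 ∧ p.2 = 0) ∨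
      (D.IsTerm i 0 N p.1 p.2 ∧ p.2 ∉ tauIdeal φ I i 0)}.Finite := by
    intro i N
    refine ((Set.finite_singleton ((1 : k), (0 : (ℤ × ℤ) × L))).union
      (finite_isTerm (D := D) hI h0 i 0 N)).subset ?_
    rintro p (⟨h1, h2⟩ | h)
    · exact Or.inl (Prod.ext h1 h2)
    · exact Or.inr h
  have key2 : ∀ {i : ZMod n} {N : ℕ} {c : k} {e : (ℤ × ℤ) × L}, D.Crosses i N c e →
      htPos φ i e ∉ elems I → (c, e) ∈ {p : k × ((ℤ × ℤ) × L) | (p.1 = 1 ∧ p.2 = 0) ∨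
      (D.IsTerm i 0 N p.1 p.2 ∧ p.2 ∉ tauIdeal φ I i 0)} := by
    rintro i N c e (h | h) he
    · exact Or.inl h
    · exact Or.inr ⟨h.1, fun h' => he (htPos_mem_of_tauIdeal (IsTerm.mem h.1) h')⟩
  obtain ⟨i, a, q⟩ := x
  refine (((key (i + 1) q.1.1.toNat).image fun p =>
      ((i + 1, a * p.1, transport d φ i q + p.2) : ZMod n × k × ((ℤ × ℤ) × L))).union
    (((key i q.1.2.toNat).image fun p =>
      ((i - 1, a * p.1, (transport d φ (i - 1)).symm (q + p.2)) :
        ZMod n × k × ((ℤ × ℤ) × L))).union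
    ((D.walls hI i).finite_toSet.biUnion fun s _ =>
      (finite_isTerm (D := D) hI h0 i s ((s.num : ℤ) * q.1.1 - (s.den : ℤ) * q.1.2).natAbs).image
        fun p => ((i, a * p.1, q + p.2) : ZMod n × k × ((ℤ × ℤ) × L))))).subset ?_
  rintro y ⟨l, l', h, hx, rfl, hl, hl'⟩
  simp only [Leg.type, Prod.mk.injEq] at hx
  obtain ⟨rfl, rfl, rfl⟩ := hx
  rcases h with ⟨N, c, e, t, hcone, hend, hN, hN0, hbend, hcoeff, hexpo, ht, hline, hin⟩ |
    ⟨N, c, e, t, hcone, hend, hN, hN0, hbend, hcoeff, hexpo, ht, hline, hin⟩ |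
    ⟨s, N, c, e, t, hcone, hs, hend, hend', hN, hbend, hdir, hcoeff, hexpo, ht, hline, hin⟩
  · refine Or.inl ⟨(c, e), ?_, ?_⟩
    · rw [hN, Int.toNat_natCast]
      refine key2 hbend fun h => hl' ?_
      rw [Leg.height, hcone, hexpo, map_add, htPos_transport, hN, natCast_zsmul]
      exact add_mem_elems (add_mem hl (nsmul_mem (φ.bend _).2 _)) h
    · simp [Leg.type, hcone, hcoeff, hexpo]
  · refine Or.inr (Or.inl ⟨(c, e), ?_, ?_⟩)
    · rw [hN, Int.toNat_natCast]
      refine key2 hbend fun h => hl' ?_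
      rw [Leg.height, ← htNeg_transport (d := d), hexpo, map_add, ← hcone,
        htNeg_termMon (Crosses.mem hbend), htNeg_eq, hN, natCast_zsmul]
      exact add_mem_elems (add_mem hl (nsmul_mem (φ.bend _).2 _)) h
    · have h1 : l.cone - 1 = l'.cone := by rw [hcone]; ring
      simp only [Leg.type, h1, hcoeff, ← hexpo, AddEquiv.symm_apply_apply]
  · have he : e ∉ tauIdeal φ I l.cone s := fun h => hl' (by
      rw [Leg.height, hcone, hexpo, map_add]
      exact add_mem_elems hl (htPos_mem_of_tauIdeal (IsTerm.mem hbend) h))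
    refine Or.inr (Or.inr (Set.mem_biUnion
      (IsTerm.mem_walls hI h0 hbend he hs fun h => hdir (by rw [h]; rfl)) ⟨(c, e), ⟨?_, he⟩, ?_⟩))
    · rw [hN]; exact hbend
    · simp [Leg.type, hcone, hcoeff, hexpo]

lemma slope_mul_eq {s : ℚ≥0} {a b : ℤ} (h : (s.num : ℤ) * a = s.den * b) : (s : ℝ) * a = b := by
  have hd : (s.den : ℝ) ≠ 0 := by exact_mod_cast s.den_ne_zero
  rw [NNRat.cast_def, div_mul_eq_mul_div, div_eq_iff hd]
  have : ((s.num : ℤ) : ℝ) * a = (s.den : ℤ) * b := by exact_mod_cast h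
  push_cast at this
  linarith

lemma slope_mul_ne {s : ℚ≥0} {a b : ℤ} (h : (s.num : ℤ) * a - s.den * b ≠ 0) :
    (s : ℝ) * a - b ≠ 0 := by
  have hd : (s.den : ℝ) ≠ 0 := by exact_mod_cast s.den_ne_zero
  intro h'
  rw [NNRat.cast_def, div_mul_eq_mul_div, sub_eq_zero, div_eq_iff hd] at h'
  refine h (sub_eq_zero.mpr ?_)
  have : ((s.num : ℤ) : ℝ) * a = (s.den : ℤ) * b := by push_cast; linarith
  exact_mod_cast this

/-- A leg is determined by its type and by the leg that follows it. -/
lemma Leg.Next.unique (hn : 3 ≤ n) {l m l' : Leg n L k} (h : Leg.Next D d l l')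
    (h' : Leg.Next D d m l') (ht : l.type = m.type) : l = m := by
  have h1 : ((1 : ℕ) : ZMod n) ≠ 0 := natCast_ne_zero_of_lt one_pos (by omega)
  have h2 : ((2 : ℕ) : ZMod n) ≠ 0 := natCast_ne_zero_of_lt two_pos (by omega)
  obtain ⟨i, P₀, a, q⟩ := l
  obtain ⟨i', P₀', a', q'⟩ := m
  simp only [Leg.type, Prod.mk.injEq] at ht
  obtain ⟨rfl, rfl, rfl⟩ := ht
  suffices P₀ = P₀' by rw [this]
  rcases h with ⟨N, c, e, t, hcone, hend, hN, hN0, hbend, hcoeff, hexpo, ht, hline, hin⟩ |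
    ⟨N, c, e, t, hcone, hend, hN, hN0, hbend, hcoeff, hexpo, ht, hline, hin⟩ |
    ⟨s, N, c, e, t, hcone, hs, hend, hend', hN, hbend, hdir, hcoeff, hexpo, ht, hline, hin⟩ <;>
  rcases h' with ⟨N', c', e', t', hcone', hend₁, hN', hN0', hbend', hcoeff', hexpo', ht', hline', -⟩ |
    ⟨N', c', e', t', hcone', hend₁, hN', hN0', hbend', hcoeff', hexpo', ht', hline', -⟩ |
    ⟨s', N', c', e', t', hcone', hs', hend₁, hend₁', hN', hbend', hdir', hcoeff', hexpo', ht',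
      hline', -⟩ <;>
  simp only at *
  · have hv : l'.velocity.2 ≠ 0 := by
      have h3 : l'.expo.1.2 = -(N : ℤ) := by
        rw [hexpo, Prod.fst_add, Prod.snd_add, termMon_snd (Crosses.mem hbend), add_zero, ← hN]
        rfl
      simp only [Leg.velocity, h3]
      push_cast
      rw [neg_neg]
      positivity
    rw [hline] at hline'
    have e1 := congrArg Prod.fst hline'
    have e2 := congrArg Prod.snd hline'
    simp only [Prod.fst_add, Prod.snd_add, Prod.smul_fst, Prod.smul_snd, smul_eq_mul,
      zero_add] at e1 e2
    have := mul_right_cancel₀ hv e2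
    subst this
    exact Prod.ext (by rw [hend, hend₁]) (add_right_cancel e1)
  · exact absurd (by rw [hcone'] at hcone; push_cast; linear_combination -hcone) h2
  · exact absurd (by rw [hcone'] at hcone; push_cast; linear_combination -hcone) h1
  · exact absurd (by rw [hcone'] at hcone; push_cast; linear_combination -hcone) h2
  · have hv : l'.velocity.1 ≠ 0 := by
      have h3 : l'.expo.1.1 = -(N : ℤ) := by
        have h4 : -l'.expo.1.1 = (q + e).1.2 := by rw [← hexpo]; rfl
        rw [Prod.fst_add, Prod.snd_add, termMon_snd (Crosses.mem hbend), hN] at h4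
        omega
      simp only [Leg.velocity, h3]
      push_cast
      rw [neg_neg]
      positivity
    rw [hline] at hline'
    have e1 := congrArg Prod.fst hline'
    have e2 := congrArg Prod.snd hline'
    simp only [Prod.fst_add, Prod.snd_add, Prod.smul_fst, Prod.smul_snd, smul_eq_mul,
      zero_add] at e1 e2
    have := mul_right_cancel₀ hv e1
    subst this
    exact Prod.ext (add_right_cancel e2) (by rw [hend, hend₁])
  · exact absurd (by rw [hcone'] at hcone; push_cast; linear_combination -hcone) h1
  · exact absurd (by rw [hcone'] at hcone; push_cast; linear_combination hcone) h1
  · exact absurd (by rw [hcone'] at hcone; push_cast; linear_combination -hcone) h1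
  · have hee : e = e' := add_left_cancel (hexpo.symm.trans hexpo')
    subst hee
    have hT := slope_mul_eq (IsTerm.mem hbend).2.1
    have hT' := slope_mul_eq (IsTerm.mem hbend').2.1
    have he1 : ((e.1.1 : ℤ) : ℝ) ≠ 0 := by
      intro h
      rw [h, mul_zero] at hT
      refine hdir (Prod.ext ?_ ?_)
      · exact_mod_cast h
      · exact_mod_cast hT.symm
    have hss : (s : ℝ) = s' := mul_right_cancel₀ he1 (hT.trans hT'.symm)
    have hN0 := IsTerm.ne_zero hbend fun h => hdir (by rw [h]; rfl)
    have hw : (s : ℝ) * q.1.1 - q.1.2 ≠ 0 := slope_mul_ne fun h => hN0 (by rw [← hN, h]; rfl)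
    have hv1 : l'.velocity.1 = -((q.1.1 : ℝ) + e.1.1) := by
      simp [Leg.velocity, hexpo]
    have hv2 : l'.velocity.2 = -((q.1.2 : ℝ) + e.1.2) := by
      simp [Leg.velocity, hexpo]
    rw [hline] at hline'
    have e1 := congrArg Prod.fst hline'
    have e2 := congrArg Prod.snd hline'
    simp only [Prod.fst_add, Prod.snd_add, Prod.smul_fst, Prod.smul_snd, smul_eq_mul] at e1 e2
    rw [hv1] at e1
    rw [hv2] at e2
    have htt : t = t' := by
      refine mul_right_cancel₀ hw ?_
      rw [← hss] at hend₁'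
      linear_combination e2 - (s : ℝ) * e1 - hend' + hend₁' - (t - t') * hT
    subst htt
    exact Prod.ext (add_right_cancel e1) (add_right_cancel e2)

/-- A broken line is determined by its endpoint and by the types of its legs. -/
lemma chain_unique (hn : 3 ≤ n) {A B : List (Leg n L k)} (hA : A.IsChain (Leg.Next D d))
    (hB : B.IsChain (Leg.Next D d)) (h : A.map Leg.type = B.map Leg.type)
    (hlast : A.getLast? = B.getLast?) : A = B := by
  induction A generalizing B with
  | nil =>
    rw [List.map_nil] at h
    exact (List.map_eq_nil_iff.mp h.symm).symm
  | cons a A ih =>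
    cases B with
    | nil => simp at h
    | cons b B =>
      rw [List.map_cons, List.map_cons, List.cons.injEq] at h
      cases A with
      | nil =>
        have : B = [] := List.map_eq_nil_iff.mp h.2.symm
        subst this
        simpa using hlast
      | cons a' A =>
        cases B with
        | nil => simp at h
        | cons b' B =>
          rw [List.isChain_cons_cons] at hA hB
          rw [List.getLast?_cons_cons, List.getLast?_cons_cons] at hlast
          have h3 := ih hA.2 hB.2 h.2 hlast
          rw [List.cons.injEq] at h3
          obtain ⟨rfl, rfl⟩ := h3
          rw [hA.1.unique hn hB.1 h.1]

end Finite

end Lines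
end MirrorFamily

namespace MirrorFamily

/-! ### Sums over broken lines -/

section Lift

open ScatteringDiagram

variable {k : Type u} [Field k] {n : ℕ} {L : Type u} [AddCommGroup L] {P : AddSubmonoid L}
  {φ : PLFun n P} {J : AddSemigroupIdeal P} {D : ScatteringDiagram φ k J} {I : AddSemigroupIdeal P}
  {d : ZMod n → ℤ} {q : B0Z n} {i : ZMod n} {Q : ℝ × ℝ}

lemma mem_elems_of_zA_eq_zero {p : P} (h : zA k I p = 0) : (p : L) ∈ elems I := by
  by_contra hp
  obtain ⟨c, hc⟩ := exists_coeff_base (k := k) hp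
  have := hc p
  rw [h, map_zero, if_pos rfl] at this
  exact zero_ne_one this

lemma ideal_pow_eq_bot_of_le {A : Type*} [CommRing A] {K : Ideal A} {M r : ℕ} (h : K ^ M = ⊥)
    (hr : M ≤ r) : K ^ r = ⊥ := le_bot_iff.mp ((Ideal.pow_le_pow_right hr).trans h.le)

lemma BrokenLine.first_height (β : BrokenLine D d q i Q) : β.first.height φ = 0 := by
  obtain ⟨-, a, b, -, h⟩ := β.first_mono
  rw [Leg.height, h]
  exact sub_self _

lemma BrokenLine.last_type (β : BrokenLine D d q i Q) :
    ((β.first :: β.rest).map Leg.type).getLast? = some β.last.type := by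
  rw [List.getLast?_map, List.getLast?_eq_getLast_of_ne_nil (List.cons_ne_nil _ _)]
  rfl

lemma BrokenLine.type_injective (hn : 3 ≤ n) : Function.Injective
    fun β : BrokenLine D d q i Q => (β.first :: β.rest).map Leg.type := by
  intro β γ h
  have h1 : β.last.type = γ.last.type := by
    have h2 := congrArg List.getLast? h
    rw [β.last_type, γ.last_type] at h2
    exact Option.some.inj h2
  simp only [Leg.type, Prod.mk.injEq] at h1
  have h3 : β.last = γ.last :=
    Leg.ext h1.1 (β.last_endpt.trans γ.last_endpt.symm) h1.2.1 h1.2.2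
  have h4 := chain_unique hn β.chain γ.chain h (by
    rw [List.getLast?_eq_getLast_of_ne_nil (List.cons_ne_nil _ _),
      List.getLast?_eq_getLast_of_ne_nil (List.cons_ne_nil _ _)]
    exact congrArg some h3)
  rw [List.cons.injEq] at h4
  obtain ⟨f, r, _, _, _, _, _⟩ := β
  obtain ⟨f', r', _, _, _, _, _⟩ := γ
  obtain ⟨rfl, rfl⟩ := h4
  rfl

lemma isChain_type (rest : List (Leg n L k)) (l : Leg n L k)
    (hchain : List.IsChain (Leg.Next D d) (l :: rest)) (hl : l.height φ ∈ P)
    (hlast : (lastLeg l rest).height φ ∉ elems I) :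
    List.IsChain (fun x y : ZMod n × k × ((ℤ × ℤ) × L) => ∃ l l' : Leg n L k, Leg.Next D d l l' ∧ l.type = x ∧ l'.type = y ∧
      l.height φ ∈ P ∧ l'.height φ ∉ elems I) ((l :: rest).map Leg.type) ∧
    l.height φ ∉ elems I := by
  induction rest generalizing l with
  | nil => exact ⟨List.isChain_singleton _, hlast⟩
  | cons l' rest ih =>
    rw [List.isChain_cons_cons] at hchain
    obtain ⟨p, hp, hh, -⟩ := hchain.1.step
    rw [lastLeg_cons] at hlast
    obtain ⟨h1, h2⟩ := ih l' hchain.2 (by rw [hh]; exact add_mem hl hp) hlast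
    refine ⟨?_, fun h => h2 ?_⟩
    · rw [List.map_cons, List.map_cons, List.isChain_cons_cons]
      exact And.intro ⟨l, l', hchain.1, rfl, rfl, hl, h2⟩ h1
    · rw [hh, add_comm]
      exact add_mem_elems hp h

lemma BrokenLine.Mono_ne_zero {β : BrokenLine D d q i Q} (h : β.Mono I ≠ 0) :
    β.last.height φ ∈ P ∧ β.last.height φ ∉ elems I := by
  unfold BrokenLine.Mono at h
  have hc : β.last.cone = i := β.last_cone
  split_ifs at h with h1
  · rw [Leg.height, hc]
    refine ⟨h1, fun h2 => ?_⟩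
    have h3 : β.last.expo ∈ idCone φ I i := ⟨h1, h2⟩
    exact h (mono_eq_zero h3 _)
  · exact absurd rfl h

/-- Modulo `I` only finitely many broken lines contribute to `Lift_Q(q)`. -/
lemma finite_brokenLines [NeZero n] (hP : P.FG) (hI : radical I = J) (h0 : (0 : P) ∉ J) (hn : 3 ≤ n)
    (hF : ∃ i, φ.bend i ∈ J) : {β : BrokenLine D d q i Q | β.Mono I ≠ 0}.Finite := by
  obtain ⟨M, hM⟩ := exists_idealOf_pow (k := k) hP hI
  refine Set.Finite.of_finite_image ?_ (BrokenLine.type_injective hn).injOn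
  let X : Set (ZMod n × ℕ × ℕ) := {(q.cone, q.a, q.b), (q.cone - 1, 0, q.a)}
  have hX : X.Finite := Set.toFinite _
  have hR := finite_next (D := D) (d := d) hI h0
  let start : ZMod n × ℕ × ℕ → ZMod n × k × ((ℤ × ℤ) × L) := fun x =>
    (x.1, 1, (((x.2.1 : ℤ), (x.2.2 : ℤ)), φ.pos x.1 ((x.2.1 : ℤ), (x.2.2 : ℤ))))
  refine (hX.biUnion fun x _ => (finite_chains hR (M * n + n) (start x)).image
    (List.cons (start x))).subset ?_
  rintro _ ⟨β, hβ, rfl⟩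
  have h3 := β.first_height
  have hlast := BrokenLine.Mono_ne_zero hβ
  obtain ⟨hc, a, b, hpt, he⟩ := β.first_mono
  have h1 : (β.first.cone, a, b) ∈ X := by
    rcases pt_eq_some.mp hpt with h | h
    · exact Or.inl (by rw [← h.1, ← h.2.1, ← h.2.2])
    · obtain ⟨h, h', h''⟩ := h
      refine Or.inr (Prod.ext ?_ (Prod.ext h h''.1.symm))
      rw [h']; ring
  have h2 : β.first.type = start (β.first.cone, a, b) := by
    rw [Leg.type, hc, he]
  refine Set.mem_biUnion h1 ⟨β.rest.map Leg.type, ⟨?_, ?_⟩, ?_⟩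
  · have h4 := (isChain_type (I := I) β.rest β.first β.chain (by rw [h3]; exact zero_mem _)
      hlast.2).1
    rw [List.map_cons, h2] at h4
    exact h4
  · obtain ⟨r, p, h4, h5, h6⟩ := exists_length_bound (I := I) (F := {i | φ.bend i ∈ J}) hF
      (fun _ h => h) β.rest β.first β.chain β.first_inCone.2.2
    rw [List.length_map]
    have hr : r < M := by
      by_contra hr
      rw [ideal_pow_eq_bot_of_le hM (not_lt.mp hr), Ideal.mem_bot] at h5
      refine hlast.2 ?_
      have h7 := mem_elems_of_zA_eq_zero h5
      rw [h3, zero_add] at h4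
      rw [← h4] at h7
      exact h7
    refine h6.trans ?_
    gcongr
  · exact congrArg (· :: β.rest.map Leg.type) h2.symm

/-- A broken line that bends or crosses a ray either picks up an element of `J`, or its last
exponent points out of the cone. -/
lemma last_of_ne_nil (rest : List (Leg n L k)) (l : Leg n L k) (hne : rest ≠ [])
    (hchain : List.IsChain (Leg.Next D d) (l :: rest)) (hl : l.height φ ∈ P) :
    (lastLeg l rest).height φ ∈ elems J ∨ (lastLeg l rest).expo.1.1 < 0 ∨
      (lastLeg l rest).expo.1.2 < 0 := by
  induction rest generalizing l with
  | nil => exact absurd rfl hne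
  | cons l' rest ih =>
    rw [List.isChain_cons_cons] at hchain
    obtain ⟨p, hp, hh, hcase⟩ := hchain.1.step
    rw [lastLeg_cons]
    cases rest with
    | nil =>
      change l'.height φ ∈ elems J ∨ l'.expo.1.1 < 0 ∨ l'.expo.1.2 < 0
      rcases hcase with h | h | h
      · exact Or.inl (by rw [hh]; exact add_mem_elems hl h)
      · exact Or.inr (Or.inr h.2.2.2.2)
      · exact Or.inr (Or.inl h.2.2.2.2)
    | cons l'' rest => exact ih l' (List.cons_ne_nil _ _) hchain.2 (by rw [hh]; exact add_mem hl hp)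

lemma laurCone_Mono (β : BrokenLine D d q i Q) (h : β.last.expo ∈ monCone φ i) :
    laurCone k I φ i (β.Mono I) = AddMonoidAlgebra.single β.last.expo.1
      (β.last.coeff • zA k I ⟨htPos φ i β.last.expo, h⟩) := by
  rw [BrokenLine.Mono, dif_pos h, mono_eq_smul, map_smul, laurCone_mono,
    AddMonoidAlgebra.smul_single]

/-- Modulo `J`, only the straight broken line contributes an exponent in the cone of its endpoint.
-/
lemma coeff_Mono_mem {β : BrokenLine D d q i Q} {a b : ℕ}
    (hne : (laurCone k I φ i (β.Mono I)).coeff ((a : ℤ), (b : ℤ)) ∉ idealOf k I J) :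
    β.rest = [] ∧ pt i a b = some q ∧ β.first = ⟨i, Q, 1, ((a, b), φ.pos i (a, b))⟩ := by
  have hcone : β.last.cone = i := β.last_cone
  have hm : β.last.expo ∈ monCone φ i := by
    by_contra h
    refine hne ?_
    rw [BrokenLine.Mono, dif_neg h, map_zero]
    exact zero_mem _
  rw [laurCone_Mono β hm, laurent_coeff_single] at hne
  have hab : β.last.expo.1 = ((a : ℤ), (b : ℤ)) := by
    by_contra h
    refine hne ?_
    rw [if_neg (by first | exact h | exact fun h' => h h'.symm)]
    exact zero_mem _
  have hrest : β.rest = [] := by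
    by_contra h
    rcases last_of_ne_nil β.rest β.first h β.chain (by rw [β.first_height]; exact zero_mem _) with
      h1 | h1 | h1
    · refine hne ?_
      split_ifs
      · refine Submodule.smul_of_tower_mem _ _ (zA_mem_idealOf ?_)
        have h2 : β.last.height φ ∈ elems J := h1
        rwa [Leg.height, hcone] at h2
      · exact zero_mem _
    · change β.last.expo.1.1 < 0 at h1
      rw [hab] at h1
      exact absurd h1 (by simp)
    · change β.last.expo.1.2 < 0 at h1
      rw [hab] at h1
      exact absurd h1 (by simp)
  have hlast : β.last = β.first := by
    simp only [BrokenLine.last, hrest, List.getLast_singleton]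
  obtain ⟨hc, a', b', hpt, he⟩ := β.first_mono
  have hend : β.last.endpt = Q := β.last_endpt
  rw [hlast] at hcone hab hend
  rw [he] at hab
  have h1 : a' = a := Int.ofNat.inj (congrArg Prod.fst hab)
  have h2 : b' = b := Int.ofNat.inj (congrArg Prod.snd hab)
  subst h1 h2
  rw [hcone] at hpt he
  exact ⟨hrest, hpt, Leg.ext hcone hend hc he⟩

/-- The broken line that comes straight from infinity in the cone of its endpoint. -/
def straight (D : ScatteringDiagram φ k J) (d : ZMod n → ℤ) {a b : ℕ} (hq : pt i a b = some q)
    (hQ : IsIrrational Q) : BrokenLine D d q i Q where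
  first := ⟨i, Q, 1, ((a, b), φ.pos i (a, b))⟩
  rest := []
  first_mono := ⟨rfl, a, b, hq, rfl⟩
  first_inCone := ⟨hQ.1.le, hQ.2.1.le, fun h => hQ.1.ne' (by rw [show Q = 0 from h]; rfl)⟩
  chain := List.isChain_singleton _
  last_cone := rfl
  last_endpt := rfl

open scoped Classical in
/-- Modulo `J`, the only monomial of `Lift_Q(q)` in the cone of `Q` is that of the straight broken
line. -/
lemma coeff_Lift [NeZero n] (hP : P.FG) (hI : radical I = J) (h0 : (0 : P) ∉ J) (hn : 3 ≤ n)
    (hF : ∃ i, φ.bend i ∈ J) (hQ : IsIrrational Q) (a b : ℕ) :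
    (laurCone k I φ i (D.Lift d I i Q q)).coeff ((a : ℤ), (b : ℤ))
      - (if pt i a b = some q then 1 else 0) ∈ idealOf k I J := by
  let Λ : RCone φ I k i →+ Base (P := P) I k ⧸ idealOf k I J :=
    (Ideal.Quotient.mk (idealOf k I J)).toAddMonoidHom.comp
      ((lcoeff (k := k) _ ((a : ℤ), (b : ℤ)) ∘ₗ
        (laurCone k I φ i).toLinearMap).toAddMonoidHom)
  have hΛ : ∀ x, Λ x = Ideal.Quotient.mk _ ((laurCone k I φ i x).coeff ((a : ℤ), (b : ℤ))) :=
    fun x => rfl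
  rw [← Ideal.Quotient.eq, ← hΛ, ScatteringDiagram.Lift,
    AddMonoidHom.map_finsum Λ (finite_brokenLines hP hI h0 hn hF)]
  by_cases hq : pt i a b = some q
  · rw [if_pos hq, finsum_eq_single _ (straight D d hq hQ)]
    · rw [hΛ]
      congr 1
      have hm : (straight D d hq hQ).last.expo ∈ monCone φ i := by
        change φ.pos i ((a : ℤ), (b : ℤ)) - φ.pos i ((a : ℤ), (b : ℤ)) ∈ P
        rw [sub_self]; exact zero_mem _
      rw [laurCone_Mono _ hm]
      have h1 : (⟨htPos φ i (straight D d hq hQ).last.expo, hm⟩ : P) = 0 :=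
        Subtype.ext (sub_self _)
      rw [h1, zA_zero, laurent_coeff_single]
      change (if (((a : ℤ), (b : ℤ)) : ℤ × ℤ) = ((a : ℤ), (b : ℤ)) then (1 : k) • (1 : Base I k)
        else 0) = 1
      rw [if_pos rfl, one_smul]
    · intro β hβ
      rw [hΛ]
      by_contra h
      have h2 := coeff_Mono_mem (β := β) fun h' => h (Ideal.Quotient.eq_zero_iff_mem.mpr h')
      refine hβ ?_
      obtain ⟨f, r, _, _, _, _, _⟩ := β
      obtain ⟨h3, -, h4⟩ := h2
      simp only at h3 h4
      subst h3 h4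
      rfl
  · rw [if_neg hq, map_zero]
    refine finsum_eq_zero_of_forall_eq_zero fun β => ?_
    rw [hΛ]
    by_contra h
    exact hq (coeff_Mono_mem (β := β) fun h' => h (Ideal.Quotient.eq_zero_iff_mem.mpr h')).2.1

end Lift
end MirrorFamily

namespace MirrorFamily

/-! ### Theta functions -/

section ThetaFunctions

open ScatteringDiagram

variable {k : Type u} [Field k] {n : ℕ} {L : Type u} [AddCommGroup L] {P : AddSubmonoid L}
  {φ : PLFun n P} {J : AddSemigroupIdeal P} {D : ScatteringDiagram φ k J} {I : AddSemigroupIdeal P}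
  {d : ZMod n → ℤ}

lemma theta_congr (hI : radical I = J) (i : ZMod n) {T T' : Set ℚ≥0}
    (h : ∀ s ∈ D.walls hI i, s ∈ T ↔ s ∈ T') : D.theta hI i T = D.theta hI i T' := by
  classical
  unfold ScatteringDiagram.theta
  rw [Finset.filter_congr h]

lemma theta_empty (hI : radical I = J) (i : ZMod n) : D.theta hI i ∅ = AlgHom.id k _ := by
  unfold ScatteringDiagram.theta
  simp

lemma Lift_eq_of_no_walls (hD : D.IsConsistent d) (hI : radical I = J) (q : B0Z n) (i : ZMod n)
    {Q Q' : ℝ × ℝ} (hQ : IsIrrational Q) (hQ' : IsIrrational Q')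
    (h : ∀ s ∈ D.walls hI i, ¬ (Q.2 / Q.1 < s ∧ (s : ℝ) < Q'.2 / Q'.1) ∧
      ¬ (Q'.2 / Q'.1 < s ∧ (s : ℝ) < Q.2 / Q.1)) :
    D.Lift d I i Q q = D.Lift d I i Q' q := by
  rcases le_total (Q.2 / Q.1) (Q'.2 / Q'.1) with hle | hle
  · rw [hD.cone I hI q i Q Q' hQ hQ' hle, theta_congr (T' := ∅) hI i (fun s hs => by
      simpa using (h s hs).1), theta_empty, AlgHom.id_apply]
  · rw [hD.cone I hI q i Q' Q hQ' hQ hle, theta_congr (T' := ∅) hI i (fun s hs => by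
      simpa using (h s hs).2), theta_empty, AlgHom.id_apply]

lemma exists_above (hI : radical I = J) (i : ZMod n) :
    ∃ Q : ℝ × ℝ, IsIrrational Q ∧ ∀ s ∈ D.walls hI i, (s : ℝ) < Q.2 / Q.1 := by
  obtain ⟨B, hB⟩ : ∃ B : ℚ≥0, ∀ s ∈ D.walls hI i, s ≤ B := (D.walls hI i).exists_le
  obtain ⟨x, hx, h1, -⟩ := exists_irrational_btwn (lt_add_one (B : ℝ))
  have hB0 : (0 : ℝ) ≤ B := by positivity
  refine ⟨(1, x), ⟨one_pos, by simp only; linarith, by simpa using hx⟩, fun s hs => ?_⟩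
  have h2 : (s : ℝ) ≤ B := by exact_mod_cast hB s hs
  simp only [div_one]
  linarith

lemma exists_below (hI : radical I = J) (i : ZMod n) :
    ∃ Q : ℝ × ℝ, IsIrrational Q ∧ ∀ s ∈ D.walls hI i, Q.2 / Q.1 < s := by
  obtain ⟨B, hB0, hB⟩ : ∃ B : ℝ, 0 < B ∧ ∀ s ∈ D.walls hI i, B ≤ s := by
    have hpos : ∀ s ∈ D.walls hI i, (0 : ℝ) < s := by
      intro s hs
      rw [ScatteringDiagram.walls, Set.Finite.mem_toFinset] at hs
      exact_mod_cast pos_iff_ne_zero.mpr hs.1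
    generalize D.walls hI i = W at hpos
    induction W using Finset.induction_on with
    | empty => exact ⟨1, one_pos, by simp⟩
    | insert a W _ ih =>
      obtain ⟨B, h0, hB⟩ := ih fun s hs => hpos s (Finset.mem_insert_of_mem hs)
      refine ⟨min a B, lt_min (hpos a (Finset.mem_insert_self _ _)) h0, fun s hs => ?_⟩
      rcases Finset.mem_insert.mp hs with rfl | hs
      · exact min_le_left _ _
      · exact (min_le_right _ _).trans (hB s hs)
  obtain ⟨x, hx, h1, h2⟩ := exists_irrational_btwn hB0
  refine ⟨(1, x), ⟨one_pos, h1, by simpa using hx⟩, fun s hs => ?_⟩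
  simp only [div_one]
  linarith [hB s hs]

/-- By consistency, the `Lift_Q(q)` are the restrictions of a function on `X°`. -/
theorem exists_theta (hD : D.IsConsistent d) (hI : radical I = J) (q : B0Z n) :
    ∃ g : D.Functions hI d, ∀ (i : ZMod n) (Q Q' : ℝ × ℝ), IsIrrational Q → IsIrrational Q' →
      D.Adjacent hI i Q Q' →
      D.psiNeg I d i (D.restrict hI d (i + 1) g) = D.Lift d I i Q q ∧
      D.psiPos I (i + 1) (D.restrict hI d (i + 1) g) = D.Lift d I (i + 1) Q' q := by
  choose A hA hA' using exists_above (D := D) hI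
  choose B hB hB' using exists_below (D := D) hI
  have hx : ∀ j, ∃ x : D.RGlued I j, D.psiPos I j x = D.Lift d I j (B j) q ∧
      ∀ (i : ZMod n) (h : j = i + 1),
        D.psiNeg I d i (cast (by rw [h]) x) = D.Lift d I i (A i) q := by
    intro j
    obtain ⟨i, rfl⟩ : ∃ i, j = i + 1 := ⟨j - 1, by ring⟩
    obtain ⟨x, h1, h2⟩ := hD.ray I hI q i (A i) (B (i + 1)) (hA i) (hB _) ⟨hA' i, hB' _⟩
    refine ⟨x, h2, fun i' h => ?_⟩
    obtain rfl := add_right_cancel h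
    exact h1
  choose x hx1 hx2 using hx
  have hx2' : ∀ i, D.psiNeg I d i (x (i + 1)) = D.Lift d I i (A i) q := fun i =>
    hx2 (i + 1) i rfl
  obtain ⟨g, hg⟩ := D.exists_restrict_eq hI d x (fun i => by
    rw [hx1, hx2']
    rcases le_total ((B i).2 / (B i).1) ((A i).2 / (A i).1) with hle | hle
    · rw [hD.cone I hI q i (B i) (A i) (hB i) (hA i) hle]
      refine DFunLike.congr_fun (theta_congr hI i fun s hs => ?_) _
      simpa using ⟨hB' i s hs, hA' i s hs⟩
    · have hw : ∀ s ∈ D.walls hI i, False := fun s hs => by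
        have h1 := hB' i s hs
        have h2 := hA' i s hs
        linarith
      rw [theta_congr (T' := ∅) hI i (fun s hs => (hw s hs).elim), theta_empty, AlgHom.id_apply]
      exact Lift_eq_of_no_walls hD hI q i (hB i) (hA i) fun s hs => (hw s hs).elim)
  refine ⟨g, fun i Q Q' hQ hQ' hadj => ?_⟩
  rw [hg, hx1, hx2']
  constructor
  · refine Lift_eq_of_no_walls hD hI q i (hA i) hQ fun s hs => ?_
    have h1 := hA' i s hs
    have h2 := hadj.1 s hs
    exact ⟨fun h => by linarith [h.1], fun h => by linarith [h.1]⟩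
  · refine Lift_eq_of_no_walls hD hI q (i + 1) (hB _) hQ' fun s hs => ?_
    have h1 := hB' _ s hs
    have h2 := hadj.2 s hs
    exact ⟨fun h => by linarith [h.2], fun h => by linarith [h.2]⟩

/-- The theta functions. -/
def thetaFun (hD : D.IsConsistent d) (hI : radical I = J) : BZ n → D.Functions hI d
  | none => 1
  | some q => (exists_theta hD hI q).choose

lemma psiPos_thetaFun (hD : D.IsConsistent d) (hI : radical I = J) (q : B0Z n) (j : ZMod n) :
    ∃ Q, IsIrrational Q ∧
      D.psiPos I j (D.restrict hI d j (thetaFun hD hI (some q))) = D.Lift d I j Q q := by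
  obtain ⟨i, rfl⟩ : ∃ i, j = i + 1 := ⟨j - 1, by ring⟩
  obtain ⟨A, hA, hA'⟩ := exists_above (D := D) hI i
  obtain ⟨B, hB, hB'⟩ := exists_below (D := D) hI (i + 1)
  exact ⟨B, hB, ((exists_theta hD hI q).choose_spec i A B hA hB ⟨hA', hB'⟩).2⟩

/-- The theta functions are dual, modulo `J`, to the integral points. -/
theorem isDual_thetaFun [NeZero n] (hD : D.IsConsistent d) (hI : radical I = J) (hP : P.FG)
    (hn : (0 : P) ∉ J → 3 ≤ n) : (atlas D hI d).IsDual (thetaFun hD hI) := by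
  classical
  intro q q'
  -- if `0 ∈ J`, then `J` generates the unit ideal and there is nothing to prove
  by_cases h0 : (0 : P) ∈ J
  · have h1 : (1 : Base (P := P) I k) ∈ idealOf k I J := by
      rw [← zA_zero (k := k) (I := I)]
      exact zA_mem_idealOf (mem_elems.mpr h0)
    exact (Ideal.eq_top_iff_one _).mpr h1 |>.ge Submodule.mem_top
  rcases q with _ | q
  · change (atlas D hI d).own q' 1 - _ ∈ _
    rcases q' with _ | q'
    · rw [ConeAtlas.own_none, map_one, laurent_coeff_one, if_pos rfl, if_pos rfl, sub_self]
      exact zero_mem _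
    · have h2 : (((q'.a : ℤ), (q'.b : ℤ)) : ℤ × ℤ) ≠ 0 := fun h => by
        have h3 : (q'.a : ℤ) = 0 := congrArg Prod.fst h
        have h4 := q'.pos
        omega
      rw [ConeAtlas.own_some, map_one, laurent_coeff_one, if_neg h2, if_neg (by simp), sub_self]
      exact zero_mem _
  · have key : ∀ (j : ZMod n) (a b : ℕ),
        ((atlas D hI d).y j (thetaFun hD hI (some q))).coeff ((a : ℤ), (b : ℤ))
          - (if pt j a b = some q then 1 else 0) ∈ idealOf k I J := by
      intro j a b
      obtain ⟨Q, hQ, h⟩ := psiPos_thetaFun hD hI q j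
      rw [atlas_y, ← laurCone_psiPos_restrict, h]
      exact coeff_Lift hP hI h0 (hn h0) hD.exists_bend hQ a b
    rcases q' with _ | q'
    · have h2 := key 0 0 0
      rw [pt_zero, if_neg (by simp)] at h2
      rw [ConeAtlas.own_none, if_neg (by simp)]
      exact h2
    · have h2 := key q'.cone q'.a q'.b
      rw [pt_pos_left q'.pos] at h2
      rw [ConeAtlas.own_some]
      convert h2

end ThetaFunctions
end MirrorFamily

namespace MirrorFamily

/-! ### Gluing morphisms from schemes to locally ringed spaces -/

section Gluing

open CategoryTheory.Limits

variable {W : Scheme.{u}} (𝒰 : Scheme.OpenCover.{u} W) {Z : LocallyRingedSpace.{u}}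

/-- The glued locally ringed space of an open cover. -/
abbrev gluedL : LocallyRingedSpace.{u} :=
  𝒰.gluedCover.toLocallyRingedSpaceGlueData.toGlueData.glued

/-- The identification of a scheme with the gluing of an open cover. -/
def gluedIso : W.toLocallyRingedSpace ≅ gluedL 𝒰 :=
  (Scheme.forgetToLocallyRingedSpace.mapIso (asIso 𝒰.fromGlued)).symm ≪≫
    𝒰.gluedCover.isoLocallyRingedSpace

/-- The inclusion of a member of the cover into the gluing. -/
def gluedι (i : 𝒰.I₀) : (𝒰.X i).toLocallyRingedSpace ⟶ gluedL 𝒰 :=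
  𝒰.gluedCover.toLocallyRingedSpaceGlueData.toGlueData.ι i

lemma gluedι_gluedIso_inv (i : 𝒰.I₀) : gluedι 𝒰 i ≫ (gluedIso 𝒰).inv = (𝒰.f i).toLRSHom := by
  have h := 𝒰.gluedCover.ι_isoLocallyRingedSpace_inv i
  have h2 : (𝒰.gluedCover.ι i ≫ 𝒰.fromGlued).toLRSHom = (𝒰.f i).toLRSHom := by
    rw [𝒰.ι_fromGlued]
  exact (Category.assoc _ _ _).symm.trans
    ((congrArg (fun f => f ≫ 𝒰.fromGlued.toLRSHom) h).trans h2)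

lemma toLRS_hom_ext {f g : W.toLocallyRingedSpace ⟶ Z}
    (h : ∀ i, (𝒰.f i).toLRSHom ≫ f = (𝒰.f i).toLRSHom ≫ g) : f = g := by
  have h' : ∀ (i : 𝒰.I₀) (f : W.toLocallyRingedSpace ⟶ Z),
      gluedι 𝒰 i ≫ (gluedIso 𝒰).inv ≫ f = (𝒰.f i).toLRSHom ≫ f := fun i f => by
    rw [← gluedι_gluedIso_inv, Category.assoc]
  rw [← cancel_epi (gluedIso 𝒰).inv]
  apply Multicoequalizer.hom_ext
  intro i
  exact (h' i f).trans ((h i).trans (h' i g).symm)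

lemma exists_glue_toLRS (f : ∀ i, (𝒰.X i).toLocallyRingedSpace ⟶ Z)
    (hf : ∀ i j, (pullback.fst (𝒰.f i) (𝒰.f j)).toLRSHom ≫ f i
      = (pullback.snd (𝒰.f i) (𝒰.f j)).toLRSHom ≫ f j) :
    ∃ F : W.toLocallyRingedSpace ⟶ Z, ∀ i, (𝒰.f i).toLRSHom ≫ F = f i := by
  let G : gluedL 𝒰 ⟶ Z := Multicoequalizer.desc _ _ f (by
    rintro ⟨i, j⟩
    refine (hf i j).trans ?_
    have h := pullbackSymmetry_hom_comp_fst (𝒰.f i) (𝒰.f j)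
    exact congrArg (fun p : pullback (𝒰.f i) (𝒰.f j) ⟶ 𝒰.X j => p.toLRSHom ≫ f j) h.symm)
  refine ⟨(gluedIso 𝒰).hom ≫ G, fun i => ?_⟩
  rw [← gluedι_gluedIso_inv 𝒰 i, Category.assoc, Iso.inv_hom_id_assoc]
  exact Multicoequalizer.π_desc _ _ _ _ _

/-- Morphisms out of a scheme agree if they agree in a neighbourhood of every point. -/
lemma toLRS_hom_ext_nhds {f g : W.toLocallyRingedSpace ⟶ Z}
    (h : ∀ w : W, ∃ N : W.Opens, w ∈ N ∧ N.ι.toLRSHom ≫ f = N.ι.toLRSHom ≫ g) : f = g := by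
  choose N hN h using h
  refine toLRS_hom_ext (W.openCoverOfIsOpenCover N ?_) fun w => h w
  exact TopologicalSpace.Opens.ext (Set.eq_univ_of_forall fun w =>
    TopologicalSpace.Opens.mem_iSup.mpr ⟨w, hN w⟩)

/-- A morphism `t : X' → X` to a scheme is an open immersion if `X'` is obtained by gluing charts
`R i`, embedded by `t` as open subschemes, any two of which are identified in `X'` wherever they
meet in `X`. -/
theorem isOpenImmersion_of_charts {ι : Type u} {X' : LocallyRingedSpace.{u}} {X : Scheme.{u}}
    (t : X' ⟶ X.toLocallyRingedSpace) (R : ι → Scheme.{u})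
    (c : ∀ i, (R i).toLocallyRingedSpace ⟶ X') (j : ∀ i, R i ⟶ X) [∀ i, IsOpenImmersion (j i)]
    (hc : ∀ i, c i ≫ t = (j i).toLRSHom)
    (ext : ∀ {Z : LocallyRingedSpace.{u}} {f g : X' ⟶ Z}, (∀ i, c i ≫ f = c i ≫ g) → f = g)
    (desc : ∀ {Z : LocallyRingedSpace.{u}} (f : ∀ i, (R i).toLocallyRingedSpace ⟶ Z),
      (∀ (W : Scheme.{u}) (a b : ι) (p : W ⟶ R a) (q : W ⟶ R b), p ≫ j a = q ≫ j b →
        p.toLRSHom ≫ f a = q.toLRSHom ≫ f b) → ∃ F : X' ⟶ Z, ∀ i, c i ≫ F = f i)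
    (agree : ∀ (W : Scheme.{u}) (a b : ι) (p : W ⟶ R a) (q : W ⟶ R b), p ≫ j a = q ≫ j b →
      ∀ w : W, ∃ N : W.Opens, w ∈ N ∧
        (N.ι ≫ p).toLRSHom ≫ c a = (N.ι ≫ q).toLRSHom ≫ c b) :
    LocallyRingedSpace.IsOpenImmersion t := by
  have agree' : ∀ (W : Scheme.{u}) (a b : ι) (p : W ⟶ R a) (q : W ⟶ R b), p ≫ j a = q ≫ j b →
      p.toLRSHom ≫ c a = q.toLRSHom ≫ c b := by
    intro W a b p q h
    refine toLRS_hom_ext_nhds fun w => ?_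
    obtain ⟨N, hw, hN⟩ := agree W a b p q h w
    exact ⟨N, hw, (Category.assoc _ _ _).symm.trans (hN.trans (Category.assoc _ _ _))⟩
  let V : X.Opens := ⨆ i, (j i).opensRange
  have hV : ∀ i, Set.range (j i) ⊆ Set.range V.ι := by
    intro i
    rw [Scheme.Opens.range_ι]
    exact le_iSup (fun i => (j i).opensRange) i
  let e : ∀ i, R i ⟶ V.toScheme := fun i => IsOpenImmersion.lift V.ι (j i) (hV i)
  have he : ∀ i, e i ≫ V.ι = j i := fun i => IsOpenImmersion.lift_fac _ _ _
  have : ∀ i, IsOpenImmersion (e i) := fun i =>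
    have : IsOpenImmersion (e i ≫ V.ι) := by rw [he]; infer_instance
    IsOpenImmersion.of_comp _ V.ι
  let 𝒰 : Scheme.OpenCover.{u} V.toScheme :=
    { I₀ := ι
      X := R
      f := e
      mem₀ := by
        rw [Scheme.presieve₀_mem_precoverage_iff]
        refine ⟨fun x => ?_, inferInstance⟩
        obtain ⟨i, y, hy⟩ := TopologicalSpace.Opens.mem_iSup.mp x.2
        refine ⟨i, y, ?_⟩
        apply V.ι.isOpenEmbedding.injective
        rw [← Scheme.Hom.comp_apply, he]
        exact hy }
  obtain ⟨g, hg⟩ := exists_glue_toLRS 𝒰 c (by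
    intro a b
    refine agree' _ a b _ _ ?_
    rw [← he a, ← he b, ← Category.assoc, ← Category.assoc]
    exact congrArg (fun f => f ≫ V.ι) (pullback.condition (f := 𝒰.f a) (g := 𝒰.f b)))
  obtain ⟨t', ht'⟩ := desc (fun i => (e i).toLRSHom) (by
    intro W a b p q h
    have : p ≫ e a = q ≫ e b := by
      rw [← cancel_mono V.ι, Category.assoc, Category.assoc, he, he, h]
    exact congrArg Scheme.Hom.toLRSHom this)
  have h1 : t' ≫ g = 𝟙 _ := ext fun i => by
    rw [← Category.assoc, ht', Category.comp_id]
    exact hg i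
  have h2 : g ≫ t' = 𝟙 _ := toLRS_hom_ext 𝒰 fun i => by
    rw [← Category.assoc, hg, Category.comp_id]
    exact ht' i
  have h3 : t' ≫ V.ι.toLRSHom = t := ext fun i => by
    rw [← Category.assoc, ht', hc, ← he i]
    rfl
  have : IsIso t' := ⟨g, h1, h2⟩
  rw [← h3]
  infer_instance

end Gluing
end MirrorFamily

namespace MirrorFamily

/-! ### The charts in the spectrum of the ring of functions -/

section Localization

lemma spec_of_isLocalization {R S T : Type u} [CommRing R] [CommRing S] [CommRing T] {g : R →+* S}
    {x : R} (h : @IsLocalization.Away R _ x S _ g.toAlgebra) {e : S →+* T}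
    (he : Function.Bijective e) {f : CommRingCat.of R ⟶ CommRingCat.of T}
    (hf : ∀ a, f.hom a = e (g a)) :
    IsOpenImmersion (Spec.map f) ∧
      ∀ v : PrimeSpectrum R, v ∈ Set.range (Spec.map f) ↔ x ∉ v.asIdeal := by
  let _ := g.toAlgebra
  have hfe : f = CommRingCat.ofHom g ≫ CommRingCat.ofHom e :=
    CommRingCat.hom_ext (RingHom.ext hf)
  have : IsIso (CommRingCat.ofHom e) :=
    inferInstanceAs (IsIso (RingEquiv.ofBijective e he).toCommRingCatIso.hom)
  have h1 : IsOpenImmersion (Spec.map (CommRingCat.ofHom g)) :=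
    IsOpenImmersion.of_isLocalization (S := S) x
  rw [hfe, Spec.map_comp]
  refine ⟨inferInstance, fun v => ?_⟩
  have h2 : v ∈ Set.range (Spec.map (CommRingCat.ofHom g)) ↔ x ∉ v.asIdeal :=
    Set.ext_iff.mp (PrimeSpectrum.localization_away_comap_range S x) v
  rw [← h2]
  constructor
  · rintro ⟨w, rfl⟩
    exact ⟨Spec.map (CommRingCat.ofHom e) w, (Scheme.Hom.comp_apply _ _ _).symm⟩
  · rintro ⟨w, rfl⟩
    obtain ⟨w', rfl⟩ := (Spec.map (CommRingCat.ofHom e)).homeomorph.surjective w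
    exact ⟨w', Scheme.Hom.comp_apply _ _ _⟩

/-- A function near a ray whose coefficients lie in an ideal of the base lies in the ideal generated
by it. -/
lemma RayModel.mem_of_coeff {A : Type*} [CommRing A] {t : A} {f : Laurent A} {R : Type*}
    [CommRing R] {N P : R →+* Laurent A} (h : RayModel t f N P) {b : A →+* R}
    (hN : ∀ a, N (b a) = algebraMap A _ a) (hP : ∀ a, P (b a) = algebraMap A _ a)
    {𝔮 : Ideal R} {x : R} (h1 : N x ∈ coeffIn (𝔮.comap b)) (h2 : P x ∈ coeffIn (𝔮.comap b)) :
    x ∈ 𝔮 := by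
  classical
  have hpos : ∀ m : ℤ × ℤ, ∃ e : R, (0 ≤ m.2 → P e = AddMonoidAlgebra.single m 1) ∧
      (m.2 < 0 → N e = AddMonoidAlgebra.single m 1) ∧ InRow m.2 (P e) ∧ InRow m.2 (N e) := by
    intro m
    by_cases hm : 0 ≤ m.2
    · obtain ⟨X, hX, hX'⟩ := h.exists_pos hm
      exact ⟨X, fun _ => hX, fun h => absurd hm (by omega), hX ▸ inRow_single m 1, hX'⟩
    · obtain ⟨X, hX, hX'⟩ := h.exists_neg (m := m) (by omega)
      exact ⟨X, fun h => absurd h hm, fun _ => hX, hX', hX ▸ inRow_single m 1⟩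
  choose e he1 he2 he3 he4 using hpos
  let c : ℤ × ℤ → A := fun m => if 0 ≤ m.2 then (P x).coeff m else (N x).coeff m
  let s : Finset (ℤ × ℤ) := (P x).coeff.support ∪ (N x).coeff.support
  have hc : ∀ m, m ∉ s → c m = 0 := by
    intro m hm
    simp only [s, Finset.mem_union, Finsupp.mem_support_iff, not_or, not_not] at hm
    simp [c, hm.1, hm.2]
  have hb : ∀ (Q : R →+* Laurent A) (hQ : ∀ a, Q (b a) = algebraMap A _ a) (m : ℤ × ℤ),
      (Q (∑ m' ∈ s, b (c m') * e m')).coeff m = ∑ m' ∈ s, c m' * (Q (e m')).coeff m := by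
    intro Q hQ m
    rw [map_sum, AddMonoidAlgebra.coeff_sum, Finsupp.finsetSum_apply]
    refine Finset.sum_congr rfl fun m' _ => ?_
    rw [map_mul, hQ, ← Algebra.smul_def]
    simp
  have hx : x = ∑ m ∈ s, b (c m) * e m := by
    refine h.eq_of_rows (fun m hm => ?_) fun m hm => ?_
    · rw [hb P hP, Finset.sum_eq_single m]
      · rw [he1 m hm, laurent_coeff_single, if_pos rfl, mul_one]
        exact (if_pos hm).symm
      · intro m' _ hne
        by_cases h' : m'.2 = m.2
        · rw [he1 m' (by omega), laurent_coeff_single, if_neg (fun h => hne h.symm), mul_zero]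
        · rw [he3 m' m (fun h => h' h.symm), mul_zero]
      · intro hm'
        rw [hc m hm', zero_mul]
    · rw [hb N hN, Finset.sum_eq_single m]
      · rw [he2 m hm, laurent_coeff_single, if_pos rfl, mul_one]
        exact (if_neg (by omega)).symm
      · intro m' _ hne
        by_cases h' : m'.2 = m.2
        · rw [he2 m' (by omega), laurent_coeff_single, if_neg (fun h => hne h.symm), mul_zero]
        · rw [he4 m' m (fun h => h' h.symm), mul_zero]
      · intro hm'
        rw [hc m hm', zero_mul]
  rw [hx]
  refine Ideal.sum_mem _ fun m _ => Ideal.mul_mem_right _ _ ?_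
  change c m ∈ 𝔮.comap b
  by_cases hm : 0 ≤ m.2
  · simp only [c, if_pos hm]; exact h2 m
  · simp only [c, if_neg hm]; exact h1 m

end Localization

section Charts

open ScatteringDiagram

variable {k : Type u} [Field k] {n : ℕ} {L : Type u} [AddCommGroup L] {P : AddSubmonoid L}
  {φ : PLFun n P} {J : AddSemigroupIdeal P} {D : ScatteringDiagram φ k J} {I : AddSemigroupIdeal P}
  {hI : radical I = J} {d : ZMod n → ℤ}

variable (D) in
lemma gluedNeg_base (i : ZMod n) (a : Base (P := P) I k) :
    gluedNeg I D i (D.baseGlued I i a) = algebraMap _ _ a := laurNeg_base φ i a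

variable (D hI d) in
/-- The inclusion of the chart of `ρ_i` into the spectrum of the ring of functions. -/
def incl (i : ZMod n) : Spec (D.catGlued I i) ⟶ Spec (D.catFun hI d) :=
  Spec.map (D.restrictHom hI d i)

variable (D hI d) in
/-- The inclusion of the torus of `σ_i` into the spectrum of the ring of functions. -/
def inclCone (i : ZMod n) : Spec (catCone k φ I i) ⟶ Spec (D.catFun hI d) :=
  Spec.map (D.homU hI i) ≫ incl D hI d i

lemma inclCone_eq (i : ZMod n) :
    Spec.map (D.homUSucc I d i) ≫ incl D hI d (i + 1) = inclCone D hI d i := by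
  rw [inclCone, incl, incl, ← Spec.map_comp, ← Spec.map_comp, D.restrictHom_compat]

variable (k I φ) in
/-- `R_{σ_i,σ_i,I}` is the ring of Laurent polynomials. -/
def laurConeEquiv (i : ZMod n) : RCone φ I k i ≃+* Laurent (Base (P := P) I k) :=
  RingEquiv.ofBijective (laurCone k I φ i : RCone φ I k i →+* Laurent (Base (P := P) I k))
    ⟨laurCone_injective k I φ i, laurCone_surjective k I φ i⟩

lemma laurConeEquiv_psiPos (i : ZMod n) (x : D.RGlued I i) :
    laurConeEquiv k φ I i (D.psiPos I i x) = gluedPos I D i x := laurCone_psiPos D i x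

variable (k I φ d) in
/-- `R_{σ_i,σ_i,I}` is the ring of Laurent polynomials, in the coordinates of `ρ_{i+1}`. -/
def laurConeEquivSucc (i : ZMod n) : RCone φ I k i ≃+* Laurent (Base (P := P) I k) :=
  (laurConeEquiv k φ I i).trans (reglue (Base (P := P) I k) d i).toRingEquiv

lemma laurConeEquivSucc_psiNeg (i : ZMod n) (x : D.RGlued I (i + 1)) :
    laurConeEquivSucc k φ I d i (D.psiNeg I d i x) = gluedNeg I D (i + 1) x :=
  reglue_psiNeg D d i x

lemma spec_homU (hP : P.FG) (i : ZMod n) {X : D.RGlued I i}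
    (hX : gluedPos I D i X = AddMonoidAlgebra.single (0, 1) 1)
    (hX' : InRow 1 (gluedNeg I D i X)) : IsOpenImmersion (Spec.map (D.homU hI i)) ∧
      ∀ v : PrimeSpectrum (D.RGlued I i),
        v ∈ Set.range (Spec.map (D.homU hI i)) ↔ X ∉ v.asIdeal := by
  refine spec_of_isLocalization
    (g := (gluedPos I D i : D.RGlued I i →+* Laurent (Base (P := P) I k)))
    (e := (D.theta hI i Set.univ : RCone φ I k i →+* RCone φ I k i).comp
      ((laurConeEquiv k φ I i).symm : Laurent (Base (P := P) I k) →+* RCone φ I k i))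
    ((rayModel_glued D hI i).isLocalization_pos hX hX')
    ((theta_bijective D hI hP i _).comp (laurConeEquiv k φ I i).symm.bijective) (fun a => ?_)
  rw [homU_apply]
  refine congrArg (D.theta hI i Set.univ) ((laurConeEquiv k φ I i).eq_symm_apply.mpr ?_)
  exact laurConeEquiv_psiPos i a

lemma spec_homUSucc (i : ZMod n) {Y : D.RGlued I (i + 1)} (hI : radical I = J)
    (hY : gluedNeg I D (i + 1) Y = AddMonoidAlgebra.single (0, -1) 1)
    (hY' : InRow (-1) (gluedPos I D (i + 1) Y)) : IsOpenImmersion (Spec.map (D.homUSucc I d i)) ∧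
      ∀ v : PrimeSpectrum (D.RGlued I (i + 1)),
        v ∈ Set.range (Spec.map (D.homUSucc I d i)) ↔ Y ∉ v.asIdeal := by
  have hm := rayModel_glued D hI (i + 1)
  generalize hN : (gluedNeg I D (i + 1) : D.RGlued I (i + 1) →+* Laurent (Base (P := P) I k)) = N
    at hm
  generalize hP : (gluedPos I D (i + 1) : D.RGlued I (i + 1) →+* Laurent (Base (P := P) I k)) = P'
    at hm
  have hNY : N Y = AddMonoidAlgebra.single (0, -1) 1 := by rw [← hN]; exact hY
  have hPY : InRow (-1) (P' Y) := by rw [← hP]; exact hY'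
  have h := hm.isLocalization_neg hNY hPY
  rw [← hN] at h
  refine spec_of_isLocalization
    (g := (gluedNeg I D (i + 1) : D.RGlued I (i + 1) →+* Laurent (Base (P := P) I k)))
    (e := ((laurConeEquivSucc k φ I d i).symm : Laurent (Base (P := P) I k) →+* RCone φ I k i))
    h (laurConeEquivSucc k φ I d i).symm.bijective (fun a => ?_)
  rw [homUSucc_apply]
  exact (laurConeEquivSucc k φ I d i).eq_symm_apply.mpr (laurConeEquivSucc_psiNeg i a)

variable [NeZero n] {ϑ : BZ n → D.Functions hI d} (hP : P.FG) (hϑ : (atlas D hI d).IsDual ϑ)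
  (hF : 2 ≤ (raysI φ I).ncard)

include hP hϑ hF

lemma spec_incl (i : ZMod n) : IsOpenImmersion (incl D hI d i) ∧
    ∀ v : PrimeSpectrum (D.catFun hI d),
      v ∈ Set.range (incl D hI d i) ↔ ϑ (pt i 1 0) ∉ v.asIdeal := by
  obtain ⟨M, hM⟩ := exists_idealOf_pow (k := k) hP hI
  obtain ⟨j, rfl⟩ : ∃ j, i = j + 1 := ⟨i - 1, by ring⟩
  exact spec_of_isLocalization (e := RingHom.id _)
    ((rayChart D hI d j).isLocalization hϑ hF hM) Function.bijective_id fun _ => rfl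

lemma isOpenImmersion_inclCone (i : ZMod n) : IsOpenImmersion (inclCone D hI d i) := by
  obtain ⟨X, hX, hX'⟩ := (rayModel_glued D hI i).exists_pos (m := (0, 1)) zero_le_one
  have := (spec_homU (hI := hI) hP i hX hX').1
  have := (spec_incl hP hϑ hF i).1
  exact inferInstanceAs (IsOpenImmersion (_ ≫ _))

end Charts
end MirrorFamily

namespace MirrorFamily

/-! ### The canonical morphism to the spectrum is an open immersion -/

section OpenImmersion

open ScatteringDiagram

variable {k : Type u} [Field k] {n : ℕ} {L : Type u} [AddCommGroup L] {P : AddSubmonoid L}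
  {φ : PLFun n P} {J : AddSemigroupIdeal P} {D : ScatteringDiagram φ k J} {I : AddSemigroupIdeal P}
  {hI : radical I = J} {d : ZMod n → ℤ}

variable (D hI d) in
/-- The prime ideal of the base below a point. -/
def below (v : PrimeSpectrum (D.catFun hI d)) : Ideal (Base (P := P) I k) :=
  v.asIdeal.comap (algebraMap _ (D.Functions hI d))

lemma isPrime_below (v : PrimeSpectrum (D.catFun hI d)) : (below D hI d v).IsPrime :=
  Ideal.IsPrime.comap _

lemma range_inclCone_subset_succ (i : ZMod n) :
    Set.range (inclCone D hI d i) ⊆ Set.range (incl D hI d (i + 1)) := by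
  rw [← inclCone_eq]
  rintro _ ⟨w, rfl⟩
  exact ⟨Spec.map (D.homUSucc I d i) w, (Scheme.Hom.comp_apply _ _ _).symm⟩

variable [NeZero n] {ϑ : BZ n → D.Functions hI d} (hP : P.FG) (hϑ : (atlas D hI d).IsDual ϑ)
  (hF : 2 ≤ (raysI φ I).ncard)
  (h3 : ∀ 𝔞 : Ideal (Base (P := P) I k), 𝔞.IsPrime → 3 ≤ {s | tA k I φ s ∈ 𝔞}.ncard)

include hP hϑ hF h3

/-- A point common to the charts of two rays lies in the torus of the cone following the first ray
in the direction of the second, along a sector none of whose bending parameters vanishes at the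
point. -/
lemma mem_range_dichotomy {j e : ZMod n} (hne : e ≠ j + 1) {v : PrimeSpectrum (D.catFun hI d)}
    (h1 : v ∈ Set.range (incl D hI d (j + 1))) (h2 : v ∈ Set.range (incl D hI d e)) :
    (v ∈ Set.range (inclCone D hI d (j + 1)) ∧ ∃ r : ℕ, e = j + 1 + (r : ZMod n) + 1 ∧
      ∀ x : ℕ, 1 ≤ x → x ≤ r → tA k I φ (j + 1 + (x : ZMod n)) ∉ below D hI d v) ∨
    (v ∈ Set.range (inclCone D hI d j) ∧ ∃ r : ℕ, j + 1 = e + (r : ZMod n) + 1 ∧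
      ∀ x : ℕ, 1 ≤ x → x ≤ r → tA k I φ (e + (x : ZMod n)) ∉ below D hI d v) := by
  obtain ⟨M, hM⟩ := exists_idealOf_pow (k := k) hP hI
  obtain ⟨w, rfl⟩ := h1
  have hprime := isPrime_below (D := D) (incl D hI d (j + 1) w)
  have h𝔞 : idealOf k I J ≤ below D hI d (incl D hI d (j + 1) w) := fun a ha =>
    hprime.mem_of_pow_mem M (by
      have : a ^ M ∈ idealOf k I J ^ M := Ideal.pow_mem_pow ha M
      rw [hM] at this
      rw [(Submodule.mem_bot _).mp this]
      exact zero_mem _)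
  have hbelow : below D hI d (incl D hI d (j + 1) w)
      = w.asIdeal.comap (D.baseGlued I (j + 1) : Base (P := P) I k →+* D.RGlued I (j + 1)) := by
    ext a
    change D.restrict hI d (j + 1) (algebraMap _ (D.Functions hI d) a) ∈ w.asIdeal ↔ _
    rw [D.restrict_base]
    rfl
  obtain ⟨X, hX, hX'⟩ := exists_glued_of_nonneg D hI (j + 1) 1 (m := (0, 1)) zero_le_one
  obtain ⟨Y, hY, hY'⟩ := exists_glued_of_nonpos D hI (j + 1) 1 (m := (0, -1)) (by simp)
  have hXU := (spec_homU (hI := hI) hP (j + 1) hX hX').2 w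
  have hYU := (spec_homUSucc (d := d) j hI hY hY').2 w
  have hres : D.restrict hI d (j + 1) (ϑ (pt e 1 0)) ∉ w.asIdeal :=
    ((spec_incl hP hϑ hF e).2 _).mp h2
  have hchart := rayChart D hI d j
  have hN0 := gluedNeg_base (I := I) D (j + 1)
  have hP0 := gluedPos_base (I := I) D (j + 1)
  have hN1 : ∀ x, gluedNeg I D (j + 1) x
    = (gluedNeg I D (j + 1) : D.RGlued I (j + 1) →+* Laurent (Base (P := P) I k)) x := fun _ => rfl
  have hP1 : ∀ x, gluedPos I D (j + 1) x
    = (gluedPos I D (j + 1) : D.RGlued I (j + 1) →+* Laurent (Base (P := P) I k)) x := fun _ => rfl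
  simp only [hN1] at hN0 hX' hY
  simp only [hP1] at hP0 hX hY'
  generalize (gluedNeg I D (j + 1) : D.RGlued I (j + 1) →+* Laurent (Base (P := P) I k)) = N
    at hchart hN0 hX' hY
  generalize (gluedPos I D (j + 1) : D.RGlued I (j + 1) →+* Laurent (Base (P := P) I k)) = P'
    at hchart hP0 hX hY'
  have h𝔮 : ∀ x, N x ∈ coeffIn (below D hI d (incl D hI d (j + 1) w)) →
      P' x ∈ coeffIn (below D hI d (incl D hI d (j + 1) w)) → x ∈ w.asIdeal := fun x h1 h2 => by
    rw [hbelow] at h1 h2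
    exact hchart.model.mem_of_coeff
      (b := (D.baseGlued I (j + 1) : Base (P := P) I k →+* D.RGlued I (j + 1))) hN0 hP0 h1 h2
  have key := hchart.dichotomy hϑ hF h𝔞 (h3 _ hprime) h𝔮 hne hres hX hX' hY hY'
  refine key.imp (fun h => ⟨?_, h.2⟩) (fun h => ⟨?_, h.2⟩)
  · obtain ⟨w', rfl⟩ := hXU.mpr h.1
    exact ⟨w', Scheme.Hom.comp_apply _ _ _⟩
  · obtain ⟨w', rfl⟩ := hYU.mpr h.1
    refine ⟨w', ?_⟩
    rw [← inclCone_eq]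
    exact Scheme.Hom.comp_apply _ _ _

/-- A point common to the charts at the ends of a sector none of whose bending parameters vanishes
at the point lies in the tori of all cones of the sector. -/
lemma mem_range_inclCone_of_run {v : PrimeSpectrum (D.catFun hI d)} {e : ZMod n}
    (he : v ∈ Set.range (incl D hI d e)) (r : ℕ) (i : ZMod n)
    (hi : v ∈ Set.range (incl D hI d i)) (hr : e = i + (r : ZMod n) + 1)
    (hrun : ∀ x : ℕ, 1 ≤ x → x ≤ r → tA k I φ (i + (x : ZMod n)) ∉ below D hI d v) :
    ∀ x : ℕ, x ≤ r → v ∈ Set.range (inclCone D hI d (i + (x : ZMod n))) := by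
  have h3' := h3 _ (isPrime_below (D := D) v)
  have hne3 : {s | tA k I φ s ∈ below D hI d v}.Nonempty :=
    Set.nonempty_of_ncard_ne_zero (by omega)
  induction r generalizing i with
  | zero =>
    intro x hx
    obtain rfl : x = 0 := by omega
    have hn := run_add_ncard_le hne3 (j := i) (s := 0) (fun x h1 h2 => by omega)
    obtain ⟨j, rfl⟩ : ∃ j, i = j + 1 := ⟨i - 1, by ring⟩
    have hne : e ≠ j + 1 := by
      rw [hr, Nat.cast_zero, add_zero]
      exact add_one_ne_self (by omega) _
    rcases mem_range_dichotomy hP hϑ hF h3 hne hi he with h | ⟨-, s, hs, hrun'⟩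
    · rw [Nat.cast_zero, add_zero]
      exact h.1
    · exact (ncard_le_two_of_runs h3' hr hs hrun hrun').elim
  | succ r ih =>
    have hn := run_add_ncard_le hne3 hrun
    obtain ⟨j, rfl⟩ : ∃ j, i = j + 1 := ⟨i - 1, by ring⟩
    have hne : e ≠ j + 1 := by
      rw [hr]
      intro h
      refine add_natCast_eq_self (j := j + 1) (s := r + 2) (by omega) (by omega) ?_
      rw [← h]; push_cast at h ⊢
      linear_combination h
    rcases mem_range_dichotomy hP hϑ hF h3 hne hi he with ⟨h, -⟩ | ⟨-, s, hs, hrun'⟩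
    · have h' := range_inclCone_subset_succ _ h
      have := ih (j + 1 + 1) h' (by rw [hr]; push_cast; ring) (fun x h1 h2 => by
        have := hrun (x + 1) (by omega) (by omega)
        rwa [Nat.cast_add, Nat.cast_one, add_comm (x : ZMod n), ← add_assoc] at this)
      intro x hx
      rcases Nat.eq_zero_or_pos x with rfl | hx0
      · rwa [Nat.cast_zero, add_zero]
      · have h4 := this (x - 1) (by omega)
        rwa [Nat.cast_sub hx0, Nat.cast_one, show j + 1 + 1 + ((x : ZMod n) - 1) = j + 1 + x by
          ring] at h4
    · exact (ncard_le_two_of_runs h3' hr hs hrun hrun').elim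

end OpenImmersion

section OpenImmersion2

open ScatteringDiagram

variable {k : Type u} [Field k] {n : ℕ} {L : Type u} [AddCommGroup L] {P : AddSubmonoid L}
  {φ : PLFun n P} {J : AddSemigroupIdeal P} {D : ScatteringDiagram φ k J} {I : AddSemigroupIdeal P}
  {hI : radical I = J} {d : ZMod n → ℤ}

variable [NeZero n] {ϑ : BZ n → D.Functions hI d} (hP : P.FG) (hϑ : (atlas D hI d).IsDual ϑ)
  (hF : 2 ≤ (raysI φ I).ncard)

include hP hϑ hF

/-- The charts at the ends of a sector are identified in `X°` over the intersection of the tori of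
the cones of the sector. -/
lemma chart_agree {b : ZMod n} (r : ℕ) {W : Scheme.{u}} {i : ZMod n} (hb : b = i + (r : ZMod n))
    (p : W ⟶ Spec (D.catGlued I i)) (q : W ⟶ Spec (D.catGlued I b))
    (hpq : p ≫ incl D hI d i = q ≫ incl D hI d b)
    (h : ∀ x : ℕ, x < r → Set.range (p ≫ incl D hI d i) ⊆
      Set.range (inclCone D hI d (i + (x : ZMod n)))) :
    p.toLRSHom ≫ D.chartL hI d i = q.toLRSHom ≫ D.chartL hI d b := by
  induction r generalizing i with
  | zero =>
    obtain rfl : b = i := by simpa using hb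
    have := (spec_incl hP hϑ hF b).1
    rw [(cancel_mono _).mp hpq]
  | succ r ih =>
    have := isOpenImmersion_inclCone hP hϑ hF i
    have h0 := h 0 (by omega)
    rw [Nat.cast_zero, add_zero] at h0
    let g : W ⟶ Spec (catCone k φ I i) := IsOpenImmersion.lift (inclCone D hI d i) _ h0
    have hg : g ≫ inclCone D hI d i = p ≫ incl D hI d i := IsOpenImmersion.lift_fac _ _ _
    have hp : g ≫ Spec.map (D.homU hI i) = p := by
      have := (spec_incl hP hϑ hF i).1
      rw [← cancel_mono (incl D hI d i), Category.assoc]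
      exact hg
    have hp' : (g ≫ Spec.map (D.homUSucc I d i)) ≫ incl D hI d (i + 1) = p ≫ incl D hI d i := by
      rw [Category.assoc, inclCone_eq, hg]
    have key := ih (i := i + 1) (by rw [hb]; push_cast; ring) (g ≫ Spec.map (D.homUSucc I d i))
      (hp'.trans hpq) (fun x hx => by
        rw [hp']
        have := h (x + 1) (by omega)
        rwa [Nat.cast_add, Nat.cast_one, add_comm (x : ZMod n), ← add_assoc] at this)
    rw [← key, ← hp]
    have h2 := congrArg (fun f => g.toLRSHom ≫ f) (D.toU_chart hI d i)
    exact (Category.assoc _ _ _).trans (h2.trans (Category.assoc _ _ _).symm)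

/-- Near a point common to two charts in the spectrum, the intersection lies in the tori of all
cones of a sector between the two rays, so that the charts are already identified in `X°`. -/
theorem isOpenImmersion_toX
    (h3 : ∀ 𝔞 : Ideal (Base (P := P) I k), 𝔞.IsPrime → 3 ≤ {s | tA k I φ s ∈ 𝔞}.ncard) :
    LocallyRingedSpace.IsOpenImmersion (D.toXL hI d) := by
  have (i : ULift.{u} (ZMod n)) : IsOpenImmersion (incl D hI d i.down) :=
    (spec_incl hP hϑ hF i.down).1
  refine isOpenImmersion_of_charts (ι := ULift.{u} (ZMod n)) (X := Spec (D.catFun hI d))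
    (D.toXL hI d) (fun i => Spec (D.catGlued I i.down)) (fun i => D.chartL hI d i.down)
    (fun i => incl D hI d i.down) (fun i => D.chart_toX hI d i.down)
    (fun h => D.Xo_hom_ext hI d fun i => h ⟨i⟩) (fun f hf => ?_) ?_
  · obtain ⟨G, hG⟩ := D.exists_Xo_desc hI d (fun i => f ⟨i⟩) (fun i =>
      hf _ ⟨i⟩ ⟨i + 1⟩ (Spec.map (D.homU hI i)) (Spec.map (D.homUSucc I d i))
        (inclCone_eq i).symm)
    exact ⟨G, fun i => hG i.down⟩
  · have key : ∀ (W : Scheme.{u}) (a b : ZMod n) (p : W ⟶ Spec (D.catGlued I a))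
        (q : W ⟶ Spec (D.catGlued I b)), p ≫ incl D hI d a = q ≫ incl D hI d b → ∀ (w : W) (r : ℕ),
        b = a + (r : ZMod n) + 1 → (∀ x : ℕ, 1 ≤ x → x ≤ r →
          tA k I φ (a + (x : ZMod n)) ∉ below D hI d ((p ≫ incl D hI d a) w)) →
        ∃ N : W.Opens, w ∈ N ∧ (N.ι ≫ p).toLRSHom ≫ D.chartL hI d a
          = (N.ι ≫ q).toLRSHom ≫ D.chartL hI d b := by
      intro W a b p q hpq w r hr hrun
      have (i : ZMod n) : IsOpenImmersion (inclCone D hI d i) :=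
        isOpenImmersion_inclCone hP hϑ hF i
      have ha : (p ≫ incl D hI d a) w ∈ Set.range (incl D hI d a) :=
        ⟨p w, (Scheme.Hom.comp_apply _ _ _).symm⟩
      have hb : (p ≫ incl D hI d a) w ∈ Set.range (incl D hI d b) := by
        rw [hpq]
        exact ⟨q w, (Scheme.Hom.comp_apply _ _ _).symm⟩
      have hx := mem_range_inclCone_of_run hP hϑ hF h3 hb r a ha hr hrun
      let N : W.Opens := ⟨⋂ x : Fin (r + 1), ((p ≫ incl D hI d a) ⁻¹ᵁ
          (inclCone D hI d (a + ((x : ℕ) : ZMod n))).opensRange : W.Opens),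
        isOpen_iInter_of_finite fun x => TopologicalSpace.Opens.isOpen _⟩
      have hN : ∀ w', w' ∈ N ↔ ∀ x : Fin (r + 1), (p ≫ incl D hI d a) w' ∈
          Set.range (inclCone D hI d (a + ((x : ℕ) : ZMod n))) := fun w' => Set.mem_iInter
      refine ⟨N, (hN w).mpr fun x => hx x (by omega), ?_⟩
      refine chart_agree hP hϑ hF (r + 1) (by rw [hr]; push_cast; ring) _ _
        (by rw [Category.assoc, hpq, Category.assoc]) fun x hx => ?_
      rintro _ ⟨w', rfl⟩
      rw [Category.assoc, Scheme.Hom.comp_apply]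
      exact (hN _).mp w'.2 ⟨x, hx⟩
    rintro W ⟨a⟩ ⟨b⟩ p q hpq w
    by_cases hne : b = a
    · subst hne
      have := (spec_incl hP hϑ hF b).1
      obtain rfl : p = q := (cancel_mono (incl D hI d b)).mp hpq
      exact ⟨⊤, trivial, rfl⟩
    · obtain ⟨j, rfl⟩ : ∃ j, a = j + 1 := ⟨a - 1, by ring⟩
      have ha : (p ≫ incl D hI d (j + 1)) w ∈ Set.range (incl D hI d (j + 1)) :=
        ⟨p w, (Scheme.Hom.comp_apply _ _ _).symm⟩
      have hb : (p ≫ incl D hI d (j + 1)) w ∈ Set.range (incl D hI d b) := by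
        have h := hpq
        dsimp only at h
        rw [h]
        exact ⟨q w, (Scheme.Hom.comp_apply _ _ _).symm⟩
      rcases mem_range_dichotomy hP hϑ hF h3 hne ha hb with ⟨-, r, hr, hrun⟩ | ⟨-, r, hr, hrun⟩
      · exact key W _ _ p q hpq w r hr hrun
      · have h := hpq
        dsimp only at h
        rw [h] at hrun
        obtain ⟨N, hw, hN⟩ := key W _ _ q p hpq.symm w r hr hrun
        exact ⟨N, hw, hN.symm⟩

end OpenImmersion2
end MirrorFamily

namespace MirrorFamily

/-! ### Maximal cones of a coarsened fan -/

section MaxCones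

variable {n : ℕ} {F : Set (ZMod n)} {d : ZMod n → ℤ} {i i' : ZMod n} {l l' : ℕ}

lemma natCast_inj_of_lt {s t : ℕ} (hs : s < n) (ht : t < n) {i : ZMod n}
    (h : i + (s : ZMod n) = i + (t : ZMod n)) : s = t := by
  have h := add_left_cancel h
  rwa [ZMod.natCast_eq_natCast_iff', Nat.mod_eq_of_lt hs, Nat.mod_eq_of_lt ht] at h

lemma IsMaxCone.eq_zero_of_mem (h : IsMaxCone F i l) {t : ℕ} (ht : t < l)
    (hF : i + (t : ZMod n) ∈ F) : t = 0 := by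
  by_contra h0
  exact h.2.2.2 t (by omega) ht hF

lemma IsMaxCone.eq_of_add_eq_add (h : IsMaxCone F i l) (h' : IsMaxCone F i' l') {t t' : ℕ}
    (ht : t < l) (ht' : t' < l') (he : i + (t : ZMod n) = i' + (t' : ZMod n)) :
    i = i' ∧ t = t' := by
  wlog hle : t ≤ t' generalizing i i' l l' t t'
  · have := this h' h ht' ht he.symm (by omega)
    exact ⟨this.1.symm, this.2.symm⟩
  have h1 : i = i' + ((t' - t : ℕ) : ZMod n) := by
    rw [Nat.cast_sub hle]
    linear_combination he
  have h2 := h'.eq_zero_of_mem (t := t' - t) (by omega) (h1 ▸ h.2.1)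
  rw [h2, Nat.cast_zero, add_zero] at h1
  exact ⟨h1, by omega⟩

lemma IsMaxCone.length_eq (h : IsMaxCone F i l) (h' : IsMaxCone F i l') : l = l' := by
  by_contra hne
  rcases Nat.lt_or_gt_of_ne hne with hlt | hlt
  · exact h'.2.2.2 l h.1 hlt h.2.2.1
  · exact h.2.2.2 l' h'.1 hlt h'.2.2.1

variable [NeZero n]

lemma IsMaxCone.length_lt (h : IsMaxCone F i l) (hF : 3 ≤ F.ncard) : l + 1 < n := by
  have h0 := h.1
  have := run_add_ncard_le (F := F) ⟨i, h.2.1⟩ (j := i) (s := l - 1)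
    (fun r h1 h2 => h.2.2.2 r (by omega) (by omega))
  omega

lemma IsMaxCone.not_opposite (h : IsMaxCone F i l) (h' : IsMaxCone F i' l') (hF : 3 ≤ F.ncard)
    (h1 : i' = i + (l : ZMod n)) (h2 : i = i' + (l' : ZMod n)) : False := by
  obtain ⟨r, rfl⟩ : ∃ r, l = r + 1 := ⟨l - 1, by have := h.1; omega⟩
  obtain ⟨s, rfl⟩ : ∃ s, l' = s + 1 := ⟨l' - 1, by have := h'.1; omega⟩
  refine ncard_le_two_of_runs hF (i := i) (e := i') (r := r) (s := s)
    (by rw [h1]; push_cast; ring) (by rw [h2]; push_cast; ring)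
    (fun x h1 h2 => h.2.2.2 x (by omega) (by omega))
    (fun x h1 h2 => h'.2.2.2 x (by omega) (by omega))

lemma exists_isMaxCone (hF : F.Nonempty) (c : ZMod n) :
    ∃ (i : ZMod n) (l t : ℕ), IsMaxCone F i l ∧ t < l ∧ c = i + (t : ZMod n) := by
  classical
  obtain ⟨f, hf⟩ := hF
  have h1 : ∃ t : ℕ, c - (t : ZMod n) ∈ F := by
    obtain ⟨x, -, -, hx⟩ := exists_eq_add_natCast f c
    exact ⟨x, by rwa [hx, add_sub_cancel_right]⟩
  have h2 : ∃ x : ℕ, c + ((x + 1 : ℕ) : ZMod n) ∈ F := by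
    obtain ⟨x, hx1, -, hx⟩ := exists_eq_add_natCast c f
    exact ⟨x - 1, by rwa [Nat.sub_add_cancel hx1, ← hx]⟩
  refine ⟨c - (Nat.find h1 : ZMod n), Nat.find h1 + (Nat.find h2 + 1), Nat.find h1,
    ⟨by omega, Nat.find_spec h1, ?_, fun u hu hul => ?_⟩, by omega, by ring⟩
  · have := Nat.find_spec h2
    rwa [Nat.cast_add (Nat.find h1), ← add_assoc, sub_add_cancel]
  · rcases Nat.le_total u (Nat.find h1) with h | h
    · have := Nat.find_min h1 (m := Nat.find h1 - u) (by omega)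
      rwa [Nat.cast_sub h, ← sub_add] at this
    · rcases h.eq_or_lt with h | h
      · have := Nat.find_min h1 (m := 0) (by omega)
        rwa [← h, sub_add_cancel, ← sub_zero c, ← Nat.cast_zero]
      · have := Nat.find_min h2 (m := u - Nat.find h1 - 1) (by omega)
        rwa [Nat.sub_add_cancel (by omega), Nat.cast_sub h.le, add_sub, add_sub_right_comm] at this

omit [NeZero n] in
lemma develops_none {x : ℤ × ℤ} (hl : 0 < l) : Develops d i l none x ↔ x = 0 := by
  constructor
  · rintro ⟨t, a, b, -, h, rfl⟩
    obtain ⟨rfl, rfl⟩ := pt_eq_none.mp h.symm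
    simp
  · rintro rfl
    exact ⟨0, 0, 0, hl, pt_zero.symm, by simp⟩

omit [NeZero n] in
lemma develops_some {q : B0Z n} {x : ℤ × ℤ} (hl : 0 < l) : Develops d i l (some q) x ↔
    ∃ t : ℕ, t ≤ l ∧ q.cone = i + (t : ZMod n) ∧ (t = l → q.b = 0) ∧
      x = q.a • dev d i t + q.b • dev d i (t + 1) := by
  constructor
  · rintro ⟨t, a, b, ht, h, rfl⟩
    rcases pt_eq_some.mp h.symm with ⟨h1, rfl, rfl⟩ | ⟨rfl, h1, rfl, h2⟩
    · exact ⟨t, ht.le, h1, fun h => absurd h ht.ne, rfl⟩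
    · exact ⟨t + 1, ht, by rw [h1]; push_cast; ring, fun _ => h2, by simp [h2]⟩
  · rintro ⟨t, ht, h1, h2, rfl⟩
    rcases ht.lt_or_eq with ht | rfl
    · exact ⟨t, q.a, q.b, ht, (pt_eq_some.mpr (Or.inl ⟨h1, rfl, rfl⟩)).symm, rfl⟩
    · refine ⟨t - 1, 0, q.a, by omega, (pt_eq_some.mpr (Or.inr ⟨rfl, ?_, rfl, h2 rfl⟩)).symm, ?_⟩
      · rw [h1, Nat.cast_sub hl]; push_cast; ring
      · rw [h2 rfl, Nat.sub_add_cancel hl]; simp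

omit [NeZero n] in
lemma Develops.unique (hln : l < n) {m : BZ n} {x x' : ℤ × ℤ} (h : Develops d i l m x)
    (h' : Develops d i l m x') : x = x' := by
  have hl : 0 < l := by
    obtain ⟨t, -, -, ht, -⟩ := h
    omega
  rcases m with _ | q
  · rw [develops_none hl] at h h'
    rw [h, h']
  · rw [develops_some hl] at h h'
    obtain ⟨t, ht, h1, -, rfl⟩ := h
    obtain ⟨t', ht', h1', -, rfl⟩ := h'
    rw [natCast_inj_of_lt (by omega) (by omega) (h1.symm.trans h1')]

omit [NeZero n] in
/-- Two maximal cones meet in the origin or along a common edge. -/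
lemma Develops.inter (h : IsMaxCone F i l) (h' : IsMaxCone F i' l') (hne : i ≠ i') {q : B0Z n}
    {x x' : ℤ × ℤ} (hx : Develops d i l (some q) x) (hx' : Develops d i' l' (some q) x') :
    q.b = 0 ∧ ((q.cone = i ∧ i = i' + (l' : ZMod n)) ∨
      (q.cone = i' ∧ i' = i + (l : ZMod n))) := by
  have hl := h.1
  have hl' := h'.1
  obtain ⟨t, ht, h1, h2, -⟩ := (develops_some hl).mp hx
  obtain ⟨t', ht', h1', h2', -⟩ := (develops_some hl').mp hx'
  rcases ht.lt_or_eq with ht | rfl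
  · rcases ht'.lt_or_eq with ht' | rfl
    · exact absurd (h.eq_of_add_eq_add h' ht ht' (h1.symm.trans h1')).1 hne
    · have := h.eq_zero_of_mem ht (by rw [← h1, h1']; exact h'.2.2.1)
      subst this
      rw [Nat.cast_zero, add_zero] at h1
      exact ⟨h2' rfl, Or.inl ⟨h1, h1.symm.trans h1'⟩⟩
  · rcases ht'.lt_or_eq with ht' | rfl
    · have := h'.eq_zero_of_mem ht' (by rw [← h1', h1]; exact h.2.2.1)
      subst this
      rw [Nat.cast_zero, add_zero] at h1'
      exact ⟨h2 rfl, Or.inr ⟨h1', h1'.symm.trans h1⟩⟩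
    · refine absurd (h.eq_of_add_eq_add h' (t := t - 1) (t' := t' - 1) (by omega) (by omega) ?_).1
        hne
      rw [Nat.cast_sub hl, Nat.cast_sub hl']
      linear_combination h1' - h1

end MaxCones

/-! ### Algebras with the multiplication of a fan -/

/-- A `k`-algebra `T` with a basis `e_m`, `m ∈ B(ℤ)`, and, for every maximal cone of the fan with
rays `F`, a homomorphism to the Laurent polynomials which takes `e_m` to `z^m` if `m` lies in the
cone, and to `0` otherwise. -/
structure FanModel {n : ℕ} (d : ZMod n → ℤ) (F : Set (ZMod n)) (k T : Type*) [Field k] [CommRing T]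
    [Algebra k T] where
  e : Module.Basis (BZ n) k T
  D : ZMod n → T →ₐ[k] Laurent k
  map_of : ∀ {i l m x}, IsMaxCone F i l → Develops d i l m x →
    D i (e m) = AddMonoidAlgebra.single x 1
  map_of_not : ∀ {i l m}, IsMaxCone F i l → (∀ x, ¬ Develops d i l m x) → D i (e m) = 0
  inj : ∀ g, (∀ i l, IsMaxCone F i l → D i g = 0) → g = 0
  dev_inj : ∀ {i l m m' x}, IsMaxCone F i l → Develops d i l m x → Develops d i l m' x → m = m'

namespace FanModel

variable {n : ℕ} [NeZero n] {d : ZMod n → ℤ} {F : Set (ZMod n)} {k T : Type*} [Field k]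
  [CommRing T] [Algebra k T] (M : FanModel d F k T) (hF : 3 ≤ F.ncard)

include hF

lemma coeff_eq {i : ZMod n} {l : ℕ} (h : IsMaxCone F i l) {m : BZ n} {x : ℤ × ℤ}
    (hx : Develops d i l m x) (g : T) : (M.D i g).coeff x = M.e.repr g m := by
  classical
  have hl := h.length_lt hF
  have key : ((Finsupp.lapply x).comp (AddMonoidAlgebra.coeffLinearEquiv k).toLinearMap).comp
      (M.D i).toLinearMap = (Finsupp.lapply m).comp M.e.repr.toLinearMap := by
    refine M.e.ext fun q => ?_
    change (M.D i (M.e q)).coeff x = M.e.repr (M.e q) m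
    rw [M.e.repr_self, Finsupp.single_apply]
    by_cases hq : ∃ y, Develops d i l q y
    · obtain ⟨y, hy⟩ := hq
      rw [M.map_of h hy, laurent_coeff_single]
      by_cases hxy : x = y
      · subst hxy
        rw [if_pos rfl, if_pos (M.dev_inj h hy hx)]
      · rw [if_neg hxy, if_neg]
        rintro rfl
        exact hxy (hx.unique (by omega) hy)
    · push Not at hq
      rw [M.map_of_not h hq, if_neg]
      · simp
      · rintro rfl
        exact hq x hx
  exact LinearMap.congr_fun key g

omit hF [NeZero n] in
lemma coeff_eq_zero {i : ZMod n} {l : ℕ} (h : IsMaxCone F i l) {x : ℤ × ℤ}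
    (hx : ∀ m, ¬ Develops d i l m x) (g : T) : (M.D i g).coeff x = 0 := by
  have key : ((Finsupp.lapply x).comp (AddMonoidAlgebra.coeffLinearEquiv k).toLinearMap).comp
      (M.D i).toLinearMap = 0 := by
    refine M.e.ext fun q => ?_
    change (M.D i (M.e q)).coeff x = 0
    by_cases hq : ∃ y, Develops d i l q y
    · obtain ⟨y, hy⟩ := hq
      rw [M.map_of h hy, laurent_coeff_single, if_neg]
      rintro rfl
      exact hx q hy
    · push Not at hq
      rw [M.map_of_not h hq]
      simp
  exact LinearMap.congr_fun key g

include M in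
omit hF [NeZero n] in
lemma exists_add {i : ZMod n} {l : ℕ} (h : IsMaxCone F i l) {m m' : BZ n} {x x' : ℤ × ℤ}
    (hx : Develops d i l m x) (hx' : Develops d i l m' x') :
    ∃ m'', Develops d i l m'' (x + x') := by
  by_contra hne
  push Not at hne
  have h1 := M.coeff_eq_zero h hne (M.e m * M.e m')
  rw [map_mul, M.map_of h hx, M.map_of h hx', AddMonoidAlgebra.single_mul_single, one_mul,
    laurent_coeff_single, if_pos rfl] at h1
  exact one_ne_zero h1

omit hF in
lemma exists_develops (hF : F.Nonempty) (m : BZ n) :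
    ∃ i l x, IsMaxCone F i l ∧ Develops d i l m x := by
  obtain ⟨c, a, b, rfl⟩ := pt_surjective m
  obtain ⟨i, l, t, h, ht, rfl⟩ := exists_isMaxCone hF c
  exact ⟨i, l, _, h, t, a, b, ht, rfl, rfl⟩

lemma mul_eq {i : ZMod n} {l : ℕ} (h : IsMaxCone F i l) {m m' m'' : BZ n} {x x' : ℤ × ℤ}
    (hx : Develops d i l m x) (hx' : Develops d i l m' x') (hx'' : Develops d i l m'' (x + x')) :
    M.e m * M.e m' = M.e m'' := by
  classical
  have hne : F.Nonempty := Set.nonempty_of_ncard_ne_zero (by omega)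
  apply M.e.repr.injective
  ext q
  -- inside the cone, compare the Laurent polynomials on it
  by_cases hq : ∃ y, Develops d i l q y
  · obtain ⟨y, hy⟩ := hq
    rw [← M.coeff_eq hF h hy, ← M.coeff_eq hF h hy, map_mul, M.map_of h hx, M.map_of h hx',
      M.map_of h hx'', AddMonoidAlgebra.single_mul_single, one_mul]
  -- outside the cone, only products of multiples of a common edge could contribute
  obtain ⟨i', l', y, h', hy⟩ := exists_develops (d := d) hne q
  have hii : i ≠ i' := by
    rintro rfl
    rw [← h.length_eq h'] at hy
    exact hq ⟨y, hy⟩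
  have h0 : M.e.repr (M.e m'') q = 0 := by
    rw [M.e.repr_self, Finsupp.single_apply, if_neg]
    rintro rfl
    exact hq ⟨_, hx''⟩
  rw [h0, ← M.coeff_eq hF h' hy, map_mul]
  by_cases h1 : ∃ z, Develops d i' l' m z
  · by_cases h2 : ∃ z, Develops d i' l' m' z
    · obtain ⟨z, hz⟩ := h1
      obtain ⟨z', hz'⟩ := h2
      rw [M.map_of h' hz, M.map_of h' hz', AddMonoidAlgebra.single_mul_single, one_mul,
        laurent_coeff_single, if_neg]
      rintro rfl
      apply hq
      rcases m with _ | q1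
      · rw [(develops_none h'.1).mp hz, zero_add] at hy
        exact ⟨x', M.dev_inj h' hy hz' ▸ hx'⟩
      rcases m' with _ | q2
      · rw [(develops_none h'.1).mp hz', add_zero] at hy
        exact ⟨x, M.dev_inj h' hy hz ▸ hx⟩
      have h3 := hx.inter h h' hii hz
      have h4 := hx'.inter h h' hii hz'
      have hcone : q1.cone = q2.cone := by
        rcases h3.2 with ⟨ha, hb⟩ | ⟨ha, hb⟩ <;> rcases h4.2 with ⟨hc, he⟩ | ⟨hc, he⟩
        · rw [ha, hc]
        · exact (h.not_opposite h' hF he hb).elim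
        · exact (h.not_opposite h' hF hb he).elim
        · rw [ha, hc]
      have hsum : ∀ {i : ZMod n} {l : ℕ}, IsMaxCone F i l → ∀ {y y' : ℤ × ℤ},
          Develops d i l (some q1) y → Develops d i l (some q2) y' →
          Develops d i l (some ⟨q1.cone, q1.a + q2.a, 0, by have := q1.pos; omega⟩) (y + y') := by
        intro i l h y y' hy hy'
        have := h.length_lt hF
        obtain ⟨t, ht, h1, h2, rfl⟩ := (develops_some h.1).mp hy
        obtain ⟨t', ht', h1', h2', rfl⟩ := (develops_some h.1).mp hy'
        obtain rfl := natCast_inj_of_lt (n := n) (by omega) (by omega)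
          (h1.symm.trans (hcone.trans h1'))
        refine (develops_some h.1).mpr ⟨t, ht, h1, fun _ => rfl, ?_⟩
        rw [h3.1, h4.1, add_smul]
        simp
      rw [M.dev_inj h' hy (hsum h' hz hz')]
      exact ⟨_, hsum h hx hx'⟩
    · push Not at h2
      rw [M.map_of_not h' h2, mul_zero]
      simp
  · push Not at h1
    rw [M.map_of_not h' h1, zero_mul]
    simp

omit hF [NeZero n] in
lemma mul_eq_zero {m m' : BZ n} (h : ¬ ∃ i l x x', IsMaxCone F i l ∧ Develops d i l m x ∧
    Develops d i l m' x') : M.e m * M.e m' = 0 := by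
  refine M.inj _ fun i l hil => ?_
  rw [map_mul]
  by_cases h1 : ∃ z, Develops d i l m z
  · obtain ⟨z, hz⟩ := h1
    rw [M.map_of_not (m := m') hil fun z' hz' => h ⟨i, l, z, z', hil, hz, hz'⟩, mul_zero]
  · push Not at h1
    rw [M.map_of_not hil h1, zero_mul]

omit hF [NeZero n] in
lemma e_none : M.e none = 1 := by
  rw [← sub_eq_zero]
  refine M.inj _ fun i l hil => ?_
  rw [map_sub, M.map_of hil ((develops_none hil.1).mpr rfl), map_one, AddMonoidAlgebra.one_def,
    sub_self]

end FanModel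

namespace FanModel

variable {n : ℕ} [NeZero n] {d : ZMod n → ℤ} {F : Set (ZMod n)} {k T : Type u} [Field k]
  [CommRing T] [Algebra k T] (M : FanModel d F k T) (hF : 3 ≤ F.ncard)

/-- The homomorphism `k[Σ_F] → T`. -/
def ofFanAlg : FanAlg d k F →ₐ[k] T :=
  Ideal.Quotient.liftₐ _ (MvPolynomial.aeval M.e) (by
    intro a ha
    have hle : Ideal.span (fanRelations d k F) ≤ RingHom.ker (MvPolynomial.aeval (R := k) M.e) := by
      rw [Ideal.span_le]
      rintro f (rfl | ⟨m, m', m'', i, l, x, x', h, hx, hx', hx'', rfl⟩ | ⟨m, m', h, rfl⟩)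
      · simp [RingHom.mem_ker, M.e_none]
      · simp [RingHom.mem_ker, M.mul_eq hF h hx hx' hx'']
      · simp [RingHom.mem_ker, M.mul_eq_zero h]
    exact RingHom.mem_ker.mp (hle ha))

/-- The class of `z^m` in `k[Σ_F]`. -/
def fanX (d : ZMod n → ℤ) (k : Type u) [Field k] (F : Set (ZMod n)) (m : BZ n) : FanAlg d k F :=
  Ideal.Quotient.mk _ (MvPolynomial.X m)

lemma ofFanAlg_fanX (m : BZ n) : M.ofFanAlg hF (fanX d k F m) = M.e m := by
  change MvPolynomial.aeval (R := k) M.e (MvPolynomial.X m) = _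
  simp

include M in
omit [NeZero n] in
lemma fanX_mul (m m' : BZ n) : fanX d k F m * fanX d k F m' = 0 ∨
    ∃ m'', fanX d k F m * fanX d k F m' = fanX d k F m'' := by
  by_cases h : ∃ i l x x', IsMaxCone F i l ∧ Develops d i l m x ∧ Develops d i l m' x'
  · obtain ⟨i, l, x, x', h, hx, hx'⟩ := h
    obtain ⟨m'', hx''⟩ := M.exists_add h hx hx'
    refine Or.inr ⟨m'', ?_⟩
    rw [fanX, fanX, fanX, ← map_mul, Ideal.Quotient.eq]
    exact Ideal.subset_span (Or.inr (Or.inl ⟨m, m', m'', i, l, x, x', h, hx, hx', hx'', rfl⟩))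
  · refine Or.inl ?_
    rw [fanX, fanX, ← map_mul, Ideal.Quotient.eq_zero_iff_mem]
    exact Ideal.subset_span (Or.inr (Or.inr ⟨m, m', h, rfl⟩))

omit [NeZero n] in
lemma fanX_none : fanX d k F none = 1 := by
  rw [fanX, ← map_one (Ideal.Quotient.mk _), Ideal.Quotient.eq]
  exact Ideal.subset_span (Or.inl rfl)

include M in
omit [NeZero n] in
lemma span_fanX : Submodule.span k (Set.range (fanX d k F)) = ⊤ := by
  rw [eq_top_iff]
  rintro x -
  have hmul : ∀ x ∈ Submodule.span k (Set.range (fanX d k F)), ∀ m,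
      x * fanX d k F m ∈ Submodule.span k (Set.range (fanX d k F)) := by
    intro x hx m
    induction hx using Submodule.span_induction with
    | mem x hx =>
      obtain ⟨m', rfl⟩ := hx
      rcases fanX_mul M m' m with h | ⟨m'', h⟩
      · rw [h]; exact Submodule.zero_mem _
      · rw [h]; exact Submodule.subset_span ⟨m'', rfl⟩
    | zero => rw [zero_mul]; exact Submodule.zero_mem _
    | add x y _ _ hx hy => rw [add_mul]; exact Submodule.add_mem _ hx hy
    | smul c x _ hx => rw [smul_mul_assoc]; exact Submodule.smul_mem _ _ hx
  obtain ⟨f, rfl⟩ := Ideal.Quotient.mk_surjective x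
  induction f using MvPolynomial.induction_on with
  | C c =>
    have : Ideal.Quotient.mk (Ideal.span (fanRelations d k F)) (MvPolynomial.C c)
        = c • fanX d k F none := by
      rw [fanX_none, ← Algebra.algebraMap_eq_smul_one]
      rfl
    rw [this]
    exact Submodule.smul_mem _ _ (Submodule.subset_span ⟨none, rfl⟩)
  | add f g hf hg => rw [map_add]; exact Submodule.add_mem _ hf hg
  | mul_X f m hf =>
    rw [map_mul]
    exact hmul _ hf m

lemma ofFanAlg_bijective : Function.Bijective (M.ofFanAlg hF) := by
  have h1 : ∀ x, M.e.constr k (fanX d k F) (M.ofFanAlg hF x) = x := by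
    intro x
    have key : (M.e.constr k (fanX d k F)).comp (M.ofFanAlg hF).toLinearMap = LinearMap.id := by
      refine LinearMap.ext_on_range M.span_fanX fun m => ?_
      change M.e.constr k (fanX d k F) (M.ofFanAlg hF (fanX d k F m)) = fanX d k F m
      rw [ofFanAlg_fanX, Module.Basis.constr_basis]
    exact LinearMap.congr_fun key x
  refine ⟨Function.LeftInverse.injective h1, fun y => ?_⟩
  have h2 : y ∈ LinearMap.range (M.ofFanAlg hF).toLinearMap := by
    have : y ∈ Submodule.span k (Set.range M.e) := M.e.span_eq ▸ Submodule.mem_top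
    refine Submodule.span_le.mpr ?_ this
    rintro _ ⟨m, rfl⟩
    exact ⟨fanX d k F m, M.ofFanAlg_fanX hF m⟩
  obtain ⟨x, hx⟩ := h2
  exact ⟨x, hx⟩

/-- A fan model is isomorphic to `k[Σ_F]`. -/
def equivFanAlg : FanAlg d k F ≃ₐ[k] T := AlgEquiv.ofBijective _ (M.ofFanAlg_bijective hF)

end FanModel
end MirrorFamily

namespace MirrorFamily

/-! ### The dimension of a fan algebra -/

section Trdeg

variable {k : Type u} [Field k]

/-- The Laurent polynomials are algebraic over the subalgebra generated by the two variables. -/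
lemma laurent_trdeg_le : Algebra.trdeg k (Laurent k) ≤ 2 := by
  let s : Set (Laurent k) :=
    {AddMonoidAlgebra.single (1, 0) 1, AddMonoidAlgebra.single (0, 1) 1}
  have hmem : ∀ a b : ℕ, (AddMonoidAlgebra.single ((a : ℤ), (b : ℤ)) (1 : k) : Laurent k)
      ∈ Algebra.adjoin k s := by
    intro a b
    have : (AddMonoidAlgebra.single ((a : ℤ), (b : ℤ)) (1 : k) : Laurent k)
        = AddMonoidAlgebra.single (1, 0) 1 ^ a * AddMonoidAlgebra.single (0, 1) 1 ^ b := by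
      simp [AddMonoidAlgebra.single_pow, AddMonoidAlgebra.single_mul_single]
    rw [this]
    exact mul_mem (pow_mem (Algebra.subset_adjoin (by simp [s])) _)
      (pow_mem (Algebra.subset_adjoin (by simp [s])) _)
  have halg : Algebra.IsAlgebraic (Algebra.adjoin k s) (Laurent k) := by
    refine ⟨fun x => ?_⟩
    induction x using AddMonoidAlgebra.induction_linear with
    | zero => exact isAlgebraic_zero
    | add a b ha hb => exact ha.add hb
    | single m c =>
      let w : Algebra.adjoin k s :=
        ⟨_, hmem (-m.1).toNat (-m.2).toNat⟩
      let w' : Algebra.adjoin k s :=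
        ⟨_, Subalgebra.smul_mem _ (hmem m.1.toNat m.2.toNat) c⟩
      refine ⟨Polynomial.C w * Polynomial.X - Polynomial.C w', fun h => ?_, ?_⟩
      · have h1 := congrArg (fun p => Polynomial.coeff p 1) h
        simp only [Polynomial.coeff_sub, Polynomial.coeff_C_mul, Polynomial.coeff_X_one, mul_one,
          Polynomial.coeff_C_succ, sub_zero, Polynomial.coeff_zero] at h1
        have h2 := congrArg (fun x : Algebra.adjoin k s => (x : Laurent k).coeff
          (((-m.1).toNat : ℤ), ((-m.2).toNat : ℤ))) h1
        simp [w] at h2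
      · have h3 : (w : Laurent k) * AddMonoidAlgebra.single m c = (w' : Laurent k) := by
          simp only [w, w', AddMonoidAlgebra.single_mul_single, AddMonoidAlgebra.smul_single,
            smul_eq_mul, mul_one, one_mul]
          congr 1
          ext
          · simp only [Prod.fst_add]; omega
          · simp only [Prod.snd_add]; omega
        simp only [map_sub, map_mul, Polynomial.aeval_C, Polynomial.aeval_X]
        rw [sub_eq_zero]
        exact h3
  refine (Algebra.IsAlgebraic.trdeg_le_cardinalMk k s).trans ?_
  refine (Cardinal.mk_insert_le).trans ?_
  rw [Cardinal.mk_singleton]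
  norm_num

lemma le_two_of_injective {s : ℕ} (g : MvPolynomial (Fin s) k →ₐ[k] Laurent k)
    (hg : Function.Injective g) : s ≤ 2 := by
  have h := (trdeg_le_of_injective g hg).trans laurent_trdeg_le
  rw [MvPolynomial.trdeg_of_isDomain] at h
  simpa using h

lemma ringKrullDim_le_of_isIntegral {R S : Type*} [CommRing R] [CommRing S] (g : R →+* S)
    (hg : g.IsIntegral) : ringKrullDim S ≤ ringKrullDim R := by
  let _ := g.toAlgebra
  have : Algebra.IsIntegral R S := ⟨hg⟩
  refine Order.krullDim_le_of_strictMono (fun p => PrimeSpectrum.comap g p) fun p q hpq => ?_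
  exact Ideal.IsIntegral.comap_lt_comap (R := R) (I := p.asIdeal) (J := q.asIdeal) hpq

end Trdeg

namespace FanModel

variable {n : ℕ} [NeZero n] {d : ZMod n → ℤ} {F : Set (ZMod n)} {k T : Type u} [Field k]
  [CommRing T] [Algebra k T] (M : FanModel d F k T) (hF : 3 ≤ F.ncard)

include hF

lemma e_pt_mul (j : ZMod n) (a b a' b' : ℕ) :
    M.e (pt j a b) * M.e (pt j a' b') = M.e (pt j (a + a') (b + b')) := by
  obtain ⟨i, l, t, h, ht, rfl⟩ :=
    exists_isMaxCone (F := F) (Set.nonempty_of_ncard_ne_zero (by omega)) j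
  refine M.mul_eq hF h ⟨t, a, b, ht, rfl, rfl⟩ ⟨t, a', b', ht, rfl, rfl⟩
    ⟨t, a + a', b + b', ht, rfl, ?_⟩
  rw [add_smul, add_smul]
  abel

lemma e_pt (j : ZMod n) (a b : ℕ) :
    M.e (pt j a b) = M.e (pt j 1 0) ^ a * M.e (pt (j + 1) 1 0) ^ b := by
  have h1 : ∀ a : ℕ, M.e (pt j a 0) = M.e (pt j 1 0) ^ a := by
    intro a
    induction a with
    | zero => rw [pt_zero, e_none, pow_zero]
    | succ a ih => rw [pow_succ, ← ih, M.e_pt_mul hF]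
  have h2 : ∀ b : ℕ, M.e (pt j 0 b) = M.e (pt j 0 1) ^ b := by
    intro b
    induction b with
    | zero => rw [pt_zero, e_none, pow_zero]
    | succ b ih => rw [pow_succ, ← ih, M.e_pt_mul hF]
  rw [← h1, ← pt_zero_left, ← h2, M.e_pt_mul hF]
  simp

include M in
lemma finiteType : Algebra.FiniteType k T := by
  classical
  refine ⟨⟨Finset.univ.image fun j => M.e (pt j 1 0), ?_⟩⟩
  rw [← Algebra.toSubmodule_eq_top, eq_top_iff, ← M.e.span_eq, Submodule.span_le]
  rintro _ ⟨m, rfl⟩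
  obtain ⟨j, a, b, rfl⟩ := pt_surjective m
  rw [M.e_pt hF]
  change _ ∈ Algebra.adjoin k _
  exact mul_mem (pow_mem (Algebra.subset_adjoin (by simp)) _)
    (pow_mem (Algebra.subset_adjoin (by simp)) _)

include M in
omit hF [NeZero n] in
lemma nontrivial : Nontrivial T := by
  refine ⟨⟨M.e none, 0, M.e.ne_zero none⟩⟩

include M in
/-- By Noether normalization, a dimension `s > 2` would give an injection of a polynomial ring in
`s` variables into a product of Laurent polynomial rings of transcendence degree `2`. -/
lemma ringKrullDim_le : ringKrullDim T ≤ 2 := by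
  classical
  have := M.finiteType hF
  have := M.nontrivial
  obtain ⟨s, g, hg, hint⟩ := exists_integral_inj_algHom_of_fg k T
  have hs : s ≤ 2 := by
    by_contra hs
    -- if `s > 2`, the homomorphism to every cone has a kernel, and so has their product
    have hker : ∀ i : ZMod n, ∃ p : MvPolynomial (Fin s) k, p ≠ 0 ∧ M.D i (g p) = 0 := by
      intro i
      by_contra hne
      push Not at hne
      refine hs (le_two_of_injective ((M.D i).comp g) ?_)
      rw [injective_iff_map_eq_zero]
      intro p hp
      by_contra h0
      exact hne p h0 hp
    choose p hp0 hp using hker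
    refine Finset.prod_ne_zero_iff.mpr (fun i _ => hp0 i)
      (hg (a₁ := ∏ i, p i) (a₂ := 0) ?_)
    rw [map_zero]
    refine M.inj _ fun i l _ => ?_
    rw [map_prod, map_prod]
    exact Finset.prod_eq_zero (Finset.mem_univ i) (hp i)
  refine (ringKrullDim_le_of_isIntegral _ hint).trans ?_
  rw [MvPolynomial.ringKrullDim_of_isNoetherianRing, ringKrullDim_eq_zero_of_field, zero_add,
    Nat.card_fin]
  exact_mod_cast hs

include M in
/-- The torus of any maximal cone provides a chain of three primes. -/
lemma le_ringKrullDim : 2 ≤ ringKrullDim T := by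
  obtain ⟨c, hc⟩ := Set.nonempty_of_ncard_ne_zero (s := F) (by omega)
  obtain ⟨i, l, t, h, ht, rfl⟩ := exists_isMaxCone ⟨c, hc⟩ c
  have h1 : M.D i (M.e (pt i 1 0)) = AddMonoidAlgebra.single (1, 0) 1 :=
    M.map_of h ⟨0, 1, 0, h.1, by simp, by simp [dev]⟩
  have h2 : M.D i (M.e (pt i 0 1)) = AddMonoidAlgebra.single (0, 1) 1 :=
    M.map_of h ⟨0, 0, 1, h.1, by simp, by simp [dev]⟩
  -- the kernels of the maps to the torus, to a one-dimensional quotient torus, and to the point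
  let q (f : ℤ × ℤ →+ ℤ × ℤ) : PrimeSpectrum T :=
    ⟨RingHom.ker ((AddMonoidAlgebra.mapDomainAlgHom k k f).comp (M.D i)), RingHom.ker_isPrime _⟩
  have hq : ∀ f x, x ∈ (q f).asIdeal ↔ AddMonoidAlgebra.mapDomainAlgHom k k f (M.D i x) = 0 :=
    fun f x => Iff.rfl
  have hle : ∀ f f' : ℤ × ℤ →+ ℤ × ℤ, q f ≤ q (f'.comp f) := by
    intro f f' x hx
    rw [hq] at hx ⊢
    have h3 : AddMonoidAlgebra.mapDomainAlgHom k k (f'.comp f) (M.D i x)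
        = AddMonoidAlgebra.mapDomainAlgHom k k f'
          (AddMonoidAlgebra.mapDomainAlgHom k k f (M.D i x)) := by
      have h4 : AddMonoidAlgebra.mapDomainAlgHom k k (f'.comp f)
          = (AddMonoidAlgebra.mapDomainAlgHom k k f').comp
            (AddMonoidAlgebra.mapDomainAlgHom k k f) := by
        ext y
        simp
      rw [h4, AlgHom.comp_apply]
    rw [h3, hx, map_zero]
  let pr : ℤ × ℤ →+ ℤ × ℤ := (AddMonoidHom.inr ℤ ℤ).comp (AddMonoidHom.snd ℤ ℤ)
  have hsingle : ∀ (f : ℤ × ℤ →+ ℤ × ℤ) (x y : ℤ × ℤ),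
      (AddMonoidAlgebra.mapDomainAlgHom k k f (AddMonoidAlgebra.single x (1 : k) - 1) = 0 ↔ f x = 0) := by
    intro f x y
    rw [map_sub, map_one, sub_eq_zero, AddMonoidAlgebra.one_def]
    simp [AddMonoidAlgebra.mapDomain_single, AddMonoidAlgebra.single_left_inj]
  have h01 : q (AddMonoidHom.id _) < q pr := by
    refine lt_of_le_of_ne (hle (AddMonoidHom.id _) pr) fun he => ?_
    have h3 : M.e (pt i 1 0) - 1 ∈ (q pr).asIdeal := by
      rw [hq, map_sub, map_one, h1, hsingle _ _ 0]
      rfl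
    rw [← he, hq, map_sub, map_one, h1, hsingle _ _ 0] at h3
    simp at h3
  have h12 : q pr < q 0 := by
    refine lt_of_le_of_ne (hle pr 0) fun he => ?_
    have h3 : M.e (pt i 0 1) - 1 ∈ (q 0).asIdeal := by
      rw [hq, map_sub, map_one, h2, hsingle _ _ 0]
      rfl
    rw [← he, hq, map_sub, map_one, h2, hsingle _ _ 0] at h3
    simp [pr] at h3
  let S : LTSeries (PrimeSpectrum T) :=
    { length := 2
      toFun := ![q (AddMonoidHom.id _), q pr, q 0]
      step := fun j => by
        fin_cases j
        · exact h01
        · exact h12 }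
  exact Order.LTSeries.length_le_krullDim S

include M in
theorem ringKrullDim_eq : ringKrullDim T = 2 :=
  le_antisymm (M.ringKrullDim_le hF) (M.le_ringKrullDim hF)

end FanModel
end MirrorFamily

namespace MirrorFamily

/-! ### The vertex -/

section Enumeration

variable {n : ℕ} [NeZero n] {F : Set (ZMod n)}

/-- The rays of a fan in their cyclic order. -/
lemma exists_cyclic_enumeration (hF : F.Nonempty) :
    ∃ (f : ZMod F.ncard → ZMod n) (len : ZMod F.ncard → ℕ), Function.Injective f ∧
      Set.range f = F ∧
      ∀ j, IsMaxCone F (f j) (len j) ∧ f j + ((len j : ℕ) : ZMod n) = f (j + 1) := by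
  classical
  have h1 : ∀ c : F, ∃ l, IsMaxCone F c l := by
    intro c
    obtain ⟨i, l, t, h, ht, hc⟩ := exists_isMaxCone hF c
    have := h.eq_zero_of_mem ht (hc ▸ c.2)
    rw [this, Nat.cast_zero, add_zero] at hc
    exact ⟨l, hc ▸ h⟩
  choose len hlen using h1
  let s : F → F := fun c => ⟨c + ((len c : ℕ) : ZMod n), (hlen c).2.2.1⟩
  have hs : Function.Injective s := by
    intro c c' h
    have h2 : (c : ZMod n) + ((len c : ℕ) : ZMod n) = c' + ((len c' : ℕ) : ZMod n) :=
      congrArg Subtype.val h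
    have h3 := (hlen c).1
    have h4 := (hlen c').1
    refine Subtype.ext ((hlen c).eq_of_add_eq_add (hlen c') (t := len c - 1) (t' := len c' - 1)
      (by omega) (by omega) ?_).1
    rw [Nat.cast_sub h3, Nat.cast_sub h4]
    linear_combination h2
  let σ : Equiv.Perm F := Equiv.ofBijective s (Finite.injective_iff_bijective.mp hs)
  have hcyc : ∀ (r : ℕ) (a b : F), (b : ZMod n) = a + (r : ZMod n) → σ.SameCycle a b := by
    intro r
    induction r using Nat.strong_induction_on with
    | _ r ih =>
      intro a b h
      rcases Nat.eq_zero_or_pos r with rfl | hr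
      · rw [Nat.cast_zero, add_zero] at h
        rw [Subtype.ext h]
      · have hle : len a ≤ r := by
          by_contra hlt
          exact (hlen a).2.2.2 r hr (by omega) (h ▸ b.2)
        have h2 := (hlen a).1
        refine Equiv.Perm.sameCycle_apply_left.mp (ih (r - len a) (by omega) (σ a) b ?_)
        change (b : ZMod n) = a + ((len a : ℕ) : ZMod n) + _
        rw [Nat.cast_sub hle, h]
        ring
  have hon : σ.IsCycleOn (Finset.univ : Finset F) := by
    refine ⟨by simp, fun a _ b _ => ?_⟩
    obtain ⟨x, -, -, hx⟩ := exists_eq_add_natCast (a : ZMod n) (b : ZMod n)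
    exact hcyc x a b hx
  obtain ⟨a, ha⟩ := hF
  have hcard : (Finset.univ : Finset F).card = F.ncard := by
    rw [Set.ncard_eq_toFinset_card', Set.toFinset_card, Finset.card_univ]
  have : NeZero F.ncard := ⟨Set.ncard_ne_zero_of_mem ha⟩
  let f : ZMod F.ncard → F := fun j => (σ ^ j.val) ⟨a, ha⟩
  have hf : ∀ j, f (j + 1) = σ (f j) := by
    intro j
    rw [← Equiv.Perm.mul_apply, ← pow_succ']
    refine (hon.pow_apply_eq_pow_apply (Finset.mem_univ _)).mpr ?_
    rw [hcard, ← ZMod.natCast_eq_natCast_iff]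
    simp
  refine ⟨fun j => f j, fun j => len (f j), fun j j' h => ?_, ?_, fun j => ⟨hlen _, ?_⟩⟩
  · have h2 := (hon.pow_apply_eq_pow_apply (Finset.mem_univ _)).mp (Subtype.ext h)
    rw [hcard, ← ZMod.natCast_eq_natCast_iff] at h2
    simpa using h2
  · ext c
    constructor
    · rintro ⟨j, rfl⟩
      exact (f j).2
    · intro hc
      obtain ⟨r, hr, h2⟩ := hon.exists_pow_eq (Finset.mem_univ ⟨a, ha⟩) (Finset.mem_univ ⟨c, hc⟩)
      refine ⟨r, ?_⟩
      change (((σ ^ (r : ZMod F.ncard).val) ⟨a, ha⟩ : F) : ZMod n) = c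
      rw [ZMod.val_natCast_of_lt (hcard ▸ hr), h2]
  · exact (congrArg Subtype.val (hf j)).symm

end Enumeration

section Quadrant

variable {n : ℕ} {d : ZMod n → ℤ} {i : ZMod n} {l : ℕ}

lemma dev_det (i : ZMod n) (t : ℕ) :
    (dev d i t).1 * (dev d i (t + 1)).2 - (dev d i t).2 * (dev d i (t + 1)).1 = 1 := by
  induction t with
  | zero => simp [dev]
  | succ t ih =>
    simp only [dev, Prod.fst_sub, Prod.snd_sub, Prod.fst_neg, Prod.snd_neg, Prod.smul_fst,
      Prod.smul_snd, smul_eq_mul]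
    linear_combination ih

lemma develops_dev {t : ℕ} (ht : t ≤ l) (hl : 0 < l) :
    Develops d i l (pt (i + (t : ZMod n)) 1 0) (dev d i t) := by
  rw [pt_pos_left one_pos, develops_some hl]
  exact ⟨t, ht, rfl, fun _ => rfl, by simp⟩

/-- A cone that is isomorphic to the quadrant is generated by its two edges, as the generators of
the quadrant are irreducible and an inner generator `v_t` of the subdivision, for which
`v_{t-1} + v_{t+1}` is a multiple of `v_t`, lies on no edge. -/
lemma IsQuadrant.exists_equiv (h : IsQuadrant d i l) (hl : 0 < l) :
    ∃ g : (ℤ × ℤ) ≃+ (ℤ × ℤ), g (1, 0) = (1, 0) ∧ g (dev d i l) = (0, 1) ∧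
      ∀ m x, Develops d i l m x → 0 ≤ (g x).1 ∧ 0 ≤ (g x).2 := by
  obtain ⟨g, hg⟩ := h
  have hpos : ∀ m x, Develops d i l m x → 0 ≤ (g x).1 ∧ 0 ≤ (g x).2 :=
    fun m x hx => (hg x).mp ⟨m, hx⟩
  have hdev : ∀ t ≤ l, 0 ≤ (g (dev d i t)).1 ∧ 0 ≤ (g (dev d i t)).2 :=
    fun t ht => hpos _ _ (develops_dev ht hl)
  have hne : ∀ t, g (dev d i t) ≠ 0 := by
    intro t h0
    have h1 := dev_det (d := d) i t
    rw [g.map_eq_zero_iff.mp h0] at h1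
    simp at h1
  have hirr : ∀ y : ℤ × ℤ, y = (1, 0) ∨ y = (0, 1) → ∃ t ≤ l, g (dev d i t) = y := by
    intro y hy
    obtain ⟨m, t, a, b, ht, -, hx⟩ := (hg (g.symm y)).mpr (by
      rw [g.apply_symm_apply]
      rcases hy with rfl | rfl <;> simp)
    have h1 : y = a • g (dev d i t) + b • g (dev d i (t + 1)) := by
      rw [← g.apply_symm_apply y, hx, map_add, map_nsmul, map_nsmul]
    have h2 := hdev t ht.le
    have h3 := hdev (t + 1) ht
    have h4 := hne t
    have h5 := hne (t + 1)
    generalize hu : g (dev d i t) = u at *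
    generalize hw : g (dev d i (t + 1)) = w at *
    obtain ⟨u1, u2⟩ := u
    obtain ⟨w1, w2⟩ := w
    have key : ∀ (a b : ℕ) (u1 u2 w1 w2 : ℤ), 0 < a → 0 ≤ u1 ∧ 0 ≤ u2 → 0 ≤ w1 ∧ 0 ≤ w2 →
        (u1, u2) ≠ (0 : ℤ × ℤ) → y = a • (u1, u2) + b • (w1, w2) → (u1, u2) = y := by
      intro a b u1 u2 w1 w2 ha hu hw h0 h1
      have ha' : (1 : ℤ) ≤ a := by exact_mod_cast ha
      have e1 : u1 ≤ a * u1 := by nlinarith [hu.1]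
      have e2 : u2 ≤ a * u2 := by nlinarith [hu.2]
      have e3 : 0 ≤ b * w1 := mul_nonneg (by positivity) hw.1
      have e4 : 0 ≤ b * w2 := mul_nonneg (by positivity) hw.2
      have f1 : y.1 = a * u1 + b * w1 := by rw [h1]; simp
      have f2 : y.2 = a * u2 + b * w2 := by rw [h1]; simp
      have h0' : ¬ (u1 = 0 ∧ u2 = 0) := fun h => h0 (Prod.ext h.1 h.2)
      have hy' : y.1 = 1 ∧ y.2 = 0 ∨ y.1 = 0 ∧ y.2 = 1 := by rcases hy with rfl | rfl <;> simp
      exact Prod.ext (by simp only; omega) (by simp only; omega)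
    rcases Nat.eq_zero_or_pos a with rfl | ha
    · rcases Nat.eq_zero_or_pos b with rfl | hb
      · rw [zero_smul, zero_smul, add_zero] at h1
        rcases hy with rfl | rfl <;> simp at h1
      · exact ⟨t + 1, ht, hw.trans (key b 0 w1 w2 u1 u2 hb h3 h2 h5 (by rw [h1, add_comm]))⟩
    · exact ⟨t, ht.le, hu.trans (key a b u1 u2 w1 w2 ha h2 h3 h4 h1)⟩
  have hinner : ∀ y : ℤ × ℤ, y = (1, 0) ∨ y = (0, 1) → ∀ t ≤ l, g (dev d i t) = y →
      t = 0 ∨ t = l := by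
    intro y hy t ht h1
    by_contra hne'
    obtain ⟨t, rfl⟩ : ∃ s, t = s + 1 := ⟨t - 1, by omega⟩
    have h2 : g (dev d i (t + 2)) + g (dev d i t)
        = -d (i + ((t + 1 : ℕ) : ZMod n)) • g (dev d i (t + 1)) := by
      rw [← map_add, ← map_zsmul]
      congr 1
      simp [dev]
    have h3 := hdev t (by omega)
    have h4 := hdev (t + 2) (by omega)
    -- the neighbours are multiples of `v_{t+1}`
    have h5 : ∃ c : ℤ, g (dev d i (t + 2)) = c • g (dev d i (t + 1)) := by
      rw [h1] at h2 ⊢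
      have f1 := congrArg Prod.fst h2
      have f2 := congrArg Prod.snd h2
      simp only [Prod.fst_add, Prod.snd_add, Prod.smul_fst, Prod.smul_snd, smul_eq_mul] at f1 f2
      rcases hy with rfl | rfl
      · refine ⟨(g (dev d i (t + 2))).1, Prod.ext (by simp) ?_⟩
        simp only [mul_zero, Prod.smul_snd, smul_eq_mul] at f2 ⊢
        omega
      · refine ⟨(g (dev d i (t + 2))).2, Prod.ext ?_ (by simp)⟩
        simp only [mul_zero, Prod.smul_fst, smul_eq_mul] at f1 ⊢
        omega
    obtain ⟨c, hc⟩ := h5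
    have h6 := dev_det (d := d) i (t + 1)
    rw [← map_zsmul, g.injective.eq_iff] at hc
    rw [show t + 1 + 1 = t + 2 from rfl, hc] at h6
    simp only [Prod.smul_fst, Prod.smul_snd, smul_eq_mul] at h6
    have : (0 : ℤ) = 1 := by linear_combination h6
    omega
  obtain ⟨t, ht, h1⟩ := hirr (1, 0) (Or.inl rfl)
  obtain ⟨t', ht', h2⟩ := hirr (0, 1) (Or.inr rfl)
  have hd0 : dev d i 0 = (1, 0) := by simp [dev]
  rcases hinner _ (Or.inl rfl) t ht h1 with rfl | rfl <;>
    rcases hinner _ (Or.inr rfl) t' ht' h2 with rfl | rfl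
  · rw [h1] at h2
    simp at h2
  · exact ⟨g, hd0 ▸ h1, h2, hpos⟩
  · refine ⟨g.trans AddEquiv.prodComm, ?_, ?_, fun m x hx => (hpos m x hx).symm⟩
    · rw [← hd0, AddEquiv.trans_apply, h2]
      rfl
    · rw [AddEquiv.trans_apply, h1]
      rfl
  · rw [h1] at h2
    simp at h2

end Quadrant

namespace FanModel

variable {n : ℕ} [NeZero n] {d : ZMod n → ℤ} {F : Set (ZMod n)} {k T : Type u} [Field k]
  [CommRing T] [Algebra k T] (M : FanModel d F k T) (hF : 3 ≤ F.ncard)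
  (hQ : ∀ i l, IsMaxCone F i l → IsQuadrant d i l)

include M hF hQ

/-- If the cones are quadrants, then `T` is the coordinate ring of the vertex: an element of either
ring is determined by its restrictions to the coordinate planes. -/
theorem nonempty_equivVertexAlg : Nonempty (VertexAlg k F.ncard ≃ₐ[k] T) := by
  classical
  have hne : F.Nonempty := Set.nonempty_of_ncard_ne_zero (by omega)
  obtain ⟨f, len, hf, hrange, hmax⟩ := exists_cyclic_enumeration hne
  have : Fact (1 < F.ncard) := ⟨by omega⟩
  let Ξ : MvPolynomial (ZMod F.ncard) k →ₐ[k] T := MvPolynomial.aeval fun j => M.e (pt (f j) 1 0)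
  have hX : ∀ j, Ξ (MvPolynomial.X j) = M.e (pt (f j) 1 0) := fun j => MvPolynomial.aeval_X _ j
  have hD0 : ∀ j, M.D (f j) (Ξ (MvPolynomial.X j)) = AddMonoidAlgebra.single (1, 0) 1 := by
    intro j
    rw [hX]
    refine M.map_of (hmax j).1 ?_
    simpa [dev] using develops_dev (d := d) (i := f j) (Nat.zero_le (len j)) (hmax j).1.1
  have hD1 : ∀ j, M.D (f j) (Ξ (MvPolynomial.X (j + 1)))
      = AddMonoidAlgebra.single (dev d (f j) (len j)) 1 := by
    intro j
    rw [hX, ← (hmax j).2]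
    exact M.map_of (hmax j).1 (develops_dev le_rfl (hmax j).1.1)
  have hD2 : ∀ j j', j' ≠ j → j' ≠ j + 1 → M.D (f j) (Ξ (MvPolynomial.X j')) = 0 := by
    intro j j' h0 h1
    rw [hX]
    refine M.map_of_not (hmax j).1 fun x hx => ?_
    rw [pt_pos_left one_pos, develops_some (hmax j).1.1] at hx
    obtain ⟨t, ht, h2, -, -⟩ := hx
    change f j' = _ at h2
    rcases Nat.eq_zero_or_pos t with rfl | ht0
    · exact h0 (hf (by simpa using h2))
    · rcases ht.lt_or_eq with ht | rfl
      · exact (hmax j).1.2.2.2 t ht0 ht (h2 ▸ hrange ▸ ⟨j', rfl⟩)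
      · exact h1 (hf (h2.trans (hmax j).2))
  have hker : RingHom.ker Ξ = ⨅ i : ZMod F.ncard, Ideal.span
      ((fun j => (MvPolynomial.X j : MvPolynomial (ZMod F.ncard) k)) '' {j | j ≠ i ∧ j ≠ i + 1}) := by
    ext p
    rw [RingHom.mem_ker, Ideal.mem_iInf]
    constructor
    · intro hp j
      obtain ⟨g, hg0, hg1, -⟩ := (hQ _ _ (hmax j).1).exists_equiv (hmax j).1.1
      rw [MvPolynomial.mem_ideal_span_X_image]
      intro s hs
      by_contra hs'
      push Not at hs'
      -- the coefficient of a monomial in `X_j`, `X_{j+1}` can be read off in the plane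
      have hmon : ∀ s' : ZMod F.ncard →₀ ℕ, ∀ c : k,
          (M.D (f j) (Ξ (MvPolynomial.monomial s' c))).coeff (g.symm (s j, s (j + 1)))
            = (MvPolynomial.monomial s' c).coeff s := by
        intro s' c
        by_cases h : ∃ j', (j' ≠ j ∧ j' ≠ j + 1) ∧ s' j' ≠ 0
        · obtain ⟨j', hj', h0⟩ := h
          have h1 : s' = Finsupp.single j' 1 + (s' - Finsupp.single j' 1) := by
            rw [add_tsub_cancel_of_le]
            rw [Finsupp.single_le_iff]
            omega
          rw [MvPolynomial.coeff_monomial, if_neg (by rintro rfl; exact h0 (hs' j' hj')), h1,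
            ← one_mul c, ← MvPolynomial.monomial_mul, map_mul, map_mul]
          change (M.D (f j) (Ξ (MvPolynomial.X j')) * _).coeff _ = 0
          rw [hD2 j j' hj'.1 hj'.2, zero_mul]
          rfl
        · push Not at h
          have hs2 : ∀ s : ZMod F.ncard →₀ ℕ, (∀ j', j' ≠ j ∧ j' ≠ j + 1 → s j' = 0) →
              s = Finsupp.single j (s j) + Finsupp.single (j + 1) (s (j + 1)) := by
            intro s hs
            ext j'
            by_cases h1 : j' = j
            · subst h1
              simp
            · by_cases h2 : j' = j + 1
              · subst h2
                simp
              · rw [hs j' ⟨h1, h2⟩]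
                simp [Ne.symm h1, Ne.symm h2]
          have h1 : MvPolynomial.monomial s' c = MvPolynomial.C c * MvPolynomial.X j ^ s' j
              * MvPolynomial.X (j + 1) ^ s' (j + 1) := by
            conv_lhs => rw [hs2 s' h]
            rw [MvPolynomial.C_mul_X_pow_eq_monomial, MvPolynomial.X_pow_eq_monomial,
              MvPolynomial.monomial_mul, mul_one]
          have h2 : M.D (f j) (Ξ (MvPolynomial.monomial s' c))
              = AddMonoidAlgebra.single (g.symm (s' j, s' (j + 1))) c := by
            rw [h1, map_mul, map_mul, map_mul, map_mul, map_pow, map_pow, map_pow, map_pow, hD0, hD1,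
              ← MvPolynomial.algebraMap_eq, AlgHom.commutes, AlgHom.commutes,
              AddMonoidAlgebra.single_pow, AddMonoidAlgebra.single_pow,
              AddMonoidAlgebra.coe_algebraMap, Function.comp_apply,
              AddMonoidAlgebra.single_mul_single, AddMonoidAlgebra.single_mul_single]
            congr 1
            · rw [eq_comm, g.symm_apply_eq, zero_add, map_add g, map_nsmul, map_nsmul, hg0, hg1]
              ext <;> simp
            · simp
          rw [h2, laurent_coeff_single, MvPolynomial.coeff_monomial]
          congr 1
          rw [g.symm.injective.eq_iff, Prod.mk.injEq, Nat.cast_inj, Nat.cast_inj, eq_iff_iff]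
          constructor
          · rintro ⟨h3, h4⟩
            rw [hs2 s hs', hs2 s' h, h3, h4]
          · rintro rfl
            exact ⟨rfl, rfl⟩
      have hcoeff : (M.D (f j) (Ξ p)).coeff (g.symm (s j, s (j + 1))) = p.coeff s := by
        clear hp hs
        induction p using MvPolynomial.monomial_add_induction_on with
        | C c => exact hmon 0 c
        | monomial_add s' c p _ _ ih =>
          rw [map_add, map_add, MvPolynomial.coeff_add, ← ih, ← hmon]
          rfl
      rw [hp, map_zero] at hcoeff
      exact MvPolynomial.mem_support_iff.mp hs hcoeff.symm
    · intro hp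
      refine M.inj _ fun i l hil => ?_
      obtain ⟨j, rfl⟩ : i ∈ Set.range f := by rw [hrange]; exact hil.2.1
      have hle : Ideal.span ((fun j => (MvPolynomial.X j : MvPolynomial (ZMod F.ncard) k)) ''
          {j' | j' ≠ j ∧ j' ≠ j + 1}) ≤ RingHom.ker ((M.D (f j)).comp Ξ) := by
        rw [Ideal.span_le]
        rintro _ ⟨j', hj', rfl⟩
        exact hD2 j j' hj'.1 hj'.2
      exact hle (hp j)
  have hsurj : Function.Surjective Ξ := by
    rw [← AlgHom.range_eq_top, ← Algebra.toSubmodule_eq_top, eq_top_iff, ← M.e.span_eq,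
      Submodule.span_le]
    rintro _ ⟨m, rfl⟩
    obtain ⟨i, l, x, hil, hx⟩ := exists_develops (d := d) hne m
    obtain ⟨j, rfl⟩ : i ∈ Set.range f := by rw [hrange]; exact hil.2.1
    obtain rfl := hil.length_eq (hmax j).1
    obtain ⟨g, hg0, hg1, hg⟩ := (hQ _ _ hil).exists_equiv hil.1
    obtain ⟨a, ha⟩ := Int.eq_ofNat_of_zero_le (hg m x hx).1
    obtain ⟨b, hb⟩ := Int.eq_ofNat_of_zero_le (hg m x hx).2
    have hx' : x = a • (1, 0) + b • dev d (f j) (len j) := by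
      apply g.injective
      rw [map_add, map_nsmul, map_nsmul, hg0, hg1]
      ext <;> simp [ha, hb]
    refine ⟨MvPolynomial.X j ^ a * MvPolynomial.X (j + 1) ^ b, ?_⟩
    change Ξ _ = _
    rw [map_mul, map_pow, map_pow, hX, hX, ← mul_one (M.e (pt (f j) 1 0) ^ a),
      ← mul_one (M.e (pt (f (j + 1)) 1 0) ^ b)]
    have h1 := M.e_pt hF (f j) a 0
    have h2 := M.e_pt hF (f (j + 1)) b 0
    rw [pow_zero] at h1 h2
    rw [← h1, ← h2]
    refine M.mul_eq hF hil (x := a • (1, 0)) (x' := b • dev d (f j) (len j))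
      ⟨0, a, 0, hil.1, by simp, by simp [dev]⟩
      ⟨len j - 1, 0, b, by have := hil.1; omega, ?_, ?_⟩ (hx' ▸ hx)
    · rw [← (hmax j).2, pt_zero_left, Nat.cast_sub hil.1]
      congr 1
      push_cast
      ring
    · rw [Nat.sub_add_cancel hil.1]
      simp
  exact ⟨(Ideal.quotientEquivAlgOfEq k hker.symm).trans
    (Ideal.quotientKerAlgEquivOfSurjective hsurj)⟩

end FanModel
end MirrorFamily

namespace MirrorFamily

/-! ### Development of piecewise linear relations over a field -/

section Development

variable {n : ℕ} {k : Type*} [Field k] (d : ZMod n → ℤ) (τ : ZMod n → k) (i : ZMod n)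

/-- The parallel transport of tangent vectors from `σ_i` to `σ_{i+s}`. -/
def devEquiv : ℕ → (ℤ × ℤ) ≃+ (ℤ × ℤ)
  | 0 => AddEquiv.refl _
  | s + 1 => (devEquiv s).trans (glueΛ d (i + (s : ZMod n)))

/-- The factor acquired by the coefficient at `x` in the transport from `σ_i` to `σ_{i+s}`. -/
def devWeight : ℕ → ℤ × ℤ → k
  | 0, _ => 1
  | s + 1, x => devWeight s x * τ (i + (s : ZMod n) + 1) ^ (devEquiv d i s x).1

variable {d τ i}

lemma devEquiv_dev (s : ℕ) :
    devEquiv d i s (dev d i s) = (1, 0) ∧ devEquiv d i s (dev d i (s + 1)) = (0, 1) := by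
  induction s with
  | zero => exact ⟨rfl, rfl⟩
  | succ s ih =>
    have h1 : devEquiv d i (s + 1) (dev d i (s + 1)) = (1, 0) := by
      rw [devEquiv, AddEquiv.trans_apply, ih.2, glueΛ_apply]
      simp
    refine ⟨h1, ?_⟩
    rw [show dev d i (s + 1 + 1)
      = -(d (i + ((s + 1 : ℕ) : ZMod n)) • dev d i (s + 1)) - dev d i s from rfl, map_sub, map_neg,
      map_zsmul, h1, devEquiv, AddEquiv.trans_apply, ih.1, glueΛ_apply]
    ext
    · simp [add_assoc]
    · simp

lemma devEquiv_smul_add (s a b : ℕ) :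
    devEquiv d i s (a • dev d i s + b • dev d i (s + 1)) = ((a : ℤ), (b : ℤ)) := by
  rw [map_add, map_nsmul, map_nsmul, (devEquiv_dev s).1, (devEquiv_dev s).2]
  ext <;> simp

lemma devWeight_ne_zero {s : ℕ} (hτ : ∀ r : ℕ, 1 ≤ r → r ≤ s → τ (i + (r : ZMod n)) ≠ 0)
    (x : ℤ × ℤ) : devWeight d τ i s x ≠ 0 := by
  induction s with
  | zero => exact one_ne_zero
  | succ s ih =>
    refine mul_ne_zero (ih fun r h1 h2 => hτ r h1 (by omega)) (zpow_ne_zero _ ?_)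
    have := hτ (s + 1) (by omega) le_rfl
    rwa [Nat.cast_succ, ← add_assoc] at this

lemma devWeight_nsmul (s a : ℕ) (x : ℤ × ℤ) :
    devWeight d τ i s (a • x) = devWeight d τ i s x ^ a := by
  induction s with
  | zero => simp [devWeight]
  | succ s ih =>
    rw [devWeight, devWeight, ih, map_nsmul, mul_pow, Prod.smul_fst, nsmul_eq_mul, mul_comm (a : ℤ),
      zpow_mul, zpow_natCast]

variable {u : ZMod n → ℤ × ℤ → k}

lemma PLRel.develop (h : PLRel d τ ⊥ u) {s : ℕ}
    (hτ : ∀ r : ℕ, 1 ≤ r → r ≤ s → τ (i + (r : ZMod n)) ≠ 0) (x : ℤ × ℤ) :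
    u (i + (s : ZMod n)) (devEquiv d i s x) = devWeight d τ i s x * u i x := by
  induction s with
  | zero => simp [devWeight, devEquiv]
  | succ s ih =>
    have h0 := hτ (s + 1) (by omega) le_rfl
    rw [Nat.cast_succ, ← add_assoc] at h0 ⊢
    rw [devEquiv, devWeight, AddEquiv.trans_apply, mul_right_comm,
      ← ih fun r h1 h2 => hτ r h1 (by omega)]
    set y := devEquiv d i s x
    rcases le_total 0 y.1 with hy | hy
    · have h1 := h.ge (i + (s : ZMod n)) y hy
      rw [Submodule.mem_bot, sub_eq_zero] at h1
      rw [h1, mul_comm, ← zpow_natCast, Int.toNat_of_nonneg hy]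
    · have h1 := h.le (i + (s : ZMod n)) y hy
      rw [Submodule.mem_bot, sub_eq_zero, ← zpow_natCast, Int.toNat_of_nonneg (by omega)] at h1
      rw [h1, mul_right_comm, ← zpow_add₀ h0, neg_add_cancel, zpow_zero, one_mul]

variable {F : Set (ZMod n)} {l : ℕ}

/-- The coefficients vanish outside the maximal cones of the fan whose rays are the zeros of `τ`. -/
lemma PLRel.exists_develops (h : PLRel d τ ⊥ u) (hF : ∀ s ∈ F, τ s = 0) (hil : IsMaxCone F i l)
    {x : ℤ × ℤ} (hx : u i x ≠ 0) : ∃ m, Develops d i l m x := by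
  have hkill : ∀ s ∈ F, ∀ j m, τ s * u j m ∈ (⊥ : Ideal k) := fun s hs j m => by
    rw [hF s hs, zero_mul]
    exact Ideal.zero_mem _
  have key : ∀ r s : ℕ, s + r = l → 0 < r → 0 ≤ (devEquiv d i s x).2 →
      u (i + (s : ZMod n)) (devEquiv d i s x) ≠ 0 → ∃ m, Develops d i l m x := by
    intro r
    induction r with
    | zero => intro s _ h0; omega
    | succ r ih =>
      intro s hs _ h2 hu
      by_cases h1 : 0 ≤ (devEquiv d i s x).1
      · refine ⟨_, s, (devEquiv d i s x).1.toNat, (devEquiv d i s x).2.toNat, by omega, rfl, ?_⟩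
        apply (devEquiv d i s).injective
        rw [devEquiv_smul_add, Int.toNat_of_nonneg h1, Int.toNat_of_nonneg h2]
      · obtain ⟨h3, h4⟩ := h.step_ccw hkill (j := i + (s : ZMod n)) (by omega) hu
        have hlt : 0 < r := by
          by_contra h0
          obtain rfl : l = s + 1 := by omega
          refine h3 ?_
          have := hil.2.2.1
          rwa [Nat.cast_succ, ← add_assoc] at this
        refine ih (s + 1) (by omega) hlt ?_ ?_
        · rw [devEquiv, AddEquiv.trans_apply, glueΛ_apply]
          simp only; omega
        · rw [Nat.cast_succ, ← add_assoc]
          exact h4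
  refine key l 0 (by omega) hil.1 ?_ (by simpa [devEquiv] using hx)
  by_contra h2
  have h3 := (h.step_cw hkill (j := i - 1) (m := x) (by simpa [devEquiv] using h2)
    (by rw [sub_add_cancel]; exact hx)).1
  rw [sub_add_cancel] at h3
  exact h3 hil.2.1

end Development

/-! ### The algebra of a closed fibre -/

section Fibre

variable {n : ℕ} [NeZero n] {A k : Type*} [CommRing A] [Field k] [Algebra k A] {d : ZMod n → ℤ}
  {t : ZMod n → A} {F₀ : Set (ZMod n)} {𝔍 : Ideal A} {Γ : Type*} [CommRing Γ] [Algebra A Γ]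
  (𝒜 : ConeAtlas d t F₀ 𝔍 Γ) (ε : A →ₐ[k] k)

omit [NeZero n] in
variable (t) in
/-- The rays whose bending parameters vanish at the point `ε`. -/
abbrev raysOver : Set (ZMod n) := {s | ε (t s) = 0}

namespace ConeAtlas

/-- The coefficients of a function in the fibre over the point `ε`. -/
def fib (g : Γ) (j : ZMod n) (m : ℤ × ℤ) : k := ε ((𝒜.y j g).coeff m)

variable {𝒜 ε} (hε : 𝔍 ≤ RingHom.ker ε)
include hε

omit [NeZero n] in
lemma fib_plRel (g : Γ) : PLRel d (fun s => ε (t s)) ⊥ (𝒜.fib ε g) := by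
  have h := 𝒜.plRel hε g
  refine ⟨fun j m hm => ?_, fun j m hm => ?_⟩
  · have := h.le j m hm
    rwa [RingHom.mem_ker, map_sub, map_mul, map_pow] at this
  · have := h.ge j m hm
    rwa [RingHom.mem_ker, map_sub, map_mul, map_pow] at this

lemma fib_own (g : Γ) (j : ZMod n) (a b : ℕ) :
    𝒜.fib ε g j ((a : ℤ), (b : ℤ)) = ε (𝒜.own (pt j a b) g) := by
  have := 𝒜.own_pt_mem hε g j a b
  rwa [RingHom.mem_ker, map_sub, sub_eq_zero] at this

lemma fib_zero (g : Γ) (j j' : ZMod n) : 𝒜.fib ε g j 0 = 𝒜.fib ε g j' 0 := by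
  have h1 := fib_own (𝒜 := 𝒜) hε g j 0 0
  have h2 := fib_own (𝒜 := 𝒜) hε g j' 0 0
  rw [pt_zero] at h1 h2
  exact h1.trans h2.symm

end ConeAtlas

variable {𝒜 ε} {ϑ : BZ n → Γ} (hϑ : 𝒜.IsDual ϑ) (hε : 𝔍 ≤ RingHom.ker ε)
  (h3 : 3 ≤ (raysOver t ε).ncard)

omit [NeZero n] in
lemma IsMaxCone.apply_ne_zero {i : ZMod n} {l : ℕ} (h : IsMaxCone (raysOver t ε) i l) {s : ℕ} (hs : s < l) :
    ∀ r : ℕ, 1 ≤ r → r ≤ s → ε (t (i + (r : ZMod n))) ≠ 0 :=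
  fun r h1 h2 => h.2.2.2 r (by omega) (by omega)

namespace ConeAtlas

include hε in
/-- The coefficient of a function at the development of an integral point. -/
lemma fib_develops (𝒜 : ConeAtlas d t F₀ 𝔍 Γ) (g : Γ) {i : ZMod n} {l s a b : ℕ} (h : IsMaxCone (raysOver t ε) i l) (hs : s < l) :
    devWeight d (fun s => ε (t s)) i s (a • dev d i s + b • dev d i (s + 1))
      * 𝒜.fib ε g i (a • dev d i s + b • dev d i (s + 1))
      = ε (𝒜.own (pt (i + (s : ZMod n)) a b) g) := by
  rw [← (fib_plRel hε g).develop (h.apply_ne_zero hs), devEquiv_smul_add, fib_own hε]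

namespace IsDual

include hϑ hε

omit [NeZero n] in
open scoped Classical in
lemma own_eq (q q' : BZ n) : ε (𝒜.own q' (ϑ q)) = if q' = q then 1 else 0 := by
  have h := hε (hϑ q q')
  rw [RingHom.mem_ker, map_sub, sub_eq_zero] at h
  rw [h]
  split_ifs <;> simp

lemma fib_ne_zero {i : ZMod n} {l : ℕ} (h : IsMaxCone (raysOver t ε) i l) {m : BZ n} {x : ℤ × ℤ}
    (hx : Develops d i l m x) : 𝒜.fib ε (ϑ m) i x ≠ 0 := by
  obtain ⟨s, a, b, hs, rfl, rfl⟩ := hx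
  have h1 := fib_develops hε 𝒜 (ϑ (pt (i + (s : ZMod n)) a b)) (a := a) (b := b) h hs
  rw [hϑ.own_eq hε, if_pos rfl] at h1
  exact right_ne_zero_of_mul_eq_one h1

lemma eq_of_fib_ne_zero {i : ZMod n} {l : ℕ} (h : IsMaxCone (raysOver t ε) i l) {m m' : BZ n} {x : ℤ × ℤ}
    (hx : 𝒜.fib ε (ϑ m) i x ≠ 0) (hm : Develops d i l m' x) : m' = m := by
  obtain ⟨s, a, b, hs, rfl, rfl⟩ := hm
  have h1 := fib_develops hε 𝒜 (ϑ m) (a := a) (b := b) h hs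
  rw [hϑ.own_eq hε] at h1
  by_contra hne
  rw [if_neg hne] at h1
  exact mul_ne_zero (devWeight_ne_zero (h.apply_ne_zero hs) _) hx h1

lemma develops_of_fib_ne_zero {i : ZMod n} {l : ℕ} (h : IsMaxCone (raysOver t ε) i l) {m : BZ n} {x : ℤ × ℤ}
    (hx : 𝒜.fib ε (ϑ m) i x ≠ 0) : Develops d i l m x := by
  obtain ⟨m', hm'⟩ := (fib_plRel hε (ϑ m)).exists_develops (fun s hs => hs) h hx
  rwa [← hϑ.eq_of_fib_ne_zero hε h hx hm']

include h3

/-- The edges of a maximal cone are not parallel. They are not equal, since distinct integral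
points of the cone have distinct developments; and if they were opposite, then the product of the
theta functions of the two primitive generators would have a constant term on this cone but vanish
on the next one. -/
lemma dev_snd_ne_zero {i : ZMod n} {l : ℕ} (h : IsMaxCone (raysOver t ε) i l) : (dev d i l).2 ≠ 0 := by
  intro h0
  have hl := h.length_lt h3
  have hl0 := h.1
  have hneil : i + (l : ZMod n) ≠ i := add_natCast_eq_self hl0 (by omega)
  have hv := develops_dev (d := d) (i := i) (Nat.zero_le l) hl0
  have hv' := develops_dev (d := d) (i := i) (le_refl l) hl0
  rw [Nat.cast_zero, add_zero] at hv
  have hdet := dev_det (d := d) i (l - 1)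
  rw [Nat.sub_add_cancel hl0, h0, mul_zero, zero_sub, ← neg_mul] at hdet
  have hd0 : dev d i 0 = (1, 0) := rfl
  rcases Int.eq_one_or_neg_one_of_mul_eq_one' hdet with ⟨-, h1⟩ | ⟨-, h1⟩
  · have h2 : dev d i l = dev d i 0 := Prod.ext h1 h0
    rw [h2] at hv'
    have h4 := hϑ.eq_of_fib_ne_zero hε h (hϑ.fib_ne_zero hε h hv) hv'
    rw [pt_pos_left one_pos, pt_pos_left one_pos, Option.some.injEq, B0Z.mk.injEq] at h4
    exact hneil h4.1
  · have h2 : dev d i l = -dev d i 0 := Prod.ext h1 h0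
    have hmul : ∀ j, 𝒜.fib ε (ϑ (pt i 1 0) * ϑ (pt (i + (l : ZMod n)) 1 0)) j 0
        = (𝒜.y j (ϑ (pt i 1 0))).coeff.sum fun m' r =>
          ε r * 𝒜.fib ε (ϑ (pt (i + (l : ZMod n)) 1 0)) j (-m') := by
      intro j
      rw [fib, map_mul, laurent_coeff_mul, map_finsuppSum]
      simp only [map_mul, zero_sub]
      rfl
    obtain ⟨i', l', s, h', hs, he⟩ := exists_isMaxCone (F := (raysOver t ε))
      (Set.nonempty_of_ncard_ne_zero (by omega)) (i + (l : ZMod n))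
    have hs0 := h'.eq_zero_of_mem hs (he ▸ h.2.2.1)
    rw [hs0, Nat.cast_zero, add_zero] at he
    have hzero : 𝒜.fib ε (ϑ (pt i 1 0) * ϑ (pt (i + (l : ZMod n)) 1 0)) i' 0 = 0 := by
      rw [hmul]
      refine Finset.sum_eq_zero fun x _ => mul_eq_zero_of_left ?_ _
      by_contra hne
      have h4 := hϑ.develops_of_fib_ne_zero hε h' hne
      rw [pt_pos_left one_pos, develops_some h'.1] at h4
      obtain ⟨r, hr, h5, -⟩ := h4
      change i = _ at h5
      rcases hr.lt_or_eq with hr | rfl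
      · have := h'.eq_zero_of_mem hr (h5 ▸ h.2.1)
        rw [this, Nat.cast_zero, add_zero] at h5
        exact hneil (he.trans h5.symm)
      · exact h.not_opposite h' h3 he.symm h5
    rw [fib_zero hε _ i' i, hmul, Finsupp.sum, Finset.sum_eq_single (dev d i 0)] at hzero
    · refine mul_ne_zero ?_ ?_ hzero
      · exact hϑ.fib_ne_zero hε h hv
      · exact hϑ.fib_ne_zero hε h (h2 ▸ hv')
    · intro x _ hx
      refine mul_eq_zero_of_left ?_ _
      by_contra hne
      exact hx ((hϑ.develops_of_fib_ne_zero hε h hne).unique (by omega) hv)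
    · intro hx
      exact absurd (by rw [fib, Finsupp.notMem_support_iff.mp hx, map_zero])
        (hϑ.fib_ne_zero hε h hv)

end IsDual
end ConeAtlas
end Fibre
end MirrorFamily

namespace MirrorFamily

/-! ### Normalized theta functions on a closed fibre -/

section Twist

variable {k : Type*} [Field k]

/-- The automorphism `z^m ↦ β^{m_2} z^m` of the torus. -/
def twist (β : kˣ) : Laurent k →ₐ[k] Laurent k :=
  AddMonoidAlgebra.lift k (Laurent k) (ℤ × ℤ)
    { toFun := fun m => AddMonoidAlgebra.single m.toAdd ((β ^ m.toAdd.2 : kˣ) : k)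
      map_one' := by simp [AddMonoidAlgebra.one_def]
      map_mul' := fun m m' => by
        simp [AddMonoidAlgebra.single_mul_single, zpow_add] }

lemma coeff_twist (β : kˣ) (x : Laurent k) (m : ℤ × ℤ) :
    (twist β x).coeff m = ((β ^ m.2 : kˣ) : k) * x.coeff m := by
  induction x using AddMonoidAlgebra.induction_linear with
  | zero => simp
  | add x y hx hy => simp [hx, hy, mul_add]
  | single m' c =>
    rw [twist, AddMonoidAlgebra.lift_single]
    simp only [MonoidHom.coe_mk, OneHom.coe_mk, toAdd_ofAdd, AddMonoidAlgebra.smul_single,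
      smul_eq_mul, laurent_coeff_single]
    split_ifs with h
    · rw [h, mul_comm]
    · rw [mul_zero]

lemma exists_unit_zpow_eq [IsAlgClosed k] {z : ℤ} (hz : z ≠ 0) (w : kˣ) : ∃ β : kˣ, β ^ z = w := by
  have hpos : 0 < z.natAbs := Int.natAbs_pos.mpr hz
  have key : ∀ w : kˣ, ∃ β : kˣ, β ^ z.natAbs = w := by
    intro w
    obtain ⟨b, hb⟩ := IsAlgClosed.exists_pow_nat_eq (w : k) hpos
    have hb0 : b ≠ 0 := by
      rintro rfl
      rw [zero_pow hpos.ne'] at hb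
      exact w.ne_zero hb.symm
    exact ⟨Units.mk0 b hb0, Units.ext (by simpa using hb)⟩
  rcases Int.natAbs_eq z with h | h
  · obtain ⟨β, hβ⟩ := key w
    exact ⟨β, by rw [h, zpow_natCast, hβ]⟩
  · obtain ⟨β, hβ⟩ := key w⁻¹
    exact ⟨β, by rw [h, zpow_neg, zpow_natCast, hβ, inv_inv]⟩

end Twist

section FibreModel

variable {n : ℕ} [NeZero n] {A k : Type*} [CommRing A] [Field k] [Algebra k A] {d : ZMod n → ℤ}
  {t : ZMod n → A} {F₀ : Set (ZMod n)} {𝔍 : Ideal A} {Γ : Type*} [CommRing Γ] [Algebra A Γ]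
  {𝒜 : ConeAtlas d t F₀ 𝔍 Γ} {ε : A →ₐ[k] k} {ϑ : BZ n → Γ} (hϑ : 𝒜.IsDual ϑ)
  (hε : 𝔍 ≤ RingHom.ker ε) (h3 : 3 ≤ (raysOver t ε).ncard)

namespace ConeAtlas.IsDual
include hϑ hε h3

/-- The coefficients of the theta functions become `1` on the edges of all cones after a suitable
rescaling on every cone. -/
lemma exists_twist [IsAlgClosed k] : ∃ β : ZMod n → kˣ, ∀ i l, IsMaxCone (raysOver t ε) i l →
    ∀ (q : B0Z n) x, Develops d i l (some q) x → q.b = 0 →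
      q.cone = i ∨ q.cone = i + (l : ZMod n) →
      ((β i ^ x.2 : kˣ) : k) * 𝒜.fib ε (ϑ (some q)) i x = 1 := by
  have hβ : ∀ i, ∃ β : kˣ, ∀ l, IsMaxCone (raysOver t ε) i l →
      ((β ^ (dev d i l).2 : kˣ) : k)
        = devWeight d (fun s => ε (t s)) i (l - 1) (dev d i l) := by
    intro i
    by_cases h : ∃ l, IsMaxCone (raysOver t ε) i l
    · obtain ⟨l, h⟩ := h
      have hl := h.1
      have h0 := devWeight_ne_zero (d := d) (τ := fun s => ε (t s))
        (h.apply_ne_zero (s := l - 1) (by omega)) (dev d i l)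
      obtain ⟨β, hβ⟩ := exists_unit_zpow_eq (hϑ.dev_snd_ne_zero hε h3 h) (Units.mk0 _ h0)
      refine ⟨β, fun l' h' => ?_⟩
      rw [← h.length_eq h', hβ, Units.val_mk0]
    · exact ⟨1, fun l h' => absurd ⟨l, h'⟩ h⟩
  choose β hβ using hβ
  refine ⟨β, fun i l h q x hx hb hq => ?_⟩
  have hl := h.1
  have hln := h.length_lt h3
  obtain ⟨s, hs, h1, -, rfl⟩ := (develops_some h.1).mp hx
  rw [hb, zero_smul, add_zero]
  rcases hq with hq | hq
  · obtain rfl : s = 0 := natCast_inj_of_lt (n := n) (by omega) (by omega)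
      (h1.symm.trans (hq.trans (by simp)))
    have h2 := fib_develops hε 𝒜 (ϑ (some q)) (a := q.a) (b := 0) h hl
    rw [Nat.cast_zero, add_zero, zero_smul, add_zero, ← hq, pt_pos_left q.pos,
      hϑ.own_eq hε, if_pos] at h2
    · rw [← h2, ← hq]
      simp [devWeight, dev]
    · obtain ⟨c, a, b, _⟩ := q
      simp only at hb
      rw [hb]
  · obtain rfl : s = l := natCast_inj_of_lt (n := n) (by omega) (by omega) (h1.symm.trans hq)
    have h2 := fib_develops hε 𝒜 (ϑ (some q)) (s := s - 1) (a := 0) (b := q.a) h (by omega)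
    rw [zero_smul, zero_add, pt_zero_left, Nat.cast_sub hl, add_assoc, Nat.cast_one,
      sub_add_cancel, ← hq, pt_pos_left q.pos, hϑ.own_eq hε, Nat.sub_add_cancel hl,
      devWeight_nsmul, if_pos, ← hβ i s h] at h2
    · rw [← h2]
      congr 1
      rw [Prod.smul_snd, nsmul_eq_mul, mul_comm, zpow_mul, zpow_natCast, Units.val_pow_eq_pow_val]
    · obtain ⟨c, a, b, _⟩ := q
      simp only at hb
      rw [hb]

/-- The twists of `exists_twist`. -/
def unit [IsAlgClosed k] : ZMod n → kˣ := (hϑ.exists_twist hε h3).choose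

/-- On each cone, the coefficient of `ϑ_m` at `m` is the same after twisting: two distinct cones
meet at most along an edge, where both coefficients are `1`. -/
lemma exists_weight [IsAlgClosed k] (m : BZ n) : ∃ c : kˣ, ∀ i l x,
    IsMaxCone (raysOver t ε) i l → Develops d i l m x →
      ((hϑ.unit hε h3 i ^ x.2 : kˣ) : k) * 𝒜.fib ε (ϑ m) i x = c := by
  have hedge := (hϑ.exists_twist hε h3).choose_spec
  obtain ⟨i, l, x, h, hx⟩ := FanModel.exists_develops (d := d) (F := raysOver t ε)
    (Set.nonempty_of_ncard_ne_zero (by omega)) m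
  refine ⟨Units.mk0 _ (mul_ne_zero (Units.ne_zero (hϑ.unit hε h3 i ^ x.2))
    (hϑ.fib_ne_zero hε h hx)), fun i' l' x' h' hx' => ?_⟩
  rw [Units.val_mk0]
  by_cases hii : i' = i
  · subst hii
    obtain rfl := h.length_eq h'
    have := h.length_lt h3
    rw [hx'.unique (by omega) hx]
  · rcases m with _ | q
    · rw [(develops_none h.1).mp hx, (develops_none h'.1).mp hx', fib_zero hε _ i' i]
      simp
    · obtain ⟨hb, hq⟩ := hx'.inter h' h hii hx
      rw [unit, hedge i' l' h' q x' hx' hb (by grind), hedge i l h q x hx hb (by grind)]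

/-- The scaling of a theta function. -/
def weight [IsAlgClosed k] (m : BZ n) : kˣ := (hϑ.exists_weight hε h3 m).choose

lemma mul_fib [IsAlgClosed k] {m : BZ n} {i : ZMod n} {l : ℕ} {x : ℤ × ℤ}
    (h : IsMaxCone (raysOver t ε) i l) (hx : Develops d i l m x) :
    ((hϑ.unit hε h3 i ^ x.2 : kˣ) : k) * 𝒜.fib ε (ϑ m) i x = hϑ.weight hε h3 m :=
  (hϑ.exists_weight hε h3 m).choose_spec i l x h hx

end ConeAtlas.IsDual

variable [IsAlgClosed k] [Algebra k Γ] [IsScalarTower k A Γ]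

variable (Γ ε) in
/-- The algebra of the fibre over the point `ε`. -/
abbrev FibreAlg : Type _ := Γ ⧸ (RingHom.ker ε).map (algebraMap A Γ)

omit [IsAlgClosed k] in
lemma mk_smul (a : A) (g : Γ) :
    Ideal.Quotient.mk ((RingHom.ker ε).map (algebraMap A Γ)) (a • g)
      = ε a • (Ideal.Quotient.mk _ g : FibreAlg Γ ε) := by
  have h1 : (ε a • (Ideal.Quotient.mk _ g : FibreAlg Γ ε)) = Ideal.Quotient.mk _ (ε a • g) := rfl
  rw [h1, Ideal.Quotient.eq, ← algebraMap_smul A (ε a) g, ← sub_smul, Algebra.smul_def]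
  refine Ideal.mul_mem_right _ _ (Ideal.mem_map_of_mem _ ?_)
  rw [RingHom.mem_ker, map_sub, AlgHom.commutes, sub_eq_zero]
  rfl

variable (𝒜 ε) in
/-- The restriction to the cone `σ_i` of a function on the fibre, twisted by `β`. -/
def fibMap (β : kˣ) (i : ZMod n) : FibreAlg Γ ε →ₐ[k] Laurent k :=
  Ideal.Quotient.liftₐ _
    ((twist β).comp ((AddMonoidAlgebra.mapAlgHom (ℤ × ℤ) ε).comp ((𝒜.y i).restrictScalars k))) (by
      intro g hg
      refine (Ideal.map_le_iff_le_comap.mpr fun a ha => ?_ :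
        (RingHom.ker ε).map (algebraMap A Γ) ≤ RingHom.ker ((twist β).comp
          ((AddMonoidAlgebra.mapAlgHom (ℤ × ℤ) ε).comp ((𝒜.y i).restrictScalars k)))) hg
      rw [Ideal.mem_comap, RingHom.mem_ker]
      ext m
      have h1 : 𝒜.y i (algebraMap A Γ a) = algebraMap A (Laurent A) a := AlgHom.commutes _ _
      simp only [AlgHom.comp_apply, AlgHom.restrictScalars_apply, coeff_twist, h1,
        AddMonoidAlgebra.coeff_mapAlgHom, AddMonoidAlgebra.coe_algebraMap, Function.comp_apply,
        laurent_coeff_single]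
      rw [RingHom.mem_ker] at ha
      split_ifs <;> simp [ha])

omit [NeZero n] [IsAlgClosed k] in
lemma coeff_fibMap (β : kˣ) (i : ZMod n) (g : Γ) (m : ℤ × ℤ) :
    (fibMap 𝒜 ε β i (Ideal.Quotient.mk _ g)).coeff m
      = ((β ^ m.2 : kˣ) : k) * 𝒜.fib ε g i m := by
  change (twist β (AddMonoidAlgebra.mapAlgHom (ℤ × ℤ) ε (𝒜.y i g))).coeff m = _
  rw [coeff_twist, AddMonoidAlgebra.coeff_mapAlgHom]
  rfl

namespace ConeAtlas.IsDual

/-- The normalized theta functions on the fibre. -/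
def fibTheta (m : BZ n) : FibreAlg Γ ε :=
  ((hϑ.weight hε h3 m)⁻¹ : kˣ) • (Ideal.Quotient.mk _ (ϑ m) : FibreAlg Γ ε)

lemma fibMap_fibTheta_of {i : ZMod n} {l : ℕ} {m : BZ n} {x : ℤ × ℤ}
    (h : IsMaxCone (raysOver t ε) i l) (hx : Develops d i l m x) :
    fibMap 𝒜 ε (hϑ.unit hε h3 i) i (hϑ.fibTheta hε h3 m) = AddMonoidAlgebra.single x 1 := by
  have hln := h.length_lt h3
  ext y
  rw [fibTheta, Units.smul_def, map_smul, AddMonoidAlgebra.coeff_smul, Finsupp.smul_apply,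
    coeff_fibMap, laurent_coeff_single, smul_eq_mul]
  split_ifs with hy
  · rw [hy, hϑ.mul_fib hε h3 h hx, Units.inv_mul]
  · rw [mul_eq_zero, mul_eq_zero]
    refine Or.inr (Or.inr ?_)
    by_contra hne
    exact hy ((hϑ.develops_of_fib_ne_zero hε h hne).unique (by omega) hx)

lemma fibMap_fibTheta_of_not {i : ZMod n} {l : ℕ} {m : BZ n}
    (h : IsMaxCone (raysOver t ε) i l) (hx : ∀ x, ¬ Develops d i l m x) :
    fibMap 𝒜 ε (hϑ.unit hε h3 i) i (hϑ.fibTheta hε h3 m) = 0 := by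
  ext y
  rw [fibTheta, Units.smul_def, map_smul, AddMonoidAlgebra.coeff_smul, Finsupp.smul_apply,
    coeff_fibMap, smul_eq_mul]
  have : 𝒜.fib ε (ϑ m) i y = 0 := by
    by_contra hne
    exact hx y (hϑ.develops_of_fib_ne_zero hε h hne)
  simp [this]

include hϑ hε in
omit [IsAlgClosed k] [Algebra k Γ] [IsScalarTower k A Γ] in
lemma fibDev_inj {i : ZMod n} {l : ℕ} {m m' : BZ n} {x : ℤ × ℤ}
    (h : IsMaxCone (raysOver t ε) i l) (hm : Develops d i l m x) (hm' : Develops d i l m' x) :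
    m = m' :=
  (hϑ.eq_of_fib_ne_zero hε h (hϑ.fib_ne_zero hε h hm) hm').symm

lemma linearIndependent_fibTheta : LinearIndependent k (hϑ.fibTheta hε h3) := by
  classical
  rw [linearIndependent_iff]
  intro a ha
  ext m
  obtain ⟨i, l, x, h, hx⟩ := FanModel.exists_develops (d := d) (F := raysOver t ε)
    (Set.nonempty_of_ncard_ne_zero (by omega)) m
  have h1 := congrArg (fun y => (fibMap 𝒜 ε (hϑ.unit hε h3 i) i y).coeff x) ha
  simp only [Finsupp.linearCombination_apply, map_finsuppSum, map_zero, map_smul] at h1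
  rw [Finsupp.sum, AddMonoidAlgebra.coeff_sum, Finsupp.finsetSum_apply,
    Finset.sum_eq_single m] at h1
  · rw [hϑ.fibMap_fibTheta_of hε h3 h hx, AddMonoidAlgebra.coeff_smul, Finsupp.smul_apply,
      laurent_coeff_single, if_pos rfl, smul_eq_mul, mul_one] at h1
    exact h1
  · intro m' _ hne
    by_cases hm' : ∃ x', Develops d i l m' x'
    · obtain ⟨x', hx'⟩ := hm'
      rw [hϑ.fibMap_fibTheta_of hε h3 h hx', AddMonoidAlgebra.coeff_smul, Finsupp.smul_apply,
        laurent_coeff_single, if_neg, smul_zero]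
      rintro rfl
      exact hne (hϑ.fibDev_inj hε h hx' hx)
    · push Not at hm'
      rw [hϑ.fibMap_fibTheta_of_not hε h3 h hm']
      simp
  · intro hm
    rw [Finsupp.notMem_support_iff.mp hm]
    simp

variable (hF₀ : F₀.Nonempty) {M : ℕ} (hM : 𝔍 ^ M = ⊥)

lemma mk_eq (g : Γ) : (Ideal.Quotient.mk _ g : FibreAlg Γ ε)
    = ((hϑ.basis hF₀ hM).repr g).sum fun q a => (ε a * hϑ.weight hε h3 q) • hϑ.fibTheta hε h3 q := by
  conv_lhs => rw [← (hϑ.basis hF₀ hM).linearCombination_repr g]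
  rw [Finsupp.linearCombination_apply, map_finsuppSum]
  refine Finsupp.sum_congr fun q _ => ?_
  rw [mk_smul, hϑ.basis_apply, fibTheta, Units.smul_def, smul_smul, mul_assoc, Units.mul_inv,
    mul_one]

/-- The algebra of a closed fibre is the algebra of the fan whose rays are those with vanishing
bending parameters. -/
def fanModel : FanModel d (raysOver t ε) k (FibreAlg Γ ε) where
  e := Module.Basis.mk (hϑ.linearIndependent_fibTheta hε h3) (by
    rintro x -
    obtain ⟨g, rfl⟩ := Ideal.Quotient.mk_surjective x
    rw [hϑ.mk_eq hε h3 hF₀ hM]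
    exact Submodule.sum_mem _ fun q _ => Submodule.smul_mem _ _ (Submodule.subset_span ⟨q, rfl⟩))
  D i := fibMap 𝒜 ε (hϑ.unit hε h3 i) i
  map_of h hx := by
    rw [Module.Basis.mk_apply]
    exact hϑ.fibMap_fibTheta_of hε h3 h hx
  map_of_not h hx := by
    rw [Module.Basis.mk_apply]
    exact hϑ.fibMap_fibTheta_of_not hε h3 h hx
  inj x hx := by
    obtain ⟨g, rfl⟩ := Ideal.Quotient.mk_surjective x
    rw [hϑ.mk_eq hε h3 hF₀ hM]
    refine Finset.sum_eq_zero fun q _ => ?_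
    obtain ⟨i, l, x, h, s, a, b, hs, rfl, -⟩ := FanModel.exists_develops (d := d) (F := raysOver t ε)
      (Set.nonempty_of_ncard_ne_zero (by omega)) q
    have h1 := hε (hϑ.own_sub_repr hF₀ hM g (pt (i + (s : ZMod n)) a b))
    rw [RingHom.mem_ker, map_sub, sub_eq_zero, ← fib_develops hε 𝒜 g h hs] at h1
    have h2 := congrArg (fun y => y.coeff (a • dev d i s + b • dev d i (s + 1))) (hx i l h)
    simp only [coeff_fibMap] at h2
    change (ε _ * _) • _ = _
    rw [← h1, (mul_eq_zero.mp h2).resolve_left (Units.ne_zero _), mul_zero, zero_mul, zero_smul]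
  dev_inj h hm hm' := hϑ.fibDev_inj hε h hm hm'

end ConeAtlas.IsDual
end FibreModel
end MirrorFamily

namespace MirrorFamily

/-! ### Closed fibres of affine morphisms -/

section ClosedFibre

/-- Base change along a surjection with kernel `𝔪` is the quotient by the extension of `𝔪`. -/
lemma isPushout_quotient {R S K : CommRingCat.{u}} (f : R ⟶ S) (q : R ⟶ K)
    (hq : Function.Surjective q.hom) {𝔪 : Ideal R} (hker : RingHom.ker q.hom = 𝔪) :
    ∃ r : K ⟶ CommRingCat.of (S ⧸ 𝔪.map f.hom),
      IsPushout f q (CommRingCat.ofHom (Ideal.Quotient.mk (𝔪.map f.hom))) r := by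
  have hle : RingHom.ker q.hom ≤ RingHom.ker ((Ideal.Quotient.mk (𝔪.map f.hom)).comp f.hom) := by
    intro a ha
    rw [RingHom.mem_ker, RingHom.comp_apply, Ideal.Quotient.eq_zero_iff_mem]
    exact Ideal.mem_map_of_mem _ (hker ▸ ha)
  have hr := RingHom.liftOfSurjective_comp_apply q.hom hq ⟨_, hle⟩
  have hs : ∀ (s : Limits.PushoutCocone f q) (a : R), s.inl.hom (f.hom a) = s.inr.hom (q.hom a) :=
    fun s a => congrArg (fun g => g.hom a) s.condition
  have hs0 : ∀ (s : Limits.PushoutCocone f q), ∀ a ∈ 𝔪.map f.hom, s.inl.hom a = 0 := by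
    intro s a ha
    refine (Ideal.map_le_iff_le_comap.mpr fun a ha => ?_ :
      𝔪.map f.hom ≤ RingHom.ker s.inl.hom) ha
    rw [← hker, RingHom.mem_ker] at ha
    rw [Ideal.mem_comap, RingHom.mem_ker, hs, ha, map_zero]
  refine ⟨CommRingCat.ofHom (q.hom.liftOfSurjective hq ⟨_, hle⟩),
    ⟨⟨by ext a; exact (hr a).symm⟩, ⟨Limits.PushoutCocone.IsColimit.mk _
      (fun s => CommRingCat.ofHom (Ideal.Quotient.lift _ s.inl.hom (hs0 s))) (fun s => ?_)
      (fun s => ?_) (fun s m hl _ => ?_)⟩⟩⟩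
  · ext a
    rfl
  · ext a
    obtain ⟨a, rfl⟩ := hq a
    exact (congrArg (Ideal.Quotient.lift _ s.inl.hom (hs0 s)) (hr a)).trans (hs s a)
  · ext a
    exact congrArg (fun g => g.hom a) hl

/-- The fibre of `Spec S → Spec R` over a closed point. -/
lemma nonempty_fiber_iso {R S K : CommRingCat.{u}} (f : R ⟶ S) (x : Spec R) [x.asIdeal.IsMaximal]
    (g : K ⟶ R) :
    Nonempty (Over.mk ((Spec.map f).fiberι x ≫ Spec.map f ≫ Spec.map g) ≅
      Over.mk (Spec.map (g ≫ f ≫ CommRingCat.ofHom (Ideal.Quotient.mk (x.asIdeal.map f.hom))))) := by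
  let q : R ⟶ (Spec R).residueField x :=
    CommRingCat.ofHom (algebraMap R x.asIdeal.ResidueField) ≫ (Scheme.Spec.residueFieldIso R x).inv
  have hq : Spec.map q = (Spec R).fromSpecResidueField x := by
    rw [Spec.map_comp, Scheme.Spec.map_residueFieldIso_inv_eq_fromSpecResidueField]
  have hinv : Function.Bijective (Scheme.Spec.residueFieldIso R x).inv.hom :=
    ConcreteCategory.bijective_of_isIso (Scheme.Spec.residueFieldIso R x).inv
  have hsurj : Function.Surjective q.hom :=
    hinv.2.comp (Ideal.algebraMap_residueField_surjective x.asIdeal)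
  have hker : RingHom.ker q.hom = x.asIdeal := by
    rw [← Ideal.ker_algebraMap_residueField x.asIdeal]
    exact RingHom.ker_comp_of_injective _ hinv.1
  obtain ⟨r, hr⟩ := isPushout_quotient f q hsurj hker
  have hpb := isPullback_SpecMap_of_isPushout _ _ _ _ hr
  rw [hq] at hpb
  refine ⟨(Over.isoMk hpb.isoPullback ?_).symm⟩
  change hpb.isoPullback.hom ≫ Limits.pullback.fst _ _ ≫ _ = Spec.map _
  rw [← Category.assoc, hpb.isoPullback_hom_fst, Spec.map_comp, Spec.map_comp, Category.assoc]

lemma topologicalKrullDim_eq_of_iso {X : Scheme.{u}} {T : CommRingCat.{u}} (e : X ≅ Spec T) :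
    topologicalKrullDim X = ringKrullDim T := by
  rw [IsHomeomorph.topologicalKrullDim_eq _ e.hom.homeomorph.isHomeomorph]
  exact PrimeSpectrum.topologicalKrullDim_eq_ringKrullDim T

end ClosedFibre

/-! ### Closed points of the base -/

section BasePoints

variable {k : Type u} [Field k]

/-- A closed point of an affine scheme of finite type over an algebraically closed field is the
kernel of a homomorphism to the field. -/
lemma exists_algHom_ker_eq [IsAlgClosed k] {A : Type u} [CommRing A] [Algebra k A]
    [Algebra.FiniteType k A] (𝔪 : Ideal A) [h𝔪 : 𝔪.IsMaximal] :
    ∃ ε : A →ₐ[k] k, RingHom.ker ε = 𝔪 := by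
  let _ := Ideal.Quotient.field 𝔪
  have : Module.Finite k (A ⧸ 𝔪) := finite_of_finite_type_of_isJacobsonRing k (A ⧸ 𝔪)
  have h := IsAlgClosed.algebraMap_bijective_of_isIntegral (k := k) (K := A ⧸ 𝔪)
  let e : k ≃ₐ[k] A ⧸ 𝔪 := AlgEquiv.ofBijective (Algebra.ofId k _) h
  refine ⟨(e.symm : (A ⧸ 𝔪) →ₐ[k] k).comp (Ideal.Quotient.mkₐ k 𝔪), ?_⟩
  ext a
  rw [RingHom.mem_ker]
  change e.symm (Ideal.Quotient.mk 𝔪 a) = 0 ↔ _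
  rw [map_eq_zero_iff _ e.symm.injective, Ideal.Quotient.eq_zero_iff_mem]

variable {L : Type u} [AddCommGroup L] {P : AddSubmonoid L} {n : ℕ} [NeZero n]
  {φ : PLFun n P} {I J : AddSemigroupIdeal P}

variable (k I) in
lemma finiteType_base (hP : P.FG) : Algebra.FiniteType k (Base (P := P) I k) := by
  have : AddMonoid.FG P := (AddMonoid.fg_iff_addSubmonoid_fg P).mpr hP
  exact Algebra.FiniteType.of_surjective (Ideal.Quotient.mkₐ k _) Ideal.Quotient.mk_surjective

/-- The number of rays with vanishing bending parameter can be bounded on closed points. -/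
lemma three_le_of_isPrime (hP : P.FG)
    (h : ∀ 𝔪 : Ideal (Base (P := P) I k), 𝔪.IsMaximal → 3 ≤ {s | tA k I φ s ∈ 𝔪}.ncard)
    (𝔞 : Ideal (Base (P := P) I k)) (h𝔞 : 𝔞.IsPrime) : 3 ≤ {s | tA k I φ s ∈ 𝔞}.ncard := by
  classical
  have := finiteType_base k I hP
  have : IsJacobsonRing (Base (P := P) I k) := isJacobsonRing_of_finiteType (A := k)
  have hprod : ∏ s ∈ Finset.univ.filter (fun s => tA k I φ s ∉ 𝔞), tA k I φ s ∉ 𝔞 := by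
    rw [h𝔞.prod_mem_iff]
    rintro ⟨s, hs, h1⟩
    exact (Finset.mem_filter.mp hs).2 h1
  have hjac : ∏ s ∈ Finset.univ.filter (fun s => tA k I φ s ∉ 𝔞), tA k I φ s ∉ 𝔞.jacobson := by
    rwa [isJacobsonRing_iff_prime_eq.mp this 𝔞 h𝔞]
  rw [Ideal.jacobson, Submodule.mem_sInf] at hjac
  push Not at hjac
  obtain ⟨𝔪, ⟨hle, h𝔪⟩, hp⟩ := hjac
  refine (h 𝔪 h𝔪).trans (Set.ncard_le_ncard fun s hs => ?_)
  by_contra hs'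
  exact hp (Ideal.mem_of_dvd _ (Finset.dvd_prod_of_mem _ (by simpa using hs')) hs)

lemma three_le_of_zero_notMem (hI : radical I = J)
    (h : ∀ 𝔪 : Ideal (Base (P := P) I k), 𝔪.IsMaximal → 3 ≤ {s | tA k I φ s ∈ 𝔪}.ncard)
    (h0 : (0 : P) ∉ J) : 3 ≤ n := by
  have : Nontrivial (Base (P := P) I k) := by
    by_contra hn
    rw [not_nontrivial_iff_subsingleton] at hn
    have h1 := mem_elems_of_zA_eq_zero (k := k) (I := I) (p := 0) (Subsingleton.elim _ _)
    refine h0 ?_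
    rw [← hI]
    exact ⟨1, one_ne_zero, by simpa using mem_elems.mp h1⟩
  obtain ⟨𝔪, h𝔪⟩ := Ideal.exists_maximal (Base (P := P) I k)
  refine (h 𝔪 h𝔪).trans ((Set.ncard_le_card _).trans ?_)
  simp

end BasePoints

section ThetaFibre

open ScatteringDiagram

variable {k : Type u} [Field k] [IsAlgClosed k] {L : Type u} [AddCommGroup L] {P : AddSubmonoid L}
  {n : ℕ} [NeZero n] {φ : PLFun n P} {I J : AddSemigroupIdeal P} {D : ScatteringDiagram φ k J}
  {hI : radical I = J} {d : ZMod n → ℤ}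

omit [IsAlgClosed k] in
lemma idealOf_le_of_isPrime (hP : P.FG) (hI : radical I = J) (𝔞 : Ideal (Base (P := P) I k))
    [h𝔞 : 𝔞.IsPrime] : idealOf k I J ≤ 𝔞 := by
  obtain ⟨M, hM⟩ := exists_idealOf_pow (k := k) hP hI
  exact h𝔞.le_of_pow_le (n := M) (hM ▸ bot_le)

omit [IsAlgClosed k] [NeZero n] in
lemma raysAt_eq (hP : P.FG) (hI : radical I = J) (𝒜 : ConeAtlas d (tA k I φ) (raysI φ I)
    (idealOf k I J) (D.Functions hI d)) (x : PrimeSpectrum (Base (P := P) I k)) :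
    raysAt φ I k x = {s | tA k I φ s ∈ x.asIdeal} := by
  ext s
  refine ⟨fun h => h.elim (fun h => ?_) id, Or.inr⟩
  exact idealOf_le_of_isPrime hP hI x.asIdeal (𝒜.t_mem s h)

/-- The fibre of the mirror family over a closed point. -/
theorem exists_fanModel_fiber {ϑ : BZ n → D.Functions hI d} (hP : P.FG)
    (hϑ : (atlas D hI d).IsDual ϑ) (hF : (raysI φ I).Nonempty)
    (x : Spec (CommRingCat.of (Base (P := P) I k))) (hx : IsClosed {x})
    (h3 : 3 ≤ (raysAt φ I k x).ncard) :
    ∃ (T : Type u) (_ : CommRing T) (_ : Algebra k T) (_ : FanModel d (raysAt φ I k x) k T),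
      Nonempty (Over.mk ((D.fI hI d).fiberι x ≫ D.fI hI d ≫ Spec.map (CommRingCat.ofHom
        (algebraMap k (Base (P := P) I k)))) ≅
          Over.mk (Spec.map (CommRingCat.ofHom (algebraMap k T)))) := by
  have hmax : x.asIdeal.IsMaximal := (PrimeSpectrum.isClosed_singleton_iff_isMaximal x).mp hx
  have := finiteType_base k I hP
  obtain ⟨ε, hε⟩ := exists_algHom_ker_eq (k := k) x.asIdeal
  obtain ⟨M, hM⟩ := exists_idealOf_pow (k := k) hP hI
  have hrays : raysAt φ I k x = raysOver (tA k I φ) ε := by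
    refine (raysAt_eq hP hI (atlas D hI d) x).trans (Set.ext fun s => ?_)
    change tA k I φ s ∈ x.asIdeal ↔ tA k I φ s ∈ RingHom.ker ε
    rw [hε]
  rw [hrays] at h3 ⊢
  let _ : Algebra k (D.Functions hI d) :=
    ((algebraMap (Base (P := P) I k) (D.Functions hI d)).comp (algebraMap k _)).toAlgebra
  have : @IsScalarTower k (Base (P := P) I k) (D.Functions hI d) Algebra.toSMul Algebra.toSMul
      Algebra.toSMul := IsScalarTower.of_algebraMap_eq' rfl
  have hle : idealOf k I J ≤ RingHom.ker ε := hε ▸ idealOf_le_of_isPrime hP hI x.asIdeal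
  refine ⟨_, _, _, hϑ.fanModel hle h3 hF hM, ?_⟩
  have h := nonempty_fiber_iso (D.baseToFunctions hI d) x
    (CommRingCat.ofHom (algebraMap k (Base (P := P) I k)))
  rw [← hε] at h
  exact h

omit [IsAlgClosed k] in
lemma nonempty_over_iso_of_algEquiv {T T' : Type u} [CommRing T] [CommRing T'] [Algebra k T]
    [Algebra k T'] (e : T' ≃ₐ[k] T) :
    Nonempty (Over.mk (Spec.map (CommRingCat.ofHom (algebraMap k T))) ≅
      Over.mk (Spec.map (CommRingCat.ofHom (algebraMap k T')))) := by
  refine ⟨Over.isoMk (Scheme.Spec.mapIso e.toRingEquiv.toCommRingCatIso.op) ?_⟩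
  change Spec.map _ ≫ Spec.map _ = Spec.map _
  rw [← Spec.map_comp]
  congr 1
  ext c
  exact e.commutes c

end ThetaFibre

lemma flat_fI {k : Type u} [Field k] {L : Type u} [AddCommGroup L] {P : AddSubmonoid L}
    {n : ℕ} {φ : PLFun n P} {I J : AddSemigroupIdeal P} {D : ScatteringDiagram φ k J}
    {hI : radical I = J} {d : ZMod n → ℤ} {ι : Type*}
    (b : Module.Basis ι (Base (P := P) I k) (D.Functions hI d)) : Flat (D.fI hI d) := by
  refine Flat.SpecMap_iff.mpr ?_
  have := Module.Free.of_basis b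
  exact (inferInstance : Module.Flat (Base (P := P) I k) (D.Functions hI d))

end MirrorFamily

theorem mainTheorem6
    {k : Type u} [Field k] [IsAlgClosed k] [CharZero k]
    {L : Type u} [AddCommGroup L] [Module.Free ℤ L] [Module.Finite ℤ L]
    (P : AddSubmonoid L) (hP : MirrorFamily.IsToric P)
    {n : ℕ} [NeZero n] (d : ZMod n → ℤ) (φ : MirrorFamily.PLFun n P)
    (J I : AddSemigroupIdeal P) (hI : MirrorFamily.radical I = J)
    (hI2 : 2 ≤ (MirrorFamily.raysI φ I).ncard)
    (hconv : ∀ i l, MirrorFamily.IsMaxCone (MirrorFamily.raysI φ I) i l →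
      MirrorFamily.IsStrictlyConvex d i l)
    (D : MirrorFamily.ScatteringDiagram φ k J) (hD : D.IsConsistent d)
    (hx3 : ∀ x : Spec (CommRingCat.of (MirrorFamily.Base (P := P) I k)), IsClosed {x} →
      3 ≤ (MirrorFamily.raysAt φ I k x).ncard) :
    LocallyRingedSpace.IsOpenImmersion (D.toX hI d) ∧
    Flat (D.fI hI d) ∧
    (∀ x : Spec (CommRingCat.of (MirrorFamily.Base (P := P) I k)), IsClosed {x} →
      topologicalKrullDim ((D.fI hI d).fiber x) = 2 ∧
      Nonempty
        (Over.mk ((D.fI hI d).fiberι x ≫ D.fI hI d ≫ Spec.map (CommRingCat.ofHom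
            (algebraMap k (MirrorFamily.Base (P := P) I k)))) ≅
          Over.mk (Spec.map (CommRingCat.ofHom
            (algebraMap k (MirrorFamily.FanAlg d k (MirrorFamily.raysAt φ I k x)))))) ∧
      ((∀ i l, MirrorFamily.IsMaxCone (MirrorFamily.raysAt φ I k x) i l →
          MirrorFamily.IsQuadrant d i l) →
        Nonempty
          (Over.mk ((D.fI hI d).fiberι x ≫ D.fI hI d ≫ Spec.map (CommRingCat.ofHom
              (algebraMap k (MirrorFamily.Base (P := P) I k)))) ≅
            Over.mk (Spec.map (CommRingCat.ofHom
              (algebraMap k (MirrorFamily.VertexAlg k (MirrorFamily.raysAt φ I k x).ncard))))))) ∧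
    ∃ θ : Module.Basis (MirrorFamily.BZ n) (MirrorFamily.Base (P := P) I k) (D.Functions hI d),
      θ none = 1 ∧
      ∀ (q : MirrorFamily.B0Z n) (i : ZMod n) (Q Q' : ℝ × ℝ),
        MirrorFamily.ScatteringDiagram.IsIrrational Q →
        MirrorFamily.ScatteringDiagram.IsIrrational Q' → D.Adjacent hI i Q Q' →
        D.psiNeg I d i (D.restrict hI d (i + 1) (θ (some q))) = D.Lift d I i Q q ∧
        D.psiPos I (i + 1) (D.restrict hI d (i + 1) (θ (some q))) = D.Lift d I (i + 1) Q' q := by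
  have hn2 : (MirrorFamily.raysI φ I).Nonempty := Set.nonempty_of_ncard_ne_zero (by omega)
  have hmax : ∀ 𝔪 : Ideal (MirrorFamily.Base (P := P) I k), 𝔪.IsMaximal →
      3 ≤ {s | MirrorFamily.tA k I φ s ∈ 𝔪}.ncard := by
    intro 𝔪 h𝔪
    let x : Spec (CommRingCat.of (MirrorFamily.Base (P := P) I k)) := ⟨𝔪, h𝔪.isPrime⟩
    have hx := hx3 x ((PrimeSpectrum.isClosed_singleton_iff_isMaximal x).mpr h𝔪)
    rwa [MirrorFamily.raysAt_eq hP.1 hI (MirrorFamily.atlas D hI d)] at hx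
  have hϑ := MirrorFamily.isDual_thetaFun hD hI (d := d) hP.1
    (MirrorFamily.three_le_of_zero_notMem hI hmax)
  obtain ⟨M, hM⟩ := MirrorFamily.exists_idealOf_pow (k := k) hP.1 hI
  refine ⟨MirrorFamily.isOpenImmersion_toX hP.1 hϑ hI2 (MirrorFamily.three_le_of_isPrime hP.1 hmax),
    MirrorFamily.flat_fI (hϑ.basis hn2 hM), fun x hx => ?_, hϑ.basis hn2 hM, ?_, ?_⟩
  · obtain ⟨T, _, _, m, ⟨e⟩⟩ := MirrorFamily.exists_fanModel_fiber hP.1 hϑ hn2 x hx (hx3 x hx)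
    refine ⟨?_, ?_, fun hQ => ?_⟩
    · exact (MirrorFamily.topologicalKrullDim_eq_of_iso ((Over.forget _).mapIso e)).trans
        (m.ringKrullDim_eq (hx3 x hx))
    · obtain ⟨e'⟩ := MirrorFamily.nonempty_over_iso_of_algEquiv (m.equivFanAlg (hx3 x hx))
      exact ⟨e.trans e'⟩
    · obtain ⟨g⟩ := m.nonempty_equivVertexAlg (hx3 x hx) hQ
      obtain ⟨e'⟩ := MirrorFamily.nonempty_over_iso_of_algEquiv g
      exact ⟨e.trans e'⟩
  · rw [hϑ.basis_apply]
    rfl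
  · intro q i Q Q' hQ hQ' hadj
    rw [hϑ.basis_apply]
    exact (MirrorFamily.exists_theta hD hI q).choose_spec i Q Q' hQ hQ' hadj
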